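/- **Setting.** An IQP circuit $C$ of depth $d$ on $n\ge 1$ qubits with $k$-local gates consists of $d$ layers; each layer is a collection of diagonal unitary gates acting on pairwise disjoint sets of at least one and at most $k$ qubits. Its noisy implementation $\tilde C$ is obtained by applying, after each layer, on every qubit the Pauli noise channel $\mathcal N(\rho)=p_I\rho+p_XX\rho X+p_YY\rho Y+p_ZZ\rho Z$, where $p_I,p_X,p_Y,p_Z\ge 0$, $p_I+p_X+p_Y+p_Z=1$ and $p_I\ge 1/2$. Put $p=p_Z+\min(p_X,p_Y)$. Let $\Phi_{\tilde C}$ be the channel implemented by $\tilde C$, and let $P_{\tilde C}$ be the distribution on $\{0,1\}^n$ of the outcome of a Hadamard-basis measurement, $$P_{\tilde C}(b)=\operatorname{tr}\left[H^{\dagger\otimes n}|b\rangle\langle b|H^{\otimes n}\,\Phi_{\tilde C}\left(|+\rangle\langle +|^{\otimes n}\right)\right].$$ A *randomized classical algorithm* is a program for a random access machine over the integers (addition, subtraction, halving, comparison with $0$, arrays, fair coin flips; unit cost per command). Its input consists of $n,d,k$, of the description of the circuit (number of gates in each layer, qubits of each gate), and of the binary digits, readable one at a time, of $p_X,p_Y,p_Z$,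 of the accuracy $\varepsilon$, and of the real and imaginary parts of the diagonal entries of the gates. **Corollary (Monte Carlo Algorithm Performance).** There are a randomized classical algorithm, a depth threshold $d^*=d^*(p,k)$ and an absolute constant $A$ with $$d^*(p,k)\le A\,p^{-1}\log(kp^{-1})\qquad\text{for all }0<p\le\tfrac12\text{ and all integers }k\ge1,$$ such that the following holds. For all $p_0>0$ and $k_0\in\mathbb N$ there are constants $B\in\mathbb R$ and $a\in\mathbb N$, depending only on $p_0$ and $k_0$, such that for all $n\ge1$, all $1\le k\le k_0$, all noise parameters as above with $p\ge p_0$, all depths $d>d^*(p,k)$, all IQP circuits $C$ of depth $d$ on $n$ qubits with $k$-local gates, and all $0<\varepsilon\le1$, the algorithm, run on this input, halts for every outcome of its coin flips within $$T\le B\,d\,(n/\varepsilon)^a$$ steps, and the distribution $\tilde Q_{\tilde C}$ of its output satisfies $\|\tilde Q_{\tilde C}-P_{\tilde C}\|_{\mathrm{TVD}}=\frac12\sum_s|\tilde Q_{\tilde C}(s)-P_{\tilde C}(s)|\le\varepsilon$. -/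

import Mathlib

noncomputable section

namespace NoisyIQP

/-! ### Noisy IQP circuits and their output distribution

The computational basis of `n` qubits is indexed by `Fin n → Bool` (`false` is 0, `true` is 1);
an operator on `n` qubits is a complex matrix over this index set. -/

/-- Bit strings of length `n`. -/
abbrev Bits (n : ℕ) := Fin n → Bool

/-- Operators (in particular density matrices) on `n` qubits. -/
abbrev Op (n : ℕ) := Matrix (Bits n) (Bits n) ℂ

/-- The Pauli matrix `X`. -/
def pauliX : Matrix Bool Bool ℂ := fun a b => if a = b then 0 else 1

/-- The Pauli matrix `Y`. -/
def pauliY : Matrix Bool Bool ℂ := fun a b =>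
  if a = b then 0 else if a then Complex.I else -Complex.I

/-- The Pauli matrix `Z`. -/
def pauliZ : Matrix Bool Bool ℂ := fun a b =>
  if a = b then (if a then -1 else 1) else 0

/-- The Hadamard matrix `H`. -/
def hadamard : Matrix Bool Bool ℂ := fun a b =>
  (if a && b then -1 else 1) / (Real.sqrt 2 : ℂ)

/-- The one-qubit operator `A` acting on qubit `i` of `n` qubits (identity elsewhere). -/
def onQubit {n : ℕ} (A : Matrix Bool Bool ℂ) (i : Fin n) : Op n := fun x y =>
  if ∀ j, j ≠ i → x j = y j then A (x i) (y i) else 0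

/-- The tensor power `H^{⊗ n}`. -/
def hadamardAll (n : ℕ) : Op n := fun x y => ∏ i, hadamard (x i) (y i)

/-- The projector `|b⟩⟨b|`. -/
def basisState {n : ℕ} (b : Bits n) : Op n := Matrix.single b b 1

/-- The initial state `|+⟩⟨+|^{⊗ n}`, with `|+⟩ = H |0⟩`. -/
def plusState (n : ℕ) : Op n :=
  hadamardAll n * basisState (fun _ => false) * (hadamardAll n).conjTranspose

/-- A diagonal unitary gate: the ordered list of (distinct, at least one) qubits on which it acts,
and its diagonal entries. -/
structure DiagGate (n : ℕ) where
  arity : ℕ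
  arity_pos : 1 ≤ arity
  wires : Fin arity ↪ Fin n
  diag : Bits arity → ℂ
  norm_diag : ∀ x, ‖diag x‖ = 1

/-- The diagonal unitary on all `n` qubits that the gate implements. -/
def DiagGate.unitary {n : ℕ} (g : DiagGate n) : Op n :=
  Matrix.diagonal fun x => g.diag fun r => x (g.wires r)

/-- The parameters of a one-qubit Pauli noise channel. -/
structure PauliNoise where
  pI : ℝ
  pX : ℝ
  pY : ℝ
  pZ : ℝ
  pI_nonneg : 0 ≤ pI
  pX_nonneg : 0 ≤ pX
  pY_nonneg : 0 ≤ pY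
  pZ_nonneg : 0 ≤ pZ
  sum_eq_one : pI + pX + pY + pZ = 1

/-- The noise strength `p = p_Z + min (p_X, p_Y)`. -/
def PauliNoise.strength (N : PauliNoise) : ℝ := N.pZ + min N.pX N.pY

/-- One element of a (potentially noisy) IQP circuit. -/
inductive Channel (n : ℕ) where
  | gate (g : DiagGate n)
  | noise (N : PauliNoise) (i : Fin n)

/-- The action of a circuit element on `n`-qubit operators. -/
def Channel.apply {n : ℕ} : Channel n → Op n → Op n
  | .gate g, ρ => g.unitary * ρ * g.unitary.conjTranspose
  | .noise N i, ρ =>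
      (N.pI : ℂ) • ρ
        + (N.pX : ℂ) • (onQubit pauliX i * ρ * onQubit pauliX i)
        + (N.pY : ℂ) • (onQubit pauliY i * ρ * onQubit pauliY i)
        + (N.pZ : ℂ) • (onQubit pauliZ i * ρ * onQubit pauliZ i)

/-- The map `Φ_C` of a circuit, given as the list of its elements in temporal order. -/
def circuitMap {n : ℕ} (C : List (Channel n)) (ρ : Op n) : Op n :=
  C.foldl (fun σ c => c.apply σ) ρ

/-- The output distribution `P_C` of a Hadamard-basis measurement of `Φ_C(|+⟩⟨+|^{⊗ n})`. -/
def outputProb {n : ℕ} (C : List (Channel n)) (b : Bits n) : ℝ :=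
  (Matrix.trace ((hadamardAll n).conjTranspose * basisState b * hadamardAll n *
    circuitMap C (plusState n))).re

/-- An IQP circuit on `n` qubits consisting of `d` layers of diagonal gates; the gates act on at
most `k` qubits each, and the gates of one layer act on disjoint sets of qubits. -/
structure IQPCircuit (n k d : ℕ) where
  layer : Fin d → List (DiagGate n)
  arity_le : ∀ l, ∀ g ∈ layer l, g.arity ≤ k
  disjoint : ∀ l, (layer l).Pairwise fun g h => ∀ r s, g.wires r ≠ h.wires s

/-- The noisy implementation: every layer is followed by the noise `N` on every qubit. -/
def IQPCircuit.noisy {n k d : ℕ} (C : IQPCircuit n k d) (N : PauliNoise) : List (Channel n) :=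
  (List.finRange d).flatMap fun l =>
    (C.layer l).map Channel.gate ++ (List.finRange n).map (Channel.noise N)

/-- Total variation distance between a probability mass function and a vector of
probabilities. -/
def tvDist {α : Type*} [Fintype α] (Q : PMF α) (P : α → ℝ) : ℝ :=
  (1 / 2) * ∑ s, |(Q s).toReal - P s|

/-! ### Randomized algorithms with a step count

A random access machine over the integers in structured form: integer variables, integer arrays
with one or several indices, fair coins, and the usual control structures.  The arithmetic
operations are addition, subtraction and halving (no multiplication), so that the bit length of
every stored number grows by at most a constant (depending on the program) per step, and the
number of steps agrees with the time of a Turing machine up to a polynomial.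
Expressions and index lists are part of the (fixed, finite) program, so one evaluation of them
counts as one step. -/

/-- Arithmetic expressions. -/
inductive Expr where
  | const (z : ℤ)
  | var (x : ℕ)
  | add (a b : Expr)
  | sub (a b : Expr)
  | half (a : Expr)

/-- Programs.  `load x a idx` is `x := a[idx]`, `store a idx e` is `a[idx] := e`, `flip x` sets `x`
to a fair random bit, `cond e c₁ c₂` is `if 0 < e then c₁ else c₂`, and `loop e c` is
`while 0 < e do c`. -/
inductive Cmd where
  | assign (x : ℕ) (e : Expr)
  | load (x : ℕ) (a : ℕ) (idx : List Expr)
  | store (a : ℕ) (idx : List Expr) (e : Expr)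
  | flip (x : ℕ)
  | seq (c₁ c₂ : Cmd)
  | cond (e : Expr) (c₁ c₂ : Cmd)
  | loop (e : Expr) (c : Cmd)

/-- The memory: the variables and the arrays, both numbered by `ℕ`. -/
structure Memory where
  var : ℕ → ℤ
  arr : ℕ → List ℤ → ℤ

/-- Value of an expression; `half` rounds down. -/
def Expr.eval (m : Memory) : Expr → ℤ
  | .const z => z
  | .var x => m.var x
  | .add a b => a.eval m + b.eval m
  | .sub a b => a.eval m - b.eval m
  | .half a => a.eval m / 2

/-- `x := v`. -/
def Memory.setVar (m : Memory) (x : ℕ) (v : ℤ) : Memory :=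
  { m with var := Function.update m.var x v }

/-- `a[idx] := v`. -/
def Memory.setArr (m : Memory) (a : ℕ) (idx : List ℤ) (v : ℤ) : Memory :=
  { m with arr := Function.update m.arr a (Function.update (m.arr a) idx v) }

/-- A configuration: the commands that are still to be executed, and the memory. -/
abbrev Config := List Cmd × Memory

/-- One step of the machine; a configuration with no command left has halted. -/
def step : Config → PMF Config
  | ([], m) => PMF.pure ([], m)
  | (.assign x e :: K, m) => PMF.pure (K, m.setVar x (e.eval m))
  | (.load x a idx :: K, m) => PMF.pure (K, m.setVar x (m.arr a (idx.map (Expr.eval m))))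
  | (.store a idx e :: K, m) => PMF.pure (K, m.setArr a (idx.map (Expr.eval m)) (e.eval m))
  | (.flip x :: K, m) =>
      (PMF.uniformOfFintype Bool).map fun b => (K, m.setVar x (if b then 1 else 0))
  | (.seq c₁ c₂ :: K, m) => PMF.pure (c₁ :: c₂ :: K, m)
  | (.cond e c₁ c₂ :: K, m) => PMF.pure ((if 0 < e.eval m then c₁ else c₂) :: K, m)
  | (.loop e c :: K, m) =>
      PMF.pure (if 0 < e.eval m then c :: .loop e c :: K else K, m)

/-- The random configuration after `t` steps. -/
def runFor : ℕ → Config → PMF Config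
  | 0, c => PMF.pure c
  | t + 1, c => (step c).bind (runFor t)

/-- Worst-case running time at most `T`: for all outcomes of the coins, the program has halted
after `T` steps. -/
def HaltsWithin (prog : Cmd) (m : Memory) (T : ℕ) : Prop :=
  ∀ c ∈ (runFor T ([prog], m)).support, c.1 = []

/-- The distribution of the `n` bits that are found in the array with number `6`
after `T` steps. -/
def sampledBits (prog : Cmd) (m : Memory) (T n : ℕ) : PMF (Bits n) :=
  (runFor T ([prog], m)).map fun c i => decide (c.2.arr 6 [(i : ℤ)] = 1)

/-! ### The input of the sampling algorithm -/

/-- The `j`-th binary digit of `x`, with the sign of `x`: if `|x| < 2`, then `x` is the sum of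
`signedDigit x j / 2 ^ j` over `j = 0, 1, 2, …`. -/
def signedDigit (x : ℝ) (j : ℕ) : ℤ := (SignType.sign x : ℤ) * (⌊2 ^ j * |x|⌋ % 2)

/-- Gate number `g` of layer number `l`, if there is one (counting from `0`). -/
def IQPCircuit.gateAt {n k d : ℕ} (C : IQPCircuit n k d) (l g : ℕ) : Option (DiagGate n) :=
  if h : l < d then (C.layer ⟨l, h⟩)[g]? else none

/-- The input arrays.  Real parameters are accessible one binary digit at a time.
* `0[i, j]`: digit `j` of `p_X`, `p_Y`, `p_Z` for `i = 0, 1, 2`;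
* `1[j]`: digit `j` of the accuracy `ε`;
* `2[l]`: the number of gates in layer `l`;
* `3[l, g]`: the number of qubits on which gate `g` of layer `l` acts;
* `4[l, g, r]`: the `r`-th of these qubits;
* `5[l, g, x, c, j]`: digit `j` of the real part (`c = 0`) or imaginary part (`c = 1`) of the
  diagonal entry of this gate at the basis state whose `r`-th bit is bit `r` of the number `x`.
All other cells are `0`. -/
def inputArr {n k d : ℕ} (C : IQPCircuit n k d) (N : PauliNoise) (ε : ℝ) : ℕ → List ℤ → ℤ
  | 0, [i, j] =>
      if i = 0 then signedDigit N.pX j.toNat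
      else if i = 1 then signedDigit N.pY j.toNat
      else if i = 2 then signedDigit N.pZ j.toNat
      else 0
  | 1, [j] => signedDigit ε j.toNat
  | 2, [l] => if h : l.toNat < d then ((C.layer ⟨l.toNat, h⟩).length : ℤ) else 0
  | 3, [l, g] => (C.gateAt l.toNat g.toNat).elim 0 fun G => (G.arity : ℤ)
  | 4, [l, g, r] => (C.gateAt l.toNat g.toNat).elim 0 fun G =>
      if h : r.toNat < G.arity then ((G.wires ⟨r.toNat, h⟩ : ℕ) : ℤ) else 0
  | 5, [l, g, x, c, j] => (C.gateAt l.toNat g.toNat).elim 0 fun G =>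
      if c = 0 then signedDigit (G.diag fun r => x.toNat.testBit r).re j.toNat
      else if c = 1 then signedDigit (G.diag fun r => x.toNat.testBit r).im j.toNat
      else 0
  | _, _ => 0

/-- The initial memory: variables `0`, `1`, `2` hold `n`, `d`, `k`, the other variables are `0`, and
the arrays hold the description of the circuit, of the noise and of the accuracy. -/
def inputMemory {n k d : ℕ} (C : IQPCircuit n k d) (N : PauliNoise) (ε : ℝ) : Memory where
  var x := if x = 0 then (n : ℤ) else if x = 1 then (d : ℤ) else if x = 2 then (k : ℤ) else 0
  arr := inputArr C N ε

end NoisyIQP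

end

/-!
The noise on one qubit is a mixture of five operations (`flips`, `dephases`, `outcomeWeight`): no
error, complete dephasing, complete dephasing with a flip, `X`, and `Y`. A `Z` error of
probability `pZ` and no error of the same probability make up a complete dephasing, and so do an
`X` error and a `Y` error up to a flip. Hence a qubit is dephased in one layer with probability
`2 * p`, where `p` is the noise strength, and the output distribution is the mixture of the
distributions `recordProb ω` over the noise records `ω`, which assign one of the five operations
to every layer and qubit (`IQPCircuit.outputProb_noisy`). Gates, dephasings and flips map operators
that are diagonal in a qubit to such operators, so a qubit that is dephased at some time can be
regarded as a uniformly random classical bit from the beginning on. The distribution `recordProb ω`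
is then the average, over the states `z` of the dephased qubits, of the squared Fourier
coefficients of the phase as a function of the bits of the surviving qubits.

A qubit survives `d` layers with probability `(1 - 2 * p) ^ d`, independently of the others, and
shares a gate with at most `d * k` qubits. Above the depth threshold, `(d * k) ^ 2 * (1 - 2 * p) ^ d`
is at most `1 / 2` (`subcritical`), and a count of the walks that run through a cluster of
surviving qubits shows that with high probability all clusters have at most `L` qubits
(`IQPCircuit.expect_not_smallClusters_le`). The phase factorizes over the clusters, and so does
`recordProb ω` for a given state `z` (`IQPCircuit.recordProb_eq_prod`). Therefore the outcomes
of the clusters can be sampled one cluster after the other, by summation over the at most `2 ^ L`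
states of a cluster.

The algorithm `sampler` takes `2 ^ L` of the order `n / ε` and rounds all real numbers to
`K = 16 * L` binary digits. Every rounded diagonal entry is a Gaussian integer divided by `2 ^ K`,
so all later computations are exact, with integers of polynomial length, and the outcome of a
cluster is selected by comparing a random integer with sums of integral weights
(`IQPCircuit.classWeight`). The running time of all this is bounded by a power of `d + k + n / ε`,
which is polynomial in `k + n / ε` as long as `d < 4 ^ L`. If `4 ^ L ≤ d`, no qubit survives with high
probability (`mul_survive_pow_le`), and a uniformly random output is good enough.

For the error analysis a lower bound on the probabilities of the outputs suffices
(`tvDist_le_of_lower_bound`). Such a bound is the probability that all clusters are small and the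
random integers select the given output (`expect_le_expect_accepts`); what the algorithm does
otherwise is irrelevant. Three errors are made: the noise parameters are rounded, large clusters
are ignored, and the gates are rounded (`IQPCircuit.sum_abs_outputProb_sub_le`, `total_error_le`).

The algorithm is split into random and deterministic parts. The deterministic parts (except for the
choice of `L`) are written as a `Prog`, whose only loops are counting loops. Such a program has a
denotation `Prog.den`, which is a function on memories, and a running time that is polynomial in
the variables that bound its loops (`Prog.exists_exec`); so its correctness is a statement about
`Prog.den` only. The random parts draw independent uniformly random bits (`RandExec`).

The programs use the following cells. Variables: `0` to `7` hold `n`, `d`, `k`, `L`, `M = 2 ^ L`,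
`K`, `K + 1` and the precision `J`; the pairs `41`, `42` and `38`, `39` are Gaussian integers;
`71` holds `M ^ 2`. Arrays: `0` to `5` the input, `6` the output, `7` the random numbers for the
noise, `8` the flips, `9` which qubits have been dephased, `10` the parities of the numbers of `Y`
errors, `11` the labels of the clusters, `12` an outcome, `13` the members of the current class,
`14` an assignment of its bits, `15` a basis state, `16` the state of the dephased qubits, `17` the
random numbers for the classes.
-/


open Finset
open scoped BigOperators

namespace NoisyIQP

/-! ### Execution of commands -/

/-- Starting from the memory `m`, the command `c` terminates after exactly `t` steps, whatever the
coins are, and leaves a memory distributed according to `μ`. -/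
def Exec (c : Cmd) (m : Memory) (t : ℕ) (μ : PMF Memory) : Prop :=
  ∀ K s, runFor (t + s) (c :: K, m) = μ.bind fun m' => runFor s (K, m')

theorem Exec.pure_iff {c : Cmd} {m m' : Memory} {t : ℕ} :
    Exec c m t (PMF.pure m') ↔ ∀ K s, runFor (t + s) (c :: K, m) = runFor s (K, m') := by
  simp [Exec]

theorem runFor_add_one (t : ℕ) (c : Config) : runFor (1 + t) c = (step c).bind (runFor t) := by
  rw [Nat.add_comm]; rfl

theorem runFor_nil (t : ℕ) (m : Memory) : runFor t ([], m) = PMF.pure ([], m) := by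
  induction t with
  | zero => rfl
  | succ t ih => simp [runFor, step, ih]

theorem exec_assign (x : ℕ) (e : Expr) (m : Memory) :
    Exec (.assign x e) m 1 (PMF.pure (m.setVar x (e.eval m))) := by
  intro K s; simp [runFor_add_one, step]

theorem exec_load (x a : ℕ) (idx : List Expr) (m : Memory) :
    Exec (.load x a idx) m 1 (PMF.pure (m.setVar x (m.arr a (idx.map (Expr.eval m))))) := by
  intro K s; simp [runFor_add_one, step]

theorem exec_store (a : ℕ) (idx : List Expr) (e : Expr) (m : Memory) :
    Exec (.store a idx e) m 1
      (PMF.pure (m.setArr a (idx.map (Expr.eval m)) (e.eval m))) := by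
  intro K s; simp [runFor_add_one, step]

theorem exec_flip (x : ℕ) (m : Memory) :
    Exec (.flip x) m 1
      ((PMF.uniformOfFintype Bool).map fun b => m.setVar x (if b then 1 else 0)) := by
  intro K s
  simp [runFor_add_one, step, PMF.bind_map, Function.comp_def]

theorem exec_seq {c₁ c₂ : Cmd} {m : Memory} {t₁ t₂ : ℕ} {μ : PMF Memory} {ν : Memory → PMF Memory}
    (h₁ : Exec c₁ m t₁ μ) (h₂ : ∀ m' ∈ μ.support, Exec c₂ m' t₂ (ν m')) :
    Exec (.seq c₁ c₂) m (1 + t₁ + t₂) (μ.bind ν) := by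
  intro K s
  rw [Nat.add_assoc, Nat.add_assoc, runFor_add_one]
  simp only [step, PMF.pure_bind]
  rw [h₁, PMF.bind_bind]
  ext c
  simp only [PMF.bind_apply]
  refine tsum_congr fun m' => ?_
  by_cases hm : μ m' = 0
  · simp [hm]
  · rw [h₂ m' ((PMF.mem_support_iff _ _).2 hm), PMF.bind_apply]

theorem exec_cond {e : Expr} {c₁ c₂ : Cmd} {m : Memory} {t : ℕ} {μ : PMF Memory}
    (h : Exec (if 0 < e.eval m then c₁ else c₂) m t μ) : Exec (.cond e c₁ c₂) m (1 + t) μ := by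
  intro K s
  rw [Nat.add_assoc, runFor_add_one]
  simp only [step, PMF.pure_bind]
  exact h K s

theorem exec_loop_false {e : Expr} {c : Cmd} {m : Memory} (h : ¬ 0 < e.eval m) :
    Exec (.loop e c) m 1 (PMF.pure m) := by
  intro K s
  simp [runFor_add_one, step, h]

theorem exec_loop_true {e : Expr} {c : Cmd} {m : Memory} {t₁ t₂ : ℕ} {μ : PMF Memory}
    {ν : Memory → PMF Memory} (h : 0 < e.eval m) (h₁ : Exec c m t₁ μ)
    (h₂ : ∀ m' ∈ μ.support, Exec (.loop e c) m' t₂ (ν m')) :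
    Exec (.loop e c) m (1 + t₁ + t₂) (μ.bind ν) := by
  have := exec_seq h₁ h₂
  intro K s
  have h' := this K s
  rw [Nat.add_assoc, Nat.add_assoc, runFor_add_one] at h' ⊢
  simpa only [step, h, if_true, PMF.pure_bind] using h'

theorem exec_seq_pure {c₁ c₂ : Cmd} {m m' : Memory} {t₁ t₂ : ℕ} {μ : PMF Memory}
    (h₁ : Exec c₁ m t₁ (PMF.pure m')) (h₂ : Exec c₂ m' t₂ μ) :
    Exec (.seq c₁ c₂) m (1 + t₁ + t₂) μ := by
  have := exec_seq (ν := fun _ => μ) h₁ (t₂ := t₂) (by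
    intro m'' hm
    rw [PMF.support_pure, Set.mem_singleton_iff] at hm
    rwa [hm])
  simpa using this

theorem exec_loop_true_pure {e : Expr} {c : Cmd} {m m' : Memory} {t₁ t₂ : ℕ} {μ : PMF Memory}
    (h : 0 < e.eval m) (h₁ : Exec c m t₁ (PMF.pure m')) (h₂ : Exec (.loop e c) m' t₂ μ) :
    Exec (.loop e c) m (1 + t₁ + t₂) μ := by
  have := exec_loop_true (ν := fun _ => μ) h h₁ (t₂ := t₂) (by
    intro m'' hm
    rw [PMF.support_pure, Set.mem_singleton_iff] at hm
    rwa [hm])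
  simpa using this

/-! ### Deterministic programs with counting loops -/

/-- Deterministic programs whose only loops are counting loops: `count x p c` runs `c` with the
variable `x` equal to `N - 1`, …, `1`, `0`, where `N` is the initial value of the variable `p`. -/
inductive Prog where
  | skip
  | assign (x : ℕ) (e : Expr)
  | load (x : ℕ) (a : ℕ) (idx : List Expr)
  | store (a : ℕ) (idx : List Expr) (e : Expr)
  | seq (c₁ c₂ : Prog)
  | cond (e : Expr) (c₁ c₂ : Prog)
  | count (x p : ℕ) (c : Prog)

/-- `downFold f i s` applies `f (i - 1)`, …, `f 1`, `f 0` in this order, starting from `s`. -/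
def downFold {σ : Type*} (f : ℕ → σ → σ) : ℕ → σ → σ
  | 0, s => s
  | i + 1, s => downFold f i (f i s)

namespace Prog

/-- The counting loop as a command. -/
def countCmd (x p : ℕ) (c : Cmd) : Cmd :=
  .seq (.assign x (.var p))
    (.loop (.var x) (.seq (.assign x (.sub (.var x) (.const 1))) c))

/-- Translation into commands of the random access machine. -/
def compile : Prog → Cmd
  | skip => .assign 0 (.var 0)
  | assign x e => .assign x e
  | load x a idx => .load x a idx
  | store a idx e => .store a idx e
  | seq c₁ c₂ => .seq c₁.compile c₂.compile
  | cond e c₁ c₂ => .cond e c₁.compile c₂.compile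
  | count x p c => countCmd x p c.compile

/-- The effect of a program on the memory, provided it is `WellFormed`. -/
def den : Prog → Memory → Memory
  | skip, m => m
  | assign x e, m => m.setVar x (e.eval m)
  | load x a idx, m => m.setVar x (m.arr a (idx.map (Expr.eval m)))
  | store a idx e, m => m.setArr a (idx.map (Expr.eval m)) (e.eval m)
  | seq c₁ c₂, m => c₂.den (c₁.den m)
  | cond e c₁ c₂, m => if 0 < e.eval m then c₁.den m else c₂.den m
  | count x p c, m =>
      downFold (fun i m => c.den (m.setVar x i)) (m.var p).toNat (m.setVar x (m.var p))

/-- The variables that a program may change. -/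
def modV : Prog → List ℕ
  | skip => []
  | assign x _ => [x]
  | load x _ _ => [x]
  | store _ _ _ => []
  | seq c₁ c₂ => c₁.modV ++ c₂.modV
  | cond _ c₁ c₂ => c₁.modV ++ c₂.modV
  | count x _ c => x :: c.modV

/-- The arrays that a program may change. -/
def modA : Prog → List ℕ
  | skip => []
  | assign _ _ => []
  | load _ _ _ => []
  | store a _ _ => [a]
  | seq c₁ c₂ => c₁.modA ++ c₂.modA
  | cond _ c₁ c₂ => c₁.modA ++ c₂.modA
  | count _ _ c => c.modA

/-- No loop body changes the counter of its loop. -/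
def WellFormed : Prog → Bool
  | seq c₁ c₂ => c₁.WellFormed && c₂.WellFormed
  | cond _ c₁ c₂ => c₁.WellFormed && c₂.WellFormed
  | count x _ c => decide (x ∉ c.modV) && c.WellFormed
  | _ => true

/-- The variables that bound the loops of a program. -/
def bounds : Prog → List ℕ
  | seq c₁ c₂ => c₁.bounds ++ c₂.bounds
  | cond _ c₁ c₂ => c₁.bounds ++ c₂.bounds
  | count _ p c => p :: c.bounds
  | _ => []

/-- A constant for the bound on the running time. -/
def size : Prog → ℕ
  | seq c₁ c₂ => c₁.size + c₂.size + 1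
  | cond _ c₁ c₂ => c₁.size + c₂.size + 1
  | count _ _ c => c.size + 3
  | _ => 1

/-- The nesting depth of the loops. -/
def depth : Prog → ℕ
  | seq c₁ c₂ => max c₁.depth c₂.depth
  | cond _ c₁ c₂ => max c₁.depth c₂.depth
  | count _ _ c => c.depth + 1
  | _ => 0

end Prog

theorem Memory.setVar_var (m : Memory) (x y : ℕ) (v : ℤ) :
    (m.setVar x v).var y = if y = x then v else m.var y := by
  simp [Memory.setVar, Function.update_apply]

@[simp] theorem Memory.setVar_arr (m : Memory) (x : ℕ) (v : ℤ) : (m.setVar x v).arr = m.arr := rfl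

@[simp] theorem Memory.setArr_var (m : Memory) (a : ℕ) (i : List ℤ) (v : ℤ) :
    (m.setArr a i v).var = m.var := rfl

theorem Memory.setArr_arr (m : Memory) (a b : ℕ) (i j : List ℤ) (v : ℤ) :
    (m.setArr a i v).arr b j = if b = a then (if j = i then v else m.arr b j) else m.arr b j := by
  unfold Memory.setArr
  by_cases h : b = a
  · subst h; simp [Function.update_apply]
  · simp [h]

theorem Memory.setArr_arr_ne (m : Memory) (a b : ℕ) (i : List ℤ) (v : ℤ) (h : b ≠ a) :
    (m.setArr a i v).arr b = m.arr b := by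
  unfold Memory.setArr
  simp [h]

/-- An invariant of a counting loop. -/
theorem downFold_induction {σ : Type*} {f : ℕ → σ → σ} (P : ℕ → σ → Prop) {N : ℕ} {s : σ}
    (h0 : P N s) (hs : ∀ i < N, ∀ s, P (i + 1) s → P i (f i s)) : P 0 (downFold f N s) := by
  induction N generalizing s with
  | zero => exact h0
  | succ N ih =>
      exact ih (hs N (Nat.lt_succ_self N) s h0) fun i hi => hs i (Nat.lt_succ_of_lt hi)

namespace Prog

theorem den_var {c : Prog} {x : ℕ} (h : x ∉ c.modV) (m : Memory) :
    (c.den m).var x = m.var x := by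
  induction c generalizing m with
  | skip => rfl
  | assign y e => simp only [modV, List.mem_singleton] at h; simp [den, Memory.setVar_var, h]
  | load y a idx => simp only [modV, List.mem_singleton] at h; simp [den, Memory.setVar_var, h]
  | store a idx e => rfl
  | seq c₁ c₂ h₁ h₂ =>
      simp only [modV, List.mem_append, not_or] at h
      rw [den, h₂ h.2, h₁ h.1]
  | cond e c₁ c₂ h₁ h₂ =>
      simp only [modV, List.mem_append, not_or] at h
      rw [den]; split_ifs
      · exact h₁ h.1 m
      · exact h₂ h.2 m
  | count y p c hc =>
      simp only [modV, List.mem_cons, not_or] at h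
      refine downFold_induction (fun _ (m' : Memory) => m'.var x = m.var x) ?_ ?_
      · simp [Memory.setVar_var, h.1]
      · intro i _ s hs
        rw [hc h.2, Memory.setVar_var, if_neg h.1, hs]

theorem den_arr {c : Prog} {a : ℕ} (h : a ∉ c.modA) (m : Memory) :
    (c.den m).arr a = m.arr a := by
  induction c generalizing m with
  | skip => rfl
  | assign y e => rfl
  | load y a idx => rfl
  | store b idx e =>
      simp only [modA, List.mem_singleton] at h
      exact Memory.setArr_arr_ne _ _ _ _ _ h
  | seq c₁ c₂ h₁ h₂ =>
      simp only [modA, List.mem_append, not_or] at h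
      rw [den, h₂ h.2, h₁ h.1]
  | cond e c₁ c₂ h₁ h₂ =>
      simp only [modA, List.mem_append, not_or] at h
      rw [den]; split_ifs
      · exact h₁ h.1 m
      · exact h₂ h.2 m
  | count y p c hc =>
      refine downFold_induction (fun _ (m' : Memory) => m'.arr a = m.arr a) rfl ?_
      intro i _ s hs
      rw [hc h, Memory.setVar_arr, hs]

/-- A well-formed program computes its denotation, in time polynomial in a common bound `Q` on
the variables that bound its loops. -/
theorem exists_exec {c : Prog} (hc : c.WellFormed) (Q : ℕ) (m : Memory)
    (hd : ∀ p ∈ c.bounds, p ∉ c.modV) (hQ : ∀ p ∈ c.bounds, m.var p ≤ Q) :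
    ∃ t ≤ c.size * (Q + 4) ^ c.depth, Exec c.compile m t (PMF.pure (c.den m)) := by
  induction c generalizing m with
  | skip =>
      refine ⟨1, by simp [size, depth], ?_⟩
      have := exec_assign 0 (.var 0) m
      have hm : m.setVar 0 (Expr.eval m (.var 0)) = m := by
        simp [Memory.setVar, Expr.eval]
      rwa [hm] at this
  | assign x e => exact ⟨1, by simp [size, depth], exec_assign x e m⟩
  | load x a idx => exact ⟨1, by simp [size, depth], exec_load x a idx m⟩
  | store a idx e => exact ⟨1, by simp [size, depth], exec_store a idx e m⟩
  | seq c₁ c₂ h₁ h₂ =>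
      simp only [WellFormed, Bool.and_eq_true] at hc
      simp only [bounds, modV, List.mem_append, not_or] at hd hQ
      obtain ⟨t₁, ht₁, e₁⟩ := h₁ hc.1 m (fun p hp => (hd p (.inl hp)).1) fun p hp => hQ p (.inl hp)
      obtain ⟨t₂, ht₂, e₂⟩ := h₂ hc.2 (c₁.den m) (fun p hp => (hd p (.inr hp)).2) fun p hp => by
        rw [den_var (hd p (.inr hp)).1]; exact hQ p (.inr hp)
      refine ⟨1 + t₁ + t₂, ?_, exec_seq_pure e₁ e₂⟩
      have hp₁ : (Q + 4) ^ c₁.depth ≤ (Q + 4) ^ max c₁.depth c₂.depth :=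
        Nat.pow_le_pow_right (by omega) (le_max_left _ _)
      have hp₂ : (Q + 4) ^ c₂.depth ≤ (Q + 4) ^ max c₁.depth c₂.depth :=
        Nat.pow_le_pow_right (by omega) (le_max_right _ _)
      have hp₃ : 1 ≤ (Q + 4) ^ max c₁.depth c₂.depth := Nat.one_le_pow _ _ (by omega)
      have := Nat.mul_le_mul_left c₁.size hp₁
      have := Nat.mul_le_mul_left c₂.size hp₂
      simp only [size, depth, add_mul]
      omega
  | cond e c₁ c₂ h₁ h₂ =>
      simp only [WellFormed, Bool.and_eq_true] at hc
      simp only [bounds, modV, List.mem_append, not_or] at hd hQ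
      obtain ⟨t₁, ht₁, e₁⟩ := h₁ hc.1 m (fun p hp => (hd p (.inl hp)).1) fun p hp => hQ p (.inl hp)
      obtain ⟨t₂, ht₂, e₂⟩ := h₂ hc.2 m (fun p hp => (hd p (.inr hp)).2) fun p hp => hQ p (.inr hp)
      have hp₁ : (Q + 4) ^ c₁.depth ≤ (Q + 4) ^ max c₁.depth c₂.depth :=
        Nat.pow_le_pow_right (by omega) (le_max_left _ _)
      have hp₂ : (Q + 4) ^ c₂.depth ≤ (Q + 4) ^ max c₁.depth c₂.depth :=
        Nat.pow_le_pow_right (by omega) (le_max_right _ _)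
      have hp₃ : 1 ≤ (Q + 4) ^ max c₁.depth c₂.depth := Nat.one_le_pow _ _ (by omega)
      have := Nat.mul_le_mul_left c₁.size hp₁
      have := Nat.mul_le_mul_left c₂.size hp₂
      by_cases h : 0 < e.eval m
      · refine ⟨1 + t₁, ?_, ?_⟩
        · simp only [size, depth, add_mul]; omega
        · simp only [compile, den, h, if_true]
          exact exec_cond (by simpa only [h, if_true] using e₁)
      · refine ⟨1 + t₂, ?_, ?_⟩
        · simp only [size, depth, add_mul]; omega
        · simp only [compile, den, h, if_false]
          exact exec_cond (by simpa only [h, if_false] using e₂)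
  | count x p c ih =>
      simp only [WellFormed, Bool.and_eq_true, decide_eq_true_eq] at hc
      simp only [bounds, modV, List.mem_cons, not_or] at hd hQ
      set b := c.size * (Q + 4) ^ c.depth with hb
      have key : ∀ (N : ℕ) (m : Memory) (_ : ∀ p ∈ c.bounds, m.var p ≤ Q)
          (_ : (m.var x).toNat = N),
          ∃ t ≤ N * (b + 3) + 1,
            Exec (.loop (.var x) (.seq (.assign x (.sub (.var x) (.const 1))) c.compile)) m t
              (PMF.pure (downFold (fun i m => c.den (m.setVar x i)) N m)) := by
        intro N
        induction N with
        | zero =>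
            intro m _ hx
            exact ⟨1, by omega, exec_loop_false (by simp only [Expr.eval]; omega)⟩
        | succ N ihN =>
            intro m hm hx
            have hxN : m.var x - 1 = (N : ℤ) := by omega
            have hm' : ∀ q ∈ c.bounds, (m.setVar x N).var q ≤ Q := by
              intro q hq
              rw [Memory.setVar_var, if_neg (hd q (.inr hq)).1]
              exact hm q hq
            obtain ⟨t₁, ht₁, e₁⟩ := ih hc.2 (m.setVar x N) (fun q hq => (hd q (.inr hq)).2) hm'
            obtain ⟨t₂, ht₂, e₂⟩ := ihN (c.den (m.setVar x N))
              (fun q hq => by rw [den_var (hd q (.inr hq)).2]; exact hm' q hq)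
              (by rw [den_var hc.1, Memory.setVar_var, if_pos rfl]; simp)
            have e₀ := exec_assign x (.sub (.var x) (.const 1)) m
            simp only [Expr.eval, hxN] at e₀
            refine ⟨_, ?_, exec_loop_true_pure (by simp only [Expr.eval]; omega)
              (exec_seq_pure e₀ e₁) e₂⟩
            rw [add_mul]; omega
      obtain ⟨t, ht, et⟩ := key (m.var p).toNat (m.setVar x (m.var p)) (fun q hq => by
          rw [Memory.setVar_var, if_neg (hd q (.inr hq)).1]; exact hQ q (.inr hq))
        (by rw [Memory.setVar_var, if_pos rfl])
      refine ⟨1 + 1 + t, ?_, exec_seq_pure (exec_assign x (.var p) m) et⟩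
      have hpQ := hQ p (.inl rfl)
      have hN : (m.var p).toNat ≤ Q := by omega
      have h1 : (m.var p).toNat * (b + 3) ≤ Q * (b + 3) := Nat.mul_le_mul_right _ hN
      have hp₃ : 1 ≤ (Q + 4) ^ c.depth := Nat.one_le_pow _ _ (by omega)
      have h2 : (c.size + 3) * (Q + 4) ^ (c.depth + 1)
          = (b + 3 * (Q + 4) ^ c.depth) * (Q + 4) := by rw [hb]; ring
      simp only [size, depth]
      rw [h2]
      have h3 : (b + 3) * (Q + 4) ≤ (b + 3 * (Q + 4) ^ c.depth) * (Q + 4) :=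
        Nat.mul_le_mul_right _ (by omega)
      have h4 : (b + 3) * (Q + 4) = Q * (b + 3) + (b + 3) * 4 := by ring
      omega

end Prog


/-! ### Uniform averages over functions -/

section Average

set_option linter.unusedSectionVars false

variable {ι β : Type*} [Fintype ι] [DecidableEq ι] [Fintype β]

/-- Taking the coordinates in `C` and the others from two independent uniformly random functions
yields a uniformly random function. -/
theorem expect_piecewise {M : Type*} [AddCommMonoid M] [Module ℚ≥0 M] (C : Finset ι)
    (H : (ι → β) → M) (hβ : Nonempty β) :
    𝔼 s : ι → β, 𝔼 t : ι → β, H (C.piecewise s t) = 𝔼 s, H s := by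
  have e : 𝔼 s : ι → β, 𝔼 t : ι → β, H (C.piecewise s t)
      = 𝔼 s : ι → β, 𝔼 _t : ι → β, H s := by
    rw [← expect_product' univ univ fun s t => H (C.piecewise s t),
      ← expect_product' univ univ fun s (_ : ι → β) => H s]
    refine expect_nbij' (fun p => (C.piecewise p.1 p.2, C.piecewise p.2 p.1))
      (fun p => (C.piecewise p.1 p.2, C.piecewise p.2 p.1)) ?_ ?_ ?_ ?_ ?_
    · simp
    · simp
    · rintro ⟨s, t⟩ _
      ext i <;> by_cases hi : i ∈ C <;> simp [hi]
    · rintro ⟨s, t⟩ _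
      ext i <;> by_cases hi : i ∈ C <;> simp [hi]
    · simp
  rw [e]
  exact expect_congr rfl fun s _ => Fintype.expect_const _

/-- Resampling one coordinate of a uniformly random function. -/
theorem expect_update {M : Type*} [AddCommMonoid M] [Module ℚ≥0 M] (j : ι)
    (H : (ι → β) → M) (hβ : Nonempty β) :
    𝔼 s : ι → β, 𝔼 o : β, H (Function.update s j o) = 𝔼 s, H s := by
  have e : 𝔼 s : ι → β, 𝔼 o : β, H (Function.update s j o) = 𝔼 s : ι → β, 𝔼 _o : β, H s := by
    rw [← expect_product' univ univ fun s o => H (Function.update s j o),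
      ← expect_product' univ univ fun s (_ : β) => H s]
    refine expect_nbij' (fun p => (Function.update p.1 j p.2, p.1 j))
      (fun p => (Function.update p.1 j p.2, p.1 j)) ?_ ?_ ?_ ?_ ?_ <;> simp
  rw [e]
  exact expect_congr rfl fun s _ => Fintype.expect_const _

variable {R : Type*} [CommSemiring R] [Module ℚ≥0 R] [IsScalarTower ℚ≥0 R R]
  [SMulCommClass ℚ≥0 R R]

theorem expect_mul_of_dependsOn {C D : Set ι} (hCD : Disjoint C D)
    {f g : (ι → β) → R} (hf : DependsOn f C) (hg : DependsOn g D) (hβ : Nonempty β) :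
    𝔼 s, f s * g s = (𝔼 s, f s) * 𝔼 s, g s := by
  classical
  rw [← expect_piecewise C.toFinset _ hβ, expect_mul_expect]
  refine expect_congr rfl fun s _ => expect_congr rfl fun t _ => ?_
  congr 1
  · exact hf fun i hi => by simp [hi]
  · exact hg fun i hi => by
      have : i ∉ C := fun h => Set.disjoint_left.1 hCD h hi
      simp [this]

theorem dependsOn_prod {V : Type*} {C : V → Set ι} {f : V → (ι → β) → R} (s : Finset V)
    (hf : ∀ v ∈ s, DependsOn (f v) (C v)) :
    DependsOn (fun x => ∏ v ∈ s, f v x) (⋃ v ∈ s, C v) := by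
  intro x y hxy
  refine prod_congr rfl fun v hv => hf v hv fun i hi => hxy i ?_
  simp only [Set.mem_iUnion]
  exact ⟨v, hv, hi⟩

/-- Functions of disjoint sets of coordinates are independent. -/
theorem expect_prod_of_dependsOn {V : Type*} [DecidableEq V] {C : V → Set ι}
    {f : V → (ι → β) → R} (s : Finset V) (hf : ∀ v ∈ s, DependsOn (f v) (C v))
    (hC : ∀ v ∈ s, ∀ w ∈ s, v ≠ w → Disjoint (C v) (C w)) (hβ : Nonempty β) :
    𝔼 x, ∏ v ∈ s, f v x = ∏ v ∈ s, 𝔼 x, f v x := by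
  induction s using Finset.induction_on with
  | empty => simp
  | insert a s ha ih =>
      simp only [prod_insert ha]
      rw [expect_mul_of_dependsOn (D := ⋃ v ∈ s, C v) _ (hf a (mem_insert_self _ _))
        (dependsOn_prod s fun v hv => hf v (mem_insert_of_mem hv)) hβ,
        ih (fun v hv => hf v (mem_insert_of_mem hv))
          fun v hv w hw => hC v (mem_insert_of_mem hv) w (mem_insert_of_mem hw)]
      simp only [Set.disjoint_iUnion_right]
      exact fun v hv => hC a (mem_insert_self _ _) v (mem_insert_of_mem hv)
        (fun h => ha (h ▸ hv))

theorem expect_eval (i : ι) (f : β → R) (hβ : Nonempty β) : 𝔼 x : ι → β, f (x i) = 𝔼 o, f o := by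
  rw [← expect_update i _ hβ]
  simp

theorem expect_prod_eval (f : ι → β → R) (hβ : Nonempty β) :
    𝔼 x : ι → β, ∏ i, f i (x i) = ∏ i, 𝔼 o, f i o := by
  rw [expect_prod_of_dependsOn (C := fun i => {i}) (f := fun i x => f i (x i)) univ _ _ hβ]
  · exact prod_congr rfl fun i _ => expect_eval i (f i) hβ
  · exact fun i _ x y h => congrArg (f i) (h i rfl)
  · exact fun i _ j _ hij => by simpa using hij

/-- The `L¹` distance of products of nonnegative functions with mean at most one that depend on
disjoint sets of coordinates is at most the sum of the distances of the factors. -/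
theorem expect_abs_prod_sub_le {V : Type*} [DecidableEq V] {C : V → Set ι}
    {f g : V → (ι → β) → ℝ} (s : Finset V) (hβ : Nonempty β)
    (hf : ∀ v ∈ s, DependsOn (f v) (C v)) (hg : ∀ v ∈ s, DependsOn (g v) (C v))
    (hC : ∀ v ∈ s, ∀ w ∈ s, v ≠ w → Disjoint (C v) (C w))
    (hf0 : ∀ v ∈ s, ∀ x, 0 ≤ f v x) (hg0 : ∀ v ∈ s, ∀ x, 0 ≤ g v x)
    (hf1 : ∀ v ∈ s, 𝔼 x, f v x ≤ 1) (hg1 : ∀ v ∈ s, 𝔼 x, g v x ≤ 1) :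
    𝔼 x, |∏ v ∈ s, f v x - ∏ v ∈ s, g v x| ≤ ∑ v ∈ s, 𝔼 x, |f v x - g v x| := by
  induction s using Finset.induction_on with
  | empty => simp
  | insert a s ha ih =>
      have hm : ∀ {v}, v ∈ s → v ∈ insert a s := fun h => mem_insert_of_mem h
      have ha' := mem_insert_self a s
      have ih' := ih (fun v hv => hf v (hm hv)) (fun v hv => hg v (hm hv))
        (fun v hv w hw => hC v (hm hv) w (hm hw)) (fun v hv => hf0 v (hm hv))
        (fun v hv => hg0 v (hm hv)) (fun v hv => hf1 v (hm hv)) (fun v hv => hg1 v (hm hv))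
      have hdisj : Disjoint (C a) (⋃ v ∈ s, C v) := by
        simp only [Set.disjoint_iUnion_right]
        exact fun v hv => hC a ha' v (hm hv) (fun h => ha (h ▸ hv))
      have dF := dependsOn_prod s fun v hv => hf v (hm hv)
      have dG := dependsOn_prod s fun v hv => hg v (hm hv)
      have hF0 : ∀ x, 0 ≤ ∏ v ∈ s, f v x := fun x => prod_nonneg fun v hv => hf0 v (hm hv) x
      have hF1 : 𝔼 x, ∏ v ∈ s, f v x ≤ 1 := by
        rw [expect_prod_of_dependsOn s (fun v hv => hf v (hm hv))
          (fun v hv w hw => hC v (hm hv) w (hm hw)) hβ]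
        exact prod_le_one (fun v hv => expect_nonneg fun x _ => hf0 v (hm hv) x)
          fun v hv => hf1 v (hm hv)
      simp only [prod_insert ha, sum_insert ha]
      have hpt : ∀ x, |f a x * ∏ v ∈ s, f v x - g a x * ∏ v ∈ s, g v x|
          ≤ |f a x - g a x| * ∏ v ∈ s, f v x
            + g a x * |∏ v ∈ s, f v x - ∏ v ∈ s, g v x| := by
        intro x
        have : f a x * ∏ v ∈ s, f v x - g a x * ∏ v ∈ s, g v x
          = (f a x - g a x) * ∏ v ∈ s, f v x
            + g a x * (∏ v ∈ s, f v x - ∏ v ∈ s, g v x) := by ring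
        rw [this]
        refine (abs_add_le _ _).trans (le_of_eq ?_)
        rw [abs_mul, abs_mul, abs_of_nonneg (hF0 x), abs_of_nonneg (hg0 a ha' x)]
      refine (expect_le_expect fun x _ => hpt x).trans ?_
      rw [expect_add_distrib]
      rw [expect_mul_of_dependsOn hdisj (f := fun x => |f a x - g a x|) _ dF hβ,
        expect_mul_of_dependsOn hdisj (hg a ha')
          (g := fun x => |∏ v ∈ s, f v x - ∏ v ∈ s, g v x|) _ hβ]
      · refine add_le_add ?_ ?_
        · exact mul_le_of_le_one_right (expect_nonneg fun x _ => abs_nonneg _) hF1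
        · refine (mul_le_of_le_one_left (expect_nonneg fun x _ => abs_nonneg _)
            (hg1 a ha')).trans ih'
      · exact fun x y h => by
          have h1 := dF h; have h2 := dG h
          simp only at h1 h2 ⊢; rw [h1, h2]
      · exact fun x y h => by simp only; rw [hf a ha' h, hg a ha' h]

end Average


/-! ### Characters -/

section Character

variable {n : ℕ}

/-- The sign `(-1) ^ (b · s)`, where only the coordinates in `C` enter the inner product. -/
noncomputable def chi (C : Finset (Fin n)) (b s : Bits n) : ℂ :=
  ∏ i ∈ C, if b i && s i then -1 else 1

theorem chi_congr {C : Finset (Fin n)} {b b' s s' : Bits n} (hb : ∀ i ∈ C, b i = b' i)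
    (hs : ∀ i ∈ C, s i = s' i) : chi C b s = chi C b' s' :=
  prod_congr rfl fun i hi => by rw [hb i hi, hs i hi]

theorem norm_chi (C : Finset (Fin n)) (b s : Bits n) : ‖chi C b s‖ = 1 := by
  rw [chi, norm_prod]
  exact prod_eq_one fun i _ => by split_ifs <;> simp

theorem conj_chi (C : Finset (Fin n)) (b s : Bits n) : (starRingEnd ℂ) (chi C b s) = chi C b s := by
  rw [chi, map_prod]
  exact prod_congr rfl fun i _ => by split_ifs <;> simp

theorem expect_bits_eq_prod {F : Bits n → ℂ} (f : Fin n → Bool → ℂ)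
    (h : ∀ b, F b = ∏ i, f i (b i)) : 𝔼 b, F b = ∏ i, (f i false + f i true) / 2 := by
  refine (expect_congr rfl fun b _ => h b).trans
    ((expect_prod_eval f ⟨true⟩).trans (prod_congr rfl fun i _ => ?_))
  rw [Fintype.expect_eq_sum_div_card]
  simp [add_comm]

theorem ite_forall_eq_prod (C : Finset (Fin n)) (p : Fin n → Prop) [DecidablePred p]
    [Decidable (∀ i ∈ C, p i)] :
    (if ∀ i ∈ C, p i then 1 else 0 : ℂ) = ∏ i, if i ∈ C then (if p i then 1 else 0) else 1 := by
  rw [prod_ite_mem, univ_inter, prod_boole]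
  congr

theorem expect_chi_mul_chi (C : Finset (Fin n)) (s t : Bits n) :
    𝔼 b, chi C b s * chi C b t = if ∀ i ∈ C, s i = t i then 1 else 0 := by
  rw [expect_bits_eq_prod fun i o => if i ∈ C then
    ((if o && s i then -1 else 1) * (if o && t i then -1 else 1) : ℂ) else 1]
  · rw [ite_forall_eq_prod]
    refine prod_congr rfl fun i _ => ?_
    by_cases hi : i ∈ C <;> cases s i <;> cases t i <;> simp [hi]
  · intro b
    rw [prod_ite_mem, univ_inter, prod_mul_distrib]
    rfl

theorem expect_agree (C : Finset (Fin n)) (s : Bits n) :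
    𝔼 t : Bits n, (if ∀ i ∈ C, s i = t i then 1 else 0 : ℂ) = (2 ^ #C)⁻¹ := by
  rw [expect_bits_eq_prod fun i o => if i ∈ C then (if s i = o then 1 else 0 : ℂ) else 1]
  · rw [← inv_pow, ← prod_const, ← univ_inter C, ← prod_ite_mem]
    refine prod_congr rfl fun i _ => ?_
    by_cases hi : i ∈ C <;> cases s i <;> simp [hi]
  · intro b
    rw [ite_forall_eq_prod]

/-- The Fourier coefficient at `b` of `f`, regarded as a function of the coordinates in `C`. -/
noncomputable def fourier (C : Finset (Fin n)) (f : Bits n → ℂ) (b : Bits n) : ℂ :=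
  𝔼 s, chi C b s * f s

theorem fourier_congr {C : Finset (Fin n)} {f : Bits n → ℂ} {b b' : Bits n}
    (hb : ∀ i ∈ C, b i = b' i) : fourier C f b = fourier C f b' :=
  expect_congr rfl fun s _ => by rw [chi_congr hb fun i _ => rfl]

theorem mul_conj_fourier (C : Finset (Fin n)) (f : Bits n → ℂ) (b : Bits n) :
    ((‖fourier C f b‖ ^ 2 : ℝ) : ℂ)
      = 𝔼 s, 𝔼 t, chi C b s * chi C b t * (f s * (starRingEnd ℂ) (f t)) := by
  have h : ((‖fourier C f b‖ ^ 2 : ℝ) : ℂ)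
      = fourier C f b * (starRingEnd ℂ) (fourier C f b) := by
    rw [Complex.mul_conj, Complex.normSq_eq_norm_sq]
  rw [h, fourier, map_expect, expect_mul_expect]
  refine expect_congr rfl fun s _ => expect_congr rfl fun t _ => ?_
  rw [map_mul, conj_chi]; ring

theorem parseval {C : Finset (Fin n)} {f : Bits n → ℂ} (hf : DependsOn f (C : Set (Fin n))) :
    𝔼 b, 2 ^ #C * ‖fourier C f b‖ ^ 2 = 𝔼 s, ‖f s‖ ^ 2 := by
  have key : (((𝔼 b, 2 ^ #C * ‖fourier C f b‖ ^ 2 : ℝ)) : ℂ) = ((𝔼 s, ‖f s‖ ^ 2 : ℝ) : ℂ) := by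
    rw [Complex.ofReal_expect, Complex.ofReal_expect]
    simp only [Complex.ofReal_mul, mul_conj_fourier]
    rw [← mul_expect, expect_comm]
    rw [mul_expect]
    refine expect_congr rfl fun s _ => ?_
    rw [expect_comm]
    simp only [← expect_mul, expect_chi_mul_chi]
    have : ∀ t, (if ∀ i ∈ C, s i = t i then 1 else 0) * (f s * (starRingEnd ℂ) (f t))
        = (if ∀ i ∈ C, s i = t i then 1 else 0) * (f s * (starRingEnd ℂ) (f s)) := by
      intro t
      split_ifs with h
      · rw [hf (x := t) (y := s) fun i hi => (h i hi).symm]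
      · simp
    simp only [this]
    rw [← expect_mul, expect_agree, Complex.mul_conj, Complex.normSq_eq_norm_sq]
    push_cast
    rw [← mul_assoc, mul_inv_cancel₀ (pow_ne_zero _ two_ne_zero), one_mul]
  exact_mod_cast key

theorem norm_expect_le {α : Type*} [Fintype α] [Nonempty α] {f : α → ℂ} {r : ℝ}
    (h : ∀ x, ‖f x‖ ≤ r) : ‖𝔼 x, f x‖ ≤ r := by
  rw [Fintype.expect_eq_sum_div_card, norm_div, Complex.norm_natCast, div_le_iff₀ (by
    exact_mod_cast Fintype.card_pos)]
  refine (norm_sum_le _ _).trans ((sum_le_sum fun x _ => h x).trans ?_)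
  simp [mul_comm]

theorem norm_fourier_le {C : Finset (Fin n)} {f : Bits n → ℂ} {b : Bits n} {r : ℝ}
    (h : ∀ s, ‖f s‖ ≤ r) : ‖fourier C f b‖ ≤ r :=
  norm_expect_le fun s => by rw [norm_mul, norm_chi, one_mul]; exact h s

theorem norm_fourier_sub_le {C : Finset (Fin n)} {f g : Bits n → ℂ} {b : Bits n} {r : ℝ}
    (h : ∀ s, ‖f s - g s‖ ≤ r) : ‖fourier C f b - fourier C g b‖ ≤ r := by
  have : fourier C f b - fourier C g b = fourier C (fun s => f s - g s) b := by
    simp only [fourier, mul_sub, expect_sub_distrib]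
  rw [this]; exact norm_fourier_le h

end Character

/-! ### Enumeration of the assignments of a set of bits -/

section Decode

variable {n : ℕ}

/-- The assignment of the bits in `C` with number `t`: the binary digits of `t` are given to the
elements of `C` in decreasing order, and the bits outside `C` are `0`. -/
def decodeBits (C : Finset (Fin n)) (t : ℕ) : Bits n :=
  fun i => decide (i ∈ C) && t.testBit #{j ∈ C | i < j}

/-- The numbers below `2 ^ #C` enumerate the assignments of the bits in `C`. -/
theorem sum_range_decodeBits (C : Finset (Fin n)) {F : Bits n → ℂ}
    (hF : DependsOn F (C : Set (Fin n))) :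
    ∑ t ∈ range (2 ^ #C), F (decodeBits C t) = 2 ^ #C * 𝔼 s, F s := by
  induction C using Finset.induction_on_min generalizing F with
  | empty =>
      have : ∀ s, F s = F (decodeBits ∅ 0) := fun s => hF fun i hi => by simp at hi
      simp only [card_empty, pow_zero, range_one, sum_singleton, one_mul]
      rw [expect_congr rfl fun s _ => this s, Fintype.expect_const]
  | insert a C ha ih =>
      have haC : a ∉ C := fun h => lt_irrefl _ (ha a h)
      have hra : #{j ∈ insert a C | a < j} = #C := by
        congr 1; ext j; simp only [mem_filter, mem_insert]
        constructor
        · rintro ⟨rfl | h, h'⟩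
          · exact absurd h' (lt_irrefl _)
          · exact h
        · exact fun h => ⟨.inr h, ha j h⟩
      have hr : ∀ i ∈ C, #{j ∈ insert a C | i < j} = #{j ∈ C | i < j} := by
        intro i hi
        congr 1; ext j; simp only [mem_filter, mem_insert]
        constructor
        · rintro ⟨rfl | h, h'⟩
          · exact absurd (ha i hi) (not_lt.2 h'.le)
          · exact ⟨h, h'⟩
        · exact fun h => ⟨.inr h.1, h.2⟩
      have hlt : ∀ i ∈ C, #{j ∈ C | i < j} < #C := fun i hi =>
        card_lt_card (filter_ssubset.2 ⟨i, hi, lt_irrefl i⟩)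
      have hd : ∀ (t : ℕ) (o : Bool), t < 2 ^ #C →
          decodeBits (insert a C) (2 ^ #C * o.toNat + t)
            = Function.update (decodeBits C t) a o := by
        intro t o ht
        ext i
        by_cases hia : i = a
        · subst hia
          simp only [decodeBits, mem_insert, true_or, decide_true, Bool.true_and,
            Function.update_self, hra]
          rw [Nat.testBit_two_pow_mul_add _ ht, if_neg (lt_irrefl _)]
          cases o <;> simp
        · rw [Function.update_of_ne hia]
          simp only [decodeBits, mem_insert, hia, false_or]
          by_cases hi : i ∈ C
          · simp only [hi, decide_true, Bool.true_and, hr i hi]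
            rw [Nat.testBit_two_pow_mul_add _ ht, if_pos (hlt i hi)]
          · simp [hi]
      rw [card_insert_of_notMem haC, pow_succ, mul_two, range_eq_Ico,
        ← sum_Ico_consecutive _ (Nat.zero_le (2 ^ #C)) (Nat.le_add_left _ _), ← range_eq_Ico]
      have h2 : ∑ t ∈ Ico (2 ^ #C) (2 ^ #C + 2 ^ #C), F (decodeBits (insert a C) t)
          = ∑ t ∈ range (2 ^ #C), F (Function.update (decodeBits C t) a true) := by
        rw [sum_Ico_eq_sum_range]
        simp only [Nat.add_sub_cancel]
        refine sum_congr rfl fun t ht => ?_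
        rw [← hd t true (mem_range.1 ht)]; simp
      have h1 : ∑ t ∈ range (2 ^ #C), F (decodeBits (insert a C) t)
          = ∑ t ∈ range (2 ^ #C), F (Function.update (decodeBits C t) a false) := by
        refine sum_congr rfl fun t ht => ?_
        rw [← hd t false (mem_range.1 ht)]; simp
      have hG : ∀ o, DependsOn (fun s => F (Function.update s a o)) (C : Set (Fin n)) := by
        intro o x y hxy
        refine hF fun i hi => ?_
        by_cases hia : i = a
        · subst hia; simp
        · rw [Function.update_of_ne hia, Function.update_of_ne hia]
          refine hxy i ?_
          simpa [hia] using hi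
      rw [h1, h2, ih (hG false), ih (hG true), ← expect_update a F ⟨true⟩, ← mul_add,
        ← expect_add_distrib]
      have h3 : ∀ s : Bits n, 𝔼 o, F (Function.update s a o)
          = (F (Function.update s a false) + F (Function.update s a true)) / 2 := by
        intro s
        rw [Fintype.expect_eq_sum_div_card]
        simp [add_comm]
      rw [expect_congr rfl fun s _ => h3 s, ← expect_div]
      field_simp
      ring

theorem exists_decodeBits_eq (C : Finset (Fin n)) (b : Bits n) :
    ∃ t < 2 ^ #C, ∀ i ∈ C, decodeBits C t i = b i := by
  by_contra! h
  have := sum_range_decodeBits C (F := fun s => if ∀ i ∈ C, b i = s i then 1 else 0)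
    (fun x y hxy => by
      have : (∀ i ∈ C, b i = x i) ↔ ∀ i ∈ C, b i = y i :=
        forall₂_congr fun i hi => by rw [hxy i hi]
      simp only [this])
  rw [expect_agree, mul_inv_cancel₀ (pow_ne_zero _ two_ne_zero)] at this
  rw [sum_eq_zero] at this
  · exact zero_ne_one this
  · intro t ht
    obtain ⟨i, hi, hne⟩ := h t (mem_range.1 ht)
    exact if_neg fun h' => hne (h' i hi).symm

end Decode


/-! ### The output distribution as a mixture over noise records -/

section Quantum

variable {n k d : ℕ}

/-- Whether an outcome of the noise on one qubit flips the qubit.  The outcomes are: no error (`0`),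
dephasing (`1`), dephasing and a flip (`2`), `X` (`3`) and `Y` (`4`). -/
def flips (o : Fin 5) : Bool := decide (2 ≤ o)

/-- Whether an outcome of the noise dephases the qubit completely. -/
def dephases (o : Fin 5) : Bool := decide (o = 1 ∨ o = 2)

/-- The weights of the outcomes: the dephasing parts of the channel are made as large as
possible. -/
noncomputable def outcomeWeight (pX pY pZ : ℝ) : Fin 5 → ℝ :=
  ![1 - pX - pY - 2 * pZ, 2 * pZ, pX + pY - max (pX - pY) 0 - max (pY - pX) 0,
    max (pX - pY) 0, max (pY - pX) 0]

/-- The factor by which an outcome of the noise multiplies the matrix entries whose two indices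
differ (`e = true`) or agree (`e = false`) in the qubit. -/
noncomputable def outcomeSign (o : Fin 5) (e : Bool) : ℂ :=
  if e then (if dephases o then 0 else if o = 4 then -1 else 1) else 1

theorem sum_agree_off (x : Bits n) (i : Fin n) (h : Bits n → ℂ) :
    ∑ u, (if ∀ j, j ≠ i → x j = u j then h u else 0)
      = h (Function.update x i false) + h (Function.update x i true) := by
  have hne : Function.update x i false ≠ Function.update x i true := fun h => by
    have := congrFun h i; simp at this
  rw [← sum_filter, ← sum_pair (f := h) hne]
  refine sum_congr ?_ fun _ _ => rfl
  ext u
  simp only [mem_filter, mem_univ, true_and, mem_insert, mem_singleton]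
  constructor
  · intro hu
    cases hb : u i
    · left; ext j; by_cases hj : j = i
      · subst hj; simp [hb]
      · simp [hj, hu j hj]
    · right; ext j; by_cases hj : j = i
      · subst hj; simp [hb]
      · simp [hj, hu j hj]
  · rintro (rfl | rfl) j hj <;> simp [hj]

theorem onQubit_mul_apply (A : Matrix Bool Bool ℂ) (i : Fin n) (ρ : Op n) (x y : Bits n) :
    (onQubit A i * ρ) x y = A (x i) false * ρ (Function.update x i false) y
      + A (x i) true * ρ (Function.update x i true) y := by
  have := sum_agree_off x i fun u => A (x i) (u i) * ρ u y
  simp only [Function.update_self] at this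
  rw [← this, Matrix.mul_apply]
  refine sum_congr rfl fun u _ => ?_
  rw [onQubit]; split_ifs <;> simp

theorem mul_onQubit_apply (A : Matrix Bool Bool ℂ) (i : Fin n) (ρ : Op n) (x y : Bits n) :
    (ρ * onQubit A i) x y = ρ x (Function.update y i false) * A false (y i)
      + ρ x (Function.update y i true) * A true (y i) := by
  have := sum_agree_off y i fun u => ρ x u * A (u i) (y i)
  simp only [Function.update_self] at this
  rw [← this, Matrix.mul_apply]
  refine sum_congr rfl fun u _ => ?_
  have hc : (∀ j, j ≠ i → u j = y j) ↔ ∀ j, j ≠ i → y j = u j :=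
    forall₂_congr fun j _ => eq_comm
  rw [onQubit]; simp only [hc]; split_ifs <;> simp

/-- The noise channel as a mixture of the five operations. Besides the factor `outcomeSign`, an
operation only flips the same bit of both indices of a matrix entry. -/
theorem noise_apply (N : PauliNoise) (i : Fin n) (ρ : Op n) (x y : Bits n) :
    (Channel.noise N i).apply ρ x y = ∑ o, (outcomeWeight N.pX N.pY N.pZ o : ℂ) *
      outcomeSign o (x i != y i) * ρ (Function.update x i (x i ^^ flips o))
        (Function.update y i (y i ^^ flips o)) := by
  have hI : (N.pI : ℂ) = 1 - N.pX - N.pY - N.pZ := by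
    have := N.sum_eq_one
    have h2 : N.pI = 1 - N.pX - N.pY - N.pZ := by linarith
    rw [h2]; push_cast; ring
  have hm : max (N.pX - N.pY) 0 - max (N.pY - N.pX) 0 = N.pX - N.pY := by
    rcases le_total N.pX N.pY with h | h
    · rw [max_eq_right (by linarith), max_eq_left (by linarith)]; ring
    · rw [max_eq_left (by linarith), max_eq_right (by linarith)]; ring
  have hm' : ((max (N.pX - N.pY) 0 : ℝ) : ℂ) = (max (N.pY - N.pX) 0 : ℝ) + (N.pX - N.pY) := by
    rw [← Complex.ofReal_sub, ← Complex.ofReal_add]; congr 1; linarith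
  have hx : ∀ b, x i = b → Function.update x i b = x := fun b h => by rw [← h]; simp
  have hy : ∀ b, y i = b → Function.update y i b = y := fun b h => by rw [← h]; simp
  simp only [Channel.apply, Matrix.add_apply, Matrix.smul_apply, smul_eq_mul, mul_onQubit_apply,
    onQubit_mul_apply, Fin.sum_univ_five, outcomeWeight, outcomeSign, flips, dephases]
  rw [hI]
  cases hxi : x i <;> cases hyi : y i <;>
    simp [pauliX, pauliY, pauliZ, hx _ hxi, hy _ hyi, Fin.ext_iff, Fin.le_def] <;>
    rw [hm'] <;> ring_nf <;> simp <;> ring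

/-- The bits of `x` flipped according to the outcomes `τ` on the qubits in `s`. -/
def flipOn (s : Finset (Fin n)) (τ : Fin n → Fin 5) (x : Bits n) : Bits n :=
  fun i => if i ∈ s then x i ^^ flips (τ i) else x i

/-- The noise on several qubits, as an average over their outcomes. The factors `5` compensate for
the weight of a single outcome in the uniform average. -/
theorem noise_foldl_apply (N : PauliNoise) (is : List (Fin n)) (his : is.Nodup) (ρ : Op n)
    (x y : Bits n) :
    (is.map (Channel.noise N)).foldl (fun σ c => c.apply σ) ρ x y =
      𝔼 τ : Fin n → Fin 5, (∏ i ∈ is.toFinset, (5 * (outcomeWeight N.pX N.pY N.pZ (τ i) : ℂ) *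
        outcomeSign (τ i) (x i != y i))) *
          ρ (flipOn is.toFinset τ x) (flipOn is.toFinset τ y) := by
  induction is generalizing ρ with
  | nil =>
      simp only [List.map_nil, List.foldl_nil, List.toFinset_nil, prod_empty, one_mul]
      have : ∀ (τ : Fin n → Fin 5) (z : Bits n), flipOn ∅ τ z = z := fun τ z => by
        ext i; simp [flipOn]
      simp only [this]
      exact (Fintype.expect_const _).symm
  | cons j is ih =>
      obtain ⟨hj, his⟩ := List.nodup_cons.1 his
      have hj' : j ∉ is.toFinset := by simpa using hj
      rw [List.map_cons, List.foldl_cons, ih his]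
      refine Eq.trans ?_ (expect_update j _ ⟨0⟩)
      refine expect_congr rfl fun τ _ => ?_
      have hz : ∀ z : Bits n, flipOn is.toFinset τ z j = z j := fun z => by
        simp only [flipOn, hj', if_false]
      rw [noise_apply, Fintype.expect_eq_sum_div_card, mul_sum, sum_div]
      refine sum_congr rfl fun o _ => ?_
      rw [List.toFinset_cons, prod_insert hj', Function.update_self]
      have h1 : ∏ i ∈ is.toFinset, (5 * (outcomeWeight N.pX N.pY N.pZ (Function.update τ j o i) : ℂ)
            * outcomeSign (Function.update τ j o i) (x i != y i))
          = ∏ i ∈ is.toFinset, (5 * (outcomeWeight N.pX N.pY N.pZ (τ i) : ℂ) *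
            outcomeSign (τ i) (x i != y i)) :=
        prod_congr rfl fun i hi => by
          have hij : i ≠ j := fun h => hj' (h ▸ hi)
          rw [Function.update_of_ne hij]
      have h2 : ∀ z : Bits n, flipOn (insert j is.toFinset) (Function.update τ j o) z
          = Function.update (flipOn is.toFinset τ z) j
            (flipOn is.toFinset τ z j ^^ flips o) := by
        intro z; ext i
        by_cases hi : i = j
        · subst hi; rw [hz]; simp [flipOn]
        · simp [flipOn, hi]
      rw [h1, h2, h2, hz, hz, Fintype.card_fin]
      push_cast; ring

/-- The gates of layer number `l`. -/
def IQPCircuit.layerAt (C : IQPCircuit n k d) (l : ℕ) : List (DiagGate n) :=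
  if h : l < d then C.layer ⟨l, h⟩ else []

theorem IQPCircuit.gateAt_eq (C : IQPCircuit n k d) (l g : ℕ) :
    C.gateAt l g = (C.layerAt l)[g]? := by
  unfold IQPCircuit.gateAt IQPCircuit.layerAt; split_ifs <;> simp

/-- The diagonal entry at `x` of gate number `g` of layer number `l`, transformed by `τ`; it is `1`
if there is no such gate. -/
def IQPCircuit.gateValue (C : IQPCircuit n k d) (τ : ℂ → ℂ) (l g : ℕ) (x : Bits n) : ℂ :=
  (C.gateAt l g).elim 1 fun G => τ (G.diag fun r => x (G.wires r))

/-- The phase that the first `L` layers give to the basis state which ends up in `x` if the bits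
are flipped by `f l` after layer `l`.  Every diagonal entry of a gate is transformed by `τ`. -/
def IQPCircuit.phase (C : IQPCircuit n k d) (τ : ℂ → ℂ) (f : ℕ → Bits n) : ℕ → Bits n → ℂ
  | 0, _ => 1
  | l + 1, x => (∏ g ∈ range n, C.gateValue τ l g fun i => x i ^^ f l i) *
      C.phase τ f l fun i => x i ^^ f l i

theorem IQPCircuit.phase_congr (C : IQPCircuit n k d) (τ : ℂ → ℂ) {f f' : ℕ → Bits n} {l : ℕ}
    (h : ∀ j < l, f j = f' j) (x : Bits n) : C.phase τ f l x = C.phase τ f' l x := by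
  induction l generalizing x with
  | zero => rfl
  | succ l ih =>
      rw [phase, phase, h l (Nat.lt_succ_self l), ih fun j hj => h j (Nat.lt_succ_of_lt hj)]

/-- The gates of a layer act on disjoint nonempty sets of qubits. So the programs find all gates of
a layer by a loop over the indices below `n`. -/
theorem IQPCircuit.layerAt_length_le (C : IQPCircuit n k d) (l : ℕ) :
    (C.layerAt l).length ≤ n := by
  unfold layerAt
  split_ifs with h
  · set L := C.layer ⟨l, h⟩ with hL
    have hd := List.pairwise_iff_getElem.1 (C.disjoint ⟨l, h⟩)
    let w : Fin L.length → Fin n := fun g => L[g].wires ⟨0, L[g].arity_pos⟩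
    have hw : Function.Injective w := by
      intro g g' hgg
      by_contra hne
      rcases lt_or_gt_of_ne hne with hlt | hlt
      · exact hd g g' g.2 g'.2 hlt _ _ hgg
      · exact hd g' g g'.2 g.2 hlt _ _ hgg.symm
    simpa using Fintype.card_le_of_injective w hw
  · simp

theorem IQPCircuit.prod_gateValue (C : IQPCircuit n k d) (τ : ℂ → ℂ) (l : ℕ) (x : Bits n) :
    ∏ g ∈ range n, C.gateValue τ l g x
      = ((C.layerAt l).map fun G => τ (G.diag fun r => x (G.wires r))).prod := by
  have key : ∀ (L : List (DiagGate n)) (m : ℕ), L.length ≤ m →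
      ∏ g ∈ range m, (L[g]?).elim 1 (fun G => τ (G.diag fun r => x (G.wires r)))
        = (L.map fun G => τ (G.diag fun r => x (G.wires r))).prod := by
    intro L
    induction L with
    | nil => intro m _; simp
    | cons G L ih =>
        intro m hm
        obtain ⟨m, rfl⟩ : ∃ m', m = m' + 1 := ⟨m - 1, by simp at hm; omega⟩
        rw [prod_range_succ', List.map_cons, List.prod_cons, mul_comm]
        simp only [List.getElem?_cons_succ, List.getElem?_cons_zero, Option.elim_some]
        rw [ih m (by simpa using hm)]
  simp only [IQPCircuit.gateValue, C.gateAt_eq]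
  exact key _ _ (C.layerAt_length_le l)

theorem gate_foldl_apply (L : List (DiagGate n)) (ρ : Op n) (x y : Bits n) :
    (L.map Channel.gate).foldl (fun σ c => c.apply σ) ρ x y =
      (L.map fun G => G.diag fun r => x (G.wires r)).prod *
        (starRingEnd ℂ) (L.map fun G => G.diag fun r => y (G.wires r)).prod * ρ x y := by
  induction L generalizing ρ with
  | nil => simp
  | cons G L ih =>
      rw [List.map_cons, List.foldl_cons, ih]
      simp only [Channel.apply, DiagGate.unitary, Matrix.diagonal_conjTranspose,
        Matrix.diagonal_mul, Matrix.mul_diagonal, List.map_cons, List.prod_cons, map_mul,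
        Pi.star_apply, RCLike.star_def]
      ring

/-- The flips prescribed by a noise record. -/
def flipsOf (ω : Fin d → Fin n → Fin 5) (l : ℕ) : Bits n :=
  fun i => if h : l < d then flips (ω ⟨l, h⟩ i) else false

theorem hadamardAll_apply (b x : Bits n) :
    hadamardAll n b x = chi univ b x / (Real.sqrt 2 : ℂ) ^ n := by
  simp [hadamardAll, hadamard, chi, prod_div_distrib]

theorem star_hadamardAll_apply (b x : Bits n) :
    star (hadamardAll n b x) = chi univ b x / (Real.sqrt 2 : ℂ) ^ n := by
  rw [hadamardAll_apply, Complex.star_def, map_div₀, conj_chi, map_pow, Complex.conj_ofReal]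

theorem sqrt_two_pow_mul_self (n : ℕ) :
    (Real.sqrt 2 : ℂ) ^ n * (Real.sqrt 2 : ℂ) ^ n = 2 ^ n := by
  rw [← mul_pow, ← Complex.ofReal_mul, Real.mul_self_sqrt (by norm_num)]
  norm_num

theorem mul_basisState_mul_apply (A B : Op n) (b x y : Bits n) :
    (A * basisState b * B) x y = A x b * B b y := by
  rw [basisState, Matrix.mul_apply, sum_eq_single b]
  · simp [Matrix.mul_apply, Matrix.single_apply]
  · intro c _ hc
    rw [Matrix.mul_apply]
    simp [hc.symm]
  · simp

theorem plusState_apply (x y : Bits n) : plusState n x y = (2 ^ n)⁻¹ := by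
  rw [plusState, mul_basisState_mul_apply, Matrix.conjTranspose_apply, hadamardAll_apply,
    star_hadamardAll_apply, div_mul_div_comm, sqrt_two_pow_mul_self]
  simp [chi]

/-- The elements of layer `l` of the noisy circuit. -/
def IQPCircuit.noisyLayer (C : IQPCircuit n k d) (N : PauliNoise) (l : ℕ) : List (Channel n) :=
  (C.layerAt l).map Channel.gate ++ (List.finRange n).map (Channel.noise N)

theorem IQPCircuit.noisy_eq (C : IQPCircuit n k d) (N : PauliNoise) :
    C.noisy N = (List.range d).flatMap (C.noisyLayer N) := by
  rw [IQPCircuit.noisy, ← List.map_coe_finRange_eq_range, List.flatMap_map]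
  congr 1
  ext l : 1
  simp [noisyLayer, layerAt]

/-- The matrix entries after `l` layers, as an average over the noise records. -/
theorem IQPCircuit.circuitMap_apply (C : IQPCircuit n k d) (N : PauliNoise) (l : ℕ) (hl : l ≤ d)
    (x y : Bits n) :
    circuitMap ((List.range l).flatMap (C.noisyLayer N)) (plusState n) x y =
      𝔼 ω : Fin d → Fin n → Fin 5,
        (∏ j : Fin d, if (j : ℕ) < l then ∏ i, (5 * (outcomeWeight N.pX N.pY N.pZ (ω j i) : ℂ) *
          outcomeSign (ω j i) (x i != y i)) else 1) *
          (C.phase id (flipsOf ω) l x * (starRingEnd ℂ) (C.phase id (flipsOf ω) l y)) *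
          (2 ^ n)⁻¹ := by
  induction l generalizing x y with
  | zero =>
      have h0 : circuitMap ((List.range 0).flatMap (C.noisyLayer N)) (plusState n) x y
        = (2 ^ n)⁻¹ := plusState_apply x y
      rw [h0]
      simp only [Nat.not_lt_zero, if_false, prod_const_one, phase, map_one, mul_one, one_mul]
      exact (Fintype.expect_const _).symm
  | succ l ih =>
      have hstep : circuitMap ((List.range (l + 1)).flatMap (C.noisyLayer N)) (plusState n)
          = circuitMap (C.noisyLayer N l)
            (circuitMap ((List.range l).flatMap (C.noisyLayer N)) (plusState n)) := by
        simp [circuitMap, List.range_succ, List.flatMap_append]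
      rw [hstep]
      set ρ := circuitMap ((List.range l).flatMap (C.noisyLayer N)) (plusState n) with hρ
      rw [circuitMap, noisyLayer, List.foldl_append,
        noise_foldl_apply N _ (List.nodup_finRange n), List.toFinset_finRange,
        ← expect_update ⟨l, hl⟩ _ ⟨fun _ => 0⟩, expect_comm]
      refine expect_congr rfl fun τ _ => ?_
      rw [gate_foldl_apply, ih (by omega), mul_expect, mul_expect]
      refine expect_congr rfl fun ω _ => ?_
      set ω' := Function.update ω ⟨l, hl⟩ τ with hω'
      have hf : flipsOf ω' l = fun i => flips (τ i) := by
        ext i; simp [flipsOf, hω', Nat.lt_of_succ_le hl]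
      have hf' : ∀ j < l, flipsOf ω' j = flipsOf ω j := by
        intro j hj; ext i
        have hne : (⟨j, by omega⟩ : Fin d) ≠ ⟨l, hl⟩ := fun h => by
          rw [Fin.mk.injEq] at h; omega
        simp [flipsOf, hω', Function.update_of_ne hne, show j < d by omega]
      have hs : ∀ z : Bits n, flipOn univ τ z = fun i => z i ^^ flips (τ i) := fun z => by
        ext i; simp [flipOn]
      rw [phase, phase, hf, C.phase_congr id hf', C.phase_congr id hf', C.prod_gateValue,
        C.prod_gateValue, hs, hs]
      have hb : ∀ a b c : Bool, ((a ^^ c) != (b ^^ c)) = (a != b) := by decide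
      have hW : (∏ j : Fin d, if (j : ℕ) < l + 1 then
            ∏ i, (5 * (outcomeWeight N.pX N.pY N.pZ (ω' j i) : ℂ) *
              outcomeSign (ω' j i) (x i != y i)) else 1)
          = (∏ i, (5 * (outcomeWeight N.pX N.pY N.pZ (τ i) : ℂ) *
              outcomeSign (τ i) (x i != y i))) *
            ∏ j : Fin d, if (j : ℕ) < l then ∏ i, (5 * (outcomeWeight N.pX N.pY N.pZ (ω j i) : ℂ) *
              outcomeSign (ω j i) ((x i ^^ flips (τ i)) != (y i ^^ flips (τ i)))) else 1 := by
        rw [← mul_prod_erase univ _ (mem_univ (⟨l, hl⟩ : Fin d)),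
          ← mul_prod_erase univ (fun j : Fin d => if (j : ℕ) < l then _ else _)
            (mem_univ (⟨l, hl⟩ : Fin d))]
        simp only [Nat.lt_succ_self, if_true, lt_irrefl, if_false, one_mul]
        congr 1
        · simp [hω']
        · refine prod_congr rfl fun j hj => ?_
          have hne := (mem_erase.1 hj).1
          have hne' : (j : ℕ) ≠ l := fun h => hne (Fin.ext h)
          have hlt : (j : ℕ) < l + 1 ↔ (j : ℕ) < l := by omega
          simp only [hlt, hω', Function.update_of_ne hne, hb]
      rw [hW]
      simp only [id, map_mul]
      ring

/-- A sum over paths: since all gates are diagonal and the noise only flips bits, the matrix entry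
`(x, y)` of the final state has a single path for every noise record. -/
theorem IQPCircuit.outputProb_eq_expect (C : IQPCircuit n k d) (N : PauliNoise) (b : Bits n) :
    outputProb (C.noisy N) b = (𝔼 ω : Fin d → Fin n → Fin 5, 𝔼 x : Bits n, 𝔼 y : Bits n,
      (∏ j, ∏ i, (5 * (outcomeWeight N.pX N.pY N.pZ (ω j i) : ℂ) *
          outcomeSign (ω j i) (x i != y i))) * (chi univ b x * chi univ b y) *
        (C.phase id (flipsOf ω) d x * (starRingEnd ℂ) (C.phase id (flipsOf ω) d y))).re := by
  rw [outputProb, C.noisy_eq]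
  congr 1
  set ρ := circuitMap ((List.range d).flatMap (C.noisyLayer N)) (plusState n) with hρ
  have h1 : ∀ x y, ((hadamardAll n).conjTranspose * basisState b * hadamardAll n) x y
      = chi univ b x * chi univ b y * (2 ^ n)⁻¹ := by
    intro x y
    rw [mul_basisState_mul_apply, Matrix.conjTranspose_apply, star_hadamardAll_apply,
      hadamardAll_apply, div_mul_div_comm, sqrt_two_pow_mul_self, div_eq_mul_inv]
  have hcard : (Fintype.card (Bits n) : ℂ) = 2 ^ n := by simp
  have h2n : (2 ^ n : ℂ) ≠ 0 := pow_ne_zero _ two_ne_zero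
  have hsum : ∀ F : Bits n → ℂ, ∑ x, F x = 2 ^ n * 𝔼 x, F x := fun F => by
    rw [Fintype.expect_eq_sum_div_card, hcard, mul_div_cancel₀ _ h2n]
  rw [Matrix.trace_mul_comm, Matrix.trace, expect_comm, hsum, mul_expect]
  refine expect_congr rfl fun x _ => ?_
  rw [Matrix.diag_apply, Matrix.mul_apply, hsum, expect_comm, mul_expect, mul_expect]
  refine expect_congr rfl fun y _ => ?_
  rw [h1, hρ, C.circuitMap_apply N d le_rfl, expect_mul, mul_expect, mul_expect]
  refine expect_congr rfl fun ω _ => ?_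
  simp only [Fin.is_lt, if_true]
  field_simp

/-- The qubits that are never dephased. -/
def survivors (ω : Fin d → Fin n → Fin 5) : Finset (Fin n) :=
  {i | ∀ l, dephases (ω l i) = false}

/-- Whether the number of `Y` errors on qubit `i` is odd. -/
def signFlip (ω : Fin d → Fin n → Fin 5) : Bits n := fun i => decide (Odd #{l | ω l i = 4})

/-- The density of the distribution of the noise records with respect to the uniform one. -/
noncomputable def recordDensity (pX pY pZ : ℝ) (ω : Fin d → Fin n → Fin 5) : ℝ :=
  ∏ j, ∏ i, 5 * outcomeWeight pX pY pZ (ω j i)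

/-- The output distribution for a given noise record: the qubits that are dephased at some time are
in a uniformly random computational basis state, and the others are measured after a diagonal
unitary that depends on this state. -/
noncomputable def IQPCircuit.recordProb (C : IQPCircuit n k d) (ω : Fin d → Fin n → Fin 5)
    (b : Bits n) : ℝ :=
  (2 ^ n)⁻¹ * 𝔼 z : Bits n, 2 ^ #(survivors ω) * ‖fourier (survivors ω)
    (fun s => C.phase id (flipsOf ω) d ((survivors ω).piecewise s z))
      (fun i => b i ^^ signFlip ω i)‖ ^ 2

theorem prod_outcomeSign (ω : Fin d → Fin n → Fin 5) (b x y : Bits n) :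
    (∏ j, ∏ i, outcomeSign (ω j i) (x i != y i)) * (chi univ b x * chi univ b y)
      = (if ∀ i ∈ (survivors ω)ᶜ, x i = y i then 1 else 0) *
        (chi (survivors ω) (fun i => b i ^^ signFlip ω i) x *
          chi (survivors ω) (fun i => b i ^^ signFlip ω i) y) := by
  have hS : ∀ v : Bits n, chi (survivors ω) (fun i => b i ^^ signFlip ω i) v
      = ∏ i, if i ∈ survivors ω then (if (b i ^^ signFlip ω i) && v i then -1 else 1) else 1 := by
    intro v; rw [prod_ite_mem, univ_inter, chi]
  rw [prod_comm, ite_forall_eq_prod, hS, hS, chi, chi, ← prod_mul_distrib, ← prod_mul_distrib,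
    ← prod_mul_distrib, ← prod_mul_distrib]
  refine prod_congr rfl fun i _ => ?_
  by_cases hxy : x i = y i
  · have : ∀ j, outcomeSign (ω j i) (x i != y i) = 1 := fun j => by simp [outcomeSign, hxy]
    rw [prod_congr rfl fun j _ => this j, prod_const_one, hxy]
    by_cases hi : i ∈ survivors ω <;> cases b i <;> cases y i <;> cases signFlip ω i <;> simp [hi]
  · have hne : (x i != y i) = true := by simpa using hxy
    by_cases hi : i ∈ survivors ω
    · have hd : ∀ j, dephases (ω j i) = false := by simpa [survivors] using hi
      have h1 : ∏ j, outcomeSign (ω j i) (x i != y i) = if signFlip ω i then -1 else 1 := by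
        simp only [outcomeSign, hne, hd, if_true, Bool.false_eq_true, if_false]
        rw [prod_ite, prod_const, prod_const_one, mul_one, signFlip]
        rcases Nat.even_or_odd #{l | ω l i = 4} with h | h
        · rw [h.neg_one_pow]; simp [h]
        · rw [h.neg_one_pow]; simp [h]
      rw [h1]
      revert hxy
      cases b i <;> cases x i <;> cases y i <;> cases signFlip ω i <;> simp [hi]
    · have hd : ∃ j, dephases (ω j i) = true := by simpa [survivors] using hi
      obtain ⟨j, hj⟩ := hd
      have h1 : ∏ j, outcomeSign (ω j i) (x i != y i) = 0 :=
        prod_eq_zero (mem_univ j) (by simp [outcomeSign, hne, hj])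
      rw [h1]; simp [hi, hxy]

/-- Averaging over two bit strings that agree outside `S`. -/
theorem expect_expect_agree (S : Finset (Fin n)) (F : Bits n → Bits n → ℂ) :
    𝔼 x : Bits n, 𝔼 y : Bits n, (if ∀ i ∈ Sᶜ, x i = y i then 1 else 0) * F x y
      = (2 ^ #Sᶜ)⁻¹ * 𝔼 z : Bits n, 𝔼 s : Bits n, 𝔼 t : Bits n,
          F (S.piecewise s z) (S.piecewise t z) := by
  rw [expect_comm (f := fun z s => 𝔼 t : Bits n, F (S.piecewise s z) (S.piecewise t z)),
    ← expect_piecewise S _ ⟨true⟩, mul_expect]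
  refine expect_congr rfl fun s _ => ?_
  rw [mul_expect]
  refine expect_congr rfl fun z _ => ?_
  rw [← expect_piecewise S _ ⟨true⟩, mul_expect]
  refine expect_congr rfl fun t _ => ?_
  have h : ∀ z' : Bits n,
      (if ∀ i ∈ Sᶜ, S.piecewise s z i = S.piecewise t z' i then (1 : ℂ) else 0) *
      F (S.piecewise s z) (S.piecewise t z')
      = (if ∀ i ∈ Sᶜ, z i = z' i then 1 else 0) * F (S.piecewise s z) (S.piecewise t z) := by
    intro z'
    have hiff : (∀ i ∈ Sᶜ, S.piecewise s z i = S.piecewise t z' i) ↔ ∀ i ∈ Sᶜ, z i = z' i :=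
      forall₂_congr fun i hi => by
        have := mem_compl.1 hi; simp [this]
    simp only [hiff]
    split_ifs with h
    · congr 2
      ext i
      by_cases hi : i ∈ S
      · simp [hi]
      · simp [hi, h i (mem_compl.2 hi)]
    · simp
  simp only [h]
  rw [← expect_mul, expect_agree]

/-- The output distribution is a mixture of the distributions for the noise records. -/
theorem IQPCircuit.outputProb_noisy (C : IQPCircuit n k d) (N : PauliNoise) (b : Bits n) :
    outputProb (C.noisy N) b = 𝔼 ω : Fin d → Fin n → Fin 5,
      recordDensity N.pX N.pY N.pZ ω * C.recordProb ω b := by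
  rw [C.outputProb_eq_expect, ← Complex.ofReal_re (𝔼 ω : Fin d → Fin n → Fin 5, _),
    Complex.ofReal_expect]
  congr 1
  refine expect_congr rfl fun ω _ => ?_
  have h1 : ∀ x y : Bits n, (∏ j, ∏ i, (5 * (outcomeWeight N.pX N.pY N.pZ (ω j i) : ℂ) *
          outcomeSign (ω j i) (x i != y i))) * (chi univ b x * chi univ b y) *
        (C.phase id (flipsOf ω) d x * (starRingEnd ℂ) (C.phase id (flipsOf ω) d y))
      = (recordDensity N.pX N.pY N.pZ ω : ℂ) *
        ((if ∀ i ∈ (survivors ω)ᶜ, x i = y i then 1 else 0) *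
        (chi (survivors ω) (fun i => b i ^^ signFlip ω i) x *
          chi (survivors ω) (fun i => b i ^^ signFlip ω i) y *
          (C.phase id (flipsOf ω) d x * (starRingEnd ℂ) (C.phase id (flipsOf ω) d y)))) := by
    intro x y
    simp only [prod_mul_distrib (f := fun i => 5 * (outcomeWeight N.pX N.pY N.pZ _ : ℂ))]
    rw [prod_mul_distrib, mul_assoc _ _ (chi univ b x * chi univ b y), prod_outcomeSign,
      recordDensity]
    push_cast
    ring
  simp only [h1]
  simp only [← mul_expect]
  rw [expect_expect_agree, Complex.ofReal_mul]
  congr 1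
  have hcard : (2 ^ #(survivors ω)ᶜ : ℂ)⁻¹ = (2 ^ n)⁻¹ * 2 ^ #(survivors ω) := by
    have h := card_compl_add_card (survivors ω)
    rw [Fintype.card_fin] at h
    have h2 : (2 : ℂ) ^ n = 2 ^ #(survivors ω)ᶜ * 2 ^ #(survivors ω) := by rw [← pow_add, h]
    rw [h2]
    field_simp
  rw [hcard, IQPCircuit.recordProb, ← mul_expect, Complex.ofReal_mul, Complex.ofReal_mul,
    Complex.ofReal_expect, ← mul_assoc]
  push_cast
  congr 1
  refine expect_congr rfl fun z _ => ?_
  have := mul_conj_fourier (survivors ω)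
    (fun s => C.phase id (flipsOf ω) d ((survivors ω).piecewise s z))
      (fun i => b i ^^ signFlip ω i)
  push_cast at this
  rw [this]
  refine expect_congr rfl fun s _ => expect_congr rfl fun t _ => ?_
  rw [chi_congr (s' := s) (fun i _ => rfl) fun i hi => by simp [hi],
    chi_congr (s := (survivors ω).piecewise t z) (s' := t) (fun i _ => rfl)
      fun i hi => by simp [hi]]

end Quantum


/-! ### The weights of the noise records -/

section Records

variable {n k d : ℕ}

theorem outcomeWeight_nonneg {pX pY pZ : ℝ} (hX : 0 ≤ pX) (hY : 0 ≤ pY) (hZ : 0 ≤ pZ)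
    (h : pX + pY + 2 * pZ ≤ 1) (o : Fin 5) : 0 ≤ outcomeWeight pX pY pZ o := by
  have h2 : 0 ≤ pX + pY - max (pX - pY) 0 - max (pY - pX) 0 := by
    rcases le_total pX pY with h | h
    · rw [max_eq_right (by linarith), max_eq_left (by linarith)]; linarith
    · rw [max_eq_left (by linarith), max_eq_right (by linarith)]; linarith
  fin_cases o
  · simp [outcomeWeight]; linarith
  · simpa [outcomeWeight]
  · simpa [outcomeWeight] using h2
  · simp [outcomeWeight]
  · simp [outcomeWeight]

theorem sum_outcomeWeight (pX pY pZ : ℝ) : ∑ o, outcomeWeight pX pY pZ o = 1 := by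
  simp [Fin.sum_univ_five, outcomeWeight]; ring

/-- The probability that a qubit survives one layer. -/
theorem sum_outcomeWeight_not_dephased (N : PauliNoise) :
    ∑ o, outcomeWeight N.pX N.pY N.pZ o * (if dephases o then 0 else 1) = 1 - 2 * N.strength := by
  simp [Fin.sum_univ_five, outcomeWeight, dephases, PauliNoise.strength]
  rcases le_total N.pX N.pY with h | h
  · rw [max_eq_right (by linarith), max_eq_left (by linarith), min_eq_left h]; ring
  · rw [max_eq_left (by linarith), max_eq_right (by linarith), min_eq_right h]; ring

theorem PauliNoise.weight_nonneg (N : PauliNoise) (h : 1 / 2 ≤ N.pI) (o : Fin 5) :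
    0 ≤ outcomeWeight N.pX N.pY N.pZ o :=
  outcomeWeight_nonneg N.pX_nonneg N.pY_nonneg N.pZ_nonneg (by
    have := N.sum_eq_one; have := N.pX_nonneg; have := N.pY_nonneg; linarith) o

theorem recordDensity_nonneg {pX pY pZ : ℝ} (h : ∀ o, 0 ≤ outcomeWeight pX pY pZ o)
    (ω : Fin d → Fin n → Fin 5) : 0 ≤ recordDensity pX pY pZ ω :=
  prod_nonneg fun j _ => prod_nonneg fun i _ => mul_nonneg (by norm_num) (h _)

theorem expect_prod_outcome (F : Fin d → Fin n → Fin 5 → ℝ) :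
    𝔼 ω : Fin d → Fin n → Fin 5, ∏ j, ∏ i, 5 * F j i (ω j i) = ∏ j, ∏ i, ∑ o, F j i o := by
  rw [expect_prod_eval (β := Fin n → Fin 5) (fun j τ => ∏ i, 5 * F j i (τ i)) ⟨fun _ => 0⟩]
  refine prod_congr rfl fun j _ => ?_
  rw [expect_prod_eval (fun i o => 5 * F j i o) ⟨0⟩]
  refine prod_congr rfl fun i _ => ?_
  rw [← mul_expect, Fintype.expect_eq_sum_div_card, Fintype.card_fin]
  push_cast; ring

theorem expect_recordDensity (pX pY pZ : ℝ) :
    𝔼 ω : Fin d → Fin n → Fin 5, recordDensity pX pY pZ ω = 1 := by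
  simp only [recordDensity]
  rw [expect_prod_outcome fun _ _ => outcomeWeight pX pY pZ]
  simp [sum_outcomeWeight]

/-- The probability that the qubits in `V` are never dephased. -/
theorem expect_recordDensity_survive (N : PauliNoise) (V : Finset (Fin n)) :
    𝔼 ω : Fin d → Fin n → Fin 5, recordDensity N.pX N.pY N.pZ ω *
      (if V ⊆ survivors ω then 1 else 0) = ((1 - 2 * N.strength) ^ d) ^ #V := by
  have h : ∀ ω : Fin d → Fin n → Fin 5, recordDensity N.pX N.pY N.pZ ω *
      (if V ⊆ survivors ω then 1 else 0) = ∏ j, ∏ i, 5 * (outcomeWeight N.pX N.pY N.pZ (ω j i) *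
        if i ∈ V then (if dephases (ω j i) then 0 else 1) else 1) := by
    intro ω
    simp only [← mul_assoc, prod_mul_distrib (g := fun i => if i ∈ V then _ else (1 : ℝ))]
    rw [prod_mul_distrib, recordDensity]
    congr 1
    split_ifs with hV
    · refine (prod_eq_one fun j _ => prod_eq_one fun i _ => ?_).symm
      split_ifs with hi hd
      · have := (mem_filter.1 (hV hi)).2 j
        rw [hd] at this; cases this
      · rfl
      · rfl
    · obtain ⟨i, hi, hi'⟩ := not_subset.1 hV
      have : ∃ j, dephases (ω j i) = true := by simpa [survivors] using hi'
      obtain ⟨j, hj⟩ := this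
      exact (prod_eq_zero (mem_univ j) (prod_eq_zero (mem_univ i) (by simp [hi, hj]))).symm
  simp only [h]
  rw [expect_prod_outcome fun _ i o => outcomeWeight N.pX N.pY N.pZ o *
        if i ∈ V then (if dephases o then 0 else 1) else 1, prod_comm]
  have h2 : ∀ i : Fin n, ∑ o, (outcomeWeight N.pX N.pY N.pZ o *
        if i ∈ V then (if dephases o then 0 else 1) else 1)
        = if i ∈ V then 1 - 2 * N.strength else 1 := by
    intro i
    split_ifs
    · exact sum_outcomeWeight_not_dephased N
    · simpa using sum_outcomeWeight N.pX N.pY N.pZ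
  simp only [h2, prod_const]
  rw [prod_pow, prod_ite_mem, univ_inter, prod_const, card_univ, Fintype.card_fin]
  exact pow_right_comm _ _ _

theorem IQPCircuit.norm_gateValue_id (C : IQPCircuit n k d) (l g : ℕ) (x : Bits n) :
    ‖C.gateValue id l g x‖ = 1 := by
  unfold gateValue
  cases h : C.gateAt l g with
  | none => simp
  | some G => simpa using G.norm_diag _

theorem IQPCircuit.norm_phase_id (C : IQPCircuit n k d) (f : ℕ → Bits n) (l : ℕ) (x : Bits n) :
    ‖C.phase id f l x‖ = 1 := by
  induction l generalizing x with
  | zero => simp [phase]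
  | succ l ih => rw [phase, norm_mul, ih, norm_prod]; simp [C.norm_gateValue_id]

theorem dependsOn_piecewise {M : Type*} (S : Finset (Fin n)) (F : Bits n → M) (z : Bits n) :
    DependsOn (fun s : Bits n => F (S.piecewise s z)) (S : Set (Fin n)) := by
  intro x y h
  simp only
  congr 1
  ext i
  by_cases hi : i ∈ S
  · simp [hi, h i hi]
  · simp [hi]

theorem expect_xor {M : Type*} [AddCommMonoid M] [Module ℚ≥0 M] (c : Bits n) (F : Bits n → M) :
    𝔼 b : Bits n, F (fun i => b i ^^ c i) = 𝔼 b, F b := by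
  refine Fintype.expect_equiv ⟨fun b i => b i ^^ c i, fun b i => b i ^^ c i, ?_, ?_⟩ _ _
    fun b => rfl
  · intro b; ext i; simp
  · intro b; ext i; simp

theorem IQPCircuit.recordProb_nonneg (C : IQPCircuit n k d) (ω : Fin d → Fin n → Fin 5)
    (b : Bits n) : 0 ≤ C.recordProb ω b :=
  mul_nonneg (by positivity) (expect_nonneg fun z _ => by positivity)

theorem sum_bits_eq (F : Bits n → ℝ) : ∑ b, F b = 2 ^ n * 𝔼 b, F b := by
  rw [Fintype.expect_eq_sum_div_card]
  have hcard : (Fintype.card (Bits n) : ℝ) = 2 ^ n := by simp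
  rw [hcard, mul_div_cancel₀ _ (pow_ne_zero _ two_ne_zero)]

theorem IQPCircuit.sum_recordProb (C : IQPCircuit n k d) (ω : Fin d → Fin n → Fin 5) :
    ∑ b, C.recordProb ω b = 1 := by
  rw [sum_bits_eq]
  simp only [recordProb]
  rw [← mul_expect, ← mul_assoc, mul_inv_cancel₀ (pow_ne_zero _ two_ne_zero), one_mul,
    expect_comm]
  refine (expect_congr rfl fun z _ => ?_).trans (Fintype.expect_const (ι := Bits n) 1)
  rw [expect_xor (signFlip ω) fun b => 2 ^ #(survivors ω) * ‖fourier (survivors ω)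
    (fun s => C.phase id (flipsOf ω) d ((survivors ω).piecewise s z)) b‖ ^ 2,
    parseval (dependsOn_piecewise _ _ _)]
  simp [C.norm_phase_id]

/-- If all qubits are dephased, the phases cancel and the output is uniformly random. -/
theorem IQPCircuit.recordProb_of_survivors_eq_empty (C : IQPCircuit n k d)
    {ω : Fin d → Fin n → Fin 5} (h : survivors ω = ∅) (b : Bits n) :
    C.recordProb ω b = (2 ^ n)⁻¹ := by
  rw [recordProb, h]
  have : ∀ z c : Bits n, fourier ∅ (fun s => C.phase id (flipsOf ω) d
      ((∅ : Finset (Fin n)).piecewise s z)) c = C.phase id (flipsOf ω) d z := by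
    intro z c
    simp [fourier, chi]
  simp only [this, C.norm_phase_id]
  simp

/-- The probability that some qubit is never dephased. -/
theorem expect_survivors_nonempty_le (N : PauliNoise) (hN : 1 / 2 ≤ N.pI) :
    𝔼 ω : Fin d → Fin n → Fin 5, recordDensity N.pX N.pY N.pZ ω *
      (if survivors ω = ∅ then 0 else 1) ≤ n * (1 - 2 * N.strength) ^ d := by
  have hD := fun ω : Fin d → Fin n → Fin 5 => recordDensity_nonneg (N.weight_nonneg hN) ω
  have h : ∀ ω : Fin d → Fin n → Fin 5, recordDensity N.pX N.pY N.pZ ω *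
      (if survivors ω = ∅ then 0 else 1) ≤ ∑ i, recordDensity N.pX N.pY N.pZ ω *
        if ({i} : Finset (Fin n)) ⊆ survivors ω then 1 else 0 := by
    intro ω
    rw [← mul_sum]
    refine mul_le_mul_of_nonneg_left ?_ (hD ω)
    split_ifs with he
    · exact sum_nonneg fun i _ => by split_ifs <;> norm_num
    · obtain ⟨i, hi⟩ := nonempty_iff_ne_empty.2 he
      refine le_trans ?_ (single_le_sum (fun i _ => by split_ifs <;> norm_num) (mem_univ i))
      simp [hi]
  refine (expect_le_expect fun ω _ => h ω).trans (le_of_eq ?_)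
  rw [expect_sum_comm]
  simp only [expect_recordDensity_survive]
  simp

end Records

/-! ### Percolation: the clusters of surviving qubits are small -/

section Percolation

variable {n k d : ℕ}

open Classical in
/-- The qubits that share a gate with qubit `i`. -/
noncomputable def IQPCircuit.neighbors (C : IQPCircuit n k d) (i : Fin n) : Finset (Fin n) :=
  {j | ∃ l g G, C.gateAt l g = some G ∧ (∃ r, G.wires r = i) ∧ ∃ r, G.wires r = j}

theorem IQPCircuit.mem_neighbors {C : IQPCircuit n k d} {i j : Fin n} :
    j ∈ C.neighbors i ↔
      ∃ l g G, C.gateAt l g = some G ∧ (∃ r, G.wires r = i) ∧ ∃ r, G.wires r = j := by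
  simp [neighbors]

theorem IQPCircuit.gateAt_eq_some {C : IQPCircuit n k d} {l g : ℕ} {G : DiagGate n}
    (h : C.gateAt l g = some G) : ∃ hl : l < d, (C.layer ⟨l, hl⟩)[g]? = some G := by
  unfold gateAt at h
  split_ifs at h with hl
  exact ⟨hl, h⟩

theorem IQPCircuit.gateAt_unique {C : IQPCircuit n k d} {l g g' : ℕ} {G G' : DiagGate n}
    (h : C.gateAt l g = some G) (h' : C.gateAt l g' = some G') {r : Fin G.arity}
    {r' : Fin G'.arity} (hw : G.wires r = G'.wires r') : G = G' := by
  obtain ⟨hl, hg⟩ := gateAt_eq_some h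
  obtain ⟨_, hg'⟩ := gateAt_eq_some h'
  obtain ⟨hgl, rfl⟩ := List.getElem?_eq_some_iff.1 hg
  obtain ⟨hgl', rfl⟩ := List.getElem?_eq_some_iff.1 hg'
  have hd := List.pairwise_iff_getElem.1 (C.disjoint ⟨l, hl⟩)
  rcases lt_trichotomy g g' with hlt | heq | hlt
  · exact absurd hw (hd g g' hgl hgl' hlt _ _)
  · subst heq; rfl
  · exact absurd hw.symm (hd g' g hgl' hgl hlt _ _)

theorem IQPCircuit.arity_le_of_gateAt {C : IQPCircuit n k d} {l g : ℕ} {G : DiagGate n}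
    (h : C.gateAt l g = some G) : G.arity ≤ k := by
  obtain ⟨hl, hg⟩ := gateAt_eq_some h
  exact C.arity_le _ _ (List.mem_of_getElem? hg)

theorem IQPCircuit.card_neighbors_le (C : IQPCircuit n k d) (i : Fin n) :
    #(C.neighbors i) ≤ d * k := by
  classical
  let T : Fin d → Finset (Fin n) := fun l =>
    {j | ∃ g G, C.gateAt l g = some G ∧ (∃ r, G.wires r = i) ∧ ∃ r, G.wires r = j}
  have hsub : C.neighbors i ⊆ univ.biUnion T := by
    intro j hj
    obtain ⟨l, g, G, hG, hi, hj⟩ := mem_neighbors.1 hj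
    obtain ⟨hl, -⟩ := gateAt_eq_some hG
    exact mem_biUnion.2 ⟨⟨l, hl⟩, mem_univ _, mem_filter.2 ⟨mem_univ _, g, G, hG, hi, hj⟩⟩
  refine (card_le_card hsub).trans (card_biUnion_le.trans ?_)
  refine (sum_le_card_nsmul univ _ k fun l _ => ?_).trans (by simp)
  by_cases h : ∃ g G, C.gateAt l g = some G ∧ ∃ r, G.wires r = i
  · obtain ⟨g, G, hG, r, hr⟩ := h
    have hs : T l ⊆ univ.image G.wires := by
      intro j hj
      obtain ⟨g', G', hG', ⟨r', hr'⟩, s, hs⟩ := (mem_filter.1 hj).2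
      obtain rfl := gateAt_unique hG' hG (hr'.trans hr.symm)
      exact mem_image.2 ⟨s, mem_univ _, hs⟩
    refine (card_le_card hs).trans (card_image_le.trans ?_)
    simpa using arity_le_of_gateAt hG
  · have : T l = ∅ := filter_eq_empty_iff.2 fun j _ ⟨g, G, hG, hi, _⟩ => h ⟨g, G, hG, hi⟩
    simp [this]

/-- Two qubits in `S` that share a gate. -/
def IQPCircuit.Linked (C : IQPCircuit n k d) (S : Finset (Fin n)) (i j : Fin n) : Prop :=
  i ∈ S ∧ j ∈ S ∧ j ∈ C.neighbors i

theorem IQPCircuit.linked_symm (C : IQPCircuit n k d) (S : Finset (Fin n)) :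
    Std.Symm (C.Linked S) := ⟨by
  rintro i j ⟨hi, hj, h⟩
  obtain ⟨l, g, G, hG, h1, h2⟩ := mem_neighbors.1 h
  exact ⟨hj, hi, mem_neighbors.2 ⟨l, g, G, hG, h2, h1⟩⟩⟩

open Classical in
/-- The cluster of qubit `i` in the subgraph of the interaction graph that is induced by `S`. -/
noncomputable def IQPCircuit.cluster (C : IQPCircuit n k d) (S : Finset (Fin n)) (i : Fin n) :
    Finset (Fin n) :=
  {j | Relation.ReflTransGen (C.Linked S) i j}

theorem IQPCircuit.mem_cluster {C : IQPCircuit n k d} {S : Finset (Fin n)} {i j : Fin n} :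
    j ∈ C.cluster S i ↔ Relation.ReflTransGen (C.Linked S) i j := by
  simp [cluster]

theorem IQPCircuit.cluster_subset {C : IQPCircuit n k d} {S : Finset (Fin n)} {i : Fin n}
    (hi : i ∈ S) : C.cluster S i ⊆ S := by
  intro j hj
  rcases Relation.ReflTransGen.cases_tail (mem_cluster.1 hj) with h | ⟨c, _, hc⟩
  · exact h ▸ hi
  · exact hc.2.1

/-- A chain that leads out of `P` has a step at which `P` is left. -/
theorem exists_step_out {α : Type*} {R : α → α → Prop} {P : α → Prop} {a b : α}
    (h : Relation.ReflTransGen R a b) (ha : P a) (hb : ¬ P b) :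
    ∃ x y, P x ∧ ¬ P y ∧ R x y ∧ Relation.ReflTransGen R a x := by
  induction h with
  | refl => exact absurd ha hb
  | @tail b c hab hbc ih =>
      by_cases h : P b
      · exact ⟨b, c, h, hb, hbc, hab⟩
      · exact ih h

/-- A cluster with at least `m + 1` elements contains a walk of length `2 m` that visits exactly
`m + 1` of them: new qubits are attached one by one, as detours. -/
theorem IQPCircuit.exists_walk (C : IQPCircuit n k d) {S : Finset (Fin n)} {i : Fin n} (m : ℕ)
    (hm : m + 1 ≤ #(C.cluster S i)) :
    ∃ w : List (Fin n), w.head? = some i ∧ w.IsChain (fun a b => b ∈ C.neighbors a) ∧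
      w.length = 2 * m + 1 ∧ w.toFinset ⊆ C.cluster S i ∧ #w.toFinset = m + 1 := by
  induction m with
  | zero =>
      refine ⟨[i], rfl, by simp, rfl, ?_, by simp⟩
      intro j hj
      obtain rfl : j = i := by simpa using hj
      exact mem_cluster.2 .refl
  | succ m ih =>
      obtain ⟨w, hhead, hchain, hlen, hsub, hcard⟩ := ih (by omega)
      have hss : ∃ u ∈ C.cluster S i, u ∉ w.toFinset := by
        by_contra! h
        have := card_le_card (show C.cluster S i ⊆ w.toFinset from h)
        omega
      obtain ⟨u, hu, huw⟩ := hss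
      have hi : i ∈ w.toFinset := List.mem_toFinset.2 (List.mem_of_mem_head? hhead)
      obtain ⟨x, y, hx, hy, hxy, hix⟩ :=
        exists_step_out (P := fun v => v ∈ w.toFinset) (mem_cluster.1 hu) hi huw
      obtain ⟨a, b, rfl⟩ := List.append_of_mem (List.mem_toFinset.1 hx)
      refine ⟨a ++ x :: y :: x :: b, ?_, ?_, ?_, ?_, ?_⟩
      · cases a <;> simpa using hhead
      · have hyx := ((C.linked_symm S).symm _ _ hxy).2.2
        rw [List.isChain_append] at hchain ⊢
        refine ⟨hchain.1, ?_, ?_⟩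
        · rw [List.isChain_cons_cons, List.isChain_cons_cons]
          exact ⟨hxy.2.2, hyx, hchain.2.1⟩
        · simpa using hchain.2.2
      · simp at hlen ⊢; omega
      · intro v hv
        by_cases hvy : v = y
        · rw [hvy]; exact mem_cluster.2 (hix.tail hxy)
        · refine hsub ?_
          simp only [List.mem_toFinset, List.mem_append, List.mem_cons] at hv ⊢
          tauto
      · have : (a ++ x :: y :: x :: b).toFinset = insert y (a ++ x :: b).toFinset := by
          ext v
          simp only [List.mem_toFinset, List.mem_append, List.mem_cons, mem_insert]
          tauto
        rw [this, card_insert_of_notMem hy, hcard]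

/-- The walks with `m` steps that start at `i`. -/
noncomputable def IQPCircuit.walks (C : IQPCircuit n k d) : ℕ → Fin n → Finset (List (Fin n))
  | 0, i => {[i]}
  | m + 1, i => (C.neighbors i).biUnion fun j => (C.walks m j).image (i :: ·)

/-- A qubit is in at most one gate per layer, hence it has at most `d * k` neighbors. -/
theorem IQPCircuit.card_walks_le (C : IQPCircuit n k d) (m : ℕ) (i : Fin n) :
    #(C.walks m i) ≤ (d * k) ^ m := by
  induction m generalizing i with
  | zero => simp [walks]
  | succ m ih =>
      rw [walks, pow_succ']
      refine card_biUnion_le.trans ((sum_le_card_nsmul _ _ _ fun j _ =>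
        card_image_le.trans (ih j)).trans ?_)
      rw [smul_eq_mul]
      exact Nat.mul_le_mul_right _ (C.card_neighbors_le i)

theorem IQPCircuit.mem_walks {C : IQPCircuit n k d} {m : ℕ} {i : Fin n} {w : List (Fin n)}
    (h1 : w.head? = some i) (h2 : w.IsChain fun a b => b ∈ C.neighbors a)
    (h3 : w.length = m + 1) : w ∈ C.walks m i := by
  induction m generalizing i w with
  | zero =>
      obtain ⟨a, rfl⟩ := List.length_eq_one_iff.1 h3
      simp at h1
      simp [walks, h1]
  | succ m ih =>
      match w, h1, h2, h3 with
      | a :: b :: w, h1, h2, h3 =>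
          obtain rfl : a = i := by simpa using h1
          rw [List.isChain_cons_cons] at h2
          rw [walks, mem_biUnion]
          exact ⟨b, h2.1, mem_image.2 ⟨b :: w, ih rfl h2.2 (by simpa using h3), rfl⟩⟩

/-- All clusters of surviving qubits have at most `L` elements. -/
def IQPCircuit.SmallClusters (C : IQPCircuit n k d) (L : ℕ) (S : Finset (Fin n)) : Prop :=
  ∀ i ∈ S, #(C.cluster S i) ≤ L

open Classical in
/-- Large clusters are improbable. -/
theorem IQPCircuit.expect_not_smallClusters_le (C : IQPCircuit n k d) (N : PauliNoise)
    (hN : 1 / 2 ≤ N.pI) (hp : 0 ≤ N.strength) (hp2 : N.strength ≤ 1 / 2)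
    (hsub : ((d * k : ℕ) : ℝ) ^ 2 * (1 - 2 * N.strength) ^ d ≤ 1 / 2) (L : ℕ) :
    𝔼 ω : Fin d → Fin n → Fin 5, recordDensity N.pX N.pY N.pZ ω *
      (if C.SmallClusters L (survivors ω) then 0 else 1) ≤ n * (1 / 2) ^ L := by
  have hD := fun ω : Fin d → Fin n → Fin 5 => recordDensity_nonneg (N.weight_nonneg hN) ω
  -- A cluster with more than `L` elements contains a walk with `2 * L` steps that visits exactly
  -- `L + 1` qubits, along the edges of a tree.
  set W : Fin n → Finset (List (Fin n)) := fun i =>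
    {w ∈ C.walks (2 * L) i | #w.toFinset = L + 1} with hW
  set q := (1 - 2 * N.strength) ^ d with hq
  have hq0 : 0 ≤ q := pow_nonneg (by linarith) _
  have hq1 : q ≤ 1 := pow_le_one₀ (by linarith) (by linarith)
  have h : ∀ ω : Fin d → Fin n → Fin 5, recordDensity N.pX N.pY N.pZ ω *
      (if C.SmallClusters L (survivors ω) then 0 else 1) ≤ ∑ i, ∑ w ∈ W i,
        recordDensity N.pX N.pY N.pZ ω * if w.toFinset ⊆ survivors ω then 1 else 0 := by
    intro ω
    simp only [← mul_sum]
    refine mul_le_mul_of_nonneg_left ?_ (hD ω)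
    have h0 : ∀ i, 0 ≤ ∑ w ∈ W i, if w.toFinset ⊆ survivors ω then (1 : ℝ) else 0 :=
      fun i => sum_nonneg fun w _ => by split_ifs <;> norm_num
    split_ifs with he
    · exact sum_nonneg fun i _ => h0 i
    · simp only [SmallClusters, not_forall, not_le] at he
      obtain ⟨i, hi, hL⟩ := he
      obtain ⟨w, h1, h2, h3, h4, h5⟩ := C.exists_walk L hL
      refine le_trans ?_ (single_le_sum (fun i _ => h0 i) (mem_univ i))
      refine le_trans ?_ (single_le_sum (a := w) (fun w _ => by split_ifs <;> norm_num)
        (mem_filter.2 ⟨mem_walks h1 h2 h3, h5⟩))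
      rw [if_pos (h4.trans (cluster_subset hi))]
  refine (expect_le_expect fun ω _ => h ω).trans ?_
  rw [expect_sum_comm]
  simp only [expect_sum_comm, expect_recordDensity_survive]
  have hi : ∀ i, ∑ w ∈ W i, q ^ #w.toFinset ≤ (1 / 2) ^ L := by
    intro i
    have h1 : ∀ w ∈ W i, q ^ #w.toFinset ≤ q ^ L := fun w hw => by
      rw [(mem_filter.1 hw).2]
      exact pow_le_pow_of_le_one hq0 hq1 (Nat.le_succ L)
    refine (sum_le_card_nsmul _ _ _ h1).trans ?_
    rw [nsmul_eq_mul]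
    have h2 : (#(W i) : ℝ) ≤ ((d * k : ℕ) : ℝ) ^ (2 * L) := by
      exact_mod_cast (card_filter_le _ _).trans (C.card_walks_le _ i)
    refine (mul_le_mul_of_nonneg_right h2 (pow_nonneg hq0 _)).trans ?_
    rw [pow_mul, ← mul_pow]
    exact pow_le_pow_left₀ (by positivity) hsub L
  refine (sum_le_sum fun i _ => hi i).trans (le_of_eq ?_)
  simp

end Percolation


/-! ### The clusters as classes of a labelling -/

section Labels

variable {n k d : ℕ}

/-- One step of the computation of the clusters: if the qubit `w` is in `S`, its class is merged
with the class of the previous qubit of the same gate that is in `S`. -/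
def wireStep (S : Finset (Fin n)) (w : Fin n) (st : (Fin n → Fin n) × Option (Fin n)) :
    (Fin n → Fin n) × Option (Fin n) :=
  if w ∈ S then
    (st.2.elim st.1 fun a i => if st.1 i = st.1 w then st.1 a else st.1 i, some w)
  else st

/-- The classes of the elements of `S` in one gate are merged. -/
def gateLabels (k : ℕ) (S : Finset (Fin n)) (G : DiagGate n) (lab : Fin n → Fin n) :
    Fin n → Fin n :=
  (downFold (fun r st => if h : r < G.arity then wireStep S (G.wires ⟨r, h⟩) st else st) k
    (lab, none)).1

/-- Labels of the qubits such that the classes of the elements of `S` are their clusters. -/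
def IQPCircuit.labels (C : IQPCircuit n k d) (S : Finset (Fin n)) : Fin n → Fin n :=
  downFold (fun l lab => downFold (fun g lab =>
    (C.gateAt l g).elim lab fun G => gateLabels k S G lab) n lab) d id

/-- Qubits with the same label are in the same cluster. -/
def IQPCircuit.LabelSound (C : IQPCircuit n k d) (S : Finset (Fin n)) (lab : Fin n → Fin n) :
    Prop :=
  ∀ i j, lab i = lab j → Relation.ReflTransGen (C.Linked S) i j

/-- The qubits in `S` of one gate have the same label. -/
def GateMerged (S : Finset (Fin n)) (G : DiagGate n) (lab : Fin n → Fin n) : Prop :=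
  ∀ r s, G.wires r ∈ S → G.wires s ∈ S → lab (G.wires r) = lab (G.wires s)

/-- Merging the classes of one gate keeps the labels sound, and it does not separate any qubits. -/
theorem IQPCircuit.gateLabels_spec (C : IQPCircuit n k d) (S : Finset (Fin n)) {l g : ℕ}
    {G : DiagGate n} (hG : C.gateAt l g = some G) {lab : Fin n → Fin n}
    (hs : C.LabelSound S lab) :
    C.LabelSound S (gateLabels k S G lab) ∧ GateMerged S G (gateLabels k S G lab) ∧
      ∀ i j, lab i = lab j → gateLabels k S G lab i = gateLabels k S G lab j := by
  have := C.linked_symm S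
  have key := downFold_induction
    (f := fun r st => if h : r < G.arity then wireStep S (G.wires ⟨r, h⟩) st else st)
    (s := (lab, none)) (N := k)
    (fun r st => C.LabelSound S st.1 ∧ (∀ i j, lab i = lab j → st.1 i = st.1 j) ∧
      (∀ a, st.2 = some a → a ∈ S ∧ ∃ r, G.wires r = a) ∧
      ∀ s : Fin G.arity, r ≤ s → G.wires s ∈ S → ∃ a, st.2 = some a ∧ st.1 (G.wires s) = st.1 a)
    ⟨hs, fun i j h => h, by simp, fun s hs => by
      have := arity_le_of_gateAt hG; omega⟩ ?_
  · obtain ⟨h1, h2, -, h4⟩ := key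
    refine ⟨h1, fun r s hr hs => ?_, h2⟩
    obtain ⟨a, ha, ha'⟩ := h4 r (Nat.zero_le _) hr
    obtain ⟨b, hb, hb'⟩ := h4 s (Nat.zero_le _) hs
    obtain rfl : a = b := by rw [ha] at hb; simpa using hb
    exact ha'.trans hb'.symm
  · rintro r hr ⟨lb, c⟩ ⟨h1, h2, h3, h4⟩
    dsimp only at h1 h2 h3 h4 ⊢
    by_cases h : r < G.arity
    · simp only [h, dif_pos]
      unfold wireStep
      by_cases hw : G.wires ⟨r, h⟩ ∈ S
      · simp only [hw, if_true]
        cases c with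
        | none =>
            refine ⟨h1, h2, ?_, ?_⟩
            · rintro a ha
              obtain rfl : G.wires ⟨r, h⟩ = a := by simpa using ha
              exact ⟨hw, _, rfl⟩
            · intro s hrs hsS
              refine ⟨_, rfl, ?_⟩
              rcases Nat.lt_or_ge r s with hlt | hge
              · obtain ⟨a, ha, -⟩ := h4 s hlt hsS
                cases ha
              · have : s = ⟨r, h⟩ := Fin.ext (le_antisymm hge hrs)
                rw [this]
        | some a =>
            obtain ⟨haS, t, ht⟩ := h3 a rfl
            have hlink : C.Linked S a (G.wires ⟨r, h⟩) :=
              ⟨haS, hw, mem_neighbors.2 ⟨l, g, G, hG, ⟨t, ht⟩, ⟨_, rfl⟩⟩⟩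
            have hlink' : C.Linked S (G.wires ⟨r, h⟩) a := (C.linked_symm S).symm _ _ hlink
            simp only [Option.elim_some]
            refine ⟨?_, ?_, ?_, ?_⟩
            · intro i j hij
              dsimp only at hij
              by_cases hi : lb i = lb (G.wires ⟨r, h⟩) <;> by_cases hj : lb j = lb (G.wires ⟨r, h⟩)
              · exact h1 i j (hi.trans hj.symm)
              · rw [if_pos hi, if_neg hj] at hij
                exact ((h1 _ _ hi).tail hlink').trans (h1 _ _ hij)
              · rw [if_neg hi, if_pos hj] at hij
                exact ((h1 _ _ hij).tail hlink).trans (h1 _ _ hj.symm)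
              · rw [if_neg hi, if_neg hj] at hij
                exact h1 i j hij
            · intro i j hij
              simp only [h2 i j hij]
            · rintro b hb
              obtain rfl : G.wires ⟨r, h⟩ = b := by simpa using hb
              exact ⟨hw, _, rfl⟩
            · intro s hrs hsS
              refine ⟨_, rfl, ?_⟩
              rcases Nat.lt_or_ge r s with hlt | hge
              · obtain ⟨b, hb, hb'⟩ := h4 s hlt hsS
                obtain rfl : a = b := by simpa using hb
                simp [hb']
              · have : s = ⟨r, h⟩ := Fin.ext (le_antisymm hge hrs)
                rw [this]
      · simp only [hw, if_false]
        refine ⟨h1, h2, h3, fun s hrs hsS => ?_⟩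
        rcases Nat.lt_or_ge r s with hlt | hge
        · exact h4 s hlt hsS
        · have : s = ⟨r, h⟩ := Fin.ext (le_antisymm hge hrs)
          rw [this] at hsS; exact absurd hsS hw
    · simp only [h, dif_neg, not_false_eq_true]
      exact ⟨h1, h2, h3, fun s hrs hsS => h4 s (by omega) hsS⟩

theorem GateMerged.mono {S : Finset (Fin n)} {G : DiagGate n} {lab lab' : Fin n → Fin n}
    (h : GateMerged S G lab) (hl : ∀ i j, lab i = lab j → lab' i = lab' j) :
    GateMerged S G lab' :=
  fun r s hr hs => hl _ _ (h r s hr hs)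

theorem IQPCircuit.gateAt_lt {C : IQPCircuit n k d} {l g : ℕ} {G : DiagGate n}
    (h : C.gateAt l g = some G) : l < d ∧ g < n := by
  refine ⟨(gateAt_eq_some h).1, ?_⟩
  rw [C.gateAt_eq] at h
  exact (List.getElem?_eq_some_iff.1 h).1.trans_le (C.layerAt_length_le l)

/-- The computed classes lie inside the clusters, and the surviving qubits of a gate are all in the
same class. The first fact bounds the size of the classes, and the second one is what makes the
phase factorize. -/
theorem IQPCircuit.labels_spec (C : IQPCircuit n k d) (S : Finset (Fin n)) :
    C.LabelSound S (C.labels S) ∧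
      ∀ l g G, C.gateAt l g = some G → GateMerged S G (C.labels S) := by
  have key := downFold_induction
    (f := fun l lab => downFold (fun g lab =>
      (C.gateAt l g).elim lab fun G => gateLabels k S G lab) n lab)
    (s := (id : Fin n → Fin n)) (N := d)
    (fun l lab => C.LabelSound S lab ∧
      ∀ l' g G, l ≤ l' → C.gateAt l' g = some G → GateMerged S G lab)
    ⟨fun i j h => by rw [show i = j from h], fun l' g G h hG => by
      have := (gateAt_lt hG).1; omega⟩ ?_
  · exact ⟨key.1, fun l g G hG => key.2 l g G (Nat.zero_le _) hG⟩
  · rintro l hl lab ⟨h1, h2⟩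
    have key' := downFold_induction
      (f := fun g lab => (C.gateAt l g).elim lab fun G => gateLabels k S G lab)
      (s := lab) (N := n)
      (fun g lab => C.LabelSound S lab ∧
        (∀ l' g G, l + 1 ≤ l' → C.gateAt l' g = some G → GateMerged S G lab) ∧
        ∀ g' G, g ≤ g' → C.gateAt l g' = some G → GateMerged S G lab)
      ⟨h1, h2, fun g' G h hG => by have := (gateAt_lt hG).2; omega⟩ ?_
    · refine ⟨key'.1, fun l' g G hll hG => ?_⟩
      rcases Nat.lt_or_ge l l' with hlt | hge
      · exact key'.2.1 l' g G hlt hG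
      · obtain rfl : l' = l := le_antisymm hge hll
        exact key'.2.2 g G (Nat.zero_le _) hG
    · rintro g hg lab ⟨h1, h2, h3⟩
      cases hG : C.gateAt l g with
      | none =>
          refine ⟨h1, h2, fun g' G hgg hG' => ?_⟩
          rcases Nat.lt_or_ge g g' with hlt | hge
          · exact h3 g' G hlt hG'
          · obtain rfl : g' = g := le_antisymm hge hgg
            rw [hG] at hG'; cases hG'
      | some G =>
          obtain ⟨a1, a2, a3⟩ := C.gateLabels_spec S hG h1
          refine ⟨a1, fun l' g' G' h' hG' => (h2 l' g' G' h' hG').mono a3, fun g' G' hgg hG' => ?_⟩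
          rcases Nat.lt_or_ge g g' with hlt | hge
          · exact (h3 g' G' hlt hG').mono a3
          · obtain rfl : g' = g := le_antisymm hge hgg
            rw [hG] at hG'
            obtain rfl : G = G' := by simpa using hG'
            exact a2

/-- The elements of `S` with label `v`. -/
def IQPCircuit.group (C : IQPCircuit n k d) (S : Finset (Fin n)) (v : Fin n) : Finset (Fin n) :=
  {i ∈ S | C.labels S i = v}

theorem IQPCircuit.mem_group {C : IQPCircuit n k d} {S : Finset (Fin n)} {v i : Fin n} :
    i ∈ C.group S v ↔ i ∈ S ∧ C.labels S i = v := by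
  simp [group]

theorem IQPCircuit.card_group_le {C : IQPCircuit n k d} {S : Finset (Fin n)} {L : ℕ}
    (h : C.SmallClusters L S) (v : Fin n) : #(C.group S v) ≤ L := by
  rcases (C.group S v).eq_empty_or_nonempty with h0 | ⟨i, hi⟩
  · simp [h0]
  · obtain ⟨hiS, hiv⟩ := mem_group.1 hi
    refine (card_le_card fun j hj => ?_).trans (h i hiS)
    obtain ⟨_, hjv⟩ := mem_group.1 hj
    exact mem_cluster.2 ((C.labels_spec S).1 i j (hiv.trans hjv.symm))

theorem IQPCircuit.disjoint_group (C : IQPCircuit n k d) (S : Finset (Fin n)) {v w : Fin n}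
    (h : v ≠ w) : Disjoint (C.group S v : Set (Fin n)) (C.group S w) := by
  rw [Set.disjoint_left]
  intro i hi hj
  exact h ((mem_group.1 hi).2.symm.trans (mem_group.1 hj).2)

theorem IQPCircuit.sum_card_group (C : IQPCircuit n k d) (S : Finset (Fin n)) :
    ∑ v, #(C.group S v) = #S :=
  (card_eq_sum_card_fiberwise fun i _ => mem_univ (C.labels S i)).symm

theorem IQPCircuit.prod_chi_group (C : IQPCircuit n k d) (S : Finset (Fin n)) (b s : Bits n) :
    ∏ v, chi (C.group S v) b s = chi S b s :=
  prod_fiberwise S (C.labels S) _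

/-- The surviving qubits of a gate are in a single class, so the gate takes its true value for this
class and the reference value at `z` for the other `n - 1` ones. -/
theorem IQPCircuit.prod_gateValue_group (C : IQPCircuit n k d) (S : Finset (Fin n)) (l g : ℕ)
    (s z : Bits n) :
    ∏ v, C.gateValue id l g ((C.group S v).piecewise s z)
      = C.gateValue id l g (S.piecewise s z) * C.gateValue id l g z ^ (n - 1) := by
  unfold gateValue
  cases hG : C.gateAt l g with
  | none => simp
  | some G =>
      simp only [Option.elim_some, id]
      obtain ⟨v₀, hv₀⟩ : ∃ v₀, ∀ r, G.wires r ∈ S → C.labels S (G.wires r) = v₀ := by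
        by_cases h : ∃ r, G.wires r ∈ S
        · obtain ⟨r, hr⟩ := h
          exact ⟨_, fun s hs => (C.labels_spec S).2 l g G hG s r hs hr⟩
        · exact ⟨G.wires ⟨0, G.arity_pos⟩, fun r hr => absurd ⟨r, hr⟩ h⟩
      rw [← mul_prod_erase univ _ (mem_univ v₀)]
      congr 1
      · congr 1; ext r
        by_cases hr : G.wires r ∈ S
        · have : G.wires r ∈ C.group S v₀ := mem_group.2 ⟨hr, hv₀ r hr⟩
          simp [hr, this]
        · have : G.wires r ∉ C.group S v₀ := fun h => hr (mem_group.1 h).1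
          simp [hr, this]
      · have : ∀ v ∈ univ.erase v₀, (G.diag fun r => (C.group S v).piecewise s z (G.wires r))
            = G.diag fun r => z (G.wires r) := by
          intro v hv
          congr 1; ext r
          have : G.wires r ∉ C.group S v := fun h => (mem_erase.1 hv).1
            ((mem_group.1 h).2.symm.trans (hv₀ r (mem_group.1 h).1))
          simp [this]
        rw [prod_congr rfl this, prod_const, card_erase_of_mem (mem_univ _)]
        simp

theorem piecewise_xor (S : Finset (Fin n)) (s z f : Bits n) :
    (fun i => S.piecewise s z i ^^ f i)
      = S.piecewise (fun i => s i ^^ f i) (fun i => z i ^^ f i) := by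
  ext i; by_cases hi : i ∈ S <;> simp [hi]

/-- No gate acts on two clusters, and therefore the phase factorizes over the clusters. -/
theorem IQPCircuit.prod_phase_group (C : IQPCircuit n k d) (S : Finset (Fin n))
    (f : ℕ → Bits n) (l : ℕ) (s z : Bits n) :
    ∏ v, C.phase id f l ((C.group S v).piecewise s z)
      = C.phase id f l (S.piecewise s z) * C.phase id f l z ^ (n - 1) := by
  induction l generalizing s z with
  | zero => simp [phase]
  | succ l ih =>
      simp only [phase, piecewise_xor, prod_mul_distrib, ih]
      rw [prod_comm]
      simp only [C.prod_gateValue_group, prod_mul_distrib, prod_pow]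
      ring

/-- The density of the measurement outcomes in one cluster, for gates with entries transformed
by `τ`. -/
noncomputable def IQPCircuit.groupDensity (C : IQPCircuit n k d) (τ : ℂ → ℂ)
    (ω : Fin d → Fin n → Fin 5) (z : Bits n) (v : Fin n) (b : Bits n) : ℝ :=
  2 ^ #(C.group (survivors ω) v) * ‖fourier (C.group (survivors ω) v)
    (fun s => C.phase τ (flipsOf ω) d ((C.group (survivors ω) v).piecewise s z)) b‖ ^ 2

/-- For a given state of the dephased qubits, the outcomes in different clusters are independent: up
to the constant phase at `z`, the Fourier coefficient is a product over the clusters. -/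
theorem IQPCircuit.recordProb_eq_prod (C : IQPCircuit n k d) (ω : Fin d → Fin n → Fin 5)
    (b : Bits n) :
    C.recordProb ω b = (2 ^ n)⁻¹ * 𝔼 z : Bits n,
      ∏ v, C.groupDensity id ω z v fun i => b i ^^ signFlip ω i := by
  rw [recordProb]
  congr 1
  refine expect_congr rfl fun z _ => ?_
  set S := survivors ω
  set c : Bits n := fun i => b i ^^ signFlip ω i
  simp only [groupDensity, prod_mul_distrib, prod_pow_eq_pow_sum, C.sum_card_group]
  congr 1
  rw [prod_pow]
  congr 1
  rw [← norm_prod]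
  have h : ∏ v, fourier (C.group S v)
      (fun s => C.phase id (flipsOf ω) d ((C.group S v).piecewise s z)) c
      = fourier S (fun s => C.phase id (flipsOf ω) d (S.piecewise s z)) c *
        C.phase id (flipsOf ω) d z ^ (n - 1) := by
    simp only [fourier]
    rw [← expect_prod_of_dependsOn (C := fun v => (C.group S v : Set (Fin n))) univ _
      (fun v _ w _ hvw => C.disjoint_group S hvw) ⟨true⟩, expect_mul]
    · refine expect_congr rfl fun s _ => ?_
      rw [prod_mul_distrib, C.prod_chi_group, C.prod_phase_group, mul_assoc]
    · intro v _ x y hxy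
      simp only
      rw [chi_congr (fun _ _ => rfl) hxy]
      exact congrArg _ (dependsOn_piecewise (C.group S v) (C.phase id (flipsOf ω) d) z hxy)
  rw [h, norm_mul, norm_pow, C.norm_phase_id, one_pow, mul_one]

end Labels


/-! ### Finite precision -/

section Precision

variable {n k d : ℕ}

/-- The number `2 ^ K * x`, rounded towards zero. -/
noncomputable def truncInt (K : ℕ) (x : ℝ) : ℤ := (SignType.sign x : ℤ) * ⌊2 ^ K * |x|⌋

/-- A complex number, rounded towards zero after `K` binary digits. -/
noncomputable def trunc (K : ℕ) (z : ℂ) : ℂ :=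
  ((truncInt K z.re : ℂ) + truncInt K z.im * Complex.I) / 2 ^ K

theorem truncInt_of_nonneg (K : ℕ) {x : ℝ} (hx : 0 ≤ x) : truncInt K x = ⌊2 ^ K * x⌋ := by
  rcases hx.eq_or_lt with rfl | h
  · simp [truncInt]
  · simp [truncInt, sign_pos h, abs_of_pos h]

theorem truncInt_neg (K : ℕ) (x : ℝ) : truncInt K (-x) = -truncInt K x := by
  unfold truncInt
  rcases lt_trichotomy x 0 with h | h | h
  · simp [sign_neg h, sign_pos (neg_pos.2 h)]
  · simp [h]
  · simp [sign_pos h, sign_neg (neg_neg_of_pos h)]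

theorem truncInt_bounds (K : ℕ) (x : ℝ) :
    |(truncInt K x : ℝ)| ≤ 2 ^ K * |x| ∧ |2 ^ K * x - truncInt K x| ≤ 1 := by
  have key : ∀ x : ℝ, 0 ≤ x → |(truncInt K x : ℝ)| ≤ 2 ^ K * |x| ∧
      |2 ^ K * x - truncInt K x| ≤ 1 := by
    intro x hx
    have h0 : (0 : ℝ) ≤ 2 ^ K * x := by positivity
    rw [truncInt_of_nonneg K hx, abs_of_nonneg hx,
      abs_of_nonneg (by exact_mod_cast Int.floor_nonneg.2 h0), abs_le]
    have h1 := Int.floor_le (2 ^ K * x)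
    have h2 := Int.lt_floor_add_one (2 ^ K * x)
    exact ⟨h1, by linarith, by linarith⟩
  rcases le_total 0 x with h | h
  · exact key x h
  · obtain ⟨h1, h2⟩ := key (-x) (by linarith)
    rw [truncInt_neg] at h1 h2
    push_cast at h1 h2
    rw [abs_neg, abs_neg] at h1
    refine ⟨h1, ?_⟩
    rw [← abs_neg]
    convert h2 using 2
    ring

theorem norm_trunc_le (K : ℕ) (z : ℂ) : ‖trunc K z‖ ≤ ‖z‖ := by
  rw [trunc, norm_div, norm_pow, Complex.norm_ofNat, div_le_iff₀ (by positivity)]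
  refine le_of_sq_le_sq ?_ (by positivity)
  rw [mul_pow, ← Complex.normSq_eq_norm_sq, ← Complex.normSq_eq_norm_sq, Complex.normSq_apply,
    Complex.normSq_apply]
  simp only [Complex.add_re, Complex.intCast_re, Complex.mul_re, Complex.I_re, Complex.intCast_im,
    Complex.I_im, Complex.add_im, Complex.mul_im, mul_zero, mul_one, add_zero, zero_add,
    sub_self]
  have h1 := (truncInt_bounds K z.re).1
  have h2 := (truncInt_bounds K z.im).1
  have h1' := mul_self_le_mul_self (abs_nonneg _) h1
  have h2' := mul_self_le_mul_self (abs_nonneg _) h2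
  rw [abs_mul_abs_self, mul_mul_mul_comm, abs_mul_abs_self] at h1' h2'
  linarith

theorem norm_sub_trunc_le (K : ℕ) (z : ℂ) : ‖z - trunc K z‖ ≤ 2 / 2 ^ K := by
  have h2 : (2 : ℂ) ^ K ≠ 0 := pow_ne_zero _ two_ne_zero
  have h : z - trunc K z
      = (2 ^ K * z - (truncInt K z.re + truncInt K z.im * Complex.I)) / 2 ^ K := by
    rw [trunc]; field_simp
  rw [h, norm_div, norm_pow, Complex.norm_ofNat]
  refine div_le_div_of_nonneg_right ?_ (by positivity)
  refine (Complex.norm_le_abs_re_add_abs_im _).trans ?_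
  have e : (2 : ℂ) ^ K = ((2 ^ K : ℝ) : ℂ) := by push_cast; rfl
  have hre : (2 ^ K * z - (truncInt K z.re + truncInt K z.im * Complex.I)).re
      = 2 ^ K * z.re - truncInt K z.re := by
    rw [e, Complex.sub_re, Complex.re_ofReal_mul]; simp
  have him : (2 ^ K * z - (truncInt K z.re + truncInt K z.im * Complex.I)).im
      = 2 ^ K * z.im - truncInt K z.im := by
    rw [e, Complex.sub_im, Complex.im_ofReal_mul]; simp
  rw [hre, him]
  have h1 := (truncInt_bounds K z.re).2
  have h2 := (truncInt_bounds K z.im).2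
  linarith

theorem norm_prod_sub_prod_le' {ι : Type*} (s : Finset ι) {f g : ι → ℂ}
    (hf : ∀ i ∈ s, ‖f i‖ ≤ 1) (hg : ∀ i ∈ s, ‖g i‖ ≤ 1) {δ : ℝ} (h : ∀ i ∈ s, ‖f i - g i‖ ≤ δ) :
    ‖∏ i ∈ s, f i - ∏ i ∈ s, g i‖ ≤ #s * δ := by
  classical
  induction s using Finset.induction_on with
  | empty => simp
  | insert a s ha ih =>
      have hm : ∀ {v}, v ∈ s → v ∈ insert a s := fun h => mem_insert_of_mem h
      have ha' := mem_insert_self a s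
      have ih' := ih (fun i hi => hf i (hm hi)) (fun i hi => hg i (hm hi)) fun i hi => h i (hm hi)
      rw [prod_insert ha, prod_insert ha, card_insert_of_notMem ha]
      have e : f a * ∏ i ∈ s, f i - g a * ∏ i ∈ s, g i
        = (f a - g a) * ∏ i ∈ s, f i + g a * (∏ i ∈ s, f i - ∏ i ∈ s, g i) := by ring
      rw [e]
      refine (norm_add_le _ _).trans ?_
      rw [norm_mul, norm_mul]
      have h1 : ‖∏ i ∈ s, f i‖ ≤ 1 := by
        rw [norm_prod]
        exact prod_le_one (fun _ _ => norm_nonneg _) fun i hi => hf i (hm hi)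
      have h2 := mul_le_of_le_one_right (norm_nonneg (f a - g a)) h1
      have h3 := mul_le_of_le_one_left (norm_nonneg (∏ i ∈ s, f i - ∏ i ∈ s, g i)) (hg a ha')
      have h4 := h a ha'
      push_cast
      linarith

theorem IQPCircuit.norm_gateValue_trunc_le (C : IQPCircuit n k d) (K l g : ℕ) (x : Bits n) :
    ‖C.gateValue (trunc K) l g x‖ ≤ 1 := by
  unfold gateValue
  cases h : C.gateAt l g with
  | none => simp
  | some G => simpa using (norm_trunc_le K _).trans (G.norm_diag _).le

theorem IQPCircuit.norm_gateValue_sub_le (C : IQPCircuit n k d) (K l g : ℕ) (x : Bits n) :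
    ‖C.gateValue id l g x - C.gateValue (trunc K) l g x‖ ≤ 2 / 2 ^ K := by
  unfold gateValue
  cases h : C.gateAt l g with
  | none => simp only [Option.elim_none, sub_self, norm_zero]; positivity
  | some G => simpa using norm_sub_trunc_le K _

theorem IQPCircuit.norm_phase_trunc_le (C : IQPCircuit n k d) (K : ℕ) (f : ℕ → Bits n) (l : ℕ)
    (x : Bits n) : ‖C.phase (trunc K) f l x‖ ≤ 1 := by
  induction l generalizing x with
  | zero => simp [phase]
  | succ l ih =>
      rw [phase, norm_mul, norm_prod]
      exact mul_le_one₀ (prod_le_one (fun _ _ => norm_nonneg _)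
        fun g _ => C.norm_gateValue_trunc_le K l g _) (norm_nonneg _) (ih _)

theorem IQPCircuit.norm_phase_sub_le (C : IQPCircuit n k d) (K : ℕ) (f : ℕ → Bits n) (l : ℕ)
    (x : Bits n) :
    ‖C.phase id f l x - C.phase (trunc K) f l x‖ ≤ l * (n * (2 / 2 ^ K)) := by
  induction l generalizing x with
  | zero => simp [phase]
  | succ l ih =>
      simp only [phase]
      set y : Bits n := fun i => x i ^^ f l i
      set a := ∏ g ∈ range n, C.gateValue id l g y
      set b := ∏ g ∈ range n, C.gateValue (trunc K) l g y
      have h1 : ‖a - b‖ ≤ n * (2 / 2 ^ K) := by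
        simpa using norm_prod_sub_prod_le' (range n)
          (fun g _ => (C.norm_gateValue_id l g y).le)
          (fun g _ => C.norm_gateValue_trunc_le K l g y)
          fun g _ => C.norm_gateValue_sub_le K l g y
      have h2 : ‖b‖ ≤ 1 := by
        rw [norm_prod]
        exact prod_le_one (fun _ _ => norm_nonneg _) fun g _ => C.norm_gateValue_trunc_le K l g y
      have e : a * C.phase id f l y - b * C.phase (trunc K) f l y
        = (a - b) * C.phase id f l y + b * (C.phase id f l y - C.phase (trunc K) f l y) := by ring
      rw [e]
      refine (norm_add_le _ _).trans ?_
      rw [norm_mul, norm_mul, C.norm_phase_id, mul_one]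
      have h3 := mul_le_of_le_one_left
        (norm_nonneg (C.phase id f l y - C.phase (trunc K) f l y)) h2
      have h4 := ih y
      push_cast
      linarith

theorem IQPCircuit.groupDensity_nonneg (C : IQPCircuit n k d) (τ : ℂ → ℂ)
    (ω : Fin d → Fin n → Fin 5) (z : Bits n) (v : Fin n) (b : Bits n) :
    0 ≤ C.groupDensity τ ω z v b := by unfold groupDensity; positivity

theorem IQPCircuit.expect_groupDensity_le (C : IQPCircuit n k d) {τ : ℂ → ℂ}
    (ω : Fin d → Fin n → Fin 5) (hτ : ∀ x, ‖C.phase τ (flipsOf ω) d x‖ ≤ 1) (z : Bits n)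
    (v : Fin n) : 𝔼 b, C.groupDensity τ ω z v b ≤ 1 := by
  unfold groupDensity
  rw [parseval (dependsOn_piecewise _ _ _)]
  refine (expect_le_expect fun s _ => ?_).trans (Fintype.expect_const (ι := Bits n) 1).le
  exact pow_le_one₀ (norm_nonneg _) (hτ _)

theorem IQPCircuit.dependsOn_groupDensity (C : IQPCircuit n k d) (τ : ℂ → ℂ)
    (ω : Fin d → Fin n → Fin 5) (z : Bits n) (v : Fin n) :
    DependsOn (C.groupDensity τ ω z v) (C.group (survivors ω) v : Set (Fin n)) := by
  intro x y h
  unfold groupDensity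
  rw [fourier_congr h]

theorem IQPCircuit.abs_groupDensity_sub_le (C : IQPCircuit n k d) (K : ℕ)
    (ω : Fin d → Fin n → Fin 5) (z : Bits n) (v : Fin n) (b : Bits n) :
    |C.groupDensity id ω z v b - C.groupDensity (trunc K) ω z v b|
      ≤ 2 ^ #(C.group (survivors ω) v) * (2 * (d * (n * (2 / 2 ^ K)))) := by
  unfold groupDensity
  rw [← mul_sub, abs_mul, abs_of_nonneg (by positivity : (0 : ℝ) ≤ 2 ^ _)]
  refine mul_le_mul_of_nonneg_left ?_ (by positivity)
  set A := C.group (survivors ω) v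
  set x := fourier A (fun s => C.phase id (flipsOf ω) d (A.piecewise s z)) b
  set y := fourier A (fun s => C.phase (trunc K) (flipsOf ω) d (A.piecewise s z)) b
  have hx : ‖x‖ ≤ 1 := norm_fourier_le fun s => (C.norm_phase_id _ _ _).le
  have hy : ‖y‖ ≤ 1 := norm_fourier_le fun s => C.norm_phase_trunc_le K _ _ _
  have hxy : ‖x - y‖ ≤ d * (n * (2 / 2 ^ K)) :=
    norm_fourier_sub_le fun s => C.norm_phase_sub_le K _ _ _
  rw [sq_sub_sq, abs_mul, abs_of_nonneg (by positivity : 0 ≤ ‖x‖ + ‖y‖)]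
  have := abs_norm_sub_norm_le x y
  exact mul_le_mul (by linarith) (this.trans hxy) (abs_nonneg _) (by norm_num)

/-- The distribution of the outcomes for a given noise record that is computed from the diagonal
entries with `K` digits. -/
noncomputable def IQPCircuit.recordApprox (C : IQPCircuit n k d) (K : ℕ)
    (ω : Fin d → Fin n → Fin 5) (b : Bits n) : ℝ :=
  (2 ^ n)⁻¹ * 𝔼 z : Bits n, ∏ v, C.groupDensity (trunc K) ω z v fun i => b i ^^ signFlip ω i

/-- The error caused by rounding the gates: every phase is a product of at most `d * n` entries,
each of which is off by at most `2 / 2 ^ K`, and there are at most `2 ^ L` outcomes per class. -/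
theorem IQPCircuit.sum_abs_recordProb_sub_le (C : IQPCircuit n k d) (K L : ℕ)
    {ω : Fin d → Fin n → Fin 5} (h : C.SmallClusters L (survivors ω)) :
    ∑ b, |C.recordProb ω b - C.recordApprox K ω b|
      ≤ n * (2 ^ L * (2 * (d * (n * (2 / 2 ^ K))))) := by
  have h1 : ∀ b, |C.recordProb ω b - C.recordApprox K ω b| ≤ (2 ^ n)⁻¹ * 𝔼 z : Bits n,
      |∏ v, C.groupDensity id ω z v (fun i => b i ^^ signFlip ω i)
        - ∏ v, C.groupDensity (trunc K) ω z v fun i => b i ^^ signFlip ω i| := by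
    intro b
    rw [C.recordProb_eq_prod, recordApprox, ← mul_sub, ← expect_sub_distrib, abs_mul,
      abs_of_nonneg (by positivity : (0 : ℝ) ≤ (2 ^ n)⁻¹)]
    exact mul_le_mul_of_nonneg_left (abs_expect_le _ _) (by positivity)
  refine (sum_le_sum fun b _ => h1 b).trans ?_
  rw [← mul_sum, sum_bits_eq, ← mul_assoc, inv_mul_cancel₀ (pow_ne_zero _ two_ne_zero), one_mul,
    expect_comm]
  have hz : ∀ z : Bits n, 𝔼 b : Bits n, |∏ v, C.groupDensity id ω z v (fun i => b i ^^ signFlip ω i)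
        - ∏ v, C.groupDensity (trunc K) ω z v fun i => b i ^^ signFlip ω i|
      ≤ n * (2 ^ L * (2 * (d * (n * (2 / 2 ^ K))))) := by
    intro z
    rw [expect_xor (signFlip ω) fun b => |∏ v, C.groupDensity id ω z v b
          - ∏ v, C.groupDensity (trunc K) ω z v b|]
    refine (expect_abs_prod_sub_le (C := fun v => (C.group (survivors ω) v : Set (Fin n))) univ
      ⟨true⟩ (fun v _ => C.dependsOn_groupDensity _ _ _ _)
      (fun v _ => C.dependsOn_groupDensity _ _ _ _) (fun v _ w _ hvw => C.disjoint_group _ hvw)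
      (fun v _ => C.groupDensity_nonneg _ _ _ _) (fun v _ => C.groupDensity_nonneg _ _ _ _)
      (fun v _ => C.expect_groupDensity_le _ (fun x => (C.norm_phase_id _ _ _).le) _ _)
      (fun v _ => C.expect_groupDensity_le _ (fun x => C.norm_phase_trunc_le K _ _ _) _ _)).trans ?_
    have hv : ∀ v, 𝔼 b, |C.groupDensity id ω z v b - C.groupDensity (trunc K) ω z v b|
        ≤ 2 ^ L * (2 * (d * (n * (2 / 2 ^ K)))) := by
      intro v
      refine expect_le univ_nonempty fun b _ => (C.abs_groupDensity_sub_le K ω z v b).trans ?_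
      exact mul_le_mul_of_nonneg_right (pow_le_pow_right₀ (by norm_num) (card_group_le h v))
        (by positivity)
    refine (sum_le_sum fun v _ => hv v).trans ?_
    simp
  exact expect_le univ_nonempty fun z _ => hz z

theorem abs_max_zero_sub_le (x y : ℝ) : |max x 0 - max y 0| ≤ |x - y| := by
  simpa using abs_max_sub_max_le_max x 0 y 0

theorem sum_abs_outcomeWeight_sub_le {pX pY pZ qX qY qZ δ : ℝ} (hX : |pX - qX| ≤ δ)
    (hY : |pY - qY| ≤ δ) (hZ : |pZ - qZ| ≤ δ) :
    ∑ o, |outcomeWeight pX pY pZ o - outcomeWeight qX qY qZ o| ≤ 20 * δ := by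
  have hm1 := abs_max_zero_sub_le (pX - pY) (qX - qY)
  have hm2 := abs_max_zero_sub_le (pY - pX) (qY - qX)
  have e1 : |pX - pY - (qX - qY)| ≤ 2 * δ := by
    rw [abs_le] at *; constructor <;> linarith [hX.1, hX.2, hY.1, hY.2]
  have e2 : |pY - pX - (qY - qX)| ≤ 2 * δ := by
    rw [abs_le] at *; constructor <;> linarith [hX.1, hX.2, hY.1, hY.2]
  have b1 := hm1.trans e1
  have b2 := hm2.trans e2
  have c0 : |1 - pX - pY - 2 * pZ - (1 - qX - qY - 2 * qZ)| ≤ 4 * δ := by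
    rw [abs_le] at *; constructor <;> linarith [hX.1, hX.2, hY.1, hY.2, hZ.1, hZ.2]
  have c1 : |2 * pZ - 2 * qZ| ≤ 2 * δ := by
    rw [abs_le] at *; constructor <;> linarith [hZ.1, hZ.2]
  have c2 : |pX + pY - max (pX - pY) 0 - max (pY - pX) 0
      - (qX + qY - max (qX - qY) 0 - max (qY - qX) 0)| ≤ 6 * δ := by
    rw [abs_le] at *; constructor <;> linarith [hX.1, hX.2, hY.1, hY.2, b1.1, b1.2, b2.1, b2.2]
  have hδ : 0 ≤ δ := (abs_nonneg _).trans hX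
  simp only [Fin.sum_univ_five, outcomeWeight]
  simp only [Matrix.cons_val]
  linarith

/-- The density of the noise records is a product of `d * n` probability densities, and the error of
each of them is at most `20 * δ`. -/
theorem expect_abs_recordDensity_sub_le {pX pY pZ qX qY qZ δ : ℝ}
    (hp : ∀ o, 0 ≤ outcomeWeight pX pY pZ o) (hq : ∀ o, 0 ≤ outcomeWeight qX qY qZ o)
    (hX : |pX - qX| ≤ δ) (hY : |pY - qY| ≤ δ) (hZ : |pZ - qZ| ≤ δ) :
    𝔼 ω : Fin d → Fin n → Fin 5, |recordDensity pX pY pZ ω - recordDensity qX qY qZ ω|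
      ≤ d * (n * (20 * δ)) := by
  have hmean : ∀ {pX pY pZ : ℝ}, 𝔼 o, 5 * outcomeWeight pX pY pZ o = 1 := by
    intro pX pY pZ
    rw [← mul_expect, Fintype.expect_eq_sum_div_card, sum_outcomeWeight]; simp
  have hrow : ∀ {pX pY pZ : ℝ}, 𝔼 τ : Fin n → Fin 5, ∏ i, 5 * outcomeWeight pX pY pZ (τ i) = 1 := by
    intro pX pY pZ
    rw [expect_prod_eval (fun _ o => 5 * outcomeWeight pX pY pZ o) ⟨0⟩]
    simp [hmean]
  have inner : 𝔼 τ : Fin n → Fin 5, |∏ i, 5 * outcomeWeight pX pY pZ (τ i)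
      - ∏ i, 5 * outcomeWeight qX qY qZ (τ i)| ≤ n * (20 * δ) := by
    refine (expect_abs_prod_sub_le (C := fun i => ({i} : Set (Fin n)))
      (f := fun i (τ : Fin n → Fin 5) => 5 * outcomeWeight pX pY pZ (τ i))
      (g := fun i (τ : Fin n → Fin 5) => 5 * outcomeWeight qX qY qZ (τ i)) univ
      ⟨0⟩ (fun i _ x y h => by simp only [h i rfl]) (fun i _ x y h => by simp only [h i rfl])
      (fun i _ j _ hij => by simpa using hij)
      (fun i _ x => mul_nonneg (by norm_num) (hp _)) (fun i _ x => mul_nonneg (by norm_num) (hq _))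
      (fun i _ => ?_) (fun i _ => ?_)).trans ?_
    · rw [expect_eval i (fun o => 5 * outcomeWeight pX pY pZ o) ⟨0⟩]; exact hmean.le
    · rw [expect_eval i (fun o => 5 * outcomeWeight qX qY qZ o) ⟨0⟩]; exact hmean.le
    · refine (sum_le_card_nsmul _ _ (20 * δ) fun i _ => ?_).trans (by simp)
      rw [expect_eval i (fun o => |5 * outcomeWeight pX pY pZ o - 5 * outcomeWeight qX qY qZ o|)
        ⟨0⟩]
      simp only [← mul_sub, abs_mul]
      rw [← mul_expect, Fintype.expect_eq_sum_div_card]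
      have := sum_abs_outcomeWeight_sub_le hX hY hZ
      rw [Fintype.card_fin]
      push_cast
      rw [abs_of_pos (by norm_num : (0 : ℝ) < 5)]
      linarith
  refine (expect_abs_prod_sub_le (β := Fin n → Fin 5) (C := fun j => ({j} : Set (Fin d)))
    (f := fun j (ω : Fin d → Fin n → Fin 5) => ∏ i, 5 * outcomeWeight pX pY pZ (ω j i))
    (g := fun j (ω : Fin d → Fin n → Fin 5) => ∏ i, 5 * outcomeWeight qX qY qZ (ω j i)) univ
    ⟨fun _ => 0⟩ (fun i _ x y h => by simp only [h i rfl]) (fun i _ x y h => by simp only [h i rfl])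
    (fun i _ j _ hij => by simpa using hij)
    (fun j _ x => prod_nonneg fun i _ => mul_nonneg (by norm_num) (hp _))
    (fun j _ x => prod_nonneg fun i _ => mul_nonneg (by norm_num) (hq _))
    (fun j _ => ?_) (fun j _ => ?_)).trans ?_
  · rw [expect_eval (β := Fin n → Fin 5) j (fun τ => ∏ i, 5 * outcomeWeight pX pY pZ (τ i))
      ⟨fun _ => 0⟩]
    exact hrow.le
  · rw [expect_eval (β := Fin n → Fin 5) j (fun τ => ∏ i, 5 * outcomeWeight qX qY qZ (τ i))
      ⟨fun _ => 0⟩]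
    exact hrow.le
  · refine (sum_le_card_nsmul _ _ (n * (20 * δ)) fun j _ => ?_).trans (by simp)
    rw [expect_eval (β := Fin n → Fin 5) j (fun τ => |∏ i, 5 * outcomeWeight pX pY pZ (τ i)
      - ∏ i, 5 * outcomeWeight qX qY qZ (τ i)|) ⟨fun _ => 0⟩]
    exact inner

end Precision


/-! ### Error analysis -/

section Errors

variable {n k d : ℕ}

/-- A lower bound for a distribution that is close to `P` shows that it is close to `P`. -/
theorem tvDist_le_of_lower_bound {α : Type*} [Fintype α] (Q : PMF α) {P s : α → ℝ} {ε : ℝ}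
    (hP : ∑ a, P a = 1) (hs : ∀ a, s a ≤ (Q a).toReal) (h : ∑ a, |P a - s a| ≤ ε) :
    tvDist Q P ≤ ε := by
  have hQ : ∑ a, (Q a).toReal = 1 := by
    rw [← ENNReal.toReal_sum fun a _ => Q.apply_ne_top a, ← tsum_fintype (L := .unconditional _),
      Q.tsum_coe]
    rfl
  have h1 : ∀ a, |(Q a).toReal - P a| ≤ ((Q a).toReal - s a) + |P a - s a| := by
    intro a
    have e : (Q a).toReal - P a = ((Q a).toReal - s a) - (P a - s a) := by ring
    rw [e]
    refine (abs_sub _ _).trans ?_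
    rw [abs_of_nonneg (sub_nonneg.2 (hs a))]
  have h2 := sum_le_sum fun a (_ : a ∈ univ) => h1 a
  rw [sum_add_distrib, sum_sub_distrib, hQ] at h2
  -- Both distributions have total mass `1`, so the missing mass of the lower bound is counted once.
  have h3 : 1 - ∑ a, s a ≤ ∑ a, |P a - s a| := by
    rw [← hP, ← sum_sub_distrib]
    exact sum_le_sum fun a _ => le_abs_self _
  unfold tvDist
  linarith

theorem IQPCircuit.sum_outputProb (C : IQPCircuit n k d) (N : PauliNoise) :
    ∑ b, outputProb (C.noisy N) b = 1 := by
  simp only [C.outputProb_noisy]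
  rw [← expect_sum_comm]
  simp only [← mul_sum, C.sum_recordProb, mul_one]
  exact expect_recordDensity _ _ _

open Classical in
/-- Replacing the noise by noise with slightly different parameters, ignoring the noise records with
large clusters, and computing with finite precision changes the output distribution little. -/
theorem IQPCircuit.sum_abs_outputProb_sub_le (C : IQPCircuit n k d) (N : PauliNoise)
    (hN : 1 / 2 ≤ N.pI) (hp : 0 ≤ N.strength) (hp2 : N.strength ≤ 1 / 2)
    (hsub : ((d * k : ℕ) : ℝ) ^ 2 * (1 - 2 * N.strength) ^ d ≤ 1 / 2) (K L : ℕ)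
    {qX qY qZ δ : ℝ} (hq : ∀ o, 0 ≤ outcomeWeight qX qY qZ o)
    (hX : |N.pX - qX| ≤ δ) (hY : |N.pY - qY| ≤ δ) (hZ : |N.pZ - qZ| ≤ δ) :
    ∑ b, |outputProb (C.noisy N) b - 𝔼 ω : Fin d → Fin n → Fin 5, recordDensity qX qY qZ ω *
      (if C.SmallClusters L (survivors ω) then C.recordApprox K ω b else 0)|
      ≤ d * (n * (20 * δ)) + n * (1 / 2) ^ L + n * (2 ^ L * (2 * (d * (n * (2 / 2 ^ K))))) := by
  set D : (Fin d → Fin n → Fin 5) → ℝ := recordDensity N.pX N.pY N.pZ with hD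
  set D' : (Fin d → Fin n → Fin 5) → ℝ := recordDensity qX qY qZ with hD'
  have hD0 : ∀ ω, 0 ≤ D ω := fun ω => recordDensity_nonneg (N.weight_nonneg hN) ω
  have hD'0 : ∀ ω, 0 ≤ D' ω := fun ω => recordDensity_nonneg hq ω
  set B := (n : ℝ) * (2 ^ L * (2 * (d * (n * (2 / 2 ^ K))))) with hB
  have hB0 : 0 ≤ B := by positivity
  have hpt : ∀ ω, ∑ b, |D ω * C.recordProb ω b -
      D' ω * (if C.SmallClusters L (survivors ω) then C.recordApprox K ω b else 0)|
      ≤ |D ω - D' ω| + D ω * (if C.SmallClusters L (survivors ω) then 0 else 1) + D' ω * B := by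
    intro ω
    by_cases hg : C.SmallClusters L (survivors ω)
    · simp only [hg, if_true, mul_zero, add_zero]
      have h1 : ∀ b, |D ω * C.recordProb ω b - D' ω * C.recordApprox K ω b|
          ≤ |D ω - D' ω| * C.recordProb ω b
            + D' ω * |C.recordProb ω b - C.recordApprox K ω b| := by
        intro b
        have e : D ω * C.recordProb ω b - D' ω * C.recordApprox K ω b
          = (D ω - D' ω) * C.recordProb ω b
            + D' ω * (C.recordProb ω b - C.recordApprox K ω b) := by ring
        rw [e]
        refine (abs_add_le _ _).trans (le_of_eq ?_)
        rw [abs_mul, abs_mul, abs_of_nonneg (C.recordProb_nonneg ω b), abs_of_nonneg (hD'0 ω)]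
      refine (sum_le_sum fun b _ => h1 b).trans ?_
      rw [sum_add_distrib, ← mul_sum, ← mul_sum, C.sum_recordProb, mul_one]
      exact add_le_add_right
        (mul_le_mul_of_nonneg_left (C.sum_abs_recordProb_sub_le K L hg) (hD'0 ω)) _
    · simp only [hg, if_false, mul_zero, sub_zero, mul_one]
      have h1 : ∑ b, |D ω * C.recordProb ω b| = D ω := by
        simp only [abs_mul, abs_of_nonneg (hD0 ω), abs_of_nonneg (C.recordProb_nonneg ω _)]
        rw [← mul_sum, C.sum_recordProb, mul_one]
      rw [h1]
      have := abs_nonneg (D ω - D' ω)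
      have := mul_nonneg (hD'0 ω) hB0
      linarith
  have hle : ∑ b, |outputProb (C.noisy N) b - 𝔼 ω : Fin d → Fin n → Fin 5, D' ω *
      (if C.SmallClusters L (survivors ω) then C.recordApprox K ω b else 0)|
      ≤ 𝔼 ω : Fin d → Fin n → Fin 5, ∑ b, |D ω * C.recordProb ω b -
      D' ω * (if C.SmallClusters L (survivors ω) then C.recordApprox K ω b else 0)| := by
    rw [expect_sum_comm]
    refine sum_le_sum fun b _ => ?_
    rw [C.outputProb_noisy, ← expect_sub_distrib]
    exact abs_expect_le _ _
  refine hle.trans ((expect_le_expect fun ω _ => hpt ω).trans ?_)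
  rw [expect_add_distrib, expect_add_distrib, ← expect_mul]
  have e1 : 𝔼 ω, D' ω = 1 := expect_recordDensity _ _ _
  rw [e1, one_mul]
  have e2 := expect_abs_recordDensity_sub_le (d := d) (n := n) (N.weight_nonneg hN) hq hX hY hZ
  have e3 := C.expect_not_smallClusters_le N hN hp hp2 hsub L
  exact add_le_add (add_le_add e2 e3) le_rfl

/-- If all qubits are dephased with high probability, the output distribution is almost uniform. -/
theorem IQPCircuit.sum_abs_outputProb_sub_uniform_le (C : IQPCircuit n k d) (N : PauliNoise)
    (hN : 1 / 2 ≤ N.pI) :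
    ∑ b, |outputProb (C.noisy N) b - 𝔼 ω : Fin d → Fin n → Fin 5,
      recordDensity N.pX N.pY N.pZ ω * (if survivors ω = ∅ then (2 ^ n)⁻¹ else 0)|
      ≤ n * (1 - 2 * N.strength) ^ d := by
  refine le_trans ?_ (expect_survivors_nonempty_le N hN)
  have hpt : ∀ (ω : Fin d → Fin n → Fin 5) b, recordDensity N.pX N.pY N.pZ ω * C.recordProb ω b -
      recordDensity N.pX N.pY N.pZ ω * (if survivors ω = ∅ then (2 ^ n)⁻¹ else 0)
      = recordDensity N.pX N.pY N.pZ ω * (if survivors ω = ∅ then 0 else 1) *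
        C.recordProb ω b := by
    intro ω b
    by_cases h : survivors ω = ∅
    · simp [h, C.recordProb_of_survivors_eq_empty h]
    · simp [h]
  have h0 : ∀ (ω : Fin d → Fin n → Fin 5), 0 ≤ recordDensity N.pX N.pY N.pZ ω *
      (if survivors ω = ∅ then 0 else 1) := fun ω =>
    mul_nonneg (recordDensity_nonneg (N.weight_nonneg hN) ω) (by split_ifs <;> norm_num)
  have h1 : ∀ b, |outputProb (C.noisy N) b - 𝔼 ω : Fin d → Fin n → Fin 5,
      recordDensity N.pX N.pY N.pZ ω * (if survivors ω = ∅ then (2 ^ n)⁻¹ else 0)|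
      = 𝔼 ω : Fin d → Fin n → Fin 5, recordDensity N.pX N.pY N.pZ ω *
        (if survivors ω = ∅ then 0 else 1) * C.recordProb ω b := by
    intro b
    rw [C.outputProb_noisy, ← expect_sub_distrib]
    simp only [hpt]
    exact abs_of_nonneg (expect_nonneg fun ω _ => mul_nonneg (h0 ω) (C.recordProb_nonneg ω b))
  rw [sum_congr rfl fun b _ => h1 b, ← expect_sum_comm]
  refine le_of_eq (expect_congr rfl fun ω _ => ?_)
  rw [← mul_sum, C.sum_recordProb, mul_one]

/-! ### Numerical estimates -/

/-- The depth threshold. -/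
noncomputable def depthThreshold (p : ℝ) (k : ℕ) : ℝ := 100 * (p⁻¹ * Real.log (k * p⁻¹))

theorem one_sub_pow_le_exp {p : ℝ} (hp2 : p ≤ 1 / 2) (d : ℕ) :
    (1 - 2 * p) ^ d ≤ Real.exp (-2 * (p * d)) := by
  have h : 1 - 2 * p ≤ Real.exp (-(2 * p)) := Real.one_sub_le_exp_neg _
  refine (pow_le_pow_left₀ (by linarith) h d).trans (le_of_eq ?_)
  rw [← Real.exp_nat_mul]; congr 1; ring

theorem depthThreshold_bounds {p : ℝ} {k : ℕ} (hp : 0 < p) (hp2 : p ≤ 1 / 2) (hk : 1 ≤ k) {d : ℕ}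
    (hd : depthThreshold p k < d) :
    100 * Real.log (k * p⁻¹) < p * d ∧ Real.log 2 ≤ Real.log (k * p⁻¹) := by
  constructor
  · have := mul_lt_mul_of_pos_left hd hp
    rw [depthThreshold] at this
    have e : p * (100 * (p⁻¹ * Real.log (k * p⁻¹))) = 100 * Real.log (k * p⁻¹) := by
      field_simp
    linarith
  · refine Real.log_le_log (by norm_num) ?_
    have h1 : (1 : ℝ) ≤ k := by exact_mod_cast hk
    have h2 : 2 ≤ p⁻¹ := by rw [le_inv_comm₀ (by norm_num) hp]; linarith
    nlinarith

/-- The depth threshold is nonnegative, because `p⁻¹` is at least `2`. -/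
theorem depth_pos {p : ℝ} {k : ℕ} (hp : 0 < p) (hp2 : p ≤ 1 / 2) (hk : 1 ≤ k) {d : ℕ}
    (hd : depthThreshold p k < d) : 1 ≤ d := by
  obtain ⟨h1, h2⟩ := depthThreshold_bounds hp hp2 hk hd
  have := Real.log_two_gt_d9
  rcases Nat.eq_zero_or_pos d with rfl | h
  · simp at h1; linarith
  · exact h

/-- Above the depth threshold, percolation is subcritical. -/
theorem subcritical {p : ℝ} {k : ℕ} (hp : 0 < p) (hp2 : p ≤ 1 / 2) (hk : 1 ≤ k) {d : ℕ}
    (hd : depthThreshold p k < d) :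
    ((d * k : ℕ) : ℝ) ^ 2 * (1 - 2 * p) ^ d ≤ 1 / 2 := by
  obtain ⟨h1, h2⟩ := depthThreshold_bounds hp hp2 hk hd
  have hl2 := Real.log_two_gt_d9
  set x := p * d with hx
  have hx0 : 60 ≤ x := by linarith
  have hk0 : (0 : ℝ) < k := by exact_mod_cast hk
  have hkp : (k * p⁻¹ : ℝ) ≤ Real.exp (x / 100) := by
    rw [← Real.log_le_iff_le_exp (by positivity)]; linarith
  have hdk : ((d * k : ℕ) : ℝ) = x * (k * p⁻¹) := by
    rw [hx]; push_cast; field_simp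
  have hxe : x ≤ 2 * Real.exp (x / 2) := by
    have := Real.add_one_le_exp (x / 2); linarith
  have h3 : ((d * k : ℕ) : ℝ) ^ 2 ≤ (2 * Real.exp (x / 2) * Real.exp (x / 100)) ^ 2 := by
    rw [hdk]
    exact pow_le_pow_left₀ (by positivity) (mul_le_mul hxe hkp (by positivity) (by positivity)) 2
  refine (mul_le_mul h3 (one_sub_pow_le_exp hp2 d) (pow_nonneg (by linarith) _)
    (by positivity)).trans ?_
  have e : (2 * Real.exp (x / 2) * Real.exp (x / 100)) ^ 2 * Real.exp (-2 * x)
      = 4 * Real.exp (-(49 / 50) * x) := by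
    have e1 : Real.exp (-(49 / 50) * x) = Real.exp (x / 2) * Real.exp (x / 2) *
        (Real.exp (x / 100) * Real.exp (x / 100)) * Real.exp (-2 * x) := by
      rw [← Real.exp_add, ← Real.exp_add, ← Real.exp_add, ← Real.exp_add]; congr 1; ring
    rw [e1]; ring
  rw [e]
  have h4 : Real.exp (-(49 / 50) * x) ≤ 1 / 8 := by
    have h5 : (8 : ℝ) ≤ Real.exp (49 / 50 * x) := by
      have := Real.add_one_le_exp (49 / 50 * x); linarith
    rw [neg_mul, Real.exp_neg, one_div]
    exact inv_anti₀ (by norm_num) h5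
  linarith

/-- Above the depth threshold and for depths that are large compared with the input size and the
inverse accuracy, all qubits are dephased with high probability. -/
theorem mul_survive_pow_le {p : ℝ} {k : ℕ} (hp : 0 < p) (hp2 : p ≤ 1 / 2) (hk : 1 ≤ k) {d n : ℕ}
    (hd : depthThreshold p k < d) {M ε : ℝ} (hM1 : 1 ≤ M) (hε : 0 < ε)
    (hM : n / ε ≤ M) (hdM : M ^ 2 ≤ d) : n * (1 - 2 * p) ^ d ≤ ε := by
  obtain ⟨h1, h2⟩ := depthThreshold_bounds hp hp2 hk hd
  have hl2 := Real.log_two_gt_d9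
  have hk1 : (1 : ℝ) ≤ k := by exact_mod_cast hk
  have hlog : Real.log M ≤ p * d := by
    -- If `M ≤ p⁻¹`, the depth threshold suffices; otherwise `M ≤ p * M ^ 2 ≤ p * d`.
    rcases le_total M p⁻¹ with h | h
    · have h3 : Real.log M ≤ Real.log (k * p⁻¹) :=
        Real.log_le_log (by linarith) (h.trans (le_mul_of_one_le_left (by positivity) hk1))
      linarith
    · have h3 : 1 ≤ p * M := by
        rw [inv_le_iff_one_le_mul₀ hp] at h; linarith
      have h4 : M ≤ p * d := by
        have : p * M ^ 2 ≤ p * d := mul_le_mul_of_nonneg_left hdM hp.le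
        nlinarith
      exact (Real.log_le_self (by linarith)).trans h4
  have hMe : M ≤ Real.exp (2 * (p * d)) := by
    rw [← Real.log_le_iff_le_exp (by linarith)]
    have : 0 ≤ Real.log M := Real.log_nonneg hM1
    linarith
  have hn : (n : ℝ) ≤ ε * M := by rw [div_le_iff₀ hε] at hM; linarith
  have he : 0 < Real.exp (2 * (p * d)) := Real.exp_pos _
  calc n * (1 - 2 * p) ^ d ≤ (ε * M) * Real.exp (-2 * (p * d)) :=
        mul_le_mul hn (one_sub_pow_le_exp hp2 d) (pow_nonneg (by linarith) _) (by positivity)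
    _ = ε * (M * (Real.exp (2 * (p * d)))⁻¹) := by
        rw [neg_mul, Real.exp_neg]; ring
    _ ≤ ε * 1 := by
        refine mul_le_mul_of_nonneg_left ?_ hε.le
        rw [← div_eq_mul_inv, div_le_one he]; exact hMe
    _ = ε := mul_one ε

/-- The errors from rounding the noise parameters, from large clusters, and from rounding the gates.
All sizes are powers of `2 ^ L`, and `16 * L` digits leave room for the first and the last one. -/
theorem total_error_le {n d L : ℕ} {ε : ℝ} (hn : 1 ≤ n) (hε : 0 < ε) (hε1 : ε ≤ 1)
    (hM : 64 * (n / ε) ≤ 2 ^ L) (hd : (d : ℝ) ≤ (2 ^ L) ^ 2) :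
    d * (n * (20 * (1 / 2 ^ (16 * L)))) + n * (1 / 2) ^ L
      + n * (2 ^ L * (2 * (d * (n * (2 / 2 ^ (16 * L)))))) ≤ ε := by
  set M : ℝ := 2 ^ L with hMdef
  have hM16 : (2 : ℝ) ^ (16 * L) = M ^ 16 := by rw [hMdef, ← pow_mul, mul_comm]
  have hn1 : (1 : ℝ) ≤ n := by exact_mod_cast hn
  have hM0 : 0 < M := by positivity
  have hnM : 64 * (n : ℝ) ≤ ε * M := by
    have := mul_le_mul_of_nonneg_left hM hε.le
    have e : ε * (64 * (n / ε)) = 64 * n := by field_simp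
    linarith
  have hM64 : 64 ≤ M := by nlinarith
  have hnM' : (n : ℝ) ≤ M := by nlinarith
  set x := M⁻¹ with hx
  have hx0 : 0 < x := by positivity
  have hxM : M * x = 1 := mul_inv_cancel₀ hM0.ne'
  have hxe : x * n ≤ ε / 64 := by
    have := mul_le_mul_of_nonneg_right hnM hx0.le
    have e : ε * M * x = ε := by rw [mul_assoc, hxM, mul_one]
    linarith
  have hx64 : x ≤ 1 / 64 := by
    rw [hx, one_div]; exact inv_anti₀ (by norm_num) hM64
  have hxε : x ≤ ε / 64 := by nlinarith
  have hhalf : (1 / 2 : ℝ) ^ L = x := by rw [hx, hMdef, one_div, inv_pow]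
  rw [hM16, hhalf, div_eq_mul_inv, div_eq_mul_inv 2, ← inv_pow, ← hx, one_mul]
  have hx10 : x ^ 10 ≤ 1 / 64 := (pow_le_of_le_one hx0.le (by linarith) (by norm_num)).trans hx64
  have h1 : d * (n * (20 * x ^ 16)) ≤ ε / 3 := by
    have : d * (n * (20 * x ^ 16)) ≤ M ^ 2 * (M * (20 * x ^ 16)) := by gcongr
    have e : M ^ 2 * (M * (20 * x ^ 16)) = 20 * ((M * x) ^ 3 * (x ^ 10 * (x ^ 2 * x))) := by ring
    rw [e, hxM, one_pow, one_mul] at this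
    have h2 : x ^ 2 * x ≤ 1 * x :=
      mul_le_mul_of_nonneg_right (pow_le_one₀ hx0.le (by linarith)) hx0.le
    have h3 : x ^ 10 * (x ^ 2 * x) ≤ 1 / 64 * (1 * x) := by gcongr
    linarith
  have h2 : n * (M * (2 * (d * (n * (2 * x ^ 16))))) ≤ ε / 3 := by
    have : n * (M * (2 * (d * (n * (2 * x ^ 16)))))
        ≤ M * (M * (2 * (M ^ 2 * (M * (2 * x ^ 16))))) := by
      gcongr
    have e : M * (M * (2 * (M ^ 2 * (M * (2 * x ^ 16))))) = 4 * ((M * x) ^ 5 * (x ^ 10 * x)) := by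
      ring
    rw [e, hxM, one_pow, one_mul] at this
    have h3 : x ^ 10 * x ≤ 1 / 64 * x := by gcongr
    linarith
  linarith

end Errors


/-! ### Reasoning about counting programs -/

instance : Add Expr := ⟨Expr.add⟩
instance : Sub Expr := ⟨Expr.sub⟩
instance (z : ℕ) : OfNat Expr z := ⟨Expr.const z⟩

@[simp] theorem Expr.eval_add (m : Memory) (a b : Expr) : (a + b).eval m = a.eval m + b.eval m :=
  rfl
@[simp] theorem Expr.eval_sub (m : Memory) (a b : Expr) : (a - b).eval m = a.eval m - b.eval m :=
  rfl
@[simp] theorem Expr.eval_zero (m : Memory) : (0 : Expr).eval m = 0 := rfl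
@[simp] theorem Expr.eval_one (m : Memory) : (1 : Expr).eval m = 1 := rfl
@[simp] theorem Expr.eval_two (m : Memory) : (2 : Expr).eval m = 2 := rfl
@[simp] theorem Expr.eval_half (m : Memory) (a : Expr) : a.half.eval m = a.eval m / 2 := rfl
@[simp] theorem Expr.eval_var (m : Memory) (x : ℕ) : (Expr.var x).eval m = m.var x := rfl

infixr:60 " ;; " => Prog.seq

theorem Prog.den_seq (c₁ c₂ : Prog) (m : Memory) : (c₁ ;; c₂).den m = c₂.den (c₁.den m) := rfl

/-- The memory `m'` agrees with `m` on everything that the program `c` does not change. -/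
def Frame (c : Prog) (m m' : Memory) : Prop :=
  (∀ y, y ∉ c.modV → m'.var y = m.var y) ∧ ∀ a, a ∉ c.modA → m'.arr a = m.arr a

theorem Frame.refl (c : Prog) (m : Memory) : Frame c m m := ⟨fun _ _ => rfl, fun _ _ => rfl⟩

theorem Frame.den (c : Prog) (m : Memory) : Frame c m (c.den m) :=
  ⟨fun _ hy => Prog.den_var hy m, fun _ ha => Prog.den_arr ha m⟩

/-- Induction over the iterations of a counting loop. -/
theorem count_induction {x p : ℕ} {c : Prog} {N : ℕ} {m : Memory} (hN : m.var p = N)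
    (P : ℕ → Memory → Prop) (h0 : P N (m.setVar x N))
    (hs : ∀ i < N, ∀ m', Frame (.count x p c) m m' → P (i + 1) m' →
      P i (c.den (m'.setVar x i))) : P 0 ((Prog.count x p c).den m) := by
  have h1 : ∀ (m' : Memory) (v : ℤ), Frame (.count x p c) m m' →
      Frame (.count x p c) m (m'.setVar x v) := by
    intro m' v h
    refine ⟨fun y hy => ?_, h.2⟩
    rw [Memory.setVar_var, if_neg (fun e => hy (by simp [e, Prog.modV])), h.1 y hy]
  have key := downFold_induction (f := fun i m => c.den (m.setVar x i)) (N := N)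
    (s := m.setVar x N) (fun i m' => Frame (.count x p c) m m' ∧ P i m')
    ⟨h1 m N (Frame.refl _ _), h0⟩ (by
      rintro i hi m' ⟨hF, hP⟩
      refine ⟨?_, hs i hi m' hF hP⟩
      have hf := h1 m' i hF
      refine ⟨fun y hy => ?_, fun a ha => ?_⟩
      · rw [Prog.den_var (fun e => hy (by simp [e, Prog.modV])), hf.1 y hy]
      · rw [Prog.den_arr (fun e => ha (by simpa [Prog.modA] using e)), hf.2 a ha])
  have e : (Prog.count x p c).den m
      = downFold (fun i m => c.den (m.setVar x i)) N (m.setVar x N) := by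
    rw [Prog.den, hN]; rfl
  rw [e]
  exact key.2

/-- The integer `0` or `1` that represents a bit. -/
def bitVal (b : Bool) : ℤ := if b then 1 else 0

/-- The array `a` holds the bit string `x`. -/
def HoldsBits {n : ℕ} (m : Memory) (a : ℕ) (x : Bits n) : Prop :=
  ∀ i : Fin n, m.arr a [((i : ℕ) : ℤ)] = bitVal (x i)

section Reading

variable {n k d : ℕ}

/-- The memory contains the input, and the parameters `L`, `2 ^ L`, `K`, `K + 1` and `J` are
stored in the variables `3`, …, `7`. -/
structure Inputs (C : IQPCircuit n k d) (N : PauliNoise) (ε : ℝ) (L K J : ℕ) (m : Memory) :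
    Prop where
  n_eq : m.var 0 = n
  d_eq : m.var 1 = d
  k_eq : m.var 2 = k
  L_eq : m.var 3 = L
  M_eq : m.var 4 = (2 ^ L : ℕ)
  K_eq : m.var 5 = K
  K1_eq : m.var 6 = (K + 1 : ℕ)
  J_eq : m.var 7 = J
  arr_eq : ∀ a < 6, m.arr a = inputArr C N ε a

/-- A program that changes neither the parameters nor the input arrays. -/
def Prog.Safe (c : Prog) : Bool := c.modV.all (7 < ·) && c.modA.all (5 < ·)

variable {C : IQPCircuit n k d} {N : PauliNoise} {ε : ℝ} {L K J : ℕ}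

theorem Inputs.of_frame {m m' : Memory} (h : Inputs C N ε L K J m) {c : Prog} (hc : c.Safe)
    (hF : Frame c m m') : Inputs C N ε L K J m' := by
  simp only [Prog.Safe, Bool.and_eq_true, List.all_eq_true, decide_eq_true_eq] at hc
  have hv : ∀ x, x ≤ 7 → m'.var x = m.var x := fun x hx =>
    hF.1 x fun hm => by have := hc.1 x hm; omega
  have ha : ∀ a, a < 6 → m'.arr a = m.arr a := fun a hx =>
    hF.2 a fun hm => by have := hc.2 a hm; omega
  constructor
  · rw [hv _ (by norm_num), h.n_eq]
  · rw [hv _ (by norm_num), h.d_eq]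
  · rw [hv _ (by norm_num), h.k_eq]
  · rw [hv _ (by norm_num), h.L_eq]
  · rw [hv _ (by norm_num), h.M_eq]
  · rw [hv _ (by norm_num), h.K_eq]
  · rw [hv _ (by norm_num), h.K1_eq]
  · rw [hv _ (by norm_num), h.J_eq]
  · intro a hlt; rw [ha a hlt, h.arr_eq a hlt]

theorem Inputs.setVar {m : Memory} (h : Inputs C N ε L K J m) {x : ℕ} (hx : 7 < x) (v : ℤ) :
    Inputs C N ε L K J (m.setVar x v) :=
  h.of_frame (c := .assign x (.const v)) (by simp [Prog.Safe, Prog.modV, Prog.modA, hx])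
    (Frame.den (.assign x (.const v)) m)

/-! ### Reading real numbers -/

/-- The value of the first `t` binary digits of `x`, as an integer. -/
noncomputable def digitSum (x : ℝ) : ℕ → ℤ
  | 0 => 0
  | t + 1 => 2 * digitSum x t + signedDigit x t

/-- Reading digits truncates towards zero. -/
theorem digitSum_succ {x : ℝ} (hx : |x| < 2) (t : ℕ) : digitSum x (t + 1) = truncInt t x := by
  induction t with
  | zero =>
      have h : ⌊|x|⌋ % 2 = ⌊|x|⌋ := by
        have h1 : 0 ≤ ⌊|x|⌋ := Int.floor_nonneg.2 (abs_nonneg x)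
        have h2 : ⌊|x|⌋ < 2 := Int.floor_lt.2 (by exact_mod_cast hx)
        exact Int.emod_eq_of_lt h1 h2
      simp [digitSum, signedDigit, truncInt, h]
  | succ t ih =>
      rw [digitSum, ih]
      have h : ⌊2 ^ t * |x|⌋ = ⌊2 ^ (t + 1) * |x|⌋ / 2 := by
        have := Int.floor_div_natCast (2 ^ (t + 1) * |x|) 2
        push_cast at this
        rw [← this]
        congr 1
        rw [pow_succ]
        ring
      have h2 := Int.emod_add_mul_ediv ⌊2 ^ (t + 1) * |x|⌋ 2
      unfold truncInt signedDigit
      rw [h]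
      linear_combination (SignType.sign x : ℤ) * h2

theorem signedDigit_cases (x : ℝ) (j : ℕ) :
    signedDigit x j = 0 ∨ signedDigit x j = 1 ∨ signedDigit x j = -1 := by
  unfold signedDigit
  rcases Int.emod_two_eq_zero_or_one ⌊2 ^ j * |x|⌋ with h | h <;> rw [h]
  · simp
  · rcases lt_trichotomy x 0 with hx | hx | hx
    · simp [sign_neg hx]
    · simp [hx]
    · simp [sign_pos hx]

/-- Reads the noise parameter with number `i` into the variable `x`. -/
def readParam (i : ℕ) (x : ℕ) : Prog :=
  .assign x 0 ;;
  .count 10 6 (.load 12 0 [.const i, .var 5 - .var 10] ;; .assign x (.var x + .var x + .var 12))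

/-- The digits of a real number, read in the order of their weights, give its truncation. -/
theorem readParam_spec {m : Memory} (h : Inputs C N ε L K J m) {i x : ℕ} {q : ℝ} (hx : 12 < x)
    (hq : ∀ j : ℕ, inputArr C N ε 0 [(i : ℤ), (j : ℤ)] = signedDigit q j) (hq2 : |q| < 2) :
    ((readParam i x).den m).var x = truncInt K q := by
  rw [readParam, Prog.den]
  have hx10 : (10 : ℕ) ≠ x := by omega
  have hx12 : (12 : ℕ) ≠ x := by omega
  have h0 : Inputs C N ε L K J ((Prog.assign x 0).den m) := h.setVar (by omega) _
  have key := count_induction (x := 10) (p := 6)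
    (c := .load 12 0 [.const i, .var 5 - .var 10] ;; .assign x (.var x + .var x + .var 12))
    h0.K1_eq (fun j m' => m'.var x = digitSum q (K + 1 - j)) ?_ ?_
  · rw [key, Nat.sub_zero, digitSum_succ hq2]
  · simp [Prog.den, Memory.setVar_var, digitSum, hx10.symm]
  · intro j hj m' hF hP
    have hsafe : Prog.Safe (.count 10 6 (.load 12 0 [.const i, .var 5 - .var 10] ;;
        .assign x (.var x + .var x + .var 12))) := by
      simp [Prog.Safe, Prog.modV, Prog.modA]; omega
    have hI := h0.of_frame hsafe hF
    have e : ((K : ℤ) - (j : ℤ)) = ((K - j : ℕ) : ℤ) := by omega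
    have e2 : K + 1 - j = (K + 1 - (j + 1)) + 1 := by omega
    have e3 : K + 1 - (j + 1) = K - j := by omega
    simp only [Prog.den, Memory.setVar_var, Memory.setVar_arr,
      Expr.eval_sub, List.map, hx10.symm, hx12.symm, if_true, if_false, hP, Expr.eval,
      hI.arr_eq 0 (by norm_num), hI.K_eq]
    norm_num
    rw [e, hq, e2, digitSum, e3]
    ring

/-! ### The phase of a basis state -/

/-- Flips the bits in array `15` according to the layer in variable `43`. -/
def flipCur : Prog :=
  .count 10 0 (.load 12 15 [.var 10] ;; .load 13 8 [.var 43, .var 10] ;;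
    .cond (.var 13) (.store 15 [.var 10] (1 - .var 12)) .skip)

theorem flipCur_spec {m : Memory} (h : Inputs C N ε L K J m) {l : ℕ} (hl : m.var 43 = l)
    {x f : Bits n} (hx : HoldsBits m 15 x)
    (hf : ∀ i : Fin n, m.arr 8 [(l : ℤ), ((i : ℕ) : ℤ)] = bitVal (f i)) :
    HoldsBits (flipCur.den m) 15 fun i => x i ^^ f i := by
  have key := count_induction (x := 10) (p := 0)
    (c := .load 12 15 [.var 10] ;; .load 13 8 [.var 43, .var 10] ;;
      .cond (.var 13) (.store 15 [.var 10] (1 - .var 12)) .skip) h.n_eq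
    (fun i m' => ∀ j : Fin n, m'.arr 15 [((j : ℕ) : ℤ)]
      = if i ≤ j then bitVal (x j ^^ f j) else bitVal (x j)) ?_ ?_
  · intro j; exact (key j).trans (by simp)
  · intro j
    have : ¬ n ≤ j := by omega
    simp [this, hx j]
  · intro i hi m' hF hP j
    have h8 : m'.arr 8 = m.arr 8 := hF.2 8 (by decide)
    have h43 : m'.var 43 = l := (hF.1 43 (by decide)).trans hl
    have hPi := hP ⟨i, hi⟩
    have hfi := hf ⟨i, hi⟩
    simp only [Nat.not_succ_le_self, if_false] at hPi
    have hPj := hP j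
    simp only [Prog.den, Memory.setVar_var, Memory.setVar_arr, Expr.eval_var, List.map,
      Expr.eval_sub, h8, h43]
    norm_num
    rw [hPi, hfi]
    by_cases hij : (j : ℕ) = i
    · obtain rfl : j = ⟨i, hi⟩ := Fin.ext hij
      cases hxv : x ⟨i, hi⟩ <;> cases hfv : f ⟨i, hi⟩ <;> rw [hxv] at hPi <;>
        simp [bitVal, Memory.setArr_arr] <;> simpa [bitVal] using hPi
    · have hle : i ≤ (j : ℕ) ↔ i + 1 ≤ (j : ℕ) := by omega
      simp only [hle, ← hPj]
      split_ifs
      · simp [Memory.setArr_arr, hij]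
      · simp

end Reading


section Phase

variable {n k d : ℕ} {C : IQPCircuit n k d} {N : PauliNoise} {ε : ℝ} {L K J : ℕ}

/-- `x := x + s * y`, for a sign `s` in `{-1, 0, 1}`. -/
def addSigned (s : Expr) (x y : ℕ) : Prog :=
  .cond s (.assign x (.var x + .var y)) (.cond (0 - s) (.assign x (.var x - .var y)) .skip)

theorem Memory.setVar_self (m : Memory) (x : ℕ) : m.setVar x (m.var x) = m := by
  simp [Memory.setVar]

theorem addSigned_den {m : Memory} {s : Expr} (x y : ℕ)
    (hs : s.eval m = 0 ∨ s.eval m = 1 ∨ s.eval m = -1) :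
    (addSigned s x y).den m = m.setVar x (m.var x + s.eval m * m.var y) := by
  rcases hs with h | h | h <;> simp [addSigned, Prog.den, h, Memory.setVar_self, sub_eq_add_neg]

theorem addSigned_var {m : Memory} {s : Expr} {x y z : ℕ} (h : z ≠ x) :
    ((addSigned s x y).den m).var z = m.var z :=
  Prog.den_var (by simp [addSigned, Prog.modV, h]) m

/-- One step of `mulEntry`. -/
def mulDigit : Prog :=
  .load 12 5 [.var 43, .var 44, .var 45, 0, .var 5 - .var 10] ;;
  .load 13 5 [.var 43, .var 44, .var 45, 1, .var 5 - .var 10] ;;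
  .assign 47 (.var 47 + .var 47) ;; .assign 48 (.var 48 + .var 48) ;;
  addSigned (.var 12) 47 41 ;; addSigned (0 - .var 13) 47 42 ;;
  addSigned (.var 12) 48 42 ;; addSigned (.var 13) 48 41

/-- Multiplies the Gaussian integer in the variables `41` and `42` by the entry number `45` of the
gate that is given by the variables `43` and `44`, rounded to an integral multiple of `2 ^ (-K)`
and scaled by `2 ^ K`. -/
def mulEntry : Prog :=
  .assign 47 0 ;; .assign 48 0 ;; .count 10 6 mulDigit ;;
  .assign 41 (.var 47) ;; .assign 42 (.var 48)

/-- The Gaussian integer in the variables `x` and `y`. -/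
noncomputable def Memory.gauss (m : Memory) (x y : ℕ) : ℂ := m.var x + m.var y * Complex.I

theorem abs_re_lt_two {z : ℂ} (hz : ‖z‖ = 1) : |z.re| < 2 ∧ |z.im| < 2 :=
  ⟨(z.abs_re_le_norm.trans_eq hz).trans_lt one_lt_two,
    (z.abs_im_le_norm.trans_eq hz).trans_lt one_lt_two⟩

/-- Multiplication by doubling and adding the digits of the entry, which are `-1`, `0` or `1`. -/
theorem mulEntry_spec {m : Memory} (h : Inputs C N ε L K J m) {l g X : ℕ} {G : DiagGate n}
    (hG : C.gateAt l g = some G) (hl : m.var 43 = l) (hg : m.var 44 = g) (hX : m.var 45 = X) :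
    (mulEntry.den m).gauss 41 42
      = m.gauss 41 42 * (2 ^ K * trunc K (G.diag fun r => X.testBit r)) := by
  set w := G.diag fun r => X.testBit r with hw
  obtain ⟨hre, him⟩ := abs_re_lt_two (G.norm_diag fun r => X.testBit r)
  have key := count_induction (x := 10) (p := 6) (c := mulDigit) (N := K + 1)
    (m := (m.setVar 47 0).setVar 48 0) (by simpa [Memory.setVar_var] using h.K1_eq)
    (fun j m' =>
      m'.var 47 = digitSum w.re (K + 1 - j) * m.var 41 - digitSum w.im (K + 1 - j) * m.var 42 ∧
      m'.var 48 = digitSum w.re (K + 1 - j) * m.var 42 + digitSum w.im (K + 1 - j) * m.var 41)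
    ?_ ?_
  · obtain ⟨k1, k2⟩ := key
    rw [Nat.sub_zero, digitSum_succ hre, digitSum_succ him] at k1 k2
    have e : mulEntry.den m
        = ((((Prog.count 10 6 mulDigit).den ((m.setVar 47 0).setVar 48 0)).setVar 41
          (((Prog.count 10 6 mulDigit).den ((m.setVar 47 0).setVar 48 0)).var 47)).setVar 42
          (((Prog.count 10 6 mulDigit).den ((m.setVar 47 0).setVar 48 0)).var 48)) := rfl
    rw [e]
    simp only [Memory.gauss, Memory.setVar_var]
    norm_num
    rw [k1, k2, trunc, mul_div_cancel₀ _ (pow_ne_zero _ two_ne_zero)]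
    push_cast
    linear_combination (-(truncInt K w.im : ℂ) * (m.var 42 : ℂ)) * Complex.I_mul_I
  · simp [Memory.setVar_var, digitSum]
  · rintro j hj m' hF ⟨h1, h2⟩
    have v41 : m'.var 41 = m.var 41 := hF.1 41 (by decide)
    have v42 : m'.var 42 = m.var 42 := hF.1 42 (by decide)
    have v43 : m'.var 43 = l := (hF.1 43 (by decide)).trans hl
    have v44 : m'.var 44 = g := (hF.1 44 (by decide)).trans hg
    have v45 : m'.var 45 = X := (hF.1 45 (by decide)).trans hX
    have v5 : m'.var 5 = K := (hF.1 5 (by decide)).trans h.K_eq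
    have a5 : m'.arr 5 = inputArr C N ε 5 := (hF.2 5 (by decide)).trans (h.arr_eq 5 (by norm_num))
    have e : (K : ℤ) - (j : ℤ) = ((K - j : ℕ) : ℤ) := by omega
    have e2 : K + 1 - j = (K - j) + 1 := by omega
    have e3 : K + 1 - (j + 1) = K - j := by omega
    have d0 : inputArr C N ε 5 [(l : ℤ), g, X, 0, ((K - j : ℕ) : ℤ)]
        = signedDigit w.re (K - j) := by
      simp [inputArr, hG, hw]
    have d1 : inputArr C N ε 5 [(l : ℤ), g, X, 1, ((K - j : ℕ) : ℤ)]
        = signedDigit w.im (K - j) := by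
      simp [inputArr, hG, hw]
    rw [e3] at h1 h2
    rw [e2]
    simp only [digitSum]
    have c0 := signedDigit_cases w.re (K - j)
    have c1 := signedDigit_cases w.im (K - j)
    generalize signedDigit w.re (K - j) = s0 at *
    generalize signedDigit w.im (K - j) = s1 at *
    have c1' : -s1 = 0 ∨ -s1 = 1 ∨ -s1 = -1 := by omega
    simp only [mulDigit, Prog.den]
    rw [addSigned_den, addSigned_den, addSigned_den, addSigned_den]
    · simp [Memory.setVar_var, v41, v42, v43, v44, v45, v5, a5, e, d0, d1, h1, h2]
      constructor <;> ring
    all_goals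
      simp [addSigned_var, Memory.setVar_var, v43, v44, v45, v5, a5, e, d0, d1]
      omega

/-- Reads the basis state of the gate `(43, 44)`, of arity `46`, from array `15`. -/
def gateIndex : Prog :=
  .assign 45 0 ;;
  .count 10 2 (.cond (.var 46 - .var 10)
    (.load 13 4 [.var 43, .var 44, .var 10] ;; .load 14 15 [.var 13] ;;
      .assign 45 (.var 45 + .var 45 + .var 14)) .skip)

/-- The number found agrees with the state of the gate on the bits below the arity; only these
matter for the entry that is read. -/
theorem gateIndex_spec {m : Memory} (h : Inputs C N ε L K J m) {l g : ℕ} {G : DiagGate n}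
    (hG : C.gateAt l g = some G) (hl : m.var 43 = l) (hg : m.var 44 = g)
    (ha : m.var 46 = G.arity) {x : Bits n} (hx : HoldsBits m 15 x) :
    ∃ X : ℕ, (gateIndex.den m).var 45 = X ∧
      (fun r : Fin G.arity => X.testBit r) = fun r => x (G.wires r) := by
  have hk := IQPCircuit.arity_le_of_gateAt hG
  have key := count_induction (x := 10) (p := 2) (c := .cond (.var 46 - .var 10)
    (.load 13 4 [.var 43, .var 44, .var 10] ;; .load 14 15 [.var 13] ;;
      .assign 45 (.var 45 + .var 45 + .var 14)) .skip) (N := k)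
    (m := m.setVar 45 0) (by simpa [Memory.setVar_var] using h.k_eq)
    (fun i m' => ∃ X : ℕ, m'.var 45 = X ∧
      ∀ s, ∀ hs : i + s < G.arity, X.testBit s = x (G.wires ⟨i + s, hs⟩)) ?_ ?_
  · obtain ⟨X, hX, hX'⟩ := key
    refine ⟨X, hX, ?_⟩
    ext r
    simpa using hX' r (by simp)
  · exact ⟨0, by simp [Memory.setVar_var], fun s hs => by omega⟩
  · rintro i hi m' hF ⟨X, hX, hX'⟩
    have v43 : m'.var 43 = l := (hF.1 43 (by decide)).trans hl
    have v44 : m'.var 44 = g := (hF.1 44 (by decide)).trans hg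
    have v46 : m'.var 46 = G.arity := (hF.1 46 (by decide)).trans ha
    have a4 : m'.arr 4 = inputArr C N ε 4 := (hF.2 4 (by decide)).trans (h.arr_eq 4 (by norm_num))
    have a15 : m'.arr 15 = m.arr 15 := hF.2 15 (by decide)
    by_cases hr : i < G.arity
    · have hr' : (0 : ℤ) < (G.arity : ℤ) - i := by omega
      have d4 : inputArr C N ε 4 [(l : ℤ), g, i] = ((G.wires ⟨i, hr⟩ : ℕ) : ℤ) := by
        simp [inputArr, hG, hr]
      refine ⟨2 * X + (x (G.wires ⟨i, hr⟩)).toNat, ?_, ?_⟩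
      · have := hx (G.wires ⟨i, hr⟩)
        simp [Prog.den, Memory.setVar_var, v43, v44, v46, a4, a15, hr, d4, this, hX, bitVal]
        cases x (G.wires ⟨i, hr⟩) <;> simp <;> ring
      · rintro (_ | s) hs
        · cases hb : x (G.wires ⟨i, hr⟩) <;> simp [Nat.testBit_zero]
        · have : (2 * X + (x (G.wires ⟨i, hr⟩)).toNat) / 2 = X := by
            cases x (G.wires ⟨i, hr⟩) <;> (simp; try omega)
          rw [Nat.testBit_succ, this, hX' s (by omega)]
          congr 3; omega
    · have hr' : ¬ (0 : ℤ) < (G.arity : ℤ) - i := by omega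
      refine ⟨X, ?_, fun s hs => by omega⟩
      simp [Prog.den, Memory.setVar_var, v46, hr, hX]

/-- The number of gates with the index `g` in layer `l`, which is `0` or `1`. -/
def IQPCircuit.gateCount (C : IQPCircuit n k d) (l g : ℕ) : ℕ :=
  if (C.gateAt l g).isSome then 1 else 0

/-- The number of gates in the first `t` layers. -/
def IQPCircuit.gatesUpTo (C : IQPCircuit n k d) (t : ℕ) : ℕ :=
  ∑ l ∈ range t, ∑ g ∈ range n, C.gateCount l g

/-- Multiplies the Gaussian integer in the variables `41` and `42` by the entries of the gates in
layer `43` at the basis state in array `15`. -/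
def mulLayer : Prog :=
  .count 44 0 (.load 46 3 [.var 43, .var 44] ;; .cond (.var 46) (gateIndex ;; mulEntry) .skip)

theorem inputArr_three (l g : ℕ) :
    inputArr C N ε 3 [(l : ℤ), g] = (C.gateAt l g).elim 0 fun G => (G.arity : ℤ) := by
  simp [inputArr]

theorem mulLayer_spec {m : Memory} (h : Inputs C N ε L K J m) {l : ℕ} (hl : m.var 43 = l)
    {x : Bits n} (hx : HoldsBits m 15 x) :
    (mulLayer.den m).gauss 41 42 = m.gauss 41 42 *
      (2 ^ (K * ∑ g ∈ range n, C.gateCount l g) * ∏ g ∈ range n, C.gateValue (trunc K) l g x) := by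
  have key := count_induction (x := 44) (p := 0)
    (c := .load 46 3 [.var 43, .var 44] ;; .cond (.var 46) (gateIndex ;; mulEntry) .skip) h.n_eq
    (fun i m' => m'.gauss 41 42 * (2 ^ (K * ∑ g ∈ range i, C.gateCount l g) *
        ∏ g ∈ range i, C.gateValue (trunc K) l g x)
      = m.gauss 41 42 * (2 ^ (K * ∑ g ∈ range n, C.gateCount l g) *
        ∏ g ∈ range n, C.gateValue (trunc K) l g x)) ?_ ?_
  · simpa [mulLayer] using key
  · simp [Memory.gauss, Memory.setVar_var]
  · intro i hi m' hF hP
    have hI := h.of_frame (by decide) hF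
    have v43 : m'.var 43 = l := (hF.1 43 (by decide)).trans hl
    have a15 : m'.arr 15 = m.arr 15 := hF.2 15 (by decide)
    rw [← hP]
    have hl3 : m'.arr 3 [(l : ℤ), (i : ℤ)] = (C.gateAt l i).elim 0 fun G => (G.arity : ℤ) := by
      rw [hI.arr_eq 3 (by norm_num), inputArr_three]
    rw [sum_range_succ, prod_range_succ]
    cases hG : C.gateAt l i with
    | none =>
        rw [hG] at hl3
        simp [Prog.den, Memory.setVar_var, v43, hl3, IQPCircuit.gateCount,
          IQPCircuit.gateValue, hG, Memory.gauss]
    | some G =>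
        rw [hG] at hl3
        set m₁ := (m'.setVar 44 i).setVar 46 G.arity with hm₁
        have h₁ : Inputs C N ε L K J m₁ := (hI.setVar (by norm_num) _).setVar (by norm_num) _
        have e : ((Prog.load 46 3 [.var 43, .var 44]) ;; .cond (.var 46) (gateIndex ;; mulEntry)
            .skip).den (m'.setVar 44 i) = mulEntry.den (gateIndex.den m₁) := by
          have := G.arity_pos
          simp [Prog.den, Memory.setVar_var, v43, hl3, hm₁]
          intro; omega
        have v43₁ : m₁.var 43 = l := by simp [hm₁, Memory.setVar_var, v43]
        have v44₁ : m₁.var 44 = i := by simp [hm₁, Memory.setVar_var]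
        obtain ⟨X, hX, hX'⟩ := gateIndex_spec h₁ hG v43₁ v44₁ (by simp [hm₁, Memory.setVar_var])
          (x := x) (fun j => by simp only [hm₁, Memory.setVar_arr, a15]; exact hx j)
        have hF₁ := Frame.den gateIndex m₁
        have hg : (gateIndex.den m₁).gauss 41 42 = m'.gauss 41 42 := by
          simp only [Memory.gauss, hF₁.1 41 (by decide), hF₁.1 42 (by decide)]
          simp [hm₁, Memory.setVar_var]
        rw [e, mulEntry_spec (h₁.of_frame (by decide) hF₁) hG
          ((hF₁.1 43 (by decide)).trans v43₁) ((hF₁.1 44 (by decide)).trans v44₁) hX, hX', hg]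
        simp only [IQPCircuit.gateCount, IQPCircuit.gateValue, hG, Option.isSome_some, if_true,
          Option.elim_some, mul_add, mul_one, pow_add]
        ring

/-- Multiplies the Gaussian integer in the variables `41` and `42` by the scaled phase that the
circuit gives to the basis state which ends up in array `15`. -/
def phaseProg : Prog := .count 43 1 (flipCur ;; mulLayer)

/-- The phase, scaled to be a Gaussian integer: each gate contributes a factor `2 ^ K`. -/
theorem phaseProg_spec {m : Memory} (h : Inputs C N ε L K J m) {x : Bits n}
    (hx : HoldsBits m 15 x) {f : ℕ → Bits n}
    (hf : ∀ l < d, ∀ i : Fin n, m.arr 8 [(l : ℤ), ((i : ℕ) : ℤ)] = bitVal (f l i)) :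
    (phaseProg.den m).gauss 41 42
      = m.gauss 41 42 * (2 ^ (K * C.gatesUpTo d) * C.phase (trunc K) f d x) := by
  have key := count_induction (x := 43) (p := 1) (c := flipCur ;; mulLayer) h.d_eq
    (fun l m' => ∃ y, HoldsBits m' 15 y ∧
      m'.gauss 41 42 * (2 ^ (K * C.gatesUpTo l) * C.phase (trunc K) f l y)
      = m.gauss 41 42 * (2 ^ (K * C.gatesUpTo d) * C.phase (trunc K) f d x)) ?_ ?_
  · obtain ⟨y, -, hy⟩ := key
    rw [← hy]
    simp [IQPCircuit.gatesUpTo, IQPCircuit.phase, phaseProg]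
  · exact ⟨x, hx, by simp [Memory.gauss, Memory.setVar_var]⟩
  · rintro l hl m' hF ⟨y, hy, hP⟩
    set m₁ := m'.setVar 43 l with hm₁
    have h₁ : Inputs C N ε L K J m₁ := (h.of_frame (by decide) hF).setVar (by norm_num) _
    have v43 : m₁.var 43 = l := by simp [hm₁, Memory.setVar_var]
    have a8 : m₁.arr 8 = m.arr 8 := hF.2 8 (by decide)
    have hflip := flipCur_spec h₁ v43 (x := y) (f := f l) hy (fun i => by rw [a8]; exact hf l hl i)
    have hF₁ := Frame.den flipCur m₁
    have hmul := mulLayer_spec (h₁.of_frame (by decide) hF₁) ((hF₁.1 43 (by decide)).trans v43)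
      hflip
    have hF₂ := Frame.den mulLayer (flipCur.den m₁)
    have a15 : (mulLayer.den (flipCur.den m₁)).arr 15 = (flipCur.den m₁).arr 15 :=
      hF₂.2 15 (by decide)
    refine ⟨fun i => y i ^^ f l i, fun i => ?_, ?_⟩
    · exact (congrFun a15 _).trans (hflip i)
    · rw [Prog.den, hmul, ← hP]
      have hg : (flipCur.den m₁).gauss 41 42 = m'.gauss 41 42 := by
        simp only [Memory.gauss, hF₁.1 41 (by decide), hF₁.1 42 (by decide)]
        simp [hm₁, Memory.setVar_var]
      rw [hg, IQPCircuit.gatesUpTo, IQPCircuit.gatesUpTo, sum_range_succ, IQPCircuit.phase,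
        mul_add, pow_add]
      ring

end Phase


/-! ### The density of the outcomes in one class -/

section Groups

variable {n k d : ℕ} {C : IQPCircuit n k d} {N : PauliNoise} {ε : ℝ} {L K J : ℕ}
  {A : Finset (Fin n)} {f : ℕ → Bits n} {z : Bits n}

/-- The memory describes a set `A` of qubits, the bit flips `f l` after the layers, and the state
`z` of the other qubits. -/
structure GroupData (d L : ℕ) (A : Finset (Fin n)) (f : ℕ → Bits n) (z : Bits n) (m : Memory) :
    Prop where
  members : HoldsBits m 13 fun i => decide (i ∈ A)
  flips : ∀ l < d, ∀ i : Fin n, m.arr 8 [(l : ℤ), ((i : ℕ) : ℤ)] = bitVal (f l i)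
  rest : HoldsBits m 16 z
  card_le : #A ≤ L
  scale : m.var 31 = (2 ^ (L - #A) : ℕ)
  patterns : m.var 32 = (2 ^ #A : ℕ)

/-- A program that does not change the data of a set of qubits. -/
def Prog.KeepsGroup (c : Prog) : Bool :=
  decide (31 ∉ c.modV) && decide (32 ∉ c.modV) && decide (8 ∉ c.modA) && decide (13 ∉ c.modA) &&
    decide (16 ∉ c.modA)

theorem GroupData.of_frame {m m' : Memory} (h : GroupData d L A f z m) {c : Prog}
    (hc : c.KeepsGroup) (hF : Frame c m m') : GroupData d L A f z m' := by
  simp only [Prog.KeepsGroup, Bool.and_eq_true, decide_eq_true_eq] at hc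
  obtain ⟨⟨⟨⟨h1, h2⟩, h3⟩, h4⟩, h5⟩ := hc
  constructor
  · intro i; rw [hF.2 _ h4, h.members i]
  · intro l hl i; rw [hF.2 _ h3, h.flips l hl i]
  · intro i; rw [hF.2 _ h5, h.rest i]
  · exact h.card_le
  · rw [hF.1 _ h1, h.scale]
  · rw [hF.1 _ h2, h.patterns]

theorem GroupData.setVar {m : Memory} (h : GroupData d L A f z m) {x : ℕ} (hx : x ≠ 31)
    (hx' : x ≠ 32) (v : ℤ) : GroupData d L A f z (m.setVar x v) :=
  h.of_frame (c := .assign x (.const v))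
    (by simp [Prog.KeepsGroup, Prog.modV, Prog.modA, hx.symm, hx'.symm])
    (Frame.den (.assign x (.const v)) m)

/-- The elements of `A` with index at least `i`. -/
def above (A : Finset (Fin n)) (i : ℕ) : Finset (Fin n) := A.filter fun j => i ≤ (j : ℕ)

theorem above_eq_empty (A : Finset (Fin n)) : above A n = ∅ := by ext j; simp [above]

theorem above_zero (A : Finset (Fin n)) : above A 0 = A := by simp [above]

theorem above_of_mem {i : ℕ} {hi : i < n} (h : (⟨i, hi⟩ : Fin n) ∈ A) :
    above A i = insert ⟨i, hi⟩ (above A (i + 1)) := by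
  ext j
  simp only [above, mem_filter, mem_insert, Fin.ext_iff]
  constructor
  · rintro ⟨ha, hb⟩
    rcases Nat.lt_or_ge i j with hlt | hge
    · exact .inr ⟨ha, hlt⟩
    · exact .inl (by omega)
  · rintro (hb | ⟨ha, hb⟩)
    · exact ⟨by rwa [show j = ⟨i, hi⟩ from Fin.ext hb], hb.ge⟩
    · exact ⟨ha, by omega⟩

theorem notMem_above {i : ℕ} {hi : i < n} : (⟨i, hi⟩ : Fin n) ∉ above A (i + 1) := by
  simp [above]

theorem above_of_notMem {i : ℕ} {hi : i < n} (h : (⟨i, hi⟩ : Fin n) ∉ A) :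
    above A i = above A (i + 1) := by
  ext j
  simp only [above, mem_filter]
  refine and_congr_right fun ha => ?_
  have : (j : ℕ) ≠ i := fun e => h (by rwa [← show j = ⟨i, hi⟩ from Fin.ext e])
  omega

/-- One step of `decode`. -/
def decodeStep (dst : ℕ) : Prog :=
  .load 50 13 [.var 10] ;; .cond (.var 50)
    (.assign 37 (.half (.var 36)) ;;
      .store dst [.var 10] (.var 36 - .var 37 - .var 37) ;; .assign 36 (.var 37))
    (.store dst [.var 10] 0)

/-- Writes the bits of the number in the variable `src` into the cells of the array `dst` that
belong to the current class, and `0` into the other cells. -/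
def decode (src dst : ℕ) : Prog :=
  .assign 36 (.var src) ;;
  .count 10 0 (decodeStep dst)

/-- The digits are taken from `t` while the array is traversed downwards, in accordance with
`decodeBits`. -/
theorem decode_spec {m : Memory} (h : Inputs C N ε L K J m) (hA : GroupData d L A f z m)
    {src dst t : ℕ} (hdst : dst ≠ 13) (ht : m.var src = t) :
    HoldsBits ((decode src dst).den m) dst (decodeBits A t) := by
  have key := count_induction (x := 10) (p := 0) (c := decodeStep dst) (N := n) (m := m.setVar 36 t)
    (by simpa [Memory.setVar_var] using h.n_eq)
    (fun i m' => m'.var 36 = ((t / 2 ^ #(above A i) : ℕ) : ℤ) ∧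
      ∀ j : Fin n, i ≤ j → m'.arr dst [((j : ℕ) : ℤ)] = bitVal (decodeBits A t j)) ?_ ?_
  · intro j
    have e : (decode src dst).den m = (Prog.count 10 0 (decodeStep dst)).den (m.setVar 36 t) := by
      rw [← ht]; rfl
    rw [e]
    exact key.2 j (Nat.zero_le _)
  · refine ⟨?_, fun j hj => by omega⟩
    simp [above_eq_empty, Memory.setVar_var]
  · rintro i hi m' hF ⟨h1, h2⟩
    have a13 : m'.arr 13 = m.arr 13 := hF.2 13 (by simp [decodeStep, Prog.modA, hdst.symm])
    have hm := hA.members ⟨i, hi⟩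
    simp only at hm
    have hlt : #{j ∈ A | (⟨i, hi⟩ : Fin n) < j} = #(above A (i + 1)) := rfl
    by_cases hiA : (⟨i, hi⟩ : Fin n) ∈ A
    · have hc : #(above A i) = #(above A (i + 1)) + 1 := by
        rw [above_of_mem hiA, card_insert_of_notMem notMem_above]
      have hm' : m.arr 13 [(i : ℤ)] = 1 := by simpa [hiA, bitVal] using hm
      have hdiv : t / 2 ^ #(above A i) = t / 2 ^ #(above A (i + 1)) / 2 := by
        rw [hc, pow_succ, Nat.div_div_eq_div_mul]
      rw [hdiv]
      constructor
      · simp [decodeStep, Prog.den, Memory.setVar_var, a13, hm', h1]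
      · intro j hj
        by_cases hij : (j : ℕ) = i
        · obtain rfl : j = ⟨i, hi⟩ := Fin.ext hij
          have hb : bitVal (decodeBits A t ⟨i, hi⟩)
              = ((t / 2 ^ #(above A (i + 1)) % 2 : ℕ) : ℤ) := by
            rw [decodeBits, hlt, Nat.testBit_eq_decide_div_mod_eq]
            simp only [hiA, decide_true, Bool.true_and, bitVal]
            generalize t / 2 ^ #(above A (i + 1)) = q
            rcases Nat.mod_two_eq_zero_or_one q with hq | hq <;> simp [hq]
          rw [hb]
          simp [decodeStep, Prog.den, Memory.setVar_var, a13, hm', h1, Memory.setArr_arr]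
          omega
        · have := h2 j (by omega)
          simp [decodeStep, Prog.den, Memory.setVar_var, a13, hm', Memory.setArr_arr, hij, this]
    · have hm' : m.arr 13 [(i : ℤ)] = 0 := by simpa [hiA, bitVal] using hm
      rw [above_of_notMem hiA]
      constructor
      · simp [decodeStep, Prog.den, Memory.setVar_var, a13, hm', h1]
      · intro j hj
        by_cases hij : (j : ℕ) = i
        · obtain rfl : j = ⟨i, hi⟩ := Fin.ext hij
          simp [decodeStep, Prog.den, Memory.setVar_var, a13, hm', Memory.setArr_arr,
            decodeBits, hiA, bitVal]
        · have := h2 j (by omega)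
          simp [decodeStep, Prog.den, Memory.setVar_var, a13, hm', Memory.setArr_arr, hij, this]

/-- One step of `prepare`. -/
def prepareStep : Prog :=
  .load 50 13 [.var 10] ;;
  .cond (.var 50) (.load 51 14 [.var 10]) (.load 51 16 [.var 10]) ;;
  .store 15 [.var 10] (.var 51) ;;
  .load 52 12 [.var 10] ;;
  .cond (.var 50 + .var 51 + .var 52 - 2) (.assign 41 (0 - .var 41)) .skip

/-- Writes the state that consists of the bits in array `14` for the qubits of the current class
and the bits in array `16` for the other qubits into array `15`, and sets the Gaussian integer in
the variables `41` and `42` to the signed scale factor. -/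
def prepare : Prog :=
  .assign 41 (.var 31) ;; .assign 42 0 ;;
  .count 10 0 prepareStep

/-- The factor `2 ^ (L - #A)` makes the scale of the amplitudes independent of the class, so that
all probabilities have the same denominator. -/
theorem prepare_spec {m : Memory} (h : Inputs C N ε L K J m) (hA : GroupData d L A f z m)
    {y s : Bits n} (hy : HoldsBits m 12 y) (hs : HoldsBits m 14 s) :
    HoldsBits (prepare.den m) 15 (A.piecewise s z) ∧
      (prepare.den m).gauss 41 42 = chi A y s * 2 ^ (L - #A) := by
  have key := count_induction (x := 10) (p := 0) (c := prepareStep)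
    (N := n) (m := (m.setVar 41 (m.var 31)).setVar 42 0)
    (by simpa [Memory.setVar_var] using h.n_eq)
    (fun i m' => m'.var 42 = 0 ∧
      (m'.var 41 : ℂ) = (∏ j ∈ above A i, if y j && s j then -1 else 1) * 2 ^ (L - #A) ∧
      ∀ j : Fin n, i ≤ j → m'.arr 15 [((j : ℕ) : ℤ)] = bitVal (A.piecewise s z j)) ?_ ?_
  · obtain ⟨h1, h2, h3⟩ := key
    refine ⟨fun j => h3 j (Nat.zero_le _), ?_⟩
    have e : prepare.den m = (Prog.count 10 0 prepareStep).den
      ((m.setVar 41 (m.var 31)).setVar 42 0) := rfl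
    rw [above_zero] at h2
    rw [e, Memory.gauss, h1, h2, chi]
    simp
  · refine ⟨by simp [Memory.setVar_var], ?_, fun j hj => by omega⟩
    simp [above_eq_empty, Memory.setVar_var, hA.scale]
  · rintro i hi m' hF ⟨h1, h2, h3⟩
    have a13 : m'.arr 13 = m.arr 13 := hF.2 13 (by decide)
    have a14 : m'.arr 14 = m.arr 14 := hF.2 14 (by decide)
    have a12 : m'.arr 12 = m.arr 12 := hF.2 12 (by decide)
    have a16 : m'.arr 16 = m.arr 16 := hF.2 16 (by decide)
    have hm := hA.members ⟨i, hi⟩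
    have h14 := hs ⟨i, hi⟩
    have h12 := hy ⟨i, hi⟩
    have h16 := hA.rest ⟨i, hi⟩
    simp only at hm h12 h14 h16
    by_cases hiA : (⟨i, hi⟩ : Fin n) ∈ A
    · have hm' : m.arr 13 [(i : ℤ)] = 1 := by simpa [hiA, bitVal] using hm
      rw [above_of_mem hiA, prod_insert notMem_above]
      refine ⟨?_, ?_, ?_⟩
      · cases hb : y ⟨i, hi⟩ <;> cases hb' : s ⟨i, hi⟩ <;>
          simp [prepareStep, Prog.den, Memory.setVar_var, a13, a12, a14, hm', h12, h14, hb, hb',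
            bitVal, h1,
            Memory.setArr_arr]
      · cases hb : y ⟨i, hi⟩ <;> cases hb' : s ⟨i, hi⟩ <;>
          simp [prepareStep, Prog.den, Memory.setVar_var, a13, a12, a14, hm', h12, h14, hb, hb',
            bitVal, h2,
            Memory.setArr_arr]
      · intro j hj
        have e : ∀ (m : Memory) (e c), ((Prog.cond e (.assign 41 c) .skip).den m).arr 15
            = m.arr 15 := fun m e c => Prog.den_arr (by simp [Prog.modA]) m
        by_cases hij : (j : ℕ) = i
        · obtain rfl : j = ⟨i, hi⟩ := Fin.ext hij
          simp only [prepareStep, Prog.den_seq, e]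
          simp [Prog.den, Memory.setVar_var, a13, a14, hm', h14, Memory.setArr_arr, hiA]
        · have := h3 j (by omega)
          simp only [prepareStep, Prog.den_seq, e]
          simp [Prog.den, Memory.setVar_var, a13, a14, hm', h14, Memory.setArr_arr, hij, this]
    · have hm' : m.arr 13 [(i : ℤ)] = 0 := by simpa [hiA, bitVal] using hm
      rw [above_of_notMem hiA]
      refine ⟨?_, ?_, ?_⟩
      · cases hb : y ⟨i, hi⟩ <;> cases hb' : z ⟨i, hi⟩ <;>
          simp [prepareStep, Prog.den, Memory.setVar_var, a13, a12, a16, hm', h12, h16, hb, hb',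
            bitVal, h1,
            Memory.setArr_arr]
      · cases hb : y ⟨i, hi⟩ <;> cases hb' : z ⟨i, hi⟩ <;>
          simp [prepareStep, Prog.den, Memory.setVar_var, a13, a12, a16, hm', h12, h16, hb, hb',
            bitVal, h2,
            Memory.setArr_arr]
      · intro j hj
        have e : ∀ (m : Memory) (e c), ((Prog.cond e (.assign 41 c) .skip).den m).arr 15
            = m.arr 15 := fun m e c => Prog.den_arr (by simp [Prog.modA]) m
        by_cases hij : (j : ℕ) = i
        · obtain rfl : j = ⟨i, hi⟩ := Fin.ext hij
          simp only [prepareStep, Prog.den_seq, e]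
          simp [Prog.den, Memory.setVar_var, a13, a16, hm', h16, Memory.setArr_arr, hiA]
        · have := h3 j (by omega)
          simp only [prepareStep, Prog.den_seq, e]
          simp [Prog.den, Memory.setVar_var, a13, a16, hm', h16, Memory.setArr_arr, hij, this]

/-- One step of `amplitude`. -/
def amplitudeStep : Prog :=
  .cond (.var 32 - .var 40)
    (decode 40 14 ;; prepare ;; phaseProg ;;
      .assign 38 (.var 38 + .var 41) ;; .assign 39 (.var 39 + .var 42)) .skip

/-- Computes the scaled amplitude of the outcome in array `12` for the current class. -/
def amplitude : Prog :=
  .assign 38 0 ;; .assign 39 0 ;;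
  .count 40 4 amplitudeStep

/-- The phase as a function of the bits in the class `A`. -/
noncomputable def IQPCircuit.classPhase (C : IQPCircuit n k d) (K : ℕ) (A : Finset (Fin n))
    (f : ℕ → Bits n) (z s : Bits n) : ℂ :=
  C.phase (trunc K) f d (A.piecewise s z)

/-- The Fourier coefficient, by summation over all assignments of the class. -/
theorem amplitude_spec {m : Memory} (h : Inputs C N ε L K J m) (hA : GroupData d L A f z m)
    {y : Bits n} (hy : HoldsBits m 12 y) :
    (amplitude.den m).gauss 38 39
      = 2 ^ (L + K * C.gatesUpTo d) * fourier A (C.classPhase K A f z) y := by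
  set F : ℕ → ℂ := fun t => chi A y (decodeBits A t) * 2 ^ (L - #A) *
    (2 ^ (K * C.gatesUpTo d) * C.classPhase K A f z (decodeBits A t)) with hFdef
  have key := count_induction (x := 40) (p := 4) (c := amplitudeStep)
    (N := 2 ^ L) (m := (m.setVar 38 0).setVar 39 0)
    (by simpa [Memory.setVar_var] using h.M_eq)
    (fun i m' => m'.gauss 38 39 = ∑ t ∈ Ico i (2 ^ #A), F t) ?_ ?_
  · have e : amplitude.den m = (Prog.count 40 4 amplitudeStep).den
      ((m.setVar 38 0).setVar 39 0) := rfl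
    rw [e, key, ← range_eq_Ico]
    have hsum := sum_range_decodeBits A (F := fun s => chi A y s * C.classPhase K A f z s)
      (fun x x' hxx => by
        simp only
        rw [chi_congr (fun _ _ => rfl) hxx]
        exact congrArg _ (dependsOn_piecewise A (C.phase (trunc K) f d) z hxx))
    have hF : ∀ t, F t = 2 ^ (L - #A) * 2 ^ (K * C.gatesUpTo d) *
        (chi A y (decodeBits A t) * C.classPhase K A f z (decodeBits A t)) := by
      intro t; rw [hFdef]; ring
    simp only [hF, ← mul_sum, hsum]
    rw [fourier, pow_add]
    have : (2 : ℂ) ^ L = 2 ^ (L - #A) * 2 ^ #A := by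
      rw [← pow_add, Nat.sub_add_cancel hA.card_le]
    rw [this]; ring
  · have : 2 ^ #A ≤ 2 ^ L := Nat.pow_le_pow_right (by norm_num) hA.card_le
    simp [Memory.gauss, Memory.setVar_var, Ico_eq_empty_of_le this]
  · rintro i hi m' hF hP
    have hI : Inputs C N ε L K J (m'.setVar 40 i) :=
      (((h.setVar (x := 38) (by norm_num) 0).setVar (x := 39) (by norm_num) 0).of_frame
        (by decide) hF).setVar (by norm_num) _
    have hG : GroupData d L A f z (m'.setVar 40 i) :=
      (((hA.setVar (x := 38) (by norm_num) (by norm_num) 0).setVar (x := 39) (by norm_num)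
        (by norm_num) 0).of_frame (by decide) hF).setVar (by norm_num) (by norm_num) _
    have a12 : m'.arr 12 = m.arr 12 := hF.2 12 (by decide)
    have hy' : HoldsBits (m'.setVar 40 i) 12 y := fun j => by
      rw [Memory.setVar_arr, a12]; exact hy j
    by_cases hiA : i < 2 ^ #A
    · have hcond : 0 < (Expr.var 32 - Expr.var 40).eval (m'.setVar 40 i) := by
        simp only [Expr.eval_sub, Expr.eval_var, hG.patterns]
        simp [Memory.setVar_var]; exact_mod_cast hiA
      rw [amplitudeStep, Prog.den, if_pos hcond]
      simp only [Prog.den]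
      set m₀ := m'.setVar 40 i with hm₀
      have g0 : m₀.gauss 38 39 = m'.gauss 38 39 := by simp [hm₀, Memory.gauss, Memory.setVar_var]
      set m₁ := (decode 40 14).den m₀ with hm₁
      have F₁ : Frame (decode 40 14) m₀ m₁ := Frame.den _ _
      have hs : HoldsBits m₁ 14 (decodeBits A i) :=
        decode_spec hI hG (by norm_num) (by simp [hm₀, Memory.setVar_var])
      have hI₁ := hI.of_frame (by decide) F₁
      have hG₁ := hG.of_frame (by decide) F₁
      have hy₁ : HoldsBits m₁ 12 y := fun j => by rw [F₁.2 12 (by decide)]; exact hy' j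
      set m₂ := prepare.den m₁ with hm₂
      have F₂ : Frame prepare m₁ m₂ := Frame.den _ _
      obtain ⟨p1, p2⟩ := prepare_spec hI₁ hG₁ hy₁ hs
      have hI₂ := hI₁.of_frame (by decide) F₂
      have hG₂ := hG₁.of_frame (by decide) F₂
      have hph := phaseProg_spec hI₂ p1 hG₂.flips
      set m₃ := phaseProg.den m₂ with hm₃
      have F₃ : Frame phaseProg m₂ m₃ := Frame.den _ _
      have g3 : m₃.gauss 38 39 = m'.gauss 38 39 := by
        rw [← g0]
        simp only [Memory.gauss, F₃.1 38 (by decide), F₃.1 39 (by decide), F₂.1 38 (by decide),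
          F₂.1 39 (by decide), F₁.1 38 (by decide), F₁.1 39 (by decide)]
      have gfin : ((m₃.setVar 38 ((Expr.var 38 + Expr.var 41).eval m₃)).setVar 39
          ((Expr.var 39 + Expr.var 42).eval
            (m₃.setVar 38 ((Expr.var 38 + Expr.var 41).eval m₃)))).gauss
            38 39 = m₃.gauss 38 39 + m₃.gauss 41 42 := by
        simp [Memory.gauss, Memory.setVar_var]; ring
      rw [gfin, g3, hP, hph, p2, sum_eq_sum_Ico_succ_bot hiA]
      simp only [hFdef, IQPCircuit.classPhase]
      ring
    · have hcond : ¬ 0 < (Expr.var 32 - Expr.var 40).eval (m'.setVar 40 i) := by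
        simp only [Expr.eval_sub, Expr.eval_var, hG.patterns]
        simp [Memory.setVar_var]; exact_mod_cast not_lt.1 hiA
      rw [amplitudeStep, Prog.den, if_neg hcond, Ico_eq_empty_of_le (not_lt.1 hiA)]
      rw [Ico_eq_empty_of_le (by omega)] at hP
      rw [← hP]
      simp [Prog.den, Memory.gauss, Memory.setVar_var]

end Groups


/-! ### Sampling in one class after the other -/

section Choice

variable {n k d : ℕ} {C : IQPCircuit n k d} {N : PauliNoise} {ε : ℝ} {L K J : ℕ}
  {A : Finset (Fin n)} {f : ℕ → Bits n} {z : Bits n}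

/-- One step of `addSquare`. -/
def squareStep : Prog :=
  .assign 56 (.half (.var 54)) ;;
  .cond (.var 54 - .var 56 - .var 56) (.assign 49 (.var 49 + .var 55)) .skip ;;
  .assign 55 (.var 55 + .var 55) ;; .assign 54 (.var 56)

/-- Adds the square of the variable `x` to the variable `49`. -/
def addSquare (x : ℕ) : Prog :=
  .cond (.var x) (.assign 54 (.var x)) (.assign 54 (0 - .var x)) ;;
  .assign 55 (.var 54) ;; .count 53 7 squareStep

/-- Squaring by binary multiplication; `J` rounds suffice for a number with at most `J` digits. -/
theorem addSquare_spec {m : Memory} (h : Inputs C N ε L K J m) {x : ℕ}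
    (hx : |m.var x| < 2 ^ J) :
    ((addSquare x).den m).var 49 = m.var 49 + m.var x ^ 2 := by
  set a := |m.var x| with ha
  have e : (addSquare x).den m
      = (Prog.count 53 7 squareStep).den ((m.setVar 54 a).setVar 55 a) := by
    simp only [addSquare, Prog.den_seq]
    congr 1
    by_cases hp : 0 < m.var x
    · simp [Prog.den, hp, ha, abs_of_pos hp, Memory.setVar_var]
    · simp [Prog.den, hp, ha, abs_of_nonpos (not_lt.1 hp), Memory.setVar_var]
  have key := count_induction (x := 53) (p := 7) (c := squareStep) (N := J)
    (m := (m.setVar 54 a).setVar 55 a) (by simpa [Memory.setVar_var] using h.J_eq)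
    (fun i m' => 0 ≤ m'.var 54 ∧ m'.var 54 < 2 ^ i ∧
      m'.var 49 + m'.var 54 * m'.var 55 = m.var 49 + a * a) ?_ ?_
  · obtain ⟨h1, h2, h3⟩ := key
    rw [e]
    have h0 : ((Prog.count 53 7 squareStep).den ((m.setVar 54 a).setVar 55 a)).var 54 = 0 := by
      simp only [pow_zero] at h2; omega
    rw [h0, zero_mul, add_zero, ha, abs_mul_abs_self] at h3
    rw [h3]; ring
  · have h0 : 0 ≤ a := abs_nonneg _
    simp [Memory.setVar_var, hx, h0]
  · rintro i hi m' hF ⟨h1, h2, h3⟩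
    have hq : m'.var 54 = 2 * (m'.var 54 / 2) ∨ m'.var 54 = 2 * (m'.var 54 / 2) + 1 := by omega
    rw [pow_succ] at h2
    rw [← h3]
    rcases hq with hq | hq
    · have hc : ¬ m'.var 54 / 2 < m'.var 54 - m'.var 54 / 2 := by omega
      have hv : (squareStep.den (m'.setVar 53 i)).var 54 = m'.var 54 / 2 ∧
          (squareStep.den (m'.setVar 53 i)).var 55 = m'.var 55 + m'.var 55 ∧
          (squareStep.den (m'.setVar 53 i)).var 49 = m'.var 49 := by
        simp only [squareStep, Prog.den_seq]
        simp [Prog.den, Memory.setVar_var, hc]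
      rw [hv.1, hv.2.1, hv.2.2]
      refine ⟨by omega, by omega, ?_⟩
      linear_combination (-m'.var 55) * hq
    · have hc : m'.var 54 / 2 < m'.var 54 - m'.var 54 / 2 := by omega
      have hv : (squareStep.den (m'.setVar 53 i)).var 54 = m'.var 54 / 2 ∧
          (squareStep.den (m'.setVar 53 i)).var 55 = m'.var 55 + m'.var 55 ∧
          (squareStep.den (m'.setVar 53 i)).var 49 = m'.var 49 + m'.var 55 := by
        simp only [squareStep, Prog.den_seq]
        simp [Prog.den, Memory.setVar_var, hc]
      rw [hv.1, hv.2.1, hv.2.2]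
      refine ⟨by omega, by omega, ?_⟩
      linear_combination (-m'.var 55) * hq

/-- The binary logarithm of the denominator of the probabilities of the outcomes in one class. -/
def IQPCircuit.precision (C : IQPCircuit n k d) (L K : ℕ) : ℕ := 2 * (L + K * C.gatesUpTo d)

/-- The scaled probability of the outcome number `t` in the class `A`. -/
noncomputable def IQPCircuit.classWeight (C : IQPCircuit n k d) (L K : ℕ) (A : Finset (Fin n))
    (f : ℕ → Bits n) (z : Bits n) (t : ℕ) : ℝ :=
  2 ^ C.precision L K * ‖fourier A (C.classPhase K A f z) (decodeBits A t)‖ ^ 2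

/-- Computes the scaled probability of the outcome in array `12`. -/
def weight : Prog := amplitude ;; .assign 49 0 ;; addSquare 38 ;; addSquare 39

/-- The parts of the scaled amplitude are at most `2 ^ (J / 2)` in absolute value, so `J` rounds of
`addSquare` suffice. -/
theorem weight_spec {m : Memory} (h : Inputs C N ε L K (C.precision L K) m) (hL : 1 ≤ L)
    (hA : GroupData d L A f z m) {t : ℕ} (hy : HoldsBits m 12 (decodeBits A t)) :
    ((weight.den m).var 49 : ℝ) = C.classWeight L K A f z t := by
  have hamp := amplitude_spec h hA hy
  set m₁ := amplitude.den m with hm₁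
  have F₁ : Frame amplitude m m₁ := Frame.den _ _
  have h₁ := h.of_frame (by decide) F₁
  set w := fourier A (C.classPhase K A f z) (decodeBits A t)
  set a := m₁.var 38 with ha
  set b := m₁.var 39 with hb
  have hnorm : (a : ℝ) ^ 2 + (b : ℝ) ^ 2 = 2 ^ C.precision L K * ‖w‖ ^ 2 := by
    have h1 : ‖m₁.gauss 38 39‖ ^ 2 = (a : ℝ) ^ 2 + (b : ℝ) ^ 2 := by
      rw [← Complex.normSq_eq_norm_sq, Complex.normSq_apply]
      simp [Memory.gauss, ← ha, ← hb]; ring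
    rw [← h1, hamp, norm_mul, norm_pow, Complex.norm_ofNat, mul_pow, ← pow_mul,
      IQPCircuit.precision, mul_comm 2]
  have hw : ‖w‖ ≤ 1 := norm_fourier_le fun s => C.norm_phase_trunc_le K f d _
  have hle : (a : ℝ) ^ 2 + (b : ℝ) ^ 2 ≤ (2 ^ (L + K * C.gatesUpTo d)) ^ 2 := by
    rw [hnorm, ← pow_mul, IQPCircuit.precision, mul_comm 2]
    have : ‖w‖ ^ 2 ≤ 1 := pow_le_one₀ (norm_nonneg _) hw
    exact mul_le_of_le_one_right (by positivity) this
  have hlt : (2 : ℝ) ^ (L + K * C.gatesUpTo d) < 2 ^ C.precision L K := by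
    apply pow_lt_pow_right₀ one_lt_two
    rw [IQPCircuit.precision]; omega
  have hlta : |a| < 2 ^ C.precision L K := by
    have : |(a : ℝ)| ≤ 2 ^ (L + K * C.gatesUpTo d) :=
      abs_le_of_sq_le_sq (by nlinarith [sq_nonneg (b : ℝ)]) (by positivity)
    exact_mod_cast this.trans_lt hlt
  have hltb : |b| < 2 ^ C.precision L K := by
    have : |(b : ℝ)| ≤ 2 ^ (L + K * C.gatesUpTo d) :=
      abs_le_of_sq_le_sq (by nlinarith [sq_nonneg (a : ℝ)]) (by positivity)
    exact_mod_cast this.trans_lt hlt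
  set m₂ := m₁.setVar 49 0 with hm₂
  have h₂ : Inputs C N ε L K (C.precision L K) m₂ := h₁.setVar (by norm_num) _
  have a₂ : m₂.var 38 = a := by simp [hm₂, Memory.setVar_var, ha]
  have s1 := addSquare_spec h₂ (x := 38) (by rw [a₂]; exact hlta)
  set m₃ := (addSquare 38).den m₂ with hm₃
  have F₃ : Frame (addSquare 38) m₂ m₃ := Frame.den _ _
  have b₃ : m₃.var 39 = b := by
    rw [F₃.1 39 (by decide)]; simp [hm₂, Memory.setVar_var, hb]
  have s2 := addSquare_spec (h₂.of_frame (by decide) F₃) (x := 39) (by rw [b₃]; exact hltb)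
  have e : weight.den m = (addSquare 39).den m₃ := rfl
  rw [e, s2, s1, b₃, a₂, IQPCircuit.classWeight, ← hnorm]
  simp [hm₂, Memory.setVar_var]

/-- One step of `writeOut`. -/
def writeStep : Prog :=
  .load 50 13 [.var 10] ;; .cond (.var 50)
    (.load 51 12 [.var 10] ;; .load 52 10 [.var 10] ;;
      .cond (.var 51 - .var 52) (.store 6 [.var 10] 1) (.store 6 [.var 10] (.var 52 - .var 51)))
    .skip

/-- Writes the sum modulo `2` of the bits in the arrays `12` and `10` into the output array, for
the qubits of the current class. -/
def writeOut : Prog := .count 10 0 writeStep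

theorem writeOut_spec {m : Memory} (h : Inputs C N ε L K J m) (hA : GroupData d L A f z m)
    {y c : Bits n} (hy : HoldsBits m 12 y) (hc : HoldsBits m 10 c) (i : Fin n) :
    (writeOut.den m).arr 6 [((i : ℕ) : ℤ)]
      = if i ∈ A then bitVal (y i ^^ c i) else m.arr 6 [((i : ℕ) : ℤ)] := by
  have key := count_induction (x := 10) (p := 0) (c := writeStep) h.n_eq
    (fun i m' => ∀ j : Fin n, m'.arr 6 [((j : ℕ) : ℤ)]
      = if j ∈ above A i then bitVal (y j ^^ c j) else m.arr 6 [((j : ℕ) : ℤ)]) ?_ ?_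
  · rw [above_zero] at key; exact key i
  · intro j; simp [above_eq_empty]
  · intro i hi m' hF hP j
    have a13 : m'.arr 13 = m.arr 13 := hF.2 13 (by decide)
    have a12 : m'.arr 12 = m.arr 12 := hF.2 12 (by decide)
    have a10 : m'.arr 10 = m.arr 10 := hF.2 10 (by decide)
    have hm := hA.members ⟨i, hi⟩
    have h12 := hy ⟨i, hi⟩
    have h10 := hc ⟨i, hi⟩
    have hPj := hP j
    simp only at hm h12 h10
    simp only [writeStep, Prog.den_seq]
    by_cases hiA : (⟨i, hi⟩ : Fin n) ∈ A
    · have hm' : m.arr 13 [(i : ℤ)] = 1 := by simpa [hiA, bitVal] using hm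
      rw [above_of_mem hiA]
      by_cases hij : (j : ℕ) = i
      · obtain rfl : j = ⟨i, hi⟩ := Fin.ext hij
        cases hb : y ⟨i, hi⟩ <;> cases hb' : c ⟨i, hi⟩ <;>
          simp [Prog.den, Memory.setVar_var, a13, a12, a10, hm', h12, h10, hb, hb', bitVal,
            Memory.setArr_arr]
      · have hne : j ≠ ⟨i, hi⟩ := fun e => hij (by rw [e])
        simp only [mem_insert, or_iff_right hne, ← hPj]
        cases hb : y ⟨i, hi⟩ <;> cases hb' : c ⟨i, hi⟩ <;>
          simp [Prog.den, Memory.setVar_var, a13, a12, a10, hm', h12, h10, hb, hb', bitVal,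
            Memory.setArr_arr, hij]
    · have hm' : m.arr 13 [(i : ℤ)] = 0 := by simpa [hiA, bitVal] using hm
      rw [above_of_notMem hiA, ← hPj]
      simp [Prog.den, Memory.setVar_var, a13, hm']

/-- One step of `choose`. -/
def chooseStep : Prog :=
  .cond (.var 32 - .var 35)
    (.cond (.var 34 + 1)
      (decode 35 12 ;; weight ;; .assign 34 (.var 34 - .var 49) ;;
        .cond (0 - .var 34) writeOut .skip) .skip) .skip

/-- Chooses an outcome for the current class with the help of the random number in array `17`. -/
def choose : Prog := .load 34 17 [.var 30] ;; .count 35 4 chooseStep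

/-- The weights are subtracted from `U` in the order of decreasing outcome numbers, until `U`
becomes negative. Hence the chosen outcome `t₀` is determined by the sums of the weights from the
top. -/
theorem choose_spec {m : Memory} (h : Inputs C N ε L K (C.precision L K) m) (hL : 1 ≤ L)
    (hA : GroupData d L A f z m) {c : Bits n} (hc : HoldsBits m 10 c) {v : ℤ} (hv : m.var 30 = v)
    {U : ℕ} (hU : m.arr 17 [v] = U) {t₀ : ℕ} (ht : t₀ < 2 ^ #A)
    (h1 : ∑ t ∈ Ico (t₀ + 1) (2 ^ #A), C.classWeight L K A f z t ≤ U)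
    (h2 : (U : ℝ) < ∑ t ∈ Ico t₀ (2 ^ #A), C.classWeight L K A f z t) (i : Fin n) :
    (choose.den m).arr 6 [((i : ℕ) : ℤ)]
      = if i ∈ A then bitVal (decodeBits A t₀ i ^^ c i) else m.arr 6 [((i : ℕ) : ℤ)] := by
  set W := C.classWeight L K A f z with hW
  have hW0 : ∀ t, 0 ≤ W t := fun t => by rw [hW, IQPCircuit.classWeight]; positivity
  have hmono : ∀ i j, i ≤ j → ∑ t ∈ Ico j (2 ^ #A), W t ≤ ∑ t ∈ Ico i (2 ^ #A), W t :=
    fun i j hij => sum_le_sum_of_subset_of_nonneg (Ico_subset_Ico hij le_rfl) fun t _ _ => hW0 t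
  have hM : 2 ^ #A ≤ 2 ^ L := Nat.pow_le_pow_right (by norm_num) hA.card_le
  have e : choose.den m = (Prog.count 35 4 chooseStep).den (m.setVar 34 U) := by
    rw [choose, Prog.den_seq]
    congr 1
    simp [Prog.den, hv, hU]
  rw [e]
  have key := count_induction (x := 35) (p := 4) (c := chooseStep) (N := 2 ^ L)
    (m := m.setVar 34 U) (by simpa [Memory.setVar_var] using h.M_eq)
    -- The numbers from `2 ^ #A` on are skipped, and so are all numbers below `t₀`.
    (fun i m' => (t₀ < i → (m'.var 34 : ℝ) = U - ∑ t ∈ Ico i (2 ^ #A), W t ∧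
        m'.arr 6 = m.arr 6) ∧
      (i ≤ t₀ → m'.var 34 < 0 ∧ ∀ j : Fin n, m'.arr 6 [((j : ℕ) : ℤ)]
        = if j ∈ A then bitVal (decodeBits A t₀ j ^^ c j) else m.arr 6 [((j : ℕ) : ℤ)])) ?_ ?_
  · exact (key.2 (Nat.zero_le _)).2 i
  · refine ⟨fun _ => ?_, fun h' => by omega⟩
    simp [Memory.setVar_var, Ico_eq_empty_of_le hM]
  · rintro i hi m' hF ⟨ha, hb⟩
    set m₀ := m'.setVar 35 i with hm₀
    have hI : Inputs C N ε L K (C.precision L K) m₀ :=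
      ((h.setVar (x := 34) (by norm_num) _).of_frame (by decide) hF).setVar (by norm_num) _
    have hG : GroupData d L A f z m₀ :=
      ((hA.setVar (x := 34) (by norm_num) (by norm_num) _).of_frame (by decide) hF).setVar
        (by norm_num) (by norm_num) _
    have hc₀ : HoldsBits m₀ 10 c := fun j => by
      rw [show m₀.arr 10 = m.arr 10 from hF.2 10 (by decide)]; exact hc j
    have v34 : m₀.var 34 = m'.var 34 := by simp [hm₀, Memory.setVar_var]
    have a6 : m₀.arr 6 = m'.arr 6 := rfl
    have v35 : m₀.var 35 = i := by simp [hm₀, Memory.setVar_var]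
    by_cases hiA : i < 2 ^ #A
    swap
    · have hcond : ¬ 0 < (Expr.var 32 - Expr.var 35).eval m₀ := by
        simp only [Expr.eval_sub, Expr.eval_var, hG.patterns, v35]
        have : ((2 ^ #A : ℕ) : ℤ) ≤ i := by exact_mod_cast not_lt.1 hiA
        omega
      have hden : chooseStep.den m₀ = m₀ := by rw [chooseStep, Prog.den, if_neg hcond]; rfl
      rw [hden, a6, v34]
      obtain ⟨ha1, ha2⟩ := ha (by omega)
      refine ⟨fun _ => ⟨?_, ha2⟩, fun h' => by omega⟩
      rw [ha1, Ico_eq_empty_of_le (by omega), Ico_eq_empty_of_le (by omega)]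
    have hcond : 0 < (Expr.var 32 - Expr.var 35).eval m₀ := by
      simp only [Expr.eval_sub, Expr.eval_var, hG.patterns, v35]
      have : (i : ℤ) < ((2 ^ #A : ℕ) : ℤ) := by exact_mod_cast hiA
      omega
    rw [chooseStep, Prog.den, if_pos hcond]
    rcases Nat.lt_or_ge t₀ (i + 1) with hti | hti
    swap
    · obtain ⟨hb1, hb2⟩ := hb hti
      have hcond' : ¬ 0 < (Expr.var 34 + 1).eval m₀ := by
        simp only [Expr.eval_add, Expr.eval_var, Expr.eval_one, v34]; omega
      rw [Prog.den, if_neg hcond']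
      exact ⟨fun h' => by omega, fun _ => ⟨by rw [Prog.den, v34]; exact hb1, hb2⟩⟩
    obtain ⟨ha1, ha2⟩ := ha hti
    have hpos : (0 : ℤ) ≤ m'.var 34 := by
      have : (0 : ℝ) ≤ m'.var 34 := by
        rw [ha1]; linarith [hmono (t₀ + 1) (i + 1) (by omega)]
      exact_mod_cast this
    have hcond' : 0 < (Expr.var 34 + 1).eval m₀ := by
      simp only [Expr.eval_add, Expr.eval_var, Expr.eval_one, v34]; omega
    rw [Prog.den, if_pos hcond']
    simp only [Prog.den_seq]
    set m₁ := (decode 35 12).den m₀ with hm₁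
    have F₁ : Frame (decode 35 12) m₀ m₁ := Frame.den _ _
    have hdec : HoldsBits m₁ 12 (decodeBits A i) := decode_spec hI hG (by norm_num) v35
    have hw := weight_spec (hI.of_frame (by decide) F₁) hL (hG.of_frame (by decide) F₁) hdec
    set m₂ := weight.den m₁ with hm₂
    have F₂ : Frame weight m₁ m₂ := Frame.den _ _
    have v34₂ : m₂.var 34 = m'.var 34 := by
      rw [F₂.1 34 (by decide), F₁.1 34 (by decide), v34]
    have a6₂ : m₂.arr 6 = m.arr 6 := by
      rw [F₂.2 6 (by decide), F₁.2 6 (by decide), a6, ha2]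
    set q := m'.var 34 - m₂.var 49 with hq
    have hqr : (q : ℝ) = U - ∑ t ∈ Ico i (2 ^ #A), W t := by
      rw [hq, Int.cast_sub, hw, ha1, sum_eq_sum_Ico_succ_bot hiA]; ring
    have hass : (Prog.assign 34 (.var 34 - .var 49)).den m₂ = m₂.setVar 34 q := by
      simp [Prog.den, v34₂, hq]
    rw [hass]
    set m₃ := m₂.setVar 34 q with hm₃
    have v34₃ : m₃.var 34 = q := by simp [hm₃, Memory.setVar_var]
    rcases Nat.lt_or_ge t₀ i with hlt | hge
    · have hq0 : 0 ≤ q := by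
        have : (0 : ℝ) ≤ q := by rw [hqr]; linarith [hmono (t₀ + 1) i (by omega)]
        exact_mod_cast this
      have hcw : ¬ 0 < (0 - Expr.var 34).eval m₃ := by
        simp only [Expr.eval_sub, Expr.eval_zero, Expr.eval_var, v34₃]; omega
      rw [Prog.den, if_neg hcw, Prog.den]
      refine ⟨fun _ => ⟨by rw [v34₃, hqr], by rw [hm₃, Memory.setVar_arr, a6₂]⟩,
        fun h' => by omega⟩
    · obtain rfl : i = t₀ := by omega
      have hq0 : q < 0 := by
        have : (q : ℝ) < 0 := by rw [hqr]; linarith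
        exact_mod_cast this
      have hcw : 0 < (0 - Expr.var 34).eval m₃ := by
        simp only [Expr.eval_sub, Expr.eval_zero, Expr.eval_var, v34₃]; omega
      rw [Prog.den, if_pos hcw]
      have hI₃ : Inputs C N ε L K (C.precision L K) m₃ :=
        ((hI.of_frame (by decide) F₁).of_frame (by decide) F₂).setVar (by norm_num) _
      have hG₃ : GroupData d L A f z m₃ :=
        ((hG.of_frame (by decide) F₁).of_frame (by decide) F₂).setVar (by norm_num)
          (by norm_num) _
      have hy₃ : HoldsBits m₃ 12 (decodeBits A i) := fun j => by
        rw [hm₃, Memory.setVar_arr, F₂.2 12 (by decide)]; exact hdec j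
      have hc₃ : HoldsBits m₃ 10 c := fun j => by
        rw [hm₃, Memory.setVar_arr, F₂.2 10 (by decide), F₁.2 10 (by decide)]; exact hc₀ j
      refine ⟨fun h' => by omega, fun _ => ⟨?_, fun j => ?_⟩⟩
      · rw [(Frame.den writeOut m₃).1 34 (by decide), v34₃]; exact hq0
      · rw [writeOut_spec hI₃ hG₃ hy₃ hc₃, hm₃, Memory.setVar_arr, a6₂]

/-- One step of `findMembers`. -/
def memberStep : Prog :=
  .load 50 11 [.var 10] ;; .load 51 9 [.var 10] ;; .store 13 [.var 10] 0 ;;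
  .cond (1 - .var 51) (.cond (1 + .var 30 - .var 50) (.cond (1 + .var 50 - .var 30)
    (.store 13 [.var 10] 1 ;; .assign 31 (.half (.var 31)) ;; .assign 32 (.var 32 + .var 32))
    .skip) .skip) .skip

/-- Finds the surviving qubits with the label in the variable `30`. -/
def findMembers : Prog := .assign 31 (.var 4) ;; .assign 32 1 ;; .count 10 0 memberStep

/-- While the members are found, the powers `2 ^ (L - #A)` and `2 ^ #A` are kept up to date. -/
theorem findMembers_spec {m : Memory} (h : Inputs C N ε L K J m) {S : Finset (Fin n)}
    {lab : Fin n → Fin n} {v : Fin n} (hv : m.var 30 = ((v : ℕ) : ℤ))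
    (hlab : ∀ i : Fin n, m.arr 11 [((i : ℕ) : ℤ)] = ((lab i : ℕ) : ℤ))
    (hS : HoldsBits m 9 fun i => decide (i ∉ S))
    (hflips : ∀ l < d, ∀ i : Fin n, m.arr 8 [(l : ℤ), ((i : ℕ) : ℤ)] = bitVal (f l i))
    (hz : HoldsBits m 16 z) (hA : A = {i ∈ S | lab i = v}) (hcard : #A ≤ L) :
    GroupData d L A f z (findMembers.den m) := by
  have e : findMembers.den m
      = (Prog.count 10 0 memberStep).den ((m.setVar 31 (2 ^ L : ℕ)).setVar 32 1) := by
    rw [← h.M_eq]; rfl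
  have F := Frame.den findMembers m
  have key := count_induction (x := 10) (p := 0) (c := memberStep) (N := n)
    (m := (m.setVar 31 (2 ^ L : ℕ)).setVar 32 1) (by simpa [Memory.setVar_var] using h.n_eq)
    (fun i m' => m'.var 31 = (2 ^ (L - #(above A i)) : ℕ) ∧ m'.var 32 = (2 ^ #(above A i) : ℕ) ∧
      ∀ j : Fin n, i ≤ j → m'.arr 13 [((j : ℕ) : ℤ)] = bitVal (decide (j ∈ A))) ?_ ?_
  · rw [above_zero, ← e] at key
    refine ⟨fun j => key.2.2 j (Nat.zero_le _), ?_, ?_, hcard, key.1, key.2.1⟩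
    · intro l hl i; rw [F.2 8 (by decide), hflips l hl i]
    · intro i; rw [F.2 16 (by decide), hz i]
  · refine ⟨?_, ?_, fun j hj => by omega⟩ <;> simp [Memory.setVar_var, above_eq_empty]
  · rintro i hi m' hF ⟨h1, h2, h3⟩
    have v30 : m'.var 30 = ((v : ℕ) : ℤ) := (hF.1 30 (by decide)).trans hv
    have a11 : m'.arr 11 = m.arr 11 := hF.2 11 (by decide)
    have a9 : m'.arr 9 = m.arr 9 := hF.2 9 (by decide)
    have h11 := hlab ⟨i, hi⟩
    have h9 := hS ⟨i, hi⟩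
    simp only at h11 h9
    simp only [memberStep, Prog.den_seq]
    by_cases hiA : (⟨i, hi⟩ : Fin n) ∈ A
    · obtain ⟨hiS, hil⟩ : (⟨i, hi⟩ : Fin n) ∈ S ∧ lab ⟨i, hi⟩ = v := by
        rw [hA] at hiA; simpa using hiA
      have h9' : m.arr 9 [(i : ℤ)] = 0 := by simpa [hiS, bitVal] using h9
      have hle : #(above A (i + 1)) + 1 ≤ L := by
        refine le_trans ?_ hcard
        rw [← card_insert_of_notMem (notMem_above (hi := hi)), ← above_of_mem hiA]
        exact card_le_card (filter_subset _ _)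
      have hL' : L - #(above A (i + 1)) = (L - (#(above A (i + 1)) + 1)) + 1 := by omega
      rw [hL', pow_succ] at h1
      rw [above_of_mem hiA, card_insert_of_notMem notMem_above]
      refine ⟨?_, ?_, fun j hj => ?_⟩
      · simp [Prog.den, Memory.setVar_var, a11, a9, h11, h9', v30, hil, h1]
      · simp [Prog.den, Memory.setVar_var, a11, a9, h11, h9', v30, hil, h2, pow_succ]
        ring
      · by_cases hij : (j : ℕ) = i
        · obtain rfl : j = ⟨i, hi⟩ := Fin.ext hij
          simp [Prog.den, Memory.setVar_var, a11, a9, h11, h9', v30, hil, Memory.setArr_arr, hiA,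
            bitVal]
        · have := h3 j (by omega)
          simp [Prog.den, Memory.setVar_var, a11, a9, h11, h9', v30, hil, Memory.setArr_arr, hij,
            this]
    · rw [above_of_notMem hiA]
      have hno : ∀ m₀ : Memory, m₀.var 30 = ((v : ℕ) : ℤ) →
          m₀.var 50 = ((lab ⟨i, hi⟩ : ℕ) : ℤ) →
          m₀.var 51 = bitVal (decide ((⟨i, hi⟩ : Fin n) ∉ S)) →
          (Prog.cond (1 - .var 51) (.cond (1 + .var 30 - .var 50) (.cond (1 + .var 50 - .var 30)
            (.store 13 [.var 10] 1 ;; .assign 31 (.half (.var 31)) ;;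
              .assign 32 (.var 32 + .var 32)) .skip) .skip) .skip).den m₀ = m₀ := by
        intro m₀ q1 q2 q3
        by_cases hiS : (⟨i, hi⟩ : Fin n) ∈ S
        · have hne : (lab ⟨i, hi⟩ : ℕ) ≠ v := fun e => hiA (by
            rw [hA]; simpa [hiS] using Fin.ext e)
          rcases lt_or_gt_of_ne hne with hlt | hgt
          · simp [Prog.den, q1, q2]
            intros; omega
          · simp [Prog.den, q1, q2]
            intros; omega
        · simp [Prog.den, q3, hiS, bitVal]
      rw [hno]
      · refine ⟨?_, ?_, fun j hj => ?_⟩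
        · simp [Prog.den, Memory.setVar_var, h1]
        · simp [Prog.den, Memory.setVar_var, h2]
        · by_cases hij : (j : ℕ) = i
          · obtain rfl : j = ⟨i, hi⟩ := Fin.ext hij
            simp [Prog.den, Memory.setVar_var, Memory.setArr_arr, hiA, bitVal]
          · have := h3 j (by omega)
            simp [Prog.den, Memory.setVar_var, Memory.setArr_arr, hij, this]
      · simp [Prog.den, Memory.setVar_var, v30]
      · simp [Prog.den, Memory.setVar_var, a11, h11]
      · simp [Prog.den, Memory.setVar_var, a9, h9]

/-- Samples the outcomes of all classes. -/
def sampleClasses : Prog := .count 30 0 (findMembers ;; choose)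

/-- The classes are treated independently of each other, and the output of the dephased qubits is
not touched. -/
theorem sampleClasses_spec {m : Memory} (h : Inputs C N ε L K (C.precision L K) m) (hL : 1 ≤ L)
    {S : Finset (Fin n)} {lab : Fin n → Fin n} {b c : Bits n} {U : Fin n → ℕ}
    (hlab : ∀ i : Fin n, m.arr 11 [((i : ℕ) : ℤ)] = ((lab i : ℕ) : ℤ))
    (hS : HoldsBits m 9 fun i => decide (i ∉ S))
    (hflips : ∀ l < d, ∀ i : Fin n, m.arr 8 [(l : ℤ), ((i : ℕ) : ℤ)] = bitVal (f l i))
    (hz : HoldsBits m 16 z) (hc : HoldsBits m 10 c)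
    (hU : ∀ v : Fin n, m.arr 17 [((v : ℕ) : ℤ)] = U v)
    (hb : ∀ i ∉ S, m.arr 6 [((i : ℕ) : ℤ)] = bitVal (b i))
    (hcard : ∀ v, #{i ∈ S | lab i = v} ≤ L)
    (hch : ∀ v, ∃ t < 2 ^ #{i ∈ S | lab i = v},
      (∀ i ∈ S, lab i = v → decodeBits {i ∈ S | lab i = v} t i = (b i ^^ c i)) ∧
      ∑ t ∈ Ico (t + 1) (2 ^ #{i ∈ S | lab i = v}),
        C.classWeight L K {i ∈ S | lab i = v} f z t ≤ U v ∧
      (U v : ℝ) < ∑ t ∈ Ico t (2 ^ #{i ∈ S | lab i = v}),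
        C.classWeight L K {i ∈ S | lab i = v} f z t) :
    HoldsBits (sampleClasses.den m) 6 b := by
  have key := count_induction (x := 30) (p := 0) (c := findMembers ;; choose) h.n_eq
    (fun v m' => ∀ i : Fin n, (i ∉ S ∨ v ≤ (lab i : ℕ)) →
      m'.arr 6 [((i : ℕ) : ℤ)] = bitVal (b i)) ?_ ?_
  · exact fun i => key i (.inr (Nat.zero_le _))
  · rintro i (hi | hi)
    · exact hb i hi
    · exact absurd (lab i).2 (not_lt.2 hi)
  · intro v hv m' hF hP i hi
    set w : Fin n := ⟨v, hv⟩
    obtain ⟨t, ht, hdec, hlo, hhi⟩ := hch w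
    set m₀ := m'.setVar 30 v with hm₀
    have hI : Inputs C N ε L K (C.precision L K) m₀ :=
      (h.of_frame (by decide) hF).setVar (by norm_num) _
    have ha : ∀ a, a ∉ (Prog.count 30 0 (findMembers ;; choose)).modA → m₀.arr a = m.arr a :=
      fun a ha => hF.2 a ha
    have hw₀ : m₀.var 30 = ((w : ℕ) : ℤ) := by simp [hm₀, Memory.setVar_var, w]
    have hG := findMembers_spec hI hw₀ (S := S) (lab := lab) (f := f) (z := z)
      (fun j => by rw [ha 11 (by decide)]; exact hlab j)
      (fun j => by rw [ha 9 (by decide)]; exact hS j)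
      (fun l hl j => by rw [ha 8 (by decide)]; exact hflips l hl j)
      (fun j => by rw [ha 16 (by decide)]; exact hz j) rfl (hcard w)
    set m₁ := findMembers.den m₀ with hm₁
    have F₁ : Frame findMembers m₀ m₁ := Frame.den _ _
    have hch := choose_spec (hI.of_frame (by decide) F₁) hL hG (c := c)
      (fun j => by rw [F₁.2 10 (by decide), ha 10 (by decide)]; exact hc j)
      ((F₁.1 30 (by decide)).trans hw₀)
      (by rw [F₁.2 17 (by decide), ha 17 (by decide)]; exact hU w) ht hlo hhi i
    rw [Prog.den_seq, hch, F₁.2 6 (by decide)]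
    split_ifs with hm
    · obtain ⟨hiS, hil⟩ := mem_filter.1 hm
      rw [hdec i hiS hil]
      congr 1
      cases b i <;> cases c i <;> rfl
    · refine hP i ?_
      rcases hi with hi | hi
      · exact .inl hi
      · by_cases hiS : i ∈ S
        · right
          have : (lab i : ℕ) ≠ v := fun e => hm (mem_filter.2 ⟨hiS, Fin.ext e⟩)
          omega
        · exact .inl hiS

end Choice


/-! ### The noise record and the labels of the qubits as computed by programs -/

section Records

variable {n k d : ℕ} {C : IQPCircuit n k d} {N : PauliNoise} {ε : ℝ} {L K J : ℕ}

/-- The outcome that a number `u` stands for, given four thresholds. -/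
def outcomeAt (t₁ t₂ t₃ t₄ u : ℤ) : Fin 5 :=
  if u < t₁ then 1 else if u < t₂ then 2 else if u < t₃ then 3 else if u < t₄ then 4 else 0

/-- Draws the outcome of the noise on the qubit `60` after the layer `61`.  The variables `62` and
`63` keep track of whether the qubit has been dephased, and of the parity of the `Y` errors. -/
def recordStep : Prog :=
  .load 12 7 [.var 61, .var 60] ;;
  .cond (.var 25 - .var 12) (.store 8 [.var 61, .var 60] 0 ;; .assign 62 1)
    (.cond (.var 26 - .var 12) (.store 8 [.var 61, .var 60] 1 ;; .assign 62 1)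
      (.cond (.var 27 - .var 12) (.store 8 [.var 61, .var 60] 1)
        (.cond (.var 28 - .var 12) (.store 8 [.var 61, .var 60] 1 ;; .assign 63 (1 - .var 63))
          (.store 8 [.var 61, .var 60] 0))))

/-- The effect of one outcome: the dephasing flag, the parity of the `Y` errors, and the flip. -/
theorem recordStep_spec {m : Memory} {l i u t₁ t₂ t₃ t₄ : ℤ} {p q : Bool} (h1 : m.var 25 = t₁)
    (h2 : m.var 26 = t₂) (h3 : m.var 27 = t₃) (h4 : m.var 28 = t₄) (hl : m.var 61 = l)
    (hi : m.var 60 = i) (hu : m.arr 7 [l, i] = u) (hp : m.var 62 = bitVal p)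
    (hq : m.var 63 = bitVal q) :
    (recordStep.den m).var 62 = bitVal (p || dephases (outcomeAt t₁ t₂ t₃ t₄ u)) ∧
    (recordStep.den m).var 63 = bitVal (q ^^ decide (outcomeAt t₁ t₂ t₃ t₄ u = 4)) ∧
    ∀ idx, (recordStep.den m).arr 8 idx
      = if idx = [l, i] then bitVal (flips (outcomeAt t₁ t₂ t₃ t₄ u)) else m.arr 8 idx := by
  have e : (Prog.load 12 7 [.var 61, .var 60]).den m = m.setVar 12 u := by
    simp [Prog.den, hl, hi, hu]
  rw [recordStep, Prog.den_seq, e]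
  unfold outcomeAt
  by_cases c1 : u < t₁
  · simp [Prog.den, Memory.setVar_var, h1, h2, h3, h4, hl, hi, hp, hq, c1, Memory.setArr_arr,
      dephases, flips, bitVal]
  by_cases c2 : u < t₂
  · simp [Prog.den, Memory.setVar_var, h1, h2, h3, h4, hl, hi, hp, hq, c1, c2, Memory.setArr_arr,
      dephases, flips, bitVal]
  by_cases c3 : u < t₃
  · simp [Prog.den, Memory.setVar_var, h1, h2, h3, h4, hl, hi, hp, hq, c1, c2, c3,
      Memory.setArr_arr, dephases, flips, bitVal]
  by_cases c4 : u < t₄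
  · simp [Prog.den, Memory.setVar_var, h1, h2, h3, h4, hl, hi, hp, hq, c1, c2, c3, c4,
      Memory.setArr_arr, dephases, flips, bitVal]
    cases q <;> simp
  · simp [Prog.den, Memory.setVar_var, h1, h2, h3, h4, hl, hi, hp, hq, c1, c2, c3, c4,
      Memory.setArr_arr, dephases, flips, bitVal]

/-- Draws the outcomes of the noise on the qubit `60`. -/
def qubitRecord : Prog :=
  .assign 62 0 ;; .assign 63 0 ;; .count 61 1 recordStep ;;
  .store 9 [.var 60] (.var 62) ;; .store 10 [.var 60] (.var 63)

/-- Draws the outcomes of the noise. -/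
def noiseRecord : Prog := .count 60 0 qubitRecord

/-- The noise record that belongs to an array of random numbers. -/
def recordOf (t₁ t₂ t₃ t₄ : ℤ) (u : Fin d → Fin n → ℤ) : Fin d → Fin n → Fin 5 :=
  fun l i => outcomeAt t₁ t₂ t₃ t₄ (u l i)

/-- The layers with index at least `l` after which qubit `i` has the outcome `4`. -/
def lateFlips (ω : Fin d → Fin n → Fin 5) (i : Fin n) (l : ℕ) : Finset (Fin d) :=
  {j | l ≤ (j : ℕ) ∧ ω j i = 4}

theorem qubitRecord_spec {m : Memory} (h : Inputs C N ε L K J m) {t₁ t₂ t₃ t₄ : ℤ}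
    {u : Fin d → Fin n → ℤ} (h1 : m.var 25 = t₁) (h2 : m.var 26 = t₂) (h3 : m.var 27 = t₃)
    (h4 : m.var 28 = t₄) {i : Fin n} (hi : m.var 60 = ((i : ℕ) : ℤ))
    (hu : ∀ (l : Fin d) (i : Fin n), m.arr 7 [((l : ℕ) : ℤ), ((i : ℕ) : ℤ)] = u l i)
    {ω : Fin d → Fin n → Fin 5} (hω : ω = recordOf t₁ t₂ t₃ t₄ u) :
    (∀ (l : Fin d) (j : Fin n), (qubitRecord.den m).arr 8 [((l : ℕ) : ℤ), ((j : ℕ) : ℤ)]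
      = if j = i then bitVal (flips (ω l i)) else m.arr 8 [((l : ℕ) : ℤ), ((j : ℕ) : ℤ)]) ∧
    (∀ j : Fin n, (qubitRecord.den m).arr 9 [((j : ℕ) : ℤ)]
      = if j = i then bitVal (decide (i ∉ survivors ω)) else m.arr 9 [((j : ℕ) : ℤ)]) ∧
    (∀ j : Fin n, (qubitRecord.den m).arr 10 [((j : ℕ) : ℤ)]
      = if j = i then bitVal (signFlip ω i) else m.arr 10 [((j : ℕ) : ℤ)]) := by
  set m₁ := (m.setVar 62 0).setVar 63 0 with hm₁
  set m₂ := (Prog.count 61 1 recordStep).den m₁ with hm₂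
  have F := Frame.den (Prog.count 61 1 recordStep) m₁
  have e : qubitRecord.den m = (m₂.setArr 9 [((i : ℕ) : ℤ)] (m₂.var 62)).setArr 10
      [((i : ℕ) : ℤ)] (m₂.var 63) := by
    have h60 : m₂.var 60 = ((i : ℕ) : ℤ) := by
      rw [F.1 60 (by decide)]; simp [hm₁, Memory.setVar_var, hi]
    rw [← h60]; rfl
  have key := count_induction (x := 61) (p := 1) (c := recordStep) (N := d) (m := m₁)
    (by simpa [hm₁, Memory.setVar_var] using h.d_eq)
    (fun l m' => m'.var 62 = bitVal (decide (∃ j : Fin d, l ≤ (j : ℕ) ∧ dephases (ω j i) = true)) ∧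
      m'.var 63 = bitVal (decide (Odd #(lateFlips ω i l))) ∧
      ∀ (j : Fin d) (i' : Fin n), m'.arr 8 [((j : ℕ) : ℤ), ((i' : ℕ) : ℤ)]
        = if i' = i ∧ l ≤ (j : ℕ) then bitVal (flips (ω j i))
          else m.arr 8 [((j : ℕ) : ℤ), ((i' : ℕ) : ℤ)]) ?_ ?_
  · obtain ⟨k1, k2, k3⟩ := key
    rw [← hm₂] at k1 k2 k3
    rw [e, k1, k2]
    refine ⟨fun l j => ?_, fun j => ?_, fun j => ?_⟩
    · have := k3 l j
      simp only [Nat.zero_le, and_true] at this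
      rw [Memory.setArr_arr_ne _ _ _ _ _ (by norm_num),
          Memory.setArr_arr_ne _ _ _ _ _ (by norm_num),
        this]
    · rw [Memory.setArr_arr_ne _ _ _ _ _ (by norm_num), Memory.setArr_arr]
      by_cases hj : j = i
      · subst hj
        simp [survivors]
      · have : (j : ℕ) ≠ i := fun e => hj (Fin.ext e)
        simp only [List.cons.injEq, Nat.cast_inj, this, hj, and_true, if_true, if_false]
        rw [F.2 9 (by decide)]; rfl
    · rw [Memory.setArr_arr]
      by_cases hj : j = i
      · subst hj
        simp [signFlip, lateFlips]
      · have : (j : ℕ) ≠ i := fun e => hj (Fin.ext e)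
        simp only [List.cons.injEq, Nat.cast_inj, this, hj, and_true, if_true, if_false]
        rw [Memory.setArr_arr_ne _ _ _ _ _ (by norm_num), F.2 10 (by decide)]; rfl
  · have hlt : ∀ j : Fin d, ¬ d ≤ (j : ℕ) := fun j => not_le.2 j.2
    simp [hm₁, Memory.setVar_var, hlt, bitVal, lateFlips]
  · rintro l hl m' hF ⟨a1, a2, a3⟩
    have hv : ∀ x, x ∉ (Prog.count 61 1 recordStep).modV → x ≠ 62 → x ≠ 63 → x ≠ 61 →
        (m'.setVar 61 l).var x = m.var x := by
      intro x hx hx2 hx3 hx1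
      rw [Memory.setVar_var, if_neg hx1, hF.1 x hx]
      simp [hm₁, Memory.setVar_var, hx2, hx3]
    have hu7 : (m'.setVar 61 l).arr 7 [(l : ℤ), ((i : ℕ) : ℤ)] = u ⟨l, hl⟩ i := by
      rw [Memory.setVar_arr, hF.2 7 (by decide)]; exact hu ⟨l, hl⟩ i
    obtain ⟨b1, b2, b3⟩ := recordStep_spec (m := m'.setVar 61 l) (l := l) (i := ((i : ℕ) : ℤ))
      ((hv 25 (by decide) (by norm_num) (by norm_num) (by norm_num)).trans h1)
      ((hv 26 (by decide) (by norm_num) (by norm_num) (by norm_num)).trans h2)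
      ((hv 27 (by decide) (by norm_num) (by norm_num) (by norm_num)).trans h3)
      ((hv 28 (by decide) (by norm_num) (by norm_num) (by norm_num)).trans h4)
      (by simp [Memory.setVar_var])
      ((hv 60 (by decide) (by norm_num) (by norm_num) (by norm_num)).trans hi) hu7
      (by rw [Memory.setVar_var, if_neg (by norm_num)]; exact a1)
      (by rw [Memory.setVar_var, if_neg (by norm_num)]; exact a2)
    have ho : outcomeAt t₁ t₂ t₃ t₄ (u ⟨l, hl⟩ i) = ω ⟨l, hl⟩ i := by rw [hω]; rfl
    rw [ho] at b1 b2 b3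
    refine ⟨?_, ?_, ?_⟩
    · rw [b1]
      congr 1
      rw [Bool.eq_iff_iff]
      simp only [Bool.or_eq_true, decide_eq_true_eq]
      constructor
      · rintro (⟨j, hj, hj'⟩ | h')
        · exact ⟨j, by omega, hj'⟩
        · exact ⟨⟨l, hl⟩, le_rfl, h'⟩
      · rintro ⟨j, hj, hj'⟩
        rcases Nat.lt_or_ge l j with hlt | hge
        · exact .inl ⟨j, hlt, hj'⟩
        · have : j = ⟨l, hl⟩ := Fin.ext (by simp only; omega)
          rw [this] at hj'; exact .inr hj'
    · rw [b2]
      congr 1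
      by_cases h4' : ω ⟨l, hl⟩ i = 4
      · have : lateFlips ω i l = insert ⟨l, hl⟩ (lateFlips ω i (l + 1)) := by
          ext j
          simp only [lateFlips, mem_filter, mem_univ, true_and, mem_insert, Fin.ext_iff]
          constructor
          · rintro ⟨h1, h2⟩
            rcases Nat.lt_or_ge l j with hlt | hge
            · exact .inr ⟨hlt, h2⟩
            · exact .inl (by omega)
          · rintro (h1 | ⟨h1, h2⟩)
            · refine ⟨h1.ge, ?_⟩
              rw [show j = ⟨l, hl⟩ from Fin.ext h1, h4']
            · exact ⟨by omega, h2⟩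
        simp only [this, card_insert_of_notMem (show (⟨l, hl⟩ : Fin d) ∉ lateFlips ω i (l + 1) by
          simp [lateFlips]), Nat.odd_add_one]
        by_cases ho : Odd #(lateFlips ω i (l + 1)) <;> simp [h4', ho]
      · have : lateFlips ω i l = lateFlips ω i (l + 1) := by
          ext j
          simp only [lateFlips, mem_filter, mem_univ, true_and]
          refine and_congr_left fun h2 => ?_
          have : (j : ℕ) ≠ l := fun e => h4' (by rw [← h2, ← show j = ⟨l, hl⟩ from Fin.ext e])
          omega
        rw [this]; simp [h4']
    · intro j i'
      rw [b3, Memory.setVar_arr, a3]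
      by_cases hj : (j : ℕ) = l
      · obtain rfl : j = ⟨l, hl⟩ := Fin.ext hj
        by_cases hi' : i' = i
        · simp [hi']
        · have : (i' : ℕ) ≠ i := fun e => hi' (Fin.ext e)
          simp [hi', this]
      · have : l ≤ (j : ℕ) ↔ l + 1 ≤ (j : ℕ) := by omega
        simp [hj, this]

/-- The program stores what is needed from the noise record: the flips after every layer, the set of
dephased qubits, and the parities of the `Y` errors. -/
theorem noiseRecord_spec {m : Memory} (h : Inputs C N ε L K J m) {t₁ t₂ t₃ t₄ : ℤ}
    {u : Fin d → Fin n → ℤ} (h1 : m.var 25 = t₁) (h2 : m.var 26 = t₂) (h3 : m.var 27 = t₃)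
    (h4 : m.var 28 = t₄)
    (hu : ∀ (l : Fin d) (i : Fin n), m.arr 7 [((l : ℕ) : ℤ), ((i : ℕ) : ℤ)] = u l i)
    {ω : Fin d → Fin n → Fin 5} (hω : ω = recordOf t₁ t₂ t₃ t₄ u) :
    (∀ l < d, ∀ i : Fin n, (noiseRecord.den m).arr 8 [(l : ℤ), ((i : ℕ) : ℤ)]
      = bitVal (flipsOf ω l i)) ∧
    HoldsBits (noiseRecord.den m) 9 (fun i => decide (i ∉ survivors ω)) ∧
    HoldsBits (noiseRecord.den m) 10 (signFlip ω) := by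
  have key := count_induction (x := 60) (p := 0) (c := qubitRecord) h.n_eq
    (fun i m' => ∀ j : Fin n, i ≤ (j : ℕ) →
      (∀ l : Fin d, m'.arr 8 [((l : ℕ) : ℤ), ((j : ℕ) : ℤ)] = bitVal (flips (ω l j))) ∧
      m'.arr 9 [((j : ℕ) : ℤ)] = bitVal (decide (j ∉ survivors ω)) ∧
      m'.arr 10 [((j : ℕ) : ℤ)] = bitVal (signFlip ω j)) ?_ ?_
  · refine ⟨fun l hl i => ?_, fun i => (key i (Nat.zero_le _)).2.1,
      fun i => (key i (Nat.zero_le _)).2.2⟩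
    rw [flipsOf, dif_pos hl]
    exact (key i (Nat.zero_le _)).1 ⟨l, hl⟩
  · intro j hj; exact absurd j.2 (not_lt.2 hj)
  · intro i hi m' hF hP
    have hv : ∀ x, x ∉ (Prog.count 60 0 qubitRecord).modV → x ≠ 60 →
        (m'.setVar 60 i).var x = m.var x := by
      intro x hx hx'
      rw [Memory.setVar_var, if_neg hx', hF.1 x hx]
    obtain ⟨s1, s2, s3⟩ := qubitRecord_spec (i := ⟨i, hi⟩)
      ((h.of_frame (by decide) hF).setVar (x := 60) (by norm_num) i)
      ((hv 25 (by decide) (by norm_num)).trans h1) ((hv 26 (by decide) (by norm_num)).trans h2)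
      ((hv 27 (by decide) (by norm_num)).trans h3) ((hv 28 (by decide) (by norm_num)).trans h4)
      (by simp [Memory.setVar_var]) (u := u)
      (fun l j => by rw [Memory.setVar_arr, hF.2 7 (by decide)]; exact hu l j) hω
    intro j hj
    simp only [s1, s2, s3]
    by_cases hij : j = ⟨i, hi⟩
    · simp [hij]
    · have : (j : ℕ) ≠ i := fun e => hij (Fin.ext e)
      simp only [hij, if_false]
      exact hP j (by omega)

/-- A counting loop and an abstract iteration that proceed in parallel. -/
theorem count_rel {x p : ℕ} {c : Prog} {N : ℕ} {m : Memory} (hN : m.var p = N) {τ : Type*}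
    {g : ℕ → τ → τ} (R : Memory → τ → Prop) {s : τ} (h0 : R (m.setVar x N) s)
    (hs : ∀ i < N, ∀ m' s', Frame (.count x p c) m m' → R m' s' →
      R (c.den (m'.setVar x i)) (g i s')) : R ((Prog.count x p c).den m) (downFold g N s) := by
  obtain ⟨s', h1, h2⟩ := count_induction hN
    (fun i m' => ∃ s', R m' s' ∧ downFold g i s' = downFold g N s) ⟨s, h0, rfl⟩
    (fun i hi m' hF ⟨s', h1, h2⟩ => ⟨g i s', hs i hi m' s' hF h1, h2⟩)
  rw [← h2]; exact h1

/-- Gives the qubits with the label `70` the label `69`. -/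
def relabel : Prog :=
  .count 10 0 (.load 50 11 [.var 10] ;;
    .cond (1 + .var 50 - .var 70) (.cond (1 + .var 70 - .var 50) (.store 11 [.var 10] (.var 69))
      .skip) .skip)

/-- The array `11` holds the labels `lab`. -/
def HoldsLabels (m : Memory) (lab : Fin n → Fin n) : Prop :=
  ∀ i : Fin n, m.arr 11 [((i : ℕ) : ℤ)] = ((lab i : ℕ) : ℤ)

theorem relabel_spec {m : Memory} (h : Inputs C N ε L K J m) {lab : Fin n → Fin n}
    (hlab : HoldsLabels m lab) {a b : Fin n} (ha : m.var 69 = ((a : ℕ) : ℤ))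
    (hb : m.var 70 = ((b : ℕ) : ℤ)) :
    HoldsLabels (relabel.den m) fun i => if lab i = b then a else lab i := by
  have key := count_induction (x := 10) (p := 0) (c := .load 50 11 [.var 10] ;;
    .cond (1 + .var 50 - .var 70) (.cond (1 + .var 70 - .var 50) (.store 11 [.var 10] (.var 69))
      .skip) .skip) h.n_eq
    (fun i m' => ∀ j : Fin n, m'.arr 11 [((j : ℕ) : ℤ)]
      = (((if i ≤ (j : ℕ) ∧ lab j = b then a else lab j : Fin n) : ℕ) : ℤ)) ?_ ?_
  · intro j; exact (key j).trans (by simp)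
  · intro j
    have : ¬ n ≤ (j : ℕ) := not_le.2 j.2
    simp [this, hlab j]
  · intro i hi m' hF hP j
    have v69 : m'.var 69 = ((a : ℕ) : ℤ) := (hF.1 69 (by decide)).trans ha
    have v70 : m'.var 70 = ((b : ℕ) : ℤ) := (hF.1 70 (by decide)).trans hb
    have hPi := hP ⟨i, hi⟩
    simp only [Nat.not_succ_le_self, false_and, if_false] at hPi
    have hPj := hP j
    by_cases hib : lab ⟨i, hi⟩ = b
    · by_cases hij : (j : ℕ) = i
      · obtain rfl : j = ⟨i, hi⟩ := Fin.ext hij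
        simp [Prog.den, Memory.setVar_var, hPi, v69, v70, hib, Memory.setArr_arr]
      · have : i ≤ (j : ℕ) ↔ i + 1 ≤ (j : ℕ) := by omega
        simp only [this, ← hPj]
        simp [Prog.den, Memory.setVar_var, hPi, v69, v70, hib, Memory.setArr_arr, hij]
    · have hne : (lab ⟨i, hi⟩ : ℕ) ≠ b := fun e => hib (Fin.ext e)
      have e : (if i ≤ (j : ℕ) ∧ lab j = b then a else lab j)
          = if i + 1 ≤ (j : ℕ) ∧ lab j = b then a else lab j := by
        by_cases hij : (j : ℕ) = i
        · obtain rfl : j = ⟨i, hi⟩ := Fin.ext hij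
          simp [hib]
        · have : i ≤ (j : ℕ) ↔ i + 1 ≤ (j : ℕ) := by omega
          simp only [this]
      rw [e, ← hPj]
      rcases lt_or_gt_of_ne hne with hlt | hgt
      · have : ¬ ((b : ℕ) : ℤ) < 1 + ((lab ⟨i, hi⟩ : ℕ) : ℤ) := by omega
        simp [Prog.den, Memory.setVar_var, hPi, v69, v70, this]
      · have : ¬ ((lab ⟨i, hi⟩ : ℕ) : ℤ) < 1 + ((b : ℕ) : ℤ) := by omega
        simp [Prog.den, Memory.setVar_var, hPi, v69, v70, this]

/-- One step of `mergeGate`. -/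
def mergeWire : Prog :=
  .cond (.var 46 - .var 67)
    (.load 68 4 [.var 64, .var 65, .var 67] ;; .load 50 9 [.var 68] ;;
      .cond (1 - .var 50)
        (.cond (.var 66 + 1) (.load 69 11 [.var 66] ;; .load 70 11 [.var 68] ;; relabel) .skip ;;
          .assign 66 (.var 68)) .skip) .skip

/-- Merges the classes of the surviving qubits of the gate `(64, 65)` of arity `46`. -/
def mergeGate : Prog := .assign 66 (0 - 1) ;; .count 67 2 mergeWire

/-- One gate of the quick-find algorithm: a class is merged by relabelling all its elements. -/
theorem mergeGate_spec {m : Memory} (h : Inputs C N ε L K J m) {S : Finset (Fin n)}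
    (hS : HoldsBits m 9 fun i => decide (i ∉ S)) {lab : Fin n → Fin n} (hlab : HoldsLabels m lab)
    {l g : ℕ} {G : DiagGate n} (hG : C.gateAt l g = some G) (hl : m.var 64 = l)
    (hg : m.var 65 = g) (ha : m.var 46 = G.arity) :
    HoldsLabels (mergeGate.den m) (gateLabels k S G lab) := by
  have e : mergeGate.den m = (Prog.count 67 2 mergeWire).den (m.setVar 66 (-1)) := rfl
  rw [e]
  refine (count_rel (x := 67) (p := 2) (c := mergeWire) (N := k) (m := m.setVar 66 (-1))
    (by simpa [Memory.setVar_var] using h.k_eq)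
    (fun m' (st : (Fin n → Fin n) × Option (Fin n)) => HoldsLabels m' st.1 ∧
      m'.var 66 = st.2.elim (-1) fun a => ((a : ℕ) : ℤ))
    (s := (lab, none)) ⟨hlab, by simp [Memory.setVar_var]⟩ ?_).1
  rintro r hr m' ⟨lb, o⟩ hF ⟨hlb, ho⟩
  simp only at hlb ho
  set m₀ := m'.setVar 67 r with hm₀
  have hI : Inputs C N ε L K J m₀ :=
    ((h.setVar (x := 66) (by norm_num) _).of_frame (by decide) hF).setVar (by norm_num) _
  have v46 : m₀.var 46 = G.arity := by
    rw [hm₀, Memory.setVar_var, if_neg (by norm_num), hF.1 46 (by decide)]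
    simp [Memory.setVar_var, ha]
  have v64 : m₀.var 64 = l := by
    rw [hm₀, Memory.setVar_var, if_neg (by norm_num), hF.1 64 (by decide)]
    simp [Memory.setVar_var, hl]
  have v65 : m₀.var 65 = g := by
    rw [hm₀, Memory.setVar_var, if_neg (by norm_num), hF.1 65 (by decide)]
    simp [Memory.setVar_var, hg]
  have v67 : m₀.var 67 = r := by simp [hm₀, Memory.setVar_var]
  have v66 : m₀.var 66 = o.elim (-1) fun a => ((a : ℕ) : ℤ) := by
    rw [hm₀, Memory.setVar_var, if_neg (by norm_num), ho]
  have hS₀ : HoldsBits m₀ 9 fun i => decide (i ∉ S) := fun i => by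
    rw [hm₀, Memory.setVar_arr, hF.2 9 (by decide)]; exact hS i
  by_cases hrG : r < G.arity
  swap
  · have hcond : ¬ 0 < (Expr.var 46 - Expr.var 67).eval m₀ := by
      simp only [Expr.eval_sub, Expr.eval_var, v46, v67]; omega
    rw [mergeWire, Prog.den, if_neg hcond, dif_neg hrG]
    exact ⟨hlb, v66⟩
  have hcond : 0 < (Expr.var 46 - Expr.var 67).eval m₀ := by
    simp only [Expr.eval_sub, Expr.eval_var, v46, v67]; omega
  rw [mergeWire, Prog.den, if_pos hcond, dif_pos hrG]
  set w := G.wires ⟨r, hrG⟩ with hw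
  have d4 : m₀.arr 4 [(l : ℤ), g, r] = ((w : ℕ) : ℤ) := by
    rw [hI.arr_eq 4 (by norm_num)]; simp [inputArr, hG, hrG, hw]
  set m₁ := (m₀.setVar 68 ((w : ℕ) : ℤ)).setVar 50 (bitVal (decide (w ∉ S))) with hm₁
  have e1 : ∀ c : Prog, (Prog.load 68 4 [.var 64, .var 65, .var 67] ;; .load 50 9 [.var 68] ;;
      c).den m₀ = c.den m₁ := by
    intro c
    simp only [Prog.den_seq]
    congr 1
    simp [Prog.den, Memory.setVar_var, v64, v65, v67, d4, hm₁, hS₀ w]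
  rw [e1, wireStep]
  have v68 : m₁.var 68 = ((w : ℕ) : ℤ) := by simp [hm₁, Memory.setVar_var]
  have v50 : m₁.var 50 = bitVal (decide (w ∉ S)) := by simp [hm₁, Memory.setVar_var]
  have v66₁ : m₁.var 66 = o.elim (-1) fun a => ((a : ℕ) : ℤ) := by
    simp [hm₁, Memory.setVar_var, v66]
  have hlb₁ : HoldsLabels m₁ lb := hlb
  by_cases hwS : w ∈ S
  swap
  · have hc : ¬ 0 < (1 - Expr.var 50).eval m₁ := by simp [v50, hwS, bitVal]
    rw [Prog.den, if_neg hc, if_neg hwS]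
    exact ⟨hlb₁, v66₁⟩
  have hc : 0 < (1 - Expr.var 50).eval m₁ := by simp [v50, hwS, bitVal]
  rw [Prog.den, if_pos hc, if_pos hwS, Prog.den_seq]
  cases o with
  | none =>
      have hc' : ¬ 0 < (Expr.var 66 + 1).eval m₁ := by simp [v66₁]
      rw [Prog.den, Prog.den, if_neg hc']
      refine ⟨hlb₁, ?_⟩
      simp [Prog.den, Memory.setVar_var, v68]
  | some a =>
      have hc' : 0 < (Expr.var 66 + 1).eval m₁ := by simp [v66₁]
      rw [Prog.den, Prog.den, if_pos hc']
      set m₂ := (m₁.setVar 69 ((lb a : ℕ) : ℤ)).setVar 70 ((lb w : ℕ) : ℤ) with hm₂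
      have e2 : (Prog.load 69 11 [.var 66] ;; .load 70 11 [.var 68] ;; relabel).den m₁
          = relabel.den m₂ := by
        simp only [Prog.den_seq]
        congr 1
        simp [Prog.den, Memory.setVar_var, v66₁, v68, hm₂, hlb₁ a, hlb₁ w]
      have hI₂ : Inputs C N ε L K J m₂ :=
        (((hI.setVar (x := 68) (by norm_num) _).setVar (x := 50) (by norm_num) _).setVar
          (x := 69) (by norm_num) _).setVar (x := 70) (by norm_num) _
      have hr := relabel_spec hI₂ (lab := lb) hlb (a := lb a) (b := lb w)
        (by simp [hm₂, Memory.setVar_var]) (by simp [hm₂, Memory.setVar_var])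
      rw [e2]
      refine ⟨hr, ?_⟩
      have v68₂ : (relabel.den m₂).var 68 = ((w : ℕ) : ℤ) := by
        rw [(Frame.den relabel m₂).1 68 (by decide)]
        simp [hm₂, Memory.setVar_var, v68]
      simp [Memory.setVar_var, v68₂]

/-- The gates of one layer in the computation of the labels. -/
def labelLayer : Prog :=
  .count 65 0 (.load 46 3 [.var 64, .var 65] ;; .cond (.var 46) mergeGate .skip)

/-- Computes the labels of the qubits. -/
def computeLabels : Prog :=
  .count 10 0 (.store 11 [.var 10] (.var 10)) ;; .count 64 1 labelLayer

theorem computeLabels_spec {m : Memory} (h : Inputs C N ε L K J m) {S : Finset (Fin n)}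
    (hS : HoldsBits m 9 fun i => decide (i ∉ S)) :
    HoldsLabels (computeLabels.den m) (C.labels S) := by
  set m₁ := (Prog.count 10 0 (.store 11 [.var 10] (.var 10))).den m with hm₁
  have hid : HoldsLabels m₁ (id : Fin n → Fin n) := by
    have key := count_induction (x := 10) (p := 0) (c := .store 11 [.var 10] (.var 10)) h.n_eq
      (fun i m' => ∀ j : Fin n, i ≤ (j : ℕ) → m'.arr 11 [((j : ℕ) : ℤ)] = ((j : ℕ) : ℤ)) ?_ ?_
    · exact fun j => key j (Nat.zero_le _)
    · intro j hj; exact absurd j.2 (not_lt.2 hj)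
    · intro i hi m' hF hP j hj
      by_cases hij : (j : ℕ) = i
      · simp [Prog.den, Memory.setVar_var, Memory.setArr_arr, hij]
      · have := hP j (by omega)
        simp [Prog.den, Memory.setVar_var, Memory.setArr_arr, hij, this]
  have F₁ : Frame (Prog.count 10 0 (.store 11 [.var 10] (.var 10))) m m₁ := Frame.den _ _
  have h₁ := h.of_frame (by decide) F₁
  have hS₁ : HoldsBits m₁ 9 fun i => decide (i ∉ S) := fun i => by
    rw [F₁.2 9 (by decide)]; exact hS i
  rw [computeLabels, Prog.den_seq, ← hm₁, IQPCircuit.labels]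
  refine count_rel h₁.d_eq HoldsLabels hid ?_
  intro l hl m' lab hF hlab
  have hI' := (h₁.of_frame (by decide) hF).setVar (x := 64) (by norm_num) l
  refine count_rel hI'.n_eq HoldsLabels hlab ?_
  intro g hg m'' lb hF' hlb
  set m₂ := m''.setVar 65 g with hm₂
  have hI₂ : Inputs C N ε L K J m₂ := (hI'.of_frame (by decide) hF').setVar (by norm_num) _
  have v64 : m₂.var 64 = l := by
    rw [hm₂, Memory.setVar_var, if_neg (by norm_num), hF'.1 64 (by decide)]
    simp [Memory.setVar_var]
  have v65 : m₂.var 65 = g := by simp [hm₂, Memory.setVar_var]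
  have hl3 : m₂.arr 3 [(l : ℤ), (g : ℤ)] = (C.gateAt l g).elim 0 fun G => (G.arity : ℤ) := by
    rw [hI₂.arr_eq 3 (by norm_num), inputArr_three]
  rw [Prog.den_seq]
  cases hG : C.gateAt l g with
  | none =>
      rw [hG] at hl3
      have : (Prog.load 46 3 [.var 64, .var 65]).den m₂ = m₂.setVar 46 0 := by
        simp [Prog.den, v64, v65, hl3]
      rw [this, Prog.den, if_neg (by simp [Memory.setVar_var])]
      exact hlb
  | some G =>
      rw [hG] at hl3
      have : (Prog.load 46 3 [.var 64, .var 65]).den m₂ = m₂.setVar 46 G.arity := by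
        simp [Prog.den, v64, v65, hl3]
      have hpos := G.arity_pos
      rw [this, Prog.den, if_pos (by simp [Memory.setVar_var]; omega)]
      refine mergeGate_spec (hI₂.setVar (by norm_num) _) (S := S) ?_ hlb hG
        (by simp [Memory.setVar_var, v64]) (by simp [Memory.setVar_var, v65])
        (by simp [Memory.setVar_var])
      intro i
      have := hS₁ i
      rw [Memory.setVar_arr, hm₂, Memory.setVar_arr, hF'.2 9 (by decide), Memory.setVar_arr,
        hF.2 9 (by decide)]
      exact this

end Records


/-! ### The deterministic part of the algorithm -/

section Deterministic

variable {n k d : ℕ} {C : IQPCircuit n k d} {N : PauliNoise} {ε : ℝ} {L K J : ℕ}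

/-- The four thresholds for the random numbers that determine the noise, for probabilities
`x / 2 ^ K`, `y / 2 ^ K` and `z / 2 ^ K` of the Pauli errors. -/
def threshold (x y z : ℤ) : Fin 4 → ℤ :=
  ![2 * z, 2 * z + x + y - max (x - y) 0 - max (y - x) 0, 2 * z + x + y - max (y - x) 0,
    2 * z + x + y]

/-- Computes the thresholds from the rounded probabilities in the variables `20`, `21`, `22`. -/
def computeThresholds : Prog :=
  .cond (.var 20 - .var 21) (.assign 23 (.var 20 - .var 21)) (.assign 23 0) ;;
  .cond (.var 21 - .var 20) (.assign 24 (.var 21 - .var 20)) (.assign 24 0) ;;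
  .assign 25 (.var 22 + .var 22) ;;
  .assign 26 (.var 25 + .var 20 + .var 21 - .var 23 - .var 24) ;;
  .assign 27 (.var 26 + .var 23) ;; .assign 28 (.var 27 + .var 24)

theorem computeThresholds_spec {m : Memory} {x y z : ℤ} (hx : m.var 20 = x) (hy : m.var 21 = y)
    (hz : m.var 22 = z) :
    (computeThresholds.den m).var 25 = threshold x y z 0 ∧
    (computeThresholds.den m).var 26 = threshold x y z 1 ∧
    (computeThresholds.den m).var 27 = threshold x y z 2 ∧
    (computeThresholds.den m).var 28 = threshold x y z 3 := by
  have e1 : (Prog.cond (.var 20 - .var 21) (.assign 23 (.var 20 - .var 21)) (.assign 23 0)).den m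
      = m.setVar 23 (max (x - y) 0) := by
    by_cases h : 0 < x - y
    · simp only [Prog.den, Expr.eval_sub, Expr.eval_var, hx, hy, if_pos h, max_eq_left h.le]
    · simp only [Prog.den, Expr.eval_sub, Expr.eval_var, hx, hy, if_neg h,
        max_eq_right (not_lt.1 h), Expr.eval_zero]
  have e2 : ∀ m : Memory, m.var 20 = x → m.var 21 = y →
      (Prog.cond (.var 21 - .var 20) (.assign 24 (.var 21 - .var 20)) (.assign 24 0)).den m
      = m.setVar 24 (max (y - x) 0) := by
    intro m hx hy
    by_cases h : 0 < y - x
    · simp only [Prog.den, Expr.eval_sub, Expr.eval_var, hx, hy, if_pos h, max_eq_left h.le]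
    · simp only [Prog.den, Expr.eval_sub, Expr.eval_var, hx, hy, if_neg h,
        max_eq_right (not_lt.1 h), Expr.eval_zero]
  simp only [computeThresholds, Prog.den_seq]
  rw [e1, e2 _ (by simp [Memory.setVar_var, hx]) (by simp [Memory.setVar_var, hy])]
  refine ⟨?_, ?_, ?_, ?_⟩ <;> simp [Prog.den, Memory.setVar_var, hx, hy, hz, threshold] <;> ring

/-- The deterministic part of the algorithm: it finds the noise record and the labels that belong
to the random numbers, and samples the outcomes of all classes. -/
def deterministicPart : Prog :=
  readParam 0 20 ;; readParam 1 21 ;; readParam 2 22 ;; computeThresholds ;; noiseRecord ;;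
  computeLabels ;; sampleClasses

/-- The rounded noise parameters, as thresholds. -/
noncomputable def PauliNoise.thresholds (N : PauliNoise) (K : ℕ) : Fin 4 → ℤ :=
  threshold (truncInt K N.pX) (truncInt K N.pY) (truncInt K N.pZ)

/-- The noise record that the algorithm finds. -/
noncomputable def PauliNoise.record (N : PauliNoise) (K : ℕ) (u : Fin d → Fin n → ℤ) :
    Fin d → Fin n → Fin 5 :=
  recordOf (N.thresholds K 0) (N.thresholds K 1) (N.thresholds K 2) (N.thresholds K 3) u

theorem PauliNoise.abs_lt_two (N : PauliNoise) : |N.pX| < 2 ∧ |N.pY| < 2 ∧ |N.pZ| < 2 := by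
  have h1 := N.sum_eq_one
  have h2 := N.pI_nonneg
  have h3 := N.pX_nonneg
  have h4 := N.pY_nonneg
  have h5 := N.pZ_nonneg
  refine ⟨?_, ?_, ?_⟩ <;> rw [abs_lt] <;> constructor <;> linarith

/-- If all clusters are small and the random number of each class selects the bits of `b` in this
class, then the output is `b`. -/
theorem deterministicPart_spec {m : Memory} (h : Inputs C N ε L K (C.precision L K) m)
    (hL : 1 ≤ L) {u : Fin d → Fin n → ℤ} {z b : Bits n} {U : Fin n → ℕ}
    (hu : ∀ (l : Fin d) (i : Fin n), m.arr 7 [((l : ℕ) : ℤ), ((i : ℕ) : ℤ)] = u l i)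
    (hz : HoldsBits m 16 z) (hU : ∀ v : Fin n, m.arr 17 [((v : ℕ) : ℤ)] = U v)
    {ω : Fin d → Fin n → Fin 5} (hω : ω = N.record K u)
    (hb : ∀ i ∉ survivors ω, m.arr 6 [((i : ℕ) : ℤ)] = bitVal (b i))
    (hsmall : C.SmallClusters L (survivors ω))
    (hch : ∀ v, ∃ t < 2 ^ #(C.group (survivors ω) v),
      (∀ i ∈ C.group (survivors ω) v, decodeBits (C.group (survivors ω) v) t i
        = (b i ^^ signFlip ω i)) ∧
      ∑ t ∈ Ico (t + 1) (2 ^ #(C.group (survivors ω) v)),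
        C.classWeight L K (C.group (survivors ω) v) (flipsOf ω) z t ≤ U v ∧
      (U v : ℝ) < ∑ t ∈ Ico t (2 ^ #(C.group (survivors ω) v)),
        C.classWeight L K (C.group (survivors ω) v) (flipsOf ω) z t) :
    HoldsBits (deterministicPart.den m) 6 b := by
  obtain ⟨bX, bY, bZ⟩ := N.abs_lt_two
  simp only [deterministicPart, Prog.den_seq]
  have r1 := readParam_spec h (i := 0) (x := 20) (q := N.pX) (by norm_num)
    (fun j => by simp [inputArr]) bX
  set m₁ := (readParam 0 20).den m with hm₁
  have F₁ : Frame (readParam 0 20) m m₁ := Frame.den _ _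
  have h₁ := h.of_frame (by decide) F₁
  have r2 := readParam_spec h₁ (i := 1) (x := 21) (q := N.pY) (by norm_num)
    (fun j => by simp [inputArr]) bY
  set m₂ := (readParam 1 21).den m₁ with hm₂
  have F₂ : Frame (readParam 1 21) m₁ m₂ := Frame.den _ _
  have h₂ := h₁.of_frame (by decide) F₂
  have r3 := readParam_spec h₂ (i := 2) (x := 22) (q := N.pZ) (by norm_num)
    (fun j => by simp [inputArr]) bZ
  set m₃ := (readParam 2 22).den m₂ with hm₃
  have F₃ : Frame (readParam 2 22) m₂ m₃ := Frame.den _ _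
  have h₃ := h₂.of_frame (by decide) F₃
  obtain ⟨t1, t2, t3, t4⟩ := computeThresholds_spec (m := m₃)
    (((F₃.1 20 (by decide)).trans (F₂.1 20 (by decide))).trans r1)
    ((F₃.1 21 (by decide)).trans r2) r3
  set m₄ := computeThresholds.den m₃ with hm₄
  have F₄ : Frame computeThresholds m₃ m₄ := Frame.den _ _
  have h₄ := h₃.of_frame (by decide) F₄
  have a₄ : m₄.arr = m.arr := by
    funext a
    rw [F₄.2 a (by simp [computeThresholds, Prog.modA]), F₃.2 a (by simp [readParam, Prog.modA]),
      F₂.2 a (by simp [readParam, Prog.modA]), F₁.2 a (by simp [readParam, Prog.modA])]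
  obtain ⟨s8, s9, s10⟩ := noiseRecord_spec h₄ t1 t2 t3 t4 (u := u)
    (fun l i => by rw [a₄]; exact hu l i) hω
  set m₅ := noiseRecord.den m₄ with hm₅
  have F₅ : Frame noiseRecord m₄ m₅ := Frame.den _ _
  have h₅ := h₄.of_frame (by decide) F₅
  have hlab := computeLabels_spec h₅ s9
  set m₆ := computeLabels.den m₅ with hm₆
  have F₆ : Frame computeLabels m₅ m₆ := Frame.den _ _
  have h₆ := h₅.of_frame (by decide) F₆
  have a₆ : ∀ a, a ∉ noiseRecord.modA → a ∉ computeLabels.modA → m₆.arr a = m.arr a := by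
    intro a ha ha'
    rw [F₆.2 a ha', F₅.2 a ha, a₄]
  refine sampleClasses_spec h₆ hL (S := survivors ω) (lab := C.labels (survivors ω)) (U := U)
    (c := signFlip ω) (f := flipsOf ω) (z := z) hlab ?_ ?_ ?_ ?_ ?_ ?_ ?_ ?_
  · intro i; rw [F₆.2 9 (by decide)]; exact s9 i
  · intro l hl i; rw [F₆.2 8 (by decide)]; exact s8 l hl i
  · intro i; rw [a₆ 16 (by decide) (by decide)]; exact hz i
  · intro i; rw [F₆.2 10 (by decide)]; exact s10 i
  · intro v; rw [a₆ 17 (by decide) (by decide)]; exact hU v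
  · intro i hi; rw [a₆ 6 (by decide) (by decide)]; exact hb i hi
  · exact fun v => IQPCircuit.card_group_le hsmall v
  · intro v
    obtain ⟨t, ht, h1, h2, h3⟩ := hch v
    exact ⟨t, ht, fun i hi hl => h1 i (IQPCircuit.mem_group.2 ⟨hi, hl⟩), h2, h3⟩

/-- Counts the gates and computes the precision that is needed for the classes. -/
def computePrecision : Prog :=
  .assign 7 (.var 3 + .var 3) ;;
  .count 10 1 (.count 11 0 (.load 12 3 [.var 10, .var 11] ;;
    .cond (.var 12) (.assign 7 (.var 7 + .var 5 + .var 5)) .skip))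

theorem gateCount_eq_zero_or {C : IQPCircuit n k d} {l g : ℕ} :
    (C.gateCount l g = 0 ∧ (C.gateAt l g).elim (0 : ℤ) (fun G => (G.arity : ℤ)) ≤ 0) ∨
    (C.gateCount l g = 1 ∧ 0 < (C.gateAt l g).elim (0 : ℤ) (fun G => (G.arity : ℤ))) := by
  unfold IQPCircuit.gateCount
  cases h : C.gateAt l g with
  | none => simp
  | some G => have := G.arity_pos; simp; omega

/-- After this program, the variable `7` holds the precision. -/
theorem computePrecision_spec {m : Memory} (h : Inputs C N ε L K J m) :
    Inputs C N ε L K (C.precision L K) (computePrecision.den m) := by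
  set c₁ : Prog := .load 12 3 [.var 10, .var 11] ;;
    .cond (.var 12) (.assign 7 (.var 7 + .var 5 + .var 5)) .skip with hc₁
  set m₁ := m.setVar 7 (L + L : ℕ) with hm₁
  have e : computePrecision.den m = (Prog.count 10 1 (.count 11 0 c₁)).den m₁ := by
    rw [computePrecision, Prog.den_seq]
    congr 1
    simp [Prog.den, h.L_eq, hm₁]
  have F := Frame.den computePrecision m
  have key := count_induction (x := 10) (p := 1) (c := .count 11 0 c₁) (N := d) (m := m₁)
    (by simpa [hm₁, Memory.setVar_var] using h.d_eq)
    (fun l m' => m'.var 7 + 2 * K * C.gatesUpTo l = C.precision L K) ?_ ?_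
  · have hv : ∀ x, x < 7 → (computePrecision.den m).var x = m.var x := by
      intro x hx
      exact F.1 x (by simp [computePrecision, Prog.modV]; omega)
    constructor
    · rw [hv _ (by norm_num), h.n_eq]
    · rw [hv _ (by norm_num), h.d_eq]
    · rw [hv _ (by norm_num), h.k_eq]
    · rw [hv _ (by norm_num), h.L_eq]
    · rw [hv _ (by norm_num), h.M_eq]
    · rw [hv _ (by norm_num), h.K_eq]
    · rw [hv _ (by norm_num), h.K1_eq]
    · rw [e]; simpa [IQPCircuit.gatesUpTo] using key
    · intro a ha
      rw [F.2 a (by simp [computePrecision, Prog.modA]), h.arr_eq a ha]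
  · simp only [hm₁, Memory.setVar_var, IQPCircuit.precision]
    push_cast
    ring
  · intro l hl m' hF hP
    set m₂ := m'.setVar 10 l with hm₂
    have n₂ : m₂.var 0 = n := by
      rw [hm₂, Memory.setVar_var, if_neg (by norm_num), hF.1 0 (by rw [hc₁]; decide), hm₁,
        Memory.setVar_var, if_neg (by norm_num), h.n_eq]
    have key' := count_induction (x := 11) (p := 0) (c := c₁) (N := n) (m := m₂) n₂
      (fun g m'' => m''.var 7 + 2 * K * (∑ j ∈ range g, (C.gateCount l j : ℤ))
        = m'.var 7 + 2 * K * ∑ j ∈ range n, (C.gateCount l j : ℤ)) ?_ ?_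
    · simp only [range_zero, sum_empty, mul_zero, add_zero] at key'
      rw [key', ← hP, IQPCircuit.gatesUpTo, IQPCircuit.gatesUpTo, sum_range_succ]
      push_cast
      ring
    · simp [hm₂, Memory.setVar_var]
    · intro g hg m'' hF' hP'
      rw [← hP', sum_range_succ]
      have v10 : m''.var 10 = l := by
        rw [hF'.1 10 (by rw [hc₁]; decide), hm₂]; simp [Memory.setVar_var]
      have v5 : m''.var 5 = K := by
        rw [hF'.1 5 (by rw [hc₁]; decide), hm₂, Memory.setVar_var, if_neg (by norm_num),
          hF.1 5 (by rw [hc₁]; decide), hm₁, Memory.setVar_var, if_neg (by norm_num), h.K_eq]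
      have a3 : m''.arr 3 [(l : ℤ), (g : ℤ)]
          = (C.gateAt l g).elim 0 fun G => (G.arity : ℤ) := by
        rw [hF'.2 3 (by rw [hc₁]; decide), hm₂, Memory.setVar_arr, hF.2 3 (by rw [hc₁]; decide),
          hm₁, Memory.setVar_arr, h.arr_eq 3 (by norm_num), inputArr_three]
      rcases gateCount_eq_zero_or (C := C) (l := l) (g := g) with ⟨q1, q2⟩ | ⟨q1, q2⟩
      · rw [q1]
        simp [hc₁, Prog.den, Memory.setVar_var, v10, a3, not_lt.2 q2]
      · rw [q1]
        simp [hc₁, Prog.den, Memory.setVar_var, v10, v5, a3, q2]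
        ring

end Deterministic


/-! ### Coin flips -/

/-- Starting from the memory `m`, the command `c` terminates after exactly `t` steps, and the final
memory is a function of a uniformly random element of `α`, related to this element by `P`. -/
def RandExec (c : Cmd) (m : Memory) (t : ℕ) (α : Type) [Fintype α] [Nonempty α]
    (P : α → Memory → Prop) : Prop :=
  ∃ F : α → Memory, Exec c m t ((PMF.uniformOfFintype α).map F) ∧ ∀ a, P a (F a)

section Overlay

variable {α : Type}

/-- The function `g` with its first `i` values replaced. -/
def overlay {i : ℕ} (g : ℕ → α) (r : Fin i → α) : ℕ → α :=
  fun j => if h : j < i then r ⟨j, h⟩ else g j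

/-- Choosing the value at `i` first and the smaller ones afterwards, as the loops do. -/
theorem overlay_snoc {i : ℕ} (g : ℕ → α) (r : Fin i → α) (a : α) :
    overlay g (Fin.snoc (α := fun _ => α) r a) = overlay (Function.update g i a) r := by
  funext j
  unfold overlay
  rcases lt_trichotomy j i with h | rfl | h
  · have h' : j < i + 1 := by omega
    simp only [h, h', dif_pos]
    exact Fin.snoc_castSucc (α := fun _ => α) a r ⟨j, h⟩
  · simp only [Nat.lt_succ_self, lt_irrefl, dif_pos, dif_neg, not_false_eq_true,
      Function.update_self]
    exact Fin.snoc_last (α := fun _ => α) a r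
  · have h1 : ¬ j < i := by omega
    have h2 : ¬ j < i + 1 := by omega
    simp [h1, h2, h.ne']

end Overlay

section Coins

variable {α β : Type} [Fintype α] [Nonempty α] [Fintype β] [Nonempty β]

theorem RandExec.mono {c : Cmd} {m : Memory} {t : ℕ} {P Q : α → Memory → Prop}
    (h : RandExec c m t α P) (hPQ : ∀ a m', P a m' → Q a m') : RandExec c m t α Q := by
  obtain ⟨F, h1, h2⟩ := h
  exact ⟨F, h1, fun a => hPQ a _ (h2 a)⟩

theorem map_uniformOfFintype (e : α ≃ β) :
    (PMF.uniformOfFintype α).map e = PMF.uniformOfFintype β := by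
  classical
  ext b
  rw [PMF.map_apply, tsum_eq_single (e.symm b)]
  · simp [Fintype.card_congr e]
  · intro a ha
    rw [if_neg]
    rintro rfl
    exact ha (by simp)

/-- The random element may be replaced by its image under a bijection, which is uniform as well. -/
theorem RandExec.equiv {c : Cmd} {m : Memory} {t : ℕ} {P : α → Memory → Prop} (e : β ≃ α)
    (h : RandExec c m t α P) : RandExec c m t β fun b => P (e b) := by
  obtain ⟨F, h1, h2⟩ := h
  refine ⟨F ∘ e, ?_, fun b => h2 (e b)⟩
  rwa [← PMF.map_comp, map_uniformOfFintype]

theorem bind_uniformOfFintype {γ : Type} (G : α → β → γ) :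
    ((PMF.uniformOfFintype α).bind fun a => (PMF.uniformOfFintype β).map (G a))
      = (PMF.uniformOfFintype (α × β)).map fun p => G p.1 p.2 := by
  have key : ((PMF.uniformOfFintype α).bind fun a => (PMF.uniformOfFintype β).map (Prod.mk a))
      = PMF.uniformOfFintype (α × β) := by
    classical
    ext ⟨a, b⟩
    rw [PMF.bind_apply, tsum_eq_single a]
    · rw [PMF.map_apply, tsum_eq_single b]
      · simp only [PMF.uniformOfFintype_apply, if_true, Fintype.card_prod, Nat.cast_mul]
        rw [ENNReal.mul_inv (by simp) (by simp)]
      · intro b' hb'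
        rw [if_neg]
        simpa using hb'.symm
    · intro a' ha'
      rw [PMF.map_apply]
      simp [ha'.symm]
  rw [← key, PMF.map_bind]
  simp only [PMF.map_comp]
  rfl

/-- The coins of consecutive commands are independent, so the pair is uniformly random. -/
theorem RandExec.seq {c₁ c₂ : Cmd} {m : Memory} {t₁ t₂ : ℕ} {P : α → Memory → Prop}
    {Q : α → β → Memory → Prop} (h₁ : RandExec c₁ m t₁ α P)
    (h₂ : ∀ a m', P a m' → RandExec c₂ m' t₂ β (Q a)) :
    RandExec (.seq c₁ c₂) m (1 + t₁ + t₂) (α × β) fun p m' => Q p.1 p.2 m' := by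
  obtain ⟨F, e₁, p₁⟩ := h₁
  choose G e₂ p₂ using fun a => h₂ a (F a) (p₁ a)
  refine ⟨fun p => G p.1 p.2, ?_, fun p => p₂ p.1 p.2⟩
  intro K s
  rw [Nat.add_assoc, Nat.add_assoc, runFor_add_one]
  simp only [step, PMF.pure_bind]
  rw [e₁, PMF.bind_map, ← bind_uniformOfFintype, PMF.bind_bind]
  congr 1
  funext a
  exact e₂ a K s

theorem RandExec.of_pure {c : Cmd} {m m' : Memory} {t : ℕ} {P : Memory → Prop}
    (h : Exec c m t (PMF.pure m')) (hP : P m') : RandExec c m t Unit fun _ => P := by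
  refine ⟨fun _ => m', ?_, fun _ => hP⟩
  have : (PMF.uniformOfFintype Unit).map (fun _ => m') = PMF.pure m' := PMF.map_const _ _
  rwa [this]

theorem RandExec.seq_pure {c₁ c₂ : Cmd} {m : Memory} {t₁ t₂ : ℕ} {P : α → Memory → Prop}
    {Q : α → Memory → Prop} (h₁ : RandExec c₁ m t₁ α P)
    (h₂ : ∀ a m', P a m' → ∃ m'', Exec c₂ m' t₂ (PMF.pure m'') ∧ Q a m'') :
    RandExec (.seq c₁ c₂) m (1 + t₁ + t₂) α Q :=
  (h₁.seq (β := Unit) (Q := fun a _ => Q a) fun a m' hp => by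
    obtain ⟨m'', e, hq⟩ := h₂ a m' hp
    exact RandExec.of_pure e hq).equiv (Equiv.prodPUnit α).symm

theorem RandExec.pure_seq {c₁ c₂ : Cmd} {m m' : Memory} {t₁ t₂ : ℕ} {P : α → Memory → Prop}
    (h₁ : Exec c₁ m t₁ (PMF.pure m')) (h₂ : RandExec c₂ m' t₂ α P) :
    RandExec (.seq c₁ c₂) m (1 + t₁ + t₂) α P := by
  obtain ⟨F, e, p⟩ := h₂
  exact ⟨F, exec_seq_pure h₁ e, p⟩

theorem RandExec.flip (x : ℕ) (m : Memory) :
    RandExec (.flip x) m 1 Bool fun b m' => m' = m.setVar x (bitVal b) :=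
  ⟨_, exec_flip x m, fun _ => rfl⟩

/-- A counting loop whose body, which takes `t` steps, uses a random element of `α` in every
iteration. -/
theorem RandExec.count {x p : ℕ} {c : Cmd} {N t : ℕ} {m : Memory} (hN : m.var p = N)
    (P : ℕ → (ℕ → α) → Memory → Prop) (h0 : ∀ g, P N g (m.setVar x N))
    (hx : ∀ i g m', P i g m' → m'.var x = i)
    (hs : ∀ i < N, ∀ g m', P (i + 1) g m' →
      RandExec c (m'.setVar x i) t α fun a => P i (Function.update g i a)) :
    RandExec (Prog.countCmd x p c) m (N * (t + 3) + 3) (Fin N → α) fun r m' =>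
      ∃ g : ℕ → α, (∀ j : Fin N, g j = r j) ∧ P 0 g m' := by
  have key : ∀ i ≤ N, ∀ g m', P i g m' → RandExec
      (.loop (.var x) (.seq (.assign x (.sub (.var x) (.const 1))) c)) m' (i * (t + 3) + 1)
      (Fin i → α) fun r => P 0 (overlay g r) := by
    intro i
    induction i with
    | zero =>
        intro _ g m' hP
        have e := exec_loop_false (e := .var x) (c := .seq (.assign x (.sub (.var x) (.const 1))) c)
          (m := m') (by simp [hx 0 g m' hP])
        rw [zero_mul, zero_add]
        refine (RandExec.of_pure (P := P 0 g) e hP).equiv (Equiv.ofUnique (Fin 0 → α) Unit)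
          |>.mono ?_
        intro r m'' h
        have : overlay g r = g := by funext j; simp [overlay]
        rwa [this]
    | succ i ih =>
        intro hi g m' hP
        have hx' := hx _ _ _ hP
        have hb := hs i (by omega) g m' hP
        have e₀ := exec_assign x (.sub (.var x) (.const 1)) m'
        have hv : (Expr.sub (.var x) (.const 1)).eval m' = (i : ℤ) := by
          simp [Expr.eval, hx']
        rw [hv] at e₀
        obtain ⟨F, e₁, p₁⟩ := RandExec.pure_seq e₀ hb
        choose G e₂ p₂ using fun a => ih (by omega) _ _ (p₁ a)
        have hloop : RandExec
            (.loop (.var x) (.seq (.assign x (.sub (.var x) (.const 1))) c)) m'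
            ((i + 1) * (t + 3) + 1) (α × (Fin i → α))
            (fun q => P 0 (overlay (Function.update g i q.1) q.2)) := by
          refine ⟨fun q => G q.1 q.2, ?_, fun q => p₂ q.1 q.2⟩
          have ht : (i + 1) * (t + 3) + 1 = 1 + (1 + 1 + t) + (i * (t + 3) + 1) := by ring
          intro K s
          rw [ht, Nat.add_assoc, Nat.add_assoc, runFor_add_one]
          have hpos : 0 < Expr.eval m' (.var x) := by simp [hx']
          simp only [step, hpos, if_true, PMF.pure_bind]
          rw [e₁, PMF.bind_map, ← bind_uniformOfFintype, PMF.bind_bind]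
          congr 1
          funext a
          exact e₂ a K s
        refine (hloop.equiv ((Fin.snocEquiv fun _ => α).symm)).mono ?_
        intro r m'' h
        have hr : r = Fin.snoc (α := fun _ => α) ((Fin.snocEquiv fun _ => α).symm r).2
            ((Fin.snocEquiv fun _ => α).symm r).1 :=
          ((Fin.snocEquiv fun _ => α).apply_symm_apply r).symm
        rw [hr, overlay_snoc]
        exact h
  obtain ⟨a₀⟩ := (inferInstance : Nonempty α)
  have e := RandExec.pure_seq (exec_assign x (.var p) m)
    (key N le_rfl (fun _ => a₀) _ (by rw [Expr.eval_var, hN]; exact h0 _))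
  have ht : 1 + 1 + (N * (t + 3) + 1) = N * (t + 3) + 3 := by ring
  rw [ht] at e
  exact e.mono fun r m' h => ⟨_, fun j => by simp [overlay], h⟩

end Coins


/-! ### Filling arrays with random numbers -/

/-- The memories agree except on the variables in `V` and the arrays in `A`. -/
def SameExcept (V A : List ℕ) (m m' : Memory) : Prop :=
  (∀ y, y ∉ V → m'.var y = m.var y) ∧ ∀ a, a ∉ A → m'.arr a = m.arr a

theorem SameExcept.refl (V A : List ℕ) (m : Memory) : SameExcept V A m m :=
  ⟨fun _ _ => rfl, fun _ _ => rfl⟩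

theorem SameExcept.trans {V A : List ℕ} {m₁ m₂ m₃ : Memory} (h : SameExcept V A m₁ m₂)
    (h' : SameExcept V A m₂ m₃) : SameExcept V A m₁ m₃ :=
  ⟨fun y hy => (h'.1 y hy).trans (h.1 y hy), fun a ha => (h'.2 a ha).trans (h.2 a ha)⟩

theorem SameExcept.mono {V A V' A' : List ℕ} {m m' : Memory} (h : SameExcept V A m m')
    (hV : V ⊆ V') (hA : A ⊆ A') : SameExcept V' A' m m' :=
  ⟨fun y hy => h.1 y fun e => hy (hV e), fun a ha => h.2 a fun e => ha (hA e)⟩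

theorem SameExcept.setVar {V A : List ℕ} {m m' : Memory} (h : SameExcept V A m m') {x : ℕ}
    (hx : x ∈ V) (v : ℤ) : SameExcept V A m (m'.setVar x v) := by
  refine ⟨fun y hy => ?_, fun a ha => ?_⟩
  · rw [Memory.setVar_var, if_neg (fun e => hy (by rwa [e])), h.1 y hy]
  · rw [Memory.setVar_arr, h.2 a ha]

theorem SameExcept.setArr {V A : List ℕ} {m m' : Memory} (h : SameExcept V A m m') {a : ℕ}
    (ha : a ∈ A) (idx : List ℤ) (v : ℤ) : SameExcept V A m (m'.setArr a idx v) := by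
  refine ⟨fun y hy => ?_, fun b hb => ?_⟩
  · rw [Memory.setArr_var, h.1 y hy]
  · rw [Memory.setArr_arr_ne _ _ _ _ _ (fun e => hb (by rwa [e])), h.2 b hb]

/-- Fills the first `n` cells of the array `a` with random bits. -/
def fillBits (a : ℕ) : Cmd :=
  Prog.countCmd 10 0 (.seq (.flip 12) (.store a [.var 10] (.var 12)))

theorem fillBits_spec {m : Memory} {n : ℕ} (hn : m.var 0 = n) (a : ℕ) :
    RandExec (fillBits a) m (n * (3 + 3) + 3) (Bits n) fun s m' =>
      HoldsBits m' a s ∧ SameExcept [10, 12] [a] m m' := by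
  refine (RandExec.count (α := Bool) (t := 3) hn
    (fun i g m' => m'.var 10 = i ∧ SameExcept [10, 12] [a] m m' ∧
      ∀ j : Fin n, i ≤ (j : ℕ) → m'.arr a [((j : ℕ) : ℤ)] = bitVal (g j)) ?_ ?_ ?_).mono ?_
  · intro g
    exact ⟨by simp [Memory.setVar_var], (SameExcept.refl _ _ _).setVar (by simp) _,
      fun j hj => absurd j.2 (not_lt.2 hj)⟩
  · exact fun i g m' h => h.1
  · rintro i hi g m' ⟨-, h2, h3⟩
    refine (RandExec.flip 12 (m'.setVar 10 i)).seq_pure (t₂ := 1) ?_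
    rintro b _ rfl
    refine ⟨_, exec_store _ _ _ _, ?_, ?_, ?_⟩
    · simp [Memory.setVar_var]
    · exact ((h2.setVar (by simp) _).setVar (by simp) _).setArr (by simp) _ _
    · intro j hj
      by_cases hij : (j : ℕ) = i
      · simp [Memory.setArr_arr, Memory.setVar_var, hij]
      · simp [Memory.setArr_arr, Memory.setVar_var, hij, h3 j (by omega)]
  · rintro r m' ⟨g, hg, -, h2, h3⟩
    exact ⟨fun j => by rw [h3 j (Nat.zero_le _), hg j], h2⟩

/-- The number with the binary digits `s`. -/
def ofBits {K : ℕ} (s : Fin K → Bool) : ℕ := ∑ i, (s i).toNat * 2 ^ (i : ℕ)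

/-- Sets the variable `74` to a random number with as many binary digits as the variable `p`
says. -/
def drawInt (p : ℕ) : Cmd :=
  .seq (.assign 74 0)
    (Prog.countCmd 75 p (.seq (.flip 12) (.assign 74 (.var 74 + .var 74 + .var 12))))

theorem drawInt_spec {m : Memory} {K p : ℕ} (hp : m.var p = K) (hp74 : p ≠ 74) :
    RandExec (drawInt p) m (1 + 1 + (K * (3 + 3) + 3)) (Fin K → Bool) fun s m' =>
      m'.var 74 = ofBits s ∧ SameExcept [74, 75, 12] [] m m' := by
  refine RandExec.pure_seq (exec_assign 74 0 m) ?_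
  set m₀ := m.setVar 74 (Expr.eval m 0) with hm₀
  refine (RandExec.count (α := Bool) (t := 3) (N := K)
    (by simpa [hm₀, Memory.setVar_var, hp74] using hp)
    (fun i g m' => m'.var 75 = i ∧ SameExcept [74, 75, 12] [] m m' ∧
      m'.var 74 = ((∑ j ∈ Ico i K, (g j).toNat * 2 ^ (j - i) : ℕ) : ℤ)) ?_ ?_ ?_).mono ?_
  · intro g
    refine ⟨by simp [Memory.setVar_var], ?_, by simp [hm₀, Memory.setVar_var]⟩
    exact ((SameExcept.refl _ _ _).setVar (by simp) _).setVar (by simp) _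
  · exact fun i g m' h => h.1
  · rintro i hi g m' ⟨-, h2, h3⟩
    refine (RandExec.flip 12 (m'.setVar 75 i)).seq_pure (t₂ := 1) ?_
    rintro b _ rfl
    refine ⟨_, exec_assign _ _ _, ?_, ?_, ?_⟩
    · simp [Memory.setVar_var]
    · exact ((h2.setVar (by simp) _).setVar (by simp) _).setVar (by simp) _
    · rw [sum_eq_sum_Ico_succ_bot hi]
      have : ∑ j ∈ Ico (i + 1) K, (Function.update g i b j).toNat * 2 ^ (j - i)
          = 2 * ∑ j ∈ Ico (i + 1) K, (g j).toNat * 2 ^ (j - (i + 1)) := by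
        rw [mul_sum]
        refine sum_congr rfl fun j hj => ?_
        have hj' := (mem_Ico.1 hj).1
        rw [Function.update_of_ne (by omega), show j - i = (j - (i + 1)) + 1 by omega, pow_succ]
        ring
      rw [this]
      cases b <;> simp [Memory.setVar_var, h3, bitVal] <;> ring
  · rintro r m' ⟨g, hg, -, h2, h3⟩
    refine ⟨?_, h2⟩
    rw [h3, ofBits, ← range_eq_Ico, sum_range]
    simp only [Nat.sub_zero, hg]

/-- Fills a row of `n` cells of the array `a` with random numbers. -/
def fillInts (p a : ℕ) (idx : List Expr) : Cmd :=
  Prog.countCmd 77 0 (.seq (drawInt p) (.store a (idx ++ [.var 77]) (.var 74)))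

/-- The number of steps for filling a row. -/
def rowTime (n K : ℕ) : ℕ := n * (1 + (1 + 1 + (K * (3 + 3) + 3)) + 1 + 3) + 3

/-- A row of independent random numbers with `K` digits, written to the cells with the
indices `idx, 0`, `idx, 1`, …. -/
theorem fillInts_spec {m : Memory} {n K p a : ℕ} (hn : m.var 0 = n) (hp : m.var p = K)
    (hpV : p ∉ [74, 75, 12, 77]) {idx : List Expr} {vals : List ℤ}
    (hidx : ∀ m', SameExcept [74, 75, 12, 77] [a] m m' → idx.map (Expr.eval m') = vals) :
    RandExec (fillInts p a idx) m (rowTime n K) (Fin n → Fin K → Bool) fun s m' =>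
      (∀ i : Fin n, m'.arr a (vals ++ [((i : ℕ) : ℤ)]) = (ofBits (s i) : ℤ)) ∧
      (∀ idx', (∀ i : Fin n, idx' ≠ vals ++ [((i : ℕ) : ℤ)]) → m'.arr a idx' = m.arr a idx') ∧
      SameExcept [74, 75, 12, 77] [a] m m' := by
  simp only [List.mem_cons, List.not_mem_nil, or_false, not_or] at hpV
  refine (RandExec.count (α := Fin K → Bool) hn
    (fun i g m' => m'.var 77 = i ∧ SameExcept [74, 75, 12, 77] [a] m m' ∧
      (∀ j : Fin n, i ≤ (j : ℕ) → m'.arr a (vals ++ [((j : ℕ) : ℤ)]) = (ofBits (g j) : ℤ)) ∧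
      ∀ idx', (∀ i : Fin n, idx' ≠ vals ++ [((i : ℕ) : ℤ)]) → m'.arr a idx' = m.arr a idx')
      ?_ ?_ ?_).mono ?_
  · intro g
    exact ⟨by simp [Memory.setVar_var], (SameExcept.refl _ _ _).setVar (by simp) _,
      fun j hj => absurd j.2 (not_lt.2 hj), fun _ _ => rfl⟩
  · exact fun i g m' h => h.1
  · rintro i hi g m' ⟨-, h2, h3, h4⟩
    have hp' : (m'.setVar 77 i).var p = K := by
      rw [Memory.setVar_var, if_neg hpV.2.2.2, h2.1 p (by simp [hpV]), hp]
    refine (drawInt_spec hp' hpV.1).seq_pure (t₂ := 1) ?_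
    rintro b m₁ ⟨q1, q2⟩
    have hS : SameExcept [74, 75, 12, 77] [a] m m₁ :=
      (h2.setVar (by simp) _).trans (q2.mono (by simp) (by simp))
    have v77 : m₁.var 77 = i := by rw [q2.1 77 (by simp)]; simp [Memory.setVar_var]
    have a₁ : m₁.arr = m'.arr := by funext x; rw [q2.2 x (by simp)]; rfl
    refine ⟨_, exec_store _ _ _ _, ?_, ?_, ?_, ?_⟩
    · simp [v77]
    · exact hS.setArr (by simp) _ _
    · intro j hj
      have hidx₁ := hidx m₁ hS
      by_cases hij : (j : ℕ) = i
      · simp [Memory.setArr_arr, hidx₁, v77, hij, q1]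
      · simp [Memory.setArr_arr, hidx₁, v77, hij, a₁, h3 j (by omega)]
    · intro idx' hne
      have hidx₁ := hidx m₁ hS
      have := hne ⟨i, hi⟩
      simp only at this
      rw [← h4 idx' hne]
      simp [Memory.setArr_arr, hidx₁, v77, this, a₁]
  · rintro r m' ⟨g, hg, -, h2, h3, h4⟩
    exact ⟨fun i => by rw [h3 i (Nat.zero_le _), hg i], h4, h2⟩

/-- Draws the random numbers for the noise. -/
def fillNoise : Cmd := Prog.countCmd 76 1 (fillInts 5 7 [.var 76])

theorem fillNoise_spec {m : Memory} {n d K : ℕ} (hn : m.var 0 = n) (hd : m.var 1 = d)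
    (hK : m.var 5 = K) :
    RandExec fillNoise m (d * (rowTime n K + 3) + 3) (Fin d → Fin n → Fin K → Bool) fun s m' =>
      (∀ (l : Fin d) (i : Fin n), m'.arr 7 [((l : ℕ) : ℤ), ((i : ℕ) : ℤ)] = (ofBits (s l i) : ℤ)) ∧
      SameExcept [74, 75, 12, 77, 76] [7] m m' := by
  refine (RandExec.count (α := Fin n → Fin K → Bool) hd
    (fun l g m' => m'.var 76 = l ∧ SameExcept [74, 75, 12, 77, 76] [7] m m' ∧
      ∀ (j : Fin d), l ≤ (j : ℕ) → ∀ i : Fin n,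
        m'.arr 7 [((j : ℕ) : ℤ), ((i : ℕ) : ℤ)] = (ofBits (g j i) : ℤ)) ?_ ?_ ?_).mono ?_
  · intro g
    exact ⟨by simp [Memory.setVar_var], (SameExcept.refl _ _ _).setVar (by simp) _,
      fun j hj => absurd j.2 (not_lt.2 hj)⟩
  · exact fun i g m' h => h.1
  · rintro l hl g m' ⟨-, h2, h3⟩
    have hv : ∀ x, x ∉ [74, 75, 12, 77, 76] → (m'.setVar 76 l).var x = m.var x := by
      intro x hx
      rw [(h2.setVar (x := 76) (by simp) l).1 x hx]
    refine (fillInts_spec (a := 7) (idx := [.var 76]) (vals := [(l : ℤ)])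
      ((hv 0 (by decide)).trans hn) ((hv 5 (by decide)).trans hK) (by decide) ?_).mono ?_
    · intro m'' hS
      have : m''.var 76 = l := by rw [hS.1 76 (by decide)]; simp [Memory.setVar_var]
      simp [this]
    · rintro s m'' ⟨q1, q2, q3⟩
      refine ⟨?_, ?_, ?_⟩
      · rw [q3.1 76 (by decide)]; simp [Memory.setVar_var]
      · exact (h2.setVar (by simp) _).trans (q3.mono (by simp) (by simp))
      · intro j hj i
        by_cases hjl : (j : ℕ) = l
        · rw [hjl, Function.update_self]
          simpa using q1 i
        · rw [Function.update_of_ne hjl, q2, Memory.setVar_arr, h3 j (by omega) i]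
          intro i'
          simp [hjl]
  · rintro r m' ⟨g, hg, -, h2, h3⟩
    exact ⟨fun l i => by rw [h3 l (Nat.zero_le _) i, hg l], h2⟩

/-- Draws all random numbers that the deterministic part needs. -/
def drawCoins : Cmd := .seq fillNoise (.seq (fillInts 7 17 []) (fillBits 16))

/-- The random numbers that are used: for the noise, for the outcomes of the classes, and for the
state of the dephased qubits. -/
abbrev Coins (n d K J : ℕ) :=
  (Fin d → Fin n → Fin K → Bool) × (Fin n → Fin J → Bool) × Bits n

/-- The number of steps of `drawCoins`. -/
def coinTime (n d K J : ℕ) : ℕ :=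
  1 + (d * (rowTime n K + 3) + 3) + (1 + rowTime n J + (n * (3 + 3) + 3))

theorem drawCoins_spec {m : Memory} {n d K J : ℕ} (hn : m.var 0 = n) (hd : m.var 1 = d)
    (hK : m.var 5 = K) (hJ : m.var 7 = J) :
    RandExec drawCoins m (coinTime n d K J) (Coins n d K J) fun s m' =>
      (∀ (l : Fin d) (i : Fin n),
        m'.arr 7 [((l : ℕ) : ℤ), ((i : ℕ) : ℤ)] = (ofBits (s.1 l i) : ℤ)) ∧
      (∀ v : Fin n, m'.arr 17 [((v : ℕ) : ℤ)] = (ofBits (s.2.1 v) : ℤ)) ∧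
      HoldsBits m' 16 s.2.2 ∧ SameExcept [74, 75, 12, 77, 76, 10] [7, 17, 16] m m' := by
  refine (fillNoise_spec hn hd hK).seq (β := (Fin n → Fin J → Bool) × Bits n) (Q := fun s q m' =>
      (∀ (l : Fin d) (i : Fin n),
        m'.arr 7 [((l : ℕ) : ℤ), ((i : ℕ) : ℤ)] = (ofBits (s l i) : ℤ)) ∧
      (∀ v : Fin n, m'.arr 17 [((v : ℕ) : ℤ)] = (ofBits (q.1 v) : ℤ)) ∧
      HoldsBits m' 16 q.2 ∧ SameExcept [74, 75, 12, 77, 76, 10] [7, 17, 16] m m') ?_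
  rintro s m₁ ⟨a1, a2⟩
  refine (fillInts_spec (a := 17) (idx := []) (vals := []) (n := n) (K := J)
    ((a2.1 0 (by decide)).trans hn) ((a2.1 7 (by decide)).trans hJ) (by decide)
    (fun _ _ => rfl)).seq (β := Bits n) (Q := fun q r m' =>
      (∀ (l : Fin d) (i : Fin n),
        m'.arr 7 [((l : ℕ) : ℤ), ((i : ℕ) : ℤ)] = (ofBits (s l i) : ℤ)) ∧
      (∀ v : Fin n, m'.arr 17 [((v : ℕ) : ℤ)] = (ofBits (q v) : ℤ)) ∧
      HoldsBits m' 16 r ∧ SameExcept [74, 75, 12, 77, 76, 10] [7, 17, 16] m m') ?_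
  rintro q m₂ ⟨b1, -, b2⟩
  refine (fillBits_spec (n := n) (((b2.1 0 (by decide)).trans (a2.1 0 (by decide))).trans hn)
    16).mono ?_
  rintro r m₃ ⟨c1, c2⟩
  refine ⟨fun l i => ?_, fun v => ?_, c1, ?_⟩
  · rw [c2.2 7 (by decide), b2.2 7 (by decide), a1]
  · rw [c2.2 17 (by decide)]; exact b1 v
  · exact ((a2.mono (by simp) (by simp)).trans (b2.mono (by simp) (by simp))).trans
      (c2.mono (by simp) (by simp))


/-! ### Choosing the parameters -/

section Parameters

variable {n k d : ℕ} {C : IQPCircuit n k d} {N : PauliNoise} {ε : ℝ}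

/-- The first nonzero digit of the accuracy. -/
theorem exists_first_digit (hε : 0 < ε) (hε1 : ε ≤ 1) :
    ∃ j₀ : ℕ, 1 ≤ 2 ^ j₀ * ε ∧ 2 ^ j₀ * ε < 2 ∧ signedDigit ε j₀ = 1 ∧
      ∀ j < j₀, signedDigit ε j = 0 := by
  classical
  have hex : ∃ j : ℕ, 1 ≤ 2 ^ j * ε := by
    obtain ⟨j, hj⟩ := pow_unbounded_of_one_lt ε⁻¹ (by norm_num : (1 : ℝ) < 2)
    exact ⟨j, by rw [inv_lt_iff_one_lt_mul₀ hε] at hj; linarith⟩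
  have hlt : ∀ j < Nat.find hex, 2 ^ j * ε < 1 := fun j hj => not_le.1 (Nat.find_min hex hj)
  have h2 : 2 ^ Nat.find hex * ε < 2 := by
    rcases Nat.eq_zero_or_pos (Nat.find hex) with h | h
    · rw [h]; linarith
    · have := hlt (Nat.find hex - 1) (by omega)
      rw [show Nat.find hex = (Nat.find hex - 1) + 1 by omega, pow_succ]
      linarith
  have hs := sign_pos hε
  refine ⟨Nat.find hex, Nat.find_spec hex, h2, ?_, fun j hj => ?_⟩
  · have : ⌊2 ^ Nat.find hex * |ε|⌋ = 1 := by
      rw [abs_of_pos hε, Int.floor_eq_iff]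
      exact ⟨by exact_mod_cast Nat.find_spec hex, by push_cast; linarith⟩
    simp [signedDigit, hs, this]
  · have : ⌊2 ^ j * |ε|⌋ = 0 := by
      rw [abs_of_pos hε, Int.floor_eq_zero_iff]
      exact ⟨by positivity, hlt j hj⟩
    simp [signedDigit, this]

/-- Finds the first nonzero digit of the accuracy. -/
def findDigit : Cmd :=
  .seq (.assign 4 1) (.seq (.load 8 1 [.var 3])
    (.loop (1 - .var 8) (.seq (.assign 3 (.var 3 + 1)) (.seq (.assign 4 (.var 4 + .var 4))
      (.load 8 1 [.var 3])))))

/-- The search ends because `ε` is positive, and it finds the largest power of two that is at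
most `ε`. -/
theorem findDigit_spec {m : Memory} (h3 : m.var 3 = 0)
    (h1 : ∀ j : ℕ, m.arr 1 [(j : ℤ)] = signedDigit ε j) (hε : 0 < ε) (hε1 : ε ≤ 1) :
    ∃ j₀ m', 1 ≤ 2 ^ j₀ * ε ∧ 2 ^ j₀ * ε < 2 ∧
      Exec findDigit m (6 * j₀ + 5) (PMF.pure m') ∧ m'.var 3 = j₀ ∧ m'.var 4 = (2 ^ j₀ : ℕ) ∧
      SameExcept [3, 4, 8] [] m m' := by
  obtain ⟨j₀, a1, a2, a3, a4⟩ := exists_first_digit hε hε1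
  have key : ∀ i ≤ j₀, ∀ m₁ : Memory, m₁.var 3 = (j₀ - i : ℕ) → m₁.var 4 = (2 ^ (j₀ - i) : ℕ) →
      m₁.var 8 = signedDigit ε (j₀ - i) → SameExcept [3, 4, 8] [] m m₁ →
      ∃ m', Exec (.loop (1 - .var 8) (.seq (.assign 3 (.var 3 + 1))
        (.seq (.assign 4 (.var 4 + .var 4)) (.load 8 1 [.var 3])))) m₁ (6 * i + 1) (PMF.pure m') ∧
        m'.var 3 = j₀ ∧ m'.var 4 = (2 ^ j₀ : ℕ) ∧ SameExcept [3, 4, 8] [] m m' := by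
    intro i
    induction i with
    | zero =>
        intro _ m₁ q3 q4 q8 qS
        exact ⟨m₁, exec_loop_false (by
          rw [Expr.eval_sub, Expr.eval_var, q8, Nat.sub_zero, a3]; simp),
          q3, q4, qS⟩
    | succ i ih =>
        intro hi m₁ q3 q4 q8 qS
        rw [a4 _ (by omega)] at q8
        have e : j₀ - i = (j₀ - (i + 1)) + 1 := by omega
        obtain ⟨m', e', r⟩ := ih (by omega)
          (((m₁.setVar 3 (j₀ - i : ℕ)).setVar 4 (2 ^ (j₀ - i) : ℕ)).setVar 8
            (signedDigit ε (j₀ - i))) (by simp [Memory.setVar_var]) (by simp [Memory.setVar_var])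
          (by simp [Memory.setVar_var])
          (((qS.setVar (by simp) _).setVar (by simp) _).setVar (by simp) _)
        refine ⟨m', ?_, r⟩
        have x1 := exec_assign 3 (.var 3 + 1) m₁
        rw [show Expr.eval m₁ (.var 3 + 1) = (j₀ - i : ℕ) by
          rw [Expr.eval_add, Expr.eval_var, q3, e]; simp] at x1
        have x2 := exec_assign 4 (.var 4 + .var 4) (m₁.setVar 3 (j₀ - i : ℕ))
        rw [show Expr.eval (m₁.setVar 3 (j₀ - i : ℕ)) (.var 4 + .var 4) = (2 ^ (j₀ - i) : ℕ) by
          rw [Expr.eval_add, Expr.eval_var, Memory.setVar_var, if_neg (by norm_num), q4, e,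
            pow_succ]
          push_cast; ring] at x2
        have x3 := exec_load 8 1 [.var 3]
          ((m₁.setVar 3 (j₀ - i : ℕ)).setVar 4 (2 ^ (j₀ - i) : ℕ))
        rw [show ((m₁.setVar 3 (j₀ - i : ℕ)).setVar 4 (2 ^ (j₀ - i) : ℕ)).arr 1
            (List.map (Expr.eval ((m₁.setVar 3 (j₀ - i : ℕ)).setVar 4 (2 ^ (j₀ - i) : ℕ))) [.var 3])
            = signedDigit ε (j₀ - i) by
          simp only [Memory.setVar_arr, List.map, Expr.eval_var]
          rw [qS.2 1 (by simp), ← h1]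
          simp [Memory.setVar_var]] at x3
        have := exec_loop_true_pure (e := 1 - .var 8) (by
          rw [Expr.eval_sub, Expr.eval_var, q8]; simp)
          (exec_seq_pure x1 (exec_seq_pure x2 x3)) e'
        rwa [show 1 + (1 + 1 + (1 + 1 + 1)) + (6 * i + 1) = 6 * (i + 1) + 1 by ring] at this
  obtain ⟨m', e', r⟩ := key j₀ le_rfl ((m.setVar 4 1).setVar 8 (signedDigit ε 0))
    (by simp [Memory.setVar_var, h3]) (by simp [Memory.setVar_var]) (by simp [Memory.setVar_var])
    (((SameExcept.refl _ _ _).setVar (by simp) _).setVar (by simp) _)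
  refine ⟨j₀, m', a1, a2, ?_, r⟩
  have x1 := exec_assign 4 1 m
  have x2 := exec_load 8 1 [.var 3] (m.setVar 4 1)
  rw [show (m.setVar 4 1).arr 1 (List.map (Expr.eval (m.setVar 4 1)) [.var 3])
      = signedDigit ε 0 by
    rw [← h1]
    simp [Memory.setVar_var, h3]] at x2
  have := exec_seq_pure x1 (exec_seq_pure x2 e')
  rwa [show 1 + 1 + (1 + 1 + (6 * j₀ + 1)) = 6 * j₀ + 5 by ring] at this

/-- Multiplies the variable `4` by a power of two that is at least `n`. -/
def scaleByWidth : Cmd :=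
  .seq (.assign 9 1) (.loop (.var 0 - .var 9) (.seq (.assign 9 (.var 9 + .var 9))
    (.seq (.assign 4 (.var 4 + .var 4)) (.assign 3 (.var 3 + 1)))))

/-- The variable `9` is doubled until it is at least `n`. -/
theorem scaleByWidth_spec {m : Memory} {j : ℕ} (h0 : m.var 0 = n) (h3 : m.var 3 = j)
    (h4 : m.var 4 = (2 ^ j : ℕ)) (hn : 1 ≤ n) :
    ∃ i₀ m', n ≤ 2 ^ i₀ ∧ 2 ^ i₀ < 2 * n ∧
      Exec scaleByWidth m (6 * i₀ + 3) (PMF.pure m') ∧ m'.var 3 = (j + i₀ : ℕ) ∧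
      m'.var 4 = (2 ^ (j + i₀) : ℕ) ∧ SameExcept [3, 4, 9] [] m m' := by
  classical
  have hex : ∃ i, n ≤ 2 ^ i := ⟨n, Nat.lt_two_pow_self.le⟩
  obtain ⟨i₀, hi₀⟩ : ∃ i₀, i₀ = Nat.find hex := ⟨_, rfl⟩
  have hlt : ∀ i < i₀, 2 ^ i < n := fun i hi => not_le.1 (Nat.find_min hex (hi₀ ▸ hi))
  have hge : n ≤ 2 ^ i₀ := hi₀ ▸ Nat.find_spec hex
  have h2 : 2 ^ i₀ < 2 * n := by
    rcases Nat.eq_zero_or_pos i₀ with h | h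
    · rw [h]; omega
    · have := hlt (i₀ - 1) (by omega)
      rw [show i₀ = (i₀ - 1) + 1 by omega, pow_succ]
      omega
  have key : ∀ i ≤ i₀, ∀ m₁ : Memory, m₁.var 9 = (2 ^ (i₀ - i) : ℕ) →
      m₁.var 3 = (j + (i₀ - i) : ℕ) → m₁.var 4 = (2 ^ (j + (i₀ - i)) : ℕ) →
      SameExcept [3, 4, 9] [] m m₁ →
      ∃ m', Exec (.loop (.var 0 - .var 9) (.seq (.assign 9 (.var 9 + .var 9))
        (.seq (.assign 4 (.var 4 + .var 4)) (.assign 3 (.var 3 + 1))))) m₁ (6 * i + 1)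
        (PMF.pure m') ∧
        m'.var 3 = (j + i₀ : ℕ) ∧ m'.var 4 = (2 ^ (j + i₀) : ℕ) ∧
        SameExcept [3, 4, 9] [] m m' := by
    intro i
    induction i with
    | zero =>
        intro _ m₁ q9 q3 q4 qS
        refine ⟨m₁, exec_loop_false ?_, q3, q4, qS⟩
        rw [Expr.eval_sub, Expr.eval_var, Expr.eval_var, q9, qS.1 0 (by simp), h0, Nat.sub_zero]
        omega
    | succ i ih =>
        intro hi m₁ q9 q3 q4 qS
        have e : i₀ - i = (i₀ - (i + 1)) + 1 := by omega
        obtain ⟨m', e', r⟩ := ih (by omega)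
          (((m₁.setVar 9 (2 ^ (i₀ - i) : ℕ)).setVar 4 (2 ^ (j + (i₀ - i)) : ℕ)).setVar 3
            (j + (i₀ - i) : ℕ)) (by simp [Memory.setVar_var]) (by simp [Memory.setVar_var])
          (by simp [Memory.setVar_var])
          (((qS.setVar (by simp) _).setVar (by simp) _).setVar (by simp) _)
        refine ⟨m', ?_, r⟩
        have x1 := exec_assign 9 (.var 9 + .var 9) m₁
        rw [show Expr.eval m₁ (.var 9 + .var 9) = (2 ^ (i₀ - i) : ℕ) by
          rw [Expr.eval_add, Expr.eval_var, q9, e, pow_succ]; push_cast; ring] at x1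
        have x2 := exec_assign 4 (.var 4 + .var 4) (m₁.setVar 9 (2 ^ (i₀ - i) : ℕ))
        rw [show Expr.eval (m₁.setVar 9 (2 ^ (i₀ - i) : ℕ)) (.var 4 + .var 4)
            = (2 ^ (j + (i₀ - i)) : ℕ) by
          rw [Expr.eval_add, Expr.eval_var, Memory.setVar_var, if_neg (by norm_num), q4, e,
            ← add_assoc, pow_succ]
          push_cast; ring] at x2
        have x3 := exec_assign 3 (.var 3 + 1)
          ((m₁.setVar 9 (2 ^ (i₀ - i) : ℕ)).setVar 4 (2 ^ (j + (i₀ - i)) : ℕ))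
        rw [show Expr.eval ((m₁.setVar 9 (2 ^ (i₀ - i) : ℕ)).setVar 4 (2 ^ (j + (i₀ - i)) : ℕ))
            (.var 3 + 1) = (j + (i₀ - i) : ℕ) by
          rw [Expr.eval_add, Expr.eval_var, Memory.setVar_var, if_neg (by norm_num),
            Memory.setVar_var, if_neg (by norm_num), q3, e]; simp; ring] at x3
        have hpos : 0 < Expr.eval m₁ (.var 0 - .var 9) := by
          rw [Expr.eval_sub, Expr.eval_var, Expr.eval_var, q9, qS.1 0 (by simp), h0]
          have := hlt (i₀ - (i + 1)) (by omega)
          omega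
        have := exec_loop_true_pure hpos (exec_seq_pure x1 (exec_seq_pure x2 x3)) e'
        rwa [show 1 + (1 + 1 + (1 + 1 + 1)) + (6 * i + 1) = 6 * (i + 1) + 1 by ring] at this
  obtain ⟨m', e', r⟩ := key i₀ le_rfl (m.setVar 9 1)
    (by simp [Memory.setVar_var]) (by simp [Memory.setVar_var, h3])
    (by simp [Memory.setVar_var, h4])
    ((SameExcept.refl _ _ _).setVar (by simp) _)
  refine ⟨i₀, m', hge, h2, ?_, r⟩
  have := exec_seq_pure (exec_assign 9 1 m) e'
  rwa [show 1 + 1 + (6 * i₀ + 1) = 6 * i₀ + 3 by ring] at this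

/-- Computes the remaining parameters from a first value of `L` and `2 ^ L`. -/
def derivedParameters : Prog :=
  .assign 4 (.var 4 + .var 4) ;; .assign 4 (.var 4 + .var 4) ;; .assign 4 (.var 4 + .var 4) ;;
  .assign 4 (.var 4 + .var 4) ;; .assign 4 (.var 4 + .var 4) ;; .assign 4 (.var 4 + .var 4) ;;
  .assign 3 (.var 3 + .const 6) ;; .assign 5 (.var 3 + .var 3) ;; .assign 5 (.var 5 + .var 5) ;;
  .assign 5 (.var 5 + .var 5) ;; .assign 5 (.var 5 + .var 5) ;; .assign 6 (.var 5 + 1)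

/-- Computes the square of `2 ^ L` in the variable `71`. -/
def squareM : Prog := .assign 71 (.var 4) ;; .count 72 3 (.assign 71 (.var 71 + .var 71))

theorem squareM_spec {m : Memory} {L : ℕ} (h3 : m.var 3 = L) (h4 : m.var 4 = (2 ^ L : ℕ)) :
    (squareM.den m).var 71 = (2 ^ L * 2 ^ L : ℕ) := by
  rw [squareM, Prog.den_seq]
  have key := count_induction (x := 72) (p := 3) (c := .assign 71 (.var 71 + .var 71))
    (m := (Prog.assign 71 (.var 4)).den m) (N := L) (by simp [Prog.den, Memory.setVar_var, h3])
    (fun i m' => m'.var 71 * 2 ^ i = (2 ^ L * 2 ^ L : ℕ))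
    (by simp [Prog.den, Memory.setVar_var, h4]) (by
      intro i _ m' _ hP
      rw [← hP]
      simp [Prog.den, Memory.setVar_var, pow_succ]
      ring)
  simpa using key

/-- Computes all parameters except the precision. -/
def parameters : Cmd :=
  .seq findDigit (.seq scaleByWidth (.seq derivedParameters.compile squareM.compile))

/-- The two searches determine `n / ε` up to a factor `4`; the factor `64` then makes sure that
`2 ^ L` is large enough for `total_error_le`. -/
theorem parameters_spec (hn : 1 ≤ n) (hε : 0 < ε) (hε1 : ε ≤ 1) :
    ∃ L t m', 64 * (n / ε) ≤ 2 ^ L ∧ (2 : ℝ) ^ L ≤ 256 * (n / ε) ∧ 6 ≤ L ∧ t ≤ 1000 * 2 ^ L ∧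
      Exec parameters (inputMemory C N ε) t (PMF.pure m') ∧ Inputs C N ε L (16 * L) 0 m' ∧
      m'.var 71 = (2 ^ L * 2 ^ L : ℕ) := by
  set m := inputMemory C N ε with hm
  obtain ⟨j, m₁, j1, j2, e₁, p3, p4, pS⟩
    := findDigit_spec (m := m) (ε := ε) (by simp [hm, inputMemory])
    (fun j => by simp [hm, inputMemory, inputArr]) hε hε1
  obtain ⟨i, m₂, i1, i2, e₂, q3, q4, qS⟩ := scaleByWidth_spec (m := m₁) (n := n)
    (by rw [pS.1 0 (by simp)]; simp [hm, inputMemory]) p3 p4 hn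
  obtain ⟨t₃, ht₃, e₃⟩ := Prog.exists_exec (c := derivedParameters) (by decide) 0 m₂
    (by decide) (by intro p hp; simp [derivedParameters, Prog.bounds] at hp)
  set m₃ := derivedParameters.den m₂ with hm₃
  obtain ⟨L, hL⟩ : ∃ L, L = j + i + 6 := ⟨_, rfl⟩
  have r3 : m₃.var 3 = L := by
    simp [hm₃, derivedParameters, Prog.den, Memory.setVar_var, q3, Expr.eval, hL]
  have r4 : m₃.var 4 = (2 ^ L : ℕ) := by
    simp [hm₃, derivedParameters, Prog.den, Memory.setVar_var, q4, hL, pow_succ, pow_add]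
    ring
  have r5 : m₃.var 5 = (16 * L : ℕ) := by
    simp [hm₃, derivedParameters, Prog.den, Memory.setVar_var, q3, hL, Expr.eval]
    ring
  have r6 : m₃.var 6 = (16 * L + 1 : ℕ) := by
    simp [hm₃, derivedParameters, Prog.den, Memory.setVar_var, q3, hL, Expr.eval]
    ring
  have F₃ : Frame derivedParameters m₂ m₃ := Frame.den _ _
  obtain ⟨t₄, ht₄, e₄⟩ := Prog.exists_exec (c := squareM) (by decide) L m₃
    (by decide) (by intro p hp; simp [squareM, Prog.bounds] at hp; rw [hp, r3])
  have F₄ : Frame squareM m₃ (squareM.den m₃) := Frame.den _ _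
  have hv : ∀ x, x ∉ [3, 4, 5, 6, 8, 9, 71, 72] → (squareM.den m₃).var x = m.var x := by
    intro x hx
    simp only [List.mem_cons, List.not_mem_nil, or_false, not_or] at hx
    rw [F₄.1 x (by simp [squareM, Prog.modV]; omega),
      F₃.1 x (by simp [derivedParameters, Prog.modV]; omega), qS.1 x (by simp; omega),
      pS.1 x (by simp; omega)]
  have hw : ∀ x < 8, (squareM.den m₃).var x = m₃.var x := by
    intro x hx
    rw [F₄.1 x (by simp [squareM, Prog.modV]; omega)]
  have hpow : (2 : ℝ) ^ L = 64 * (2 ^ j * 2 ^ i) := by rw [hL, pow_add, pow_add]; norm_num; ring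
  have i1' : (n : ℝ) ≤ 2 ^ i := by exact_mod_cast i1
  have i2' : (2 : ℝ) ^ i ≤ 2 * n := by exact_mod_cast i2.le
  have j1' : 1 / ε ≤ 2 ^ j := by rwa [div_le_iff₀ hε]
  have j2' : (2 : ℝ) ^ j ≤ 2 / ε := by rw [le_div_iff₀ hε]; exact j2.le
  refine ⟨L, _, _, ?_, ?_, by omega, ?_, exec_seq_pure e₁ (exec_seq_pure e₂ (exec_seq_pure e₃ e₄)),
    ?_, squareM_spec r3 r4⟩
  · rw [hpow]
    have := mul_le_mul j1' i1' (by positivity) (by positivity)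
    have e : 64 * (n / ε) = 64 * (1 / ε * n) := by ring
    linarith
  · rw [hpow]
    have := mul_le_mul j2' i2' (by positivity) (by positivity)
    have e : 256 * (n / ε) = 64 * (2 / ε * (2 * n)) := by ring
    linarith
  · have h1 : derivedParameters.size * (0 + 4) ^ derivedParameters.depth = 23 := by decide
    have h2 : squareM.size = 6 := by decide
    have h3 : squareM.depth = 1 := by decide
    rw [h1] at ht₃
    rw [h2, h3, pow_one] at ht₄
    have : L < 2 ^ L := Nat.lt_two_pow_self
    omega
  · constructor
    · rw [hv 0 (by decide)]; simp [hm, inputMemory]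
    · rw [hv 1 (by decide)]; simp [hm, inputMemory]
    · rw [hv 2 (by decide)]; simp [hm, inputMemory]
    · rw [hw 3 (by norm_num), r3]
    · rw [hw 4 (by norm_num), r4]
    · rw [hw 5 (by norm_num), r5]
    · rw [hw 6 (by norm_num), r6]
    · rw [hv 7 (by decide)]; simp [hm, inputMemory]
    · intro a ha
      rw [F₄.2 a (by simp [squareM, Prog.modA]), F₃.2 a (by simp [derivedParameters, Prog.modA]),
        qS.2 a (by simp), pS.2 a (by simp)]
      rfl

end Parameters


/-! ### The sampling algorithm -/

/-- A sequence whose second command is deterministic, but takes a time that may depend on the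
coins. -/
theorem RandExec.run {α : Type} [Fintype α] [Nonempty α] {c₁ c₂ : Cmd} {m : Memory} {t₁ T : ℕ}
    {P Q : α → Memory → Prop} (h : RandExec c₁ m t₁ α P)
    (h₂ : ∀ a m', P a m' → ∃ t ≤ T, ∃ m'', Exec c₂ m' t (PMF.pure m'') ∧ Q a m'') :
    ∃ F : α → Memory, (∀ a, Q a (F a)) ∧ runFor (1 + t₁ + T) ([.seq c₁ c₂], m)
      = (PMF.uniformOfFintype α).map fun a => ([], F a) := by
  obtain ⟨F, e₁, p₁⟩ := h
  choose t ht G e₂ p₂ using fun a => h₂ a (F a) (p₁ a)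
  refine ⟨G, p₂, ?_⟩
  rw [Nat.add_assoc, runFor_add_one]
  simp only [step, PMF.pure_bind]
  rw [e₁, PMF.bind_map, PMF.map]
  congr 1
  funext a
  -- A halted run stays where it is, so all runs can be extended to the same length.
  have := Exec.pure_iff.1 (e₂ a) [] (T - t a)
  rw [Nat.add_sub_cancel' (ht a), runFor_nil] at this
  exact this

/-- The time and the output distribution of a run that ends in the memory `F a`, for a uniformly
random `a`. -/
theorem halts_and_sampledBits {α : Type} [Fintype α] [Nonempty α] {prog : Cmd} {m : Memory}
    {T : ℕ} {F : α → Memory} (n : ℕ) (h : runFor T ([prog], m)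
      = (PMF.uniformOfFintype α).map fun a => ([], F a)) :
    HaltsWithin prog m T ∧ sampledBits prog m T n
      = (PMF.uniformOfFintype α).map fun a (i : Fin n) =>
        decide ((F a).arr 6 [((i : ℕ) : ℤ)] = 1) := by
  constructor
  · intro c hc
    rw [h, PMF.support_map] at hc
    obtain ⟨a, -, rfl⟩ := hc
    rfl
  · rw [sampledBits, h, PMF.map_comp]
    rfl

theorem decide_eq_of_holdsBits {n : ℕ} {m : Memory} {b : Bits n} (h : HoldsBits m 6 b) :
    (fun i : Fin n => decide (m.arr 6 [((i : ℕ) : ℤ)] = 1)) = b := by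
  funext i
  rw [h i]
  cases b i <;> simp [bitVal]

/-- Is positive if the depth is less than the square of `2 ^ L`. -/
def shallow : Expr := .var 71 - .var 1

/-- The sampling algorithm: if the circuit is very deep, then the output is uniformly random;
otherwise the random numbers determine the noise record and the outcomes of all classes. -/
def sampler : Cmd :=
  .seq (.seq parameters (.seq (.cond shallow computePrecision.compile Prog.skip.compile)
      (.seq (fillBits 6) (.cond shallow drawCoins Prog.skip.compile))))
    (.cond shallow deterministicPart.compile Prog.skip.compile)

theorem exec_skip (m : Memory) : Exec Prog.skip.compile m 1 (PMF.pure m) := by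
  have := exec_assign 0 (.var 0) m
  have hm : m.setVar 0 (Expr.eval m (.var 0)) = m := by simp [Memory.setVar, Expr.eval]
  rwa [hm] at this

section Sampler

variable {n k d : ℕ} {C : IQPCircuit n k d} {N : PauliNoise} {ε : ℝ} {L : ℕ}

/-- A bound on the running time, in terms of a bound on the parameters. -/
def timeBound (X : ℕ) : ℕ :=
  2000 * X + 100 * X ^ 3 + computePrecision.size * (X + 4) ^ computePrecision.depth
    + deterministicPart.size * (X + 4) ^ deterministicPart.depth + 100

/-- The run on a very deep circuit. -/
theorem sampler_deep {t : ℕ} {m₁ : Memory}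
    (he : Exec parameters (inputMemory C N ε) t (PMF.pure m₁)) (hI : Inputs C N ε L (16 * L) 0 m₁)
    (h71 : m₁.var 71 = (2 ^ L * 2 ^ L : ℕ)) (hd : 2 ^ L * 2 ^ L ≤ d) {X : ℕ} (hn : n ≤ X)
    (ht : t ≤ 1000 * X) :
    ∃ T ≤ timeBound X, HaltsWithin sampler (inputMemory C N ε) T ∧
      sampledBits sampler (inputMemory C N ε) T n = PMF.uniformOfFintype (Bits n) := by
  have hsh : ∀ m : Memory, m.var 71 = m₁.var 71 → m.var 1 = m₁.var 1 →
      ¬ 0 < shallow.eval m := by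
    intro m h1 h2
    rw [shallow, Expr.eval_sub, Expr.eval_var, Expr.eval_var, h1, h2, h71, hI.d_eq]
    omega
  have e₂ : Exec (.cond shallow computePrecision.compile Prog.skip.compile) m₁ (1 + 1)
      (PMF.pure m₁) :=
    exec_cond (by rw [if_neg (hsh m₁ rfl rfl)]; exact exec_skip _)
  have e₃ : RandExec (.seq (fillBits 6) (.cond shallow drawCoins Prog.skip.compile)) m₁
      (1 + (n * (3 + 3) + 3) + (1 + 1)) (Bits n)
      (fun s m' => HoldsBits m' 6 s ∧ SameExcept [10, 12] [6] m₁ m') := by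
    refine (fillBits_spec (n := n) hI.n_eq 6).seq_pure ?_
    rintro s m' ⟨h1, h2⟩
    exact ⟨m', exec_cond (by
      rw [if_neg (hsh m' (h2.1 71 (by decide)) (h2.1 1 (by decide)))]; exact exec_skip _), h1, h2⟩
  obtain ⟨F, hF, hrun⟩ := RandExec.run (T := 2) (c₂ :=
      .cond shallow deterministicPart.compile Prog.skip.compile)
    (Q := fun s m' => HoldsBits m' 6 s) (RandExec.pure_seq he (RandExec.pure_seq e₂ e₃))
    (by
      rintro s m' ⟨h1, h2⟩
      refine ⟨1 + 1, le_rfl, m', exec_cond ?_, h1⟩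
      rw [if_neg (hsh m' (h2.1 71 (by decide)) (h2.1 1 (by decide)))]
      exact exec_skip _)
  obtain ⟨h1, h2⟩ := halts_and_sampledBits n hrun
  refine ⟨_, ?_, h1, ?_⟩
  · unfold timeBound
    have : 0 ≤ 100 * X ^ 3 + computePrecision.size * (X + 4) ^ computePrecision.depth
      + deterministicPart.size * (X + 4) ^ deterministicPart.depth := Nat.zero_le _
    omega
  · change sampledBits sampler _ _ n = _ at h2
    rw [h2]
    have : (fun a (i : Fin n) => decide ((F a).arr 6 [((i : ℕ) : ℤ)] = 1)) = id := by
      funext a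
      exact decide_eq_of_holdsBits (hF a)
    rw [this, PMF.map_id]

/-- The noise record that belongs to the random numbers. -/
noncomputable def coinRecord (N : PauliNoise) {n d K : ℕ} (u : Fin d → Fin n → Fin K → Bool) :
    Fin d → Fin n → Fin 5 :=
  N.record K fun l i => (ofBits (u l i) : ℤ)

/-- The random number `U` selects the outcome `b` for a class `A` of qubits. -/
def Selects (C : IQPCircuit n k d) (L K : ℕ) (A : Finset (Fin n)) (f : ℕ → Bits n) (z : Bits n)
    (U : ℕ) (b : Bits n) : Prop :=
  ∃ t < 2 ^ #A, (∀ i ∈ A, decodeBits A t i = b i) ∧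
    ∑ s ∈ Ico (t + 1) (2 ^ #A), C.classWeight L K A f z s ≤ U ∧
    (U : ℝ) < ∑ s ∈ Ico t (2 ^ #A), C.classWeight L K A f z s

/-- The random numbers lead to the output `b`. -/
def Accepts (C : IQPCircuit n k d) (N : PauliNoise) (L K : ℕ) {J : ℕ} (b : Bits n)
    (a : Bits n × Coins n d K J) : Prop :=
  C.SmallClusters L (survivors (coinRecord N a.2.1)) ∧
  (∀ i ∉ survivors (coinRecord N a.2.1), a.1 i = b i) ∧
  ∀ v, Selects C L K (C.group (survivors (coinRecord N a.2.1)) v) (flipsOf (coinRecord N a.2.1))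
    a.2.2.2 (ofBits (a.2.2.1 v)) fun i => b i ^^ signFlip (coinRecord N a.2.1) i

theorem coinTime_le {n d K J X : ℕ} (hX : 1 ≤ X) (hn : n ≤ X) (hd : d ≤ X) (hK : K ≤ X)
    (hJ : J ≤ X) : coinTime n d K J ≤ 100 * X ^ 3 := by
  have hrow : ∀ K ≤ X, rowTime n K ≤ 20 * X ^ 2 := by
    intro K hK
    unfold rowTime
    have h1 : n * (1 + (1 + 1 + (K * (3 + 3) + 3)) + 1 + 3) ≤ X * (6 * X + 10) :=
      Nat.mul_le_mul hn (by omega)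
    nlinarith
  have h1 := hrow K hK
  have h2 := hrow J hJ
  unfold coinTime
  have h3 : d * (rowTime n K + 3) ≤ X * (20 * X ^ 2 + 3) := Nat.mul_le_mul hd (by omega)
  have h4 : X ≤ X ^ 2 := by nlinarith
  have h5 : X ^ 2 ≤ X ^ 3 := by nlinarith
  nlinarith

/-- The run on a circuit that is not very deep. -/
theorem sampler_shallow {t : ℕ} {m₁ : Memory}
    (he : Exec parameters (inputMemory C N ε) t (PMF.pure m₁)) (hI : Inputs C N ε L (16 * L) 0 m₁)
    (h71 : m₁.var 71 = (2 ^ L * 2 ^ L : ℕ)) (hd : d < 2 ^ L * 2 ^ L) (hL : 1 ≤ L) {X : ℕ}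
    (hX : 1 ≤ X) (hn : n ≤ X) (hdX : d ≤ X) (hk : k ≤ X) (hM : 2 ^ L ≤ X) (hK : 16 * L + 1 ≤ X)
    (hJ : C.precision L (16 * L) ≤ X) (ht : t ≤ 1000 * X) :
    ∃ T ≤ timeBound X, HaltsWithin sampler (inputMemory C N ε) T ∧
      ∃ out : Bits n × Coins n d (16 * L) (C.precision L (16 * L)) → Bits n,
        sampledBits sampler (inputMemory C N ε) T n = (PMF.uniformOfFintype _).map out ∧
        ∀ a b, Accepts C N L (16 * L) b a → out a = b := by
  set K := 16 * L with hKdef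
  set J := C.precision L K with hJdef
  have hsh : ∀ m : Memory, m.var 71 = m₁.var 71 → m.var 1 = m₁.var 1 → 0 < shallow.eval m := by
    intro m h1 h2
    rw [shallow, Expr.eval_sub, Expr.eval_var, Expr.eval_var, h1, h2, h71, hI.d_eq]
    omega
  obtain ⟨t₂, ht₂, e₂⟩ := Prog.exists_exec (c := computePrecision) (by decide) X m₁ (by decide) (by
    intro p hp
    have : p = 1 ∨ p = 0 := by simpa [computePrecision, Prog.bounds] using hp
    rcases this with rfl | rfl
    · rw [hI.d_eq]; exact_mod_cast hdX
    · rw [hI.n_eq]; exact_mod_cast hn)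
  have hI₂ := computePrecision_spec hI
  set m₂ := computePrecision.den m₁ with hm₂
  have F₂ : Frame computePrecision m₁ m₂ := Frame.den _ _
  have h71₂ : m₂.var 71 = m₁.var 71 := F₂.1 71 (by decide)
  have h1₂ : m₂.var 1 = m₁.var 1 := F₂.1 1 (by decide)
  have e₂' : Exec (.cond shallow computePrecision.compile Prog.skip.compile) m₁ (1 + t₂)
      (PMF.pure m₂) := exec_cond (by rw [if_pos (hsh m₁ rfl rfl)]; exact e₂)
  have e₃ : RandExec (.seq (fillBits 6) (.cond shallow drawCoins Prog.skip.compile)) m₂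
      (1 + (n * (3 + 3) + 3) + (1 + coinTime n d K J)) (Bits n × Coins n d K J)
      (fun a m' => HoldsBits m' 6 a.1 ∧
        (∀ (l : Fin d) (i : Fin n),
          m'.arr 7 [((l : ℕ) : ℤ), ((i : ℕ) : ℤ)] = (ofBits (a.2.1 l i) : ℤ)) ∧
        (∀ v : Fin n, m'.arr 17 [((v : ℕ) : ℤ)] = (ofBits (a.2.2.1 v) : ℤ)) ∧
        HoldsBits m' 16 a.2.2.2 ∧ Inputs C N ε L K J m' ∧ 0 < shallow.eval m') := by
    refine (fillBits_spec (n := n) hI₂.n_eq 6).seq (β := Coins n d K J) (Q := fun s q m' =>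
      HoldsBits m' 6 s ∧
        (∀ (l : Fin d) (i : Fin n),
          m'.arr 7 [((l : ℕ) : ℤ), ((i : ℕ) : ℤ)] = (ofBits (q.1 l i) : ℤ)) ∧
        (∀ v : Fin n, m'.arr 17 [((v : ℕ) : ℤ)] = (ofBits (q.2.1 v) : ℤ)) ∧
        HoldsBits m' 16 q.2.2 ∧ Inputs C N ε L K J m' ∧ 0 < shallow.eval m') ?_
    rintro s m₃ ⟨h6, hS⟩
    have hv : ∀ x, x ∉ [10, 12] → m₃.var x = m₂.var x := hS.1
    obtain ⟨F, eF, pF⟩ := drawCoins_spec (m := m₃) (n := n) (d := d) (K := K) (J := J)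
      (by rw [hv 0 (by decide), hI₂.n_eq]) (by rw [hv 1 (by decide), hI₂.d_eq])
      (by rw [hv 5 (by decide), hI₂.K_eq]) (by rw [hv 7 (by decide), hI₂.J_eq])
    refine ⟨F, exec_cond (by
      rw [if_pos (hsh m₃ (by rw [hv 71 (by decide), h71₂]) (by rw [hv 1 (by decide), h1₂]))]
      exact eF), fun q => ?_⟩
    obtain ⟨q1, q2, q3, q4⟩ := pF q
    have hw : ∀ x, x ∉ [74, 75, 12, 77, 76, 10] → (F q).var x = m₂.var x := fun x hx => by
      rw [q4.1 x hx, hv x (fun h => hx (by simp at h ⊢; omega))]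
    refine ⟨fun i => by rw [q4.2 6 (by decide)]; exact h6 i, q1, q2, q3, ?_, ?_⟩
    · constructor
      · rw [hw 0 (by decide), hI₂.n_eq]
      · rw [hw 1 (by decide), hI₂.d_eq]
      · rw [hw 2 (by decide), hI₂.k_eq]
      · rw [hw 3 (by decide), hI₂.L_eq]
      · rw [hw 4 (by decide), hI₂.M_eq]
      · rw [hw 5 (by decide), hI₂.K_eq]
      · rw [hw 6 (by decide), hI₂.K1_eq]
      · rw [hw 7 (by decide), hI₂.J_eq]
      · intro a ha
        rw [q4.2 a (by simp; omega), hS.2 a (by simp; omega), hI₂.arr_eq a ha]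
    · exact hsh _ (by rw [hw 71 (by decide), h71₂]) (by rw [hw 1 (by decide), h1₂])
  obtain ⟨F, hF, hrun⟩ := RandExec.run
    (T := 1 + deterministicPart.size * (X + 4) ^ deterministicPart.depth) (c₂ :=
      .cond shallow deterministicPart.compile Prog.skip.compile)
    (Q := fun a m' => ∀ b, Accepts C N L K b a → HoldsBits m' 6 b)
    (RandExec.pure_seq he (RandExec.pure_seq e₂' e₃))
    (by
      rintro ⟨s, u, U, z⟩ m' ⟨h6, h7, h17, h16, hI', hpos⟩
      obtain ⟨t₃, ht₃, e₃⟩ := Prog.exists_exec (c := deterministicPart) (by decide) X m'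
        (by decide) (by
          intro p hp
          have : p = 0 ∨ p = 1 ∨ p = 2 ∨ p = 3 ∨ p = 4 ∨ p = 5 ∨ p = 6 ∨ p = 7 := by
            have hall : deterministicPart.bounds.all (· ≤ 7) := by decide
            have := (List.all_eq_true.1 hall) p hp
            simp only [decide_eq_true_eq] at this
            omega
          have hLM : L < 2 ^ L := Nat.lt_two_pow_self
          rcases this with rfl | rfl | rfl | rfl | rfl | rfl | rfl | rfl
          · rw [hI'.n_eq]; exact_mod_cast hn
          · rw [hI'.d_eq]; exact_mod_cast hdX
          · rw [hI'.k_eq]; exact_mod_cast hk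
          · rw [hI'.L_eq]; exact_mod_cast (by omega : L ≤ X)
          · rw [hI'.M_eq]; exact_mod_cast hM
          · rw [hI'.K_eq]; exact_mod_cast (by omega : K ≤ X)
          · rw [hI'.K1_eq]; exact_mod_cast hK
          · rw [hI'.J_eq]; exact_mod_cast hJ)
      refine ⟨1 + t₃, by omega, _, exec_cond (by rw [if_pos hpos]; exact e₃), ?_⟩
      rintro b ⟨c1, c2, c3⟩
      refine deterministicPart_spec hI' hL h7 h16 h17 (ω := coinRecord N u) rfl ?_ c1 c3
      intro i hi
      rw [← c2 i hi]
      exact h6 i)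
  obtain ⟨h1, h2⟩ := halts_and_sampledBits n hrun
  refine ⟨_, ?_, h1, fun a i => decide ((F a).arr 6 [((i : ℕ) : ℤ)] = 1), h2, ?_⟩
  · unfold timeBound
    have := coinTime_le hX hn hdX (by omega : K ≤ X) hJ
    omega
  · intro a b hab
    exact decide_eq_of_holdsBits (hF a b hab)

end Sampler


/-! ### Probabilities of events that depend on the coins -/

section Uniform

theorem expect_prod_type {α β : Type} [Fintype α] [Fintype β] (f : α × β → ℝ) :
    𝔼 p, f p = 𝔼 a, 𝔼 b, f (a, b) := by
  rw [← univ_product_univ, expect_product]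

theorem toReal_map_uniformOfFintype {α β : Type} [Fintype α] [Nonempty α] [DecidableEq β]
    (f : α → β) (b : β) :
    (((PMF.uniformOfFintype α).map f) b).toReal = 𝔼 a, if f a = b then (1 : ℝ) else 0 := by
  rw [PMF.map_apply, tsum_fintype, ENNReal.toReal_sum, Fintype.expect_eq_sum_div_card, sum_div]
  · refine sum_congr rfl fun a _ => ?_
    by_cases h : f a = b
    · simp [h]
    · simp [h, Ne.symm h]
  · intro a _
    split_ifs
    · simp
    · simp

/-- Independent fair coins as digits give a uniformly random number. -/
theorem expect_ofBits (K : ℕ) (f : ℕ → ℝ) :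
    𝔼 s : Fin K → Bool, f (ofBits s) = (∑ u ∈ range (2 ^ K), f u) / 2 ^ K := by
  set e : (Fin K → Bool) ≃ Fin (2 ^ K) :=
    (Equiv.arrowCongr (Equiv.refl _) finTwoEquiv.symm).trans finFunctionFinEquiv with he
  have h : ∀ s, ofBits s = (e s : ℕ) := by
    intro s
    rw [he, Equiv.trans_apply, finFunctionFinEquiv_apply, ofBits]
    refine sum_congr rfl fun i _ => ?_
    congr 1
    cases hs : s i <;> simp [Equiv.arrowCongr, hs, finTwoEquiv]
  rw [Fintype.expect_eq_sum_div_card]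
  simp only [h]
  rw [e.sum_comp fun u => f (u : ℕ), ← sum_range]
  simp

theorem expect_ofBits_lt (K : ℕ) {t : ℤ} (h0 : 0 ≤ t) (h1 : t ≤ 2 ^ K) :
    𝔼 s : Fin K → Bool, (if (ofBits s : ℤ) < t then (1 : ℝ) else 0) = t / 2 ^ K := by
  lift t to ℕ using h0
  have h1' : t ≤ 2 ^ K := by exact_mod_cast h1
  rw [expect_ofBits K fun u => if (u : ℤ) < t then (1 : ℝ) else 0, sum_boole]
  have : (range (2 ^ K)).filter (fun u : ℕ => (u : ℤ) < t) = range t := by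
    ext u
    simp
    omega
  rw [this, card_range]
  simp

theorem expect_ofBits_mem_Ico (K : ℕ) {s t : ℕ} (hst : s ≤ t) (ht : t ≤ 2 ^ K) :
    𝔼 u : Fin K → Bool, (if s ≤ ofBits u ∧ ofBits u < t then (1 : ℝ) else 0)
      = (t - s) / 2 ^ K := by
  have h1 := expect_ofBits_lt K (t := t) (by positivity) (by exact_mod_cast ht)
  have h2 := expect_ofBits_lt K (t := s) (by positivity) (by exact_mod_cast hst.trans ht)
  have e : ∀ u : Fin K → Bool, (if s ≤ ofBits u ∧ ofBits u < t then (1 : ℝ) else 0)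
      = (if (ofBits u : ℤ) < t then (1 : ℝ) else 0) -
        if (ofBits u : ℤ) < s then (1 : ℝ) else 0 := by
    intro u
    simp only [Nat.cast_lt]
    by_cases hs : ofBits u < s
    · have : ofBits u < t := hs.trans_le hst
      simp [hs, this, not_le.2 hs]
    · simp [hs, not_lt.1 hs]
  rw [expect_congr rfl fun u _ => e u, expect_sub_distrib, h1, h2]
  push_cast
  ring

/-- A function of independent uniformly random elements, each of which is seen through a map with
known distribution. -/
theorem expect_comp_eq_sum {ι α β : Type} [Fintype ι] [DecidableEq ι] [Fintype α] [Nonempty α]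
    [Fintype β] [DecidableEq β] {φ : α → β} {w : β → ℝ}
    (hw : ∀ o, 𝔼 a, (if φ a = o then (1 : ℝ) else 0) = w o) (G : (ι → β) → ℝ) :
    𝔼 u : ι → α, G (fun i => φ (u i)) = ∑ ω : ι → β, (∏ i, w (ω i)) * G ω := by
  have h1 : ∀ u : ι → α, G (fun i => φ (u i))
      = ∑ ω : ι → β, (∏ i, if φ (u i) = ω i then (1 : ℝ) else 0) * G ω := by
    intro u
    rw [sum_eq_single fun i => φ (u i)]
    · simp
    · intro ω _ hω
      obtain ⟨i, hi⟩ : ∃ i, φ (u i) ≠ ω i := by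
        by_contra! h
        exact hω (funext fun i => (h i).symm)
      rw [prod_eq_zero (mem_univ i) (if_neg hi), zero_mul]
    · simp
  rw [expect_congr rfl fun u _ => h1 u, expect_sum_comm]
  refine sum_congr rfl fun ω _ => ?_
  rw [← expect_mul, expect_prod_eval (fun i a => if φ a = ω i then (1 : ℝ) else 0) inferInstance]
  simp only [hw]

end Uniform

/-! ### The distribution of the noise record -/

section Record

variable {n k d : ℕ}

/-- A noise parameter, rounded down to `K` binary digits. -/
noncomputable def roundDown (K : ℕ) (x : ℝ) : ℝ := truncInt K x / 2 ^ K

theorem roundDown_bounds (K : ℕ) {x : ℝ} (hx : 0 ≤ x) :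
    0 ≤ roundDown K x ∧ roundDown K x ≤ x ∧ |x - roundDown K x| ≤ 1 / 2 ^ K := by
  have h2 : (0 : ℝ) < 2 ^ K := by positivity
  obtain ⟨b1, b2⟩ := truncInt_bounds K x
  have h0 : (0 : ℝ) ≤ truncInt K x := by
    rw [truncInt_of_nonneg K hx]
    exact_mod_cast Int.floor_nonneg.2 (by positivity)
  rw [abs_of_nonneg h0, abs_of_nonneg hx] at b1
  refine ⟨div_nonneg h0 h2.le, ?_, ?_⟩
  · rw [roundDown, div_le_iff₀ h2]; linarith
  · have : x - roundDown K x = (2 ^ K * x - truncInt K x) / 2 ^ K := by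
      rw [roundDown]; field_simp
    rw [this, abs_div, abs_of_pos h2]
    exact div_le_div_of_nonneg_right b2 h2.le

/-- The weight of the outcome without an error stays nonnegative, because `pI` is at least
`1 / 2`. -/
theorem roundDown_sum_le (N : PauliNoise) (hN : 1 / 2 ≤ N.pI) (K : ℕ) :
    roundDown K N.pX + roundDown K N.pY + 2 * roundDown K N.pZ ≤ 1 := by
  have hX := roundDown_bounds K N.pX_nonneg
  have hY := roundDown_bounds K N.pY_nonneg
  have hZ := roundDown_bounds K N.pZ_nonneg
  have := N.sum_eq_one
  have := N.pX_nonneg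
  have := N.pY_nonneg
  linarith [hX.2.1, hY.2.1, hZ.2.1]

/-- The thresholds are integers, so a random number with `K` digits has an outcome with exactly the
weight that belongs to the rounded noise parameters. -/
theorem expect_outcomeAt (N : PauliNoise) (hN : 1 / 2 ≤ N.pI) (K : ℕ) (o : Fin 5) :
    𝔼 s : Fin K → Bool, (if outcomeAt (N.thresholds K 0) (N.thresholds K 1) (N.thresholds K 2)
        (N.thresholds K 3) (ofBits s) = o then (1 : ℝ) else 0)
      = outcomeWeight (roundDown K N.pX) (roundDown K N.pY) (roundDown K N.pZ) o := by
  have h2 : (0 : ℝ) < 2 ^ K := by positivity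
  have hX := (roundDown_bounds K N.pX_nonneg).1
  have hY := (roundDown_bounds K N.pY_nonneg).1
  have hZ := (roundDown_bounds K N.pZ_nonneg).1
  have hS := roundDown_sum_le N hN K
  obtain ⟨x, hx⟩ : ∃ x, x = truncInt K N.pX := ⟨_, rfl⟩
  obtain ⟨y, hy⟩ : ∃ y, y = truncInt K N.pY := ⟨_, rfl⟩
  obtain ⟨z, hz⟩ : ∃ z, z = truncInt K N.pZ := ⟨_, rfl⟩
  simp only [roundDown, PauliNoise.thresholds, ← hx, ← hy, ← hz] at hX hY hZ hS ⊢
  have hx0 : 0 ≤ x := by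
    rw [le_div_iff₀ h2, zero_mul] at hX; exact_mod_cast hX
  have hy0 : 0 ≤ y := by
    rw [le_div_iff₀ h2, zero_mul] at hY; exact_mod_cast hY
  have hz0 : 0 ≤ z := by
    rw [le_div_iff₀ h2, zero_mul] at hZ; exact_mod_cast hZ
  have hs : 2 * z + x + y ≤ 2 ^ K := by
    have e : (x / 2 ^ K + y / 2 ^ K + 2 * (z / 2 ^ K) : ℝ) = (2 * z + x + y) / 2 ^ K := by ring
    rw [e, div_le_one h2] at hS
    exact_mod_cast hS
  obtain ⟨t₁, ht₁⟩ : ∃ t, t = threshold x y z 0 := ⟨_, rfl⟩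
  obtain ⟨t₂, ht₂⟩ : ∃ t, t = threshold x y z 1 := ⟨_, rfl⟩
  obtain ⟨t₃, ht₃⟩ : ∃ t, t = threshold x y z 2 := ⟨_, rfl⟩
  obtain ⟨t₄, ht₄⟩ : ∃ t, t = threshold x y z 3 := ⟨_, rfl⟩
  rw [← ht₁, ← ht₂, ← ht₃, ← ht₄]
  simp only [threshold, Matrix.cons_val] at ht₁ ht₂ ht₃ ht₄
  have o1 : 0 ≤ t₁ := by omega
  have o2 : t₁ ≤ t₂ := by omega
  have o3 : t₂ ≤ t₃ := by omega
  have o4 : t₃ ≤ t₄ := by omega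
  have o5 : t₄ ≤ 2 ^ K := by omega
  have e1 := expect_ofBits_lt K o1 (by omega)
  have e2 := expect_ofBits_lt K (o1.trans o2) (by omega)
  have e3 := expect_ofBits_lt K (o1.trans (o2.trans o3)) (by omega)
  have e4 := expect_ofBits_lt K (o1.trans (o2.trans (o3.trans o4))) o5
  have r1 : (t₁ : ℝ) = 2 * z := by exact_mod_cast ht₁
  have r2 : (t₂ : ℝ) = 2 * z + x + y - max (x - y) 0 - max (y - x) 0 := by exact_mod_cast ht₂
  have r3 : (t₃ : ℝ) = 2 * z + x + y - max (y - x) 0 := by exact_mod_cast ht₃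
  have r4 : (t₄ : ℝ) = 2 * z + x + y := by exact_mod_cast ht₄
  have m1 : max ((x : ℝ) / 2 ^ K - y / 2 ^ K) 0 = max (x - y) 0 / 2 ^ K := by
    rw [← sub_div, ← zero_div (2 ^ K : ℝ), max_div_div_right h2.le]
    push_cast
    rfl
  have m2 : max ((y : ℝ) / 2 ^ K - x / 2 ^ K) 0 = max (y - x) 0 / 2 ^ K := by
    rw [← sub_div, ← zero_div (2 ^ K : ℝ), max_div_div_right h2.le]
    push_cast
    rfl
  have ind : ∀ u : ℤ, (if outcomeAt t₁ t₂ t₃ t₄ u = o then (1 : ℝ) else 0)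
      = (![1 - (if u < t₄ then (1 : ℝ) else 0), (if u < t₁ then (1 : ℝ) else 0),
          (if u < t₂ then (1 : ℝ) else 0) - (if u < t₁ then (1 : ℝ) else 0),
          (if u < t₃ then (1 : ℝ) else 0) - (if u < t₂ then (1 : ℝ) else 0),
          (if u < t₄ then (1 : ℝ) else 0) - (if u < t₃ then (1 : ℝ) else 0)] : Fin 5 → ℝ) o := by
    intro u
    unfold outcomeAt
    by_cases a1 : u < t₁
    · have a2 : u < t₂ := by omega
      have a3 : u < t₃ := by omega
      have a4 : u < t₄ := by omega
      simp only [a1, a2, a3, a4, if_true]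
      fin_cases o <;> simp
    by_cases a2 : u < t₂
    · have a3 : u < t₃ := by omega
      have a4 : u < t₄ := by omega
      simp only [a1, a2, a3, a4, if_true, if_false]
      fin_cases o <;> simp
    by_cases a3 : u < t₃
    · have a4 : u < t₄ := by omega
      simp only [a1, a2, a3, a4, if_true, if_false]
      fin_cases o <;> simp
    by_cases a4 : u < t₄
    · simp only [a1, a2, a3, a4, if_true, if_false]
      fin_cases o <;> simp
    · simp only [a1, a2, a3, a4, if_false]
      fin_cases o <;> simp
  rw [expect_congr rfl fun s _ => ind (ofBits s)]
  have hne : (univ : Finset (Fin K → Bool)).Nonempty := univ_nonempty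
  have h2' : (2 : ℝ) ^ K ≠ 0 := h2.ne'
  fin_cases o
  · simp only [Fin.zero_eta, Matrix.cons_val_zero, outcomeWeight]
    rw [expect_sub_distrib, expect_const hne, e4, r4]
    ring
  · simp only [Fin.mk_one, Matrix.cons_val_one, Matrix.cons_val_zero, outcomeWeight]
    rw [e1, r1]
    ring
  · simp only [Fin.reduceFinMk, Matrix.cons_val, outcomeWeight]
    rw [expect_sub_distrib, e2, e1, r1, r2, m1, m2]
    ring
  · simp only [Fin.reduceFinMk, Matrix.cons_val, outcomeWeight]
    rw [expect_sub_distrib, e2, e3, r2, r3, m1]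
    ring
  · simp only [Fin.reduceFinMk, Matrix.cons_val, outcomeWeight]
    rw [expect_sub_distrib, e3, e4, r3, r4, m2]
    ring

/-- The noise record is distributed as if the noise parameters were rounded down. -/
theorem expect_coinRecord (N : PauliNoise) (hN : 1 / 2 ≤ N.pI) (K : ℕ)
    (G : (Fin d → Fin n → Fin 5) → ℝ) :
    𝔼 u : Fin d → Fin n → Fin K → Bool, G (coinRecord N u)
      = 𝔼 ω, recordDensity (roundDown K N.pX) (roundDown K N.pY) (roundDown K N.pZ) ω * G ω := by
  set w := outcomeWeight (roundDown K N.pX) (roundDown K N.pY) (roundDown K N.pZ) with hw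
  set φ : (Fin K → Bool) → Fin 5 := fun s => outcomeAt (N.thresholds K 0) (N.thresholds K 1)
    (N.thresholds K 2) (N.thresholds K 3) (ofBits s) with hφ
  have h1 : ∀ o, 𝔼 s, (if φ s = o then (1 : ℝ) else 0) = w o := expect_outcomeAt N hN K
  have h2 : ∀ τ : Fin n → Fin 5, 𝔼 s : Fin n → Fin K → Bool,
      (if (fun i => φ (s i)) = τ then (1 : ℝ) else 0) = ∏ i, w (τ i) := by
    intro τ
    rw [expect_comp_eq_sum h1 fun ω => if ω = τ then (1 : ℝ) else 0]
    simp
  have h3 := expect_comp_eq_sum (ι := Fin d) (φ := fun (s : Fin n → Fin K → Bool) i => φ (s i)) h2 G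
  refine h3.trans ?_
  rw [Fintype.expect_eq_sum_div_card, sum_div]
  refine sum_congr rfl fun ω _ => ?_
  have hc : (Fintype.card (Fin d → Fin n → Fin 5) : ℝ) = (5 ^ n) ^ d := by simp
  have hp : ∏ j, ∏ i, 5 * w (ω j i) = (5 ^ n) ^ d * ∏ j, ∏ i, w (ω j i) := by
    simp only [prod_mul_distrib, prod_const, card_univ, Fintype.card_fin]
  rw [recordDensity, hp, hc]
  have : ((5 : ℝ) ^ n) ^ d ≠ 0 := by positivity
  field_simp

end Record


/-! ### The distribution of the output -/

section Output

variable {n k d : ℕ}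

/-- The Gaussian integers, as complex numbers. -/
abbrev gaussianIntegers : Subring ℂ := GaussianInt.toComplex.range

theorem gauss_mem (x y : ℤ) : (x + y * Complex.I : ℂ) ∈ gaussianIntegers :=
  ⟨⟨x, y⟩, by simp [GaussianInt.toComplex_def]⟩

theorem exists_normSq_eq {z : ℂ} (hz : z ∈ gaussianIntegers) : ∃ w : ℕ, ‖z‖ ^ 2 = w := by
  obtain ⟨g, rfl⟩ := hz
  refine ⟨(Zsqrtd.norm g).natAbs, ?_⟩
  rw [← Complex.normSq_eq_norm_sq, ← GaussianInt.intCast_real_norm, Nat.cast_natAbs,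
    abs_of_nonneg (GaussianInt.norm_nonneg g)]

theorem two_pow_mul_phase_mem (C : IQPCircuit n k d) (K : ℕ) (f : ℕ → Bits n) (l : ℕ)
    (x : Bits n) : 2 ^ (K * C.gatesUpTo l) * C.phase (trunc K) f l x ∈ gaussianIntegers := by
  induction l generalizing x with
  | zero => simp [IQPCircuit.phase, IQPCircuit.gatesUpTo]
  | succ l ih =>
      have e : (2 : ℂ) ^ (K * C.gatesUpTo (l + 1)) * C.phase (trunc K) f (l + 1) x
          = (∏ g ∈ range n, 2 ^ (K * C.gateCount l g) *
              C.gateValue (trunc K) l g fun i => x i ^^ f l i) *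
            (2 ^ (K * C.gatesUpTo l) * C.phase (trunc K) f l fun i => x i ^^ f l i) := by
        rw [IQPCircuit.phase, prod_mul_distrib, prod_pow_eq_pow_sum, ← mul_sum,
          IQPCircuit.gatesUpTo, sum_range_succ, mul_add, pow_add, IQPCircuit.gatesUpTo]
        ring
      rw [e]
      refine mul_mem (prod_mem fun g _ => ?_) (ih _)
      unfold IQPCircuit.gateCount IQPCircuit.gateValue
      cases C.gateAt l g with
      | none => simp
      | some G =>
          simp only [Option.isSome_some, if_true, mul_one, Option.elim, trunc]
          rw [mul_div_cancel₀ _ (pow_ne_zero _ two_ne_zero)]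
          exact gauss_mem _ _

theorem chi_mem (A : Finset (Fin n)) (b s : Bits n) : chi A b s ∈ gaussianIntegers :=
  prod_mem fun i _ => by
    split_ifs
    · exact neg_mem (one_mem _)
    · exact one_mem _

theorem dependsOn_classPhase (C : IQPCircuit n k d) (K : ℕ) (A : Finset (Fin n))
    (f : ℕ → Bits n) (z : Bits n) : DependsOn (C.classPhase K A f z) (A : Set (Fin n)) :=
  dependsOn_piecewise A (C.phase (trunc K) f d) z

/-- The scaled probabilities are integers. -/
theorem exists_classWeight_eq (C : IQPCircuit n k d) {L : ℕ} (K : ℕ) {A : Finset (Fin n)}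
    (hA : #A ≤ L) (f : ℕ → Bits n) (z : Bits n) :
    ∃ w : ℕ → ℕ, ∀ t, C.classWeight L K A f z t = w t := by
  have h : ∀ t, ∃ w : ℕ, C.classWeight L K A f z t = w := by
    intro t
    set y := decodeBits A t with hy
    have hmem : 2 ^ (L + K * C.gatesUpTo d) * fourier A (C.classPhase K A f z) y
        ∈ gaussianIntegers := by
      have hsum := sum_range_decodeBits A (F := fun s => chi A y s * C.classPhase K A f z s)
        (fun x x' hxx => by
          simp only
          rw [chi_congr (fun _ _ => rfl) hxx, dependsOn_classPhase C K A f z hxx])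
      have e : 2 ^ (L + K * C.gatesUpTo d) * fourier A (C.classPhase K A f z) y
          = 2 ^ (L - #A) * ∑ t ∈ range (2 ^ #A), chi A y (decodeBits A t) *
            (2 ^ (K * C.gatesUpTo d) * C.classPhase K A f z (decodeBits A t)) := by
        have e' : ∑ t ∈ range (2 ^ #A), chi A y (decodeBits A t) *
            (2 ^ (K * C.gatesUpTo d) * C.classPhase K A f z (decodeBits A t))
            = 2 ^ (K * C.gatesUpTo d) * (2 ^ #A * fourier A (C.classPhase K A f z) y) := by
          rw [fourier, ← hsum, mul_sum]
          exact sum_congr rfl fun t _ => by ring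
        rw [e', pow_add, ← Nat.sub_add_cancel hA, pow_add, Nat.add_sub_cancel]
        ring
      rw [e]
      have h2 : (2 : ℂ) ∈ gaussianIntegers := by
        have := gauss_mem 2 0
        rwa [Int.cast_zero, zero_mul, add_zero] at this
      exact mul_mem (pow_mem h2 _) (sum_mem fun t _ =>
        mul_mem (chi_mem _ _ _) (two_pow_mul_phase_mem _ _ _ _ _))
    obtain ⟨w, hw⟩ := exists_normSq_eq hmem
    refine ⟨w, ?_⟩
    rw [← hw, IQPCircuit.classWeight, IQPCircuit.precision, norm_mul, mul_pow, norm_pow,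
      ← pow_mul, mul_comm (L + K * C.gatesUpTo d) 2, Complex.norm_two, hy]
  choose w hw using h
  exact ⟨w, hw⟩

/-- By Parseval's identity, since rounding towards zero does not increase the absolute value of the
phases. The sum may be less than `2 ^ J`; then some random numbers select no outcome. -/
theorem sum_classWeight_le (C : IQPCircuit n k d) (L K : ℕ) (A : Finset (Fin n))
    (f : ℕ → Bits n) (z : Bits n) :
    ∑ t ∈ range (2 ^ #A), C.classWeight L K A f z t ≤ 2 ^ C.precision L K := by
  have hsum := sum_range_decodeBits A
    (F := fun y => ((‖fourier A (C.classPhase K A f z) y‖ ^ 2 : ℝ) : ℂ))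
    (fun x x' hxx => by simp only; rw [fourier_congr hxx])
  have hsum' : ∑ t ∈ range (2 ^ #A), ‖fourier A (C.classPhase K A f z) (decodeBits A t)‖ ^ 2
      = 𝔼 y, 2 ^ #A * ‖fourier A (C.classPhase K A f z) y‖ ^ 2 := by
    rw [← mul_expect]
    have := hsum
    rw [← Complex.ofReal_expect] at this
    exact_mod_cast this
  simp only [IQPCircuit.classWeight]
  rw [← mul_sum, hsum', parseval (dependsOn_classPhase C K A f z)]
  refine mul_le_of_le_one_right (by positivity) ?_
  refine (expect_le_expect fun s _ => ?_).trans (Fintype.expect_const (ι := Bits n) 1).le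
  exact pow_le_one₀ (norm_nonneg _) (C.norm_phase_trunc_le K _ _ _)

open Classical in
/-- Every outcome of a class is selected with the right probability. -/
theorem norm_fourier_sq_le_expect_selects (C : IQPCircuit n k d) {L : ℕ} (K : ℕ)
    {A : Finset (Fin n)} (hA : #A ≤ L) (f : ℕ → Bits n) (z b : Bits n) :
    ‖fourier A (C.classPhase K A f z) b‖ ^ 2
      ≤ 𝔼 u : Fin (C.precision L K) → Bool,
        if Selects C L K A f z (ofBits u) b then (1 : ℝ) else 0 := by
  obtain ⟨w, hw⟩ := exists_classWeight_eq C K hA f z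
  obtain ⟨t, ht, hb⟩ := exists_decodeBits_eq A b
  set J := C.precision L K with hJ
  have hle : ∑ s ∈ Ico t (2 ^ #A), w s ≤ 2 ^ J := by
    have h1 := sum_classWeight_le C L K A f z
    simp only [hw] at h1
    have h2 : ∑ s ∈ range (2 ^ #A), w s ≤ 2 ^ J := by exact_mod_cast h1
    refine le_trans (sum_le_sum_of_subset fun s hs => ?_) h2
    rw [mem_range]; exact (mem_Ico.1 hs).2
  have hsplit : ∑ s ∈ Ico t (2 ^ #A), w s = w t + ∑ s ∈ Ico (t + 1) (2 ^ #A), w s :=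
    sum_eq_sum_Ico_succ_bot ht w
  have key := expect_ofBits_mem_Ico J
    (s := ∑ s ∈ Ico (t + 1) (2 ^ #A), w s) (t := ∑ s ∈ Ico t (2 ^ #A), w s) (by omega) hle
  have hval : ‖fourier A (C.classPhase K A f z) b‖ ^ 2 = w t / 2 ^ J := by
    rw [← hw, IQPCircuit.classWeight, ← hJ, mul_div_cancel_left₀ _ (by positivity),
      fourier_congr hb]
  rw [hval]
  have e : (w t : ℝ) / 2 ^ J
      = ((∑ s ∈ Ico t (2 ^ #A), w s : ℕ) - (∑ s ∈ Ico (t + 1) (2 ^ #A), w s : ℕ)) / 2 ^ J := by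
    rw [hsplit]; push_cast; ring
  rw [e, ← key]
  refine expect_le_expect fun u _ => ?_
  by_cases hu : ∑ s ∈ Ico (t + 1) (2 ^ #A), w s ≤ ofBits u ∧ ofBits u < ∑ s ∈ Ico t (2 ^ #A), w s
  · rw [if_pos hu, if_pos]
    refine ⟨t, ht, hb, ?_, ?_⟩ <;> simp only [hw]
    · exact_mod_cast hu.1
    · exact_mod_cast hu.2
  · rw [if_neg hu]
    split_ifs <;> norm_num

theorem expect_agree_real (A : Finset (Fin n)) (s : Bits n) :
    𝔼 t : Bits n, (if ∀ i ∈ A, s i = t i then 1 else 0 : ℝ) = (2 ^ #A)⁻¹ := by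
  have h := expect_agree A s
  have : ((𝔼 t : Bits n, (if ∀ i ∈ A, s i = t i then 1 else 0 : ℝ) : ℝ) : ℂ)
      = (((2 ^ #A)⁻¹ : ℝ) : ℂ) := by
    rw [Complex.ofReal_expect]
    simp only [apply_ite Complex.ofReal, Complex.ofReal_one, Complex.ofReal_zero]
    rw [h]
    push_cast
    rfl
  exact_mod_cast this

/-- The factor `2 ^ n` in the denominator is cancelled by the cluster sizes, up to the probability
of the outcome of the dephased qubits. -/
theorem recordApprox_eq (C : IQPCircuit n k d) (K : ℕ) (ω : Fin d → Fin n → Fin 5) (b : Bits n) :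
    C.recordApprox K ω b = 𝔼 z : Bits n, (2 ^ #(survivors ω)ᶜ)⁻¹ *
      ∏ v, ‖fourier (C.group (survivors ω) v) (C.classPhase K (C.group (survivors ω) v)
        (flipsOf ω) z) fun i => b i ^^ signFlip ω i‖ ^ 2 := by
  rw [IQPCircuit.recordApprox, mul_expect]
  refine expect_congr rfl fun z _ => ?_
  simp only [IQPCircuit.groupDensity]
  rw [prod_mul_distrib, prod_pow_eq_pow_sum, C.sum_card_group]
  have hc : #(survivors ω) + #(survivors ω)ᶜ = n := by
    rw [card_add_card_compl, Fintype.card_fin]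
  have h2 : (2 : ℝ) ^ n = 2 ^ #(survivors ω) * 2 ^ #(survivors ω)ᶜ := by rw [← pow_add, hc]
  rw [h2, mul_inv, ← mul_assoc]
  congr 1
  field_simp

open Classical in
/-- For every noise record with small clusters and every state of the dephased qubits, the
remaining coins lead to the output `b` with the right probability. -/
theorem prod_le_expect_accepts (C : IQPCircuit n k d) (N : PauliNoise) (L K : ℕ) (b : Bits n)
    (u : Fin d → Fin n → Fin K → Bool) (z : Bits n)
    (h : C.SmallClusters L (survivors (coinRecord N u))) :
    (2 ^ #(survivors (coinRecord N u))ᶜ)⁻¹ * ∏ v,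
      ‖fourier (C.group (survivors (coinRecord N u)) v)
        (C.classPhase K (C.group (survivors (coinRecord N u)) v) (flipsOf (coinRecord N u)) z)
        fun i => b i ^^ signFlip (coinRecord N u) i‖ ^ 2
      ≤ 𝔼 s : Bits n, 𝔼 U : Fin n → Fin (C.precision L K) → Bool,
        if Accepts C N L K b (s, u, U, z) then (1 : ℝ) else 0 := by
  set ω := coinRecord N u with hω
  have e : ∀ (s : Bits n) (U : Fin n → Fin (C.precision L K) → Bool),
      (if Accepts C N L K b (s, u, U, z) then (1 : ℝ) else 0)
      = (if ∀ i ∈ (survivors ω)ᶜ, b i = s i then 1 else 0 : ℝ) *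
        ∏ v, if Selects C L K (C.group (survivors ω) v) (flipsOf ω) z (ofBits (U v))
          (fun i => b i ^^ signFlip ω i) then (1 : ℝ) else 0 := by
    intro s U
    have hA : Accepts C N L K b (s, u, U, z) ↔ (∀ i ∈ (survivors ω)ᶜ, b i = s i) ∧
        ∀ v, Selects C L K (C.group (survivors ω) v) (flipsOf ω) z (ofBits (U v))
          fun i => b i ^^ signFlip ω i := by
      rw [Accepts]
      simp only [← hω, h, true_and, mem_compl, eq_comm]
    by_cases h1 : ∀ i ∈ (survivors ω)ᶜ, b i = s i
    · rw [if_pos h1, one_mul]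
      by_cases h2 : ∀ v, Selects C L K (C.group (survivors ω) v) (flipsOf ω) z (ofBits (U v))
          fun i => b i ^^ signFlip ω i
      · rw [if_pos (hA.2 ⟨h1, h2⟩), prod_eq_one fun v _ => if_pos (h2 v)]
      · obtain ⟨v, hv⟩ := not_forall.1 h2
        rw [if_neg fun h => h2 (hA.1 h).2, prod_eq_zero (mem_univ v) (if_neg hv)]
    · rw [if_neg h1, zero_mul, if_neg fun h => h1 (hA.1 h).1]
  simp only [e]
  rw [← expect_mul_expect, expect_agree_real,
    expect_prod_eval (β := Fin (C.precision L K) → Bool) (fun v u =>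
      if Selects C L K (C.group (survivors ω) v) (flipsOf ω) z (ofBits u)
          (fun i => b i ^^ signFlip ω i) then (1 : ℝ) else 0) inferInstance]
  refine mul_le_mul_of_nonneg_left (prod_le_prod (fun v _ => by positivity) fun v _ => ?_)
    (by positivity)
  exact norm_fourier_sq_le_expect_selects C K (IQPCircuit.card_group_le h v) _ _ _

open Classical in
/-- A lower bound on the probability that the coins lead to the output `b`. -/
theorem expect_le_expect_accepts (C : IQPCircuit n k d) (N : PauliNoise) (hN : 1 / 2 ≤ N.pI)
    (L K : ℕ) (b : Bits n) :
    𝔼 ω : Fin d → Fin n → Fin 5,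
      recordDensity (roundDown K N.pX) (roundDown K N.pY) (roundDown K N.pZ) ω *
        (if C.SmallClusters L (survivors ω) then C.recordApprox K ω b else 0)
      ≤ 𝔼 a : Bits n × Coins n d K (C.precision L K),
        if Accepts C N L K b a then (1 : ℝ) else 0 := by
  rw [← expect_coinRecord N hN K fun ω =>
    if C.SmallClusters L (survivors ω) then C.recordApprox K ω b else 0]
  have e : 𝔼 a : Bits n × Coins n d K (C.precision L K),
        (if Accepts C N L K b a then (1 : ℝ) else 0)
      = 𝔼 u, 𝔼 z, 𝔼 s, 𝔼 U : Fin n → Fin (C.precision L K) → Bool,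
        if Accepts C N L K b (s, u, U, z) then (1 : ℝ) else 0 := by
    rw [expect_prod_type, expect_congr rfl fun s _ => expect_prod_type _, expect_comm]
    refine expect_congr rfl fun u _ => ?_
    rw [expect_congr rfl fun s _ => expect_prod_type _,
      expect_congr rfl fun s _ => expect_comm _ _ _, expect_comm]
  rw [e]
  refine expect_le_expect fun u _ => ?_
  split_ifs with h
  · rw [recordApprox_eq]
    exact expect_le_expect fun z _ => prod_le_expect_accepts C N L K b u z h
  · exact expect_nonneg fun z _ => expect_nonneg fun s _ => expect_nonneg fun U _ => by
      split_ifs <;> norm_num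

/-- If the coins lead to the outputs that they should lead to, then the distribution of the output
is close to that of the noisy circuit. -/
theorem tvDist_map_le (C : IQPCircuit n k d) (N : PauliNoise) {ε : ℝ} {L : ℕ}
    (hN : 1 / 2 ≤ N.pI) (hp : 0 < N.strength) (hp2 : N.strength ≤ 1 / 2) (hk : 1 ≤ k)
    (hd : depthThreshold N.strength k < d) (hn : 1 ≤ n) (hε : 0 < ε) (hε1 : ε ≤ 1)
    (hM : 64 * (n / ε) ≤ 2 ^ L) (hdM : (d : ℝ) ≤ (2 ^ L) ^ 2)
    {out : Bits n × Coins n d (16 * L) (C.precision L (16 * L)) → Bits n}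
    (hout : ∀ a b, Accepts C N L (16 * L) b a → out a = b) :
    tvDist ((PMF.uniformOfFintype _).map out) (outputProb (C.noisy N)) ≤ ε := by
  classical
  set K := 16 * L with hK
  have hX := roundDown_bounds K N.pX_nonneg
  have hY := roundDown_bounds K N.pY_nonneg
  have hZ := roundDown_bounds K N.pZ_nonneg
  refine tvDist_le_of_lower_bound _ (C.sum_outputProb N) (s := fun b =>
    𝔼 ω : Fin d → Fin n → Fin 5,
      recordDensity (roundDown K N.pX) (roundDown K N.pY) (roundDown K N.pZ) ω *
        (if C.SmallClusters L (survivors ω) then C.recordApprox K ω b else 0)) ?_ ?_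
  · intro b
    rw [toReal_map_uniformOfFintype]
    refine le_trans ?_ ((expect_le_expect_accepts C N hN L K b).trans
      (expect_le_expect fun a _ => ?_))
    · refine le_of_eq (expect_congr rfl fun ω _ => ?_)
      congr
    · by_cases h : Accepts C N L K b a
      · rw [if_pos h, if_pos (hout a b h)]
      · rw [if_neg h]; split_ifs <;> norm_num
  · have h1 := C.sum_abs_outputProb_sub_le N hN hp.le hp2 (subcritical hp hp2 hk hd) K L
      (outcomeWeight_nonneg hX.1 hY.1 hZ.1 (roundDown_sum_le N hN K)) hX.2.2 hY.2.2 hZ.2.2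
    have h2 := total_error_le (d := d) hn hε hε1 hM hdM
    refine le_trans (le_of_eq ?_) (h1.trans h2)
    refine sum_congr rfl fun b _ => ?_
    congr

/-- For a very deep circuit, the uniform distribution is close to the output distribution. -/
theorem tvDist_uniform_le (C : IQPCircuit n k d) (N : PauliNoise) {ε : ℝ} {L : ℕ}
    (hN : 1 / 2 ≤ N.pI) (hp : 0 < N.strength) (hp2 : N.strength ≤ 1 / 2) (hk : 1 ≤ k)
    (hd : depthThreshold N.strength k < d) (hε : 0 < ε)
    (hM : 64 * (n / ε) ≤ 2 ^ L) (hdM : ((2 : ℝ) ^ L) ^ 2 ≤ d) :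
    tvDist (PMF.uniformOfFintype (Bits n)) (outputProb (C.noisy N)) ≤ ε := by
  refine tvDist_le_of_lower_bound _ (C.sum_outputProb N) (s := fun _ =>
    𝔼 ω : Fin d → Fin n → Fin 5,
      recordDensity N.pX N.pY N.pZ ω * (if survivors ω = ∅ then (2 ^ n)⁻¹ else 0)) ?_ ?_
  · intro b
    have h1 : ((PMF.uniformOfFintype (Bits n)) b).toReal = (2 ^ n)⁻¹ := by simp
    rw [h1]
    have h0 : ∀ ω, 0 ≤ recordDensity N.pX N.pY N.pZ ω := fun ω : Fin d → Fin n → Fin 5 =>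
      recordDensity_nonneg (N.weight_nonneg hN) ω
    have h2 : 𝔼 ω : Fin d → Fin n → Fin 5, recordDensity N.pX N.pY N.pZ ω * (2 ^ n)⁻¹
        = (2 ^ n)⁻¹ := by
      rw [← expect_mul, expect_recordDensity, one_mul]
    refine (expect_le_expect fun ω _ => mul_le_mul_of_nonneg_left ?_ (h0 ω)).trans h2.le
    split_ifs
    · exact le_rfl
    · positivity
  · refine (C.sum_abs_outputProb_sub_uniform_le N hN).trans ?_
    have hne : 0 ≤ (n : ℝ) / ε := by positivity
    exact mul_survive_pow_le hp hp2 hk hd (one_le_pow₀ (by norm_num)) hε (by linarith) hdM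

end Output


/-! ### The running time -/

theorem IQPCircuit.gatesUpTo_le {n k d : ℕ} (C : IQPCircuit n k d) (t : ℕ) :
    C.gatesUpTo t ≤ t * n := by
  have h : ∀ l g, C.gateCount l g ≤ 1 := by
    intro l g
    unfold gateCount
    split_ifs <;> omega
  calc C.gatesUpTo t ≤ ∑ _l ∈ range t, ∑ _g ∈ range n, 1 :=
        sum_le_sum fun l _ => sum_le_sum fun g _ => h l g
    _ = t * n := by simp

/-- The exponent of the bound on the running time. -/
def timeExponent : ℕ := 3 + computePrecision.depth + deterministicPart.depth

/-- The factor in the bound on the running time. -/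
def timeFactor : ℕ := 2200 + computePrecision.size + deterministicPart.size

/-- The bound on the running time as a single power. -/
theorem timeBound_le (X : ℕ) : timeBound X ≤ timeFactor * (X + 4) ^ timeExponent := by
  have h1 : 1 ≤ X + 4 := by omega
  have hp : ∀ e ≤ timeExponent, (X + 4) ^ e ≤ (X + 4) ^ timeExponent := fun e he =>
    Nat.pow_le_pow_right (by omega) he
  have q0 := hp 0 (by unfold timeExponent; omega)
  have q1 := hp 1 (by unfold timeExponent; omega)
  have q3 := hp 3 (by unfold timeExponent; omega)
  have qp := Nat.mul_le_mul_left computePrecision.size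
    (hp computePrecision.depth (by unfold timeExponent; omega))
  have qd := Nat.mul_le_mul_left deterministicPart.size
    (hp deterministicPart.depth (by unfold timeExponent; omega))
  have x3 : X ^ 3 ≤ (X + 4) ^ 3 := Nat.pow_le_pow_left (by omega) 3
  rw [pow_one] at q1
  rw [pow_zero] at q0
  unfold timeBound timeFactor
  simp only [add_mul]
  omega

/-- The minimum of `pX` and `pY` is at most `pX`, and the errors have total probability at
most `1 / 2`. -/
theorem PauliNoise.strength_le {N : PauliNoise} (hN : 1 / 2 ≤ N.pI) : N.strength ≤ 1 / 2 := by
  have h1 := N.sum_eq_one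
  have h2 := N.pY_nonneg
  have h3 := min_le_left N.pX N.pY
  unfold strength
  linarith

/-- The algorithm runs in polynomial time, and its output distribution is close to that of the
noisy circuit. -/
theorem sampler_spec {n k d : ℕ} (C : IQPCircuit n k d) (N : PauliNoise) {ε : ℝ} {k₀ : ℕ}
    (hn : 1 ≤ n) (hk : 1 ≤ k) (hk₀ : k ≤ k₀) (hN : 1 / 2 ≤ N.pI) (hp : 0 < N.strength)
    (hd : depthThreshold N.strength k < d) (hε : 0 < ε) (hε1 : ε ≤ 1) :
    ∃ L T : ℕ, (2 : ℝ) ^ L ≤ 256 * (n / ε) ∧ T ≤ timeBound (40 * (k₀ + 1) * (2 ^ L) ^ 4) ∧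
      HaltsWithin sampler (inputMemory C N ε) T ∧
      tvDist (sampledBits sampler (inputMemory C N ε) T n) (outputProb (C.noisy N)) ≤ ε := by
  have hp2 := PauliNoise.strength_le hN
  obtain ⟨L, t, m₁, l1, l2, l3, ht, he, hI, h71⟩ := parameters_spec (C := C) (N := N) hn hε hε1
  set M := 2 ^ L with hM
  -- A common bound on all variables that bound loops. The power `M ^ 4` comes from the precision,
  -- which is at most `2 * (L + 16 * L * (d * n))` with `d ≤ M ^ 2` and `n ≤ M`.
  set X := 40 * (k₀ + 1) * M ^ 4 with hX
  have hLM : L < M := Nat.lt_two_pow_self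
  have hM1 : 1 ≤ M := Nat.one_le_two_pow
  have hM4 : M ^ 2 ≤ M ^ 4 := Nat.pow_le_pow_right hM1 (by norm_num)
  have hM2 : M ≤ M ^ 2 := Nat.le_self_pow (by norm_num) M
  have hXM : 40 * M ^ 4 ≤ X := Nat.mul_le_mul_right _ (by omega)
  have hXk : k₀ ≤ X := by
    have h1 : 1 ≤ M ^ 4 := Nat.one_le_pow _ _ hM1
    have : 40 * (k₀ + 1) * 1 ≤ X := Nat.mul_le_mul_left _ h1
    omega
  have hnM : n ≤ M := by
    have h1 : (n : ℝ) ≤ n / ε := le_div_self (by positivity) hε hε1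
    have h2 : (0 : ℝ) ≤ n / ε := by positivity
    have : (n : ℝ) ≤ (M : ℕ) := by push_cast [hM]; linarith
    exact_mod_cast this
  have ht' : t ≤ 1000 * X := ht.trans (Nat.mul_le_mul_left _ (by omega))
  -- The algorithm makes the same case distinction.
  by_cases hdM : M * M ≤ d
  · obtain ⟨T, hT, h1, h2⟩ := sampler_deep he hI h71 hdM (X := X) (by omega) ht'
    refine ⟨L, T, l2, hT, h1, ?_⟩
    rw [h2]
    refine tvDist_uniform_le C N hN hp hp2 hk hd hε l1 ?_
    have : ((M * M : ℕ) : ℝ) ≤ d := by exact_mod_cast hdM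
    push_cast [hM] at this
    rwa [sq]
  · have hd2 : d ≤ M ^ 2 := by rw [sq]; omega
    have hJ : C.precision L (16 * L) ≤ X := by
      have g1 := C.gatesUpTo_le d
      have g2 : d * n ≤ M ^ 2 * M := Nat.mul_le_mul hd2 hnM
      have g3 : 16 * L * C.gatesUpTo d ≤ 16 * M * (M ^ 2 * M) :=
        Nat.mul_le_mul (by omega) (g1.trans g2)
      have g4 : 16 * M * (M ^ 2 * M) = 16 * M ^ 4 := by ring
      unfold IQPCircuit.precision
      omega
    obtain ⟨T, hT, h1, out, h2, h3⟩ := sampler_shallow he hI h71 (not_le.1 hdM) (by omega) (X := X)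
      (by omega) (by omega) (by omega) (by omega) (by omega) (by omega) hJ ht'
    refine ⟨L, T, l2, hT, h1, ?_⟩
    rw [h2]
    refine tvDist_map_le C N hN hp hp2 hk hd hn hε hε1 l1 ?_ h3
    have : (d : ℝ) ≤ ((M ^ 2 : ℕ) : ℝ) := by exact_mod_cast hd2
    rwa [Nat.cast_pow, hM, Nat.cast_pow, Nat.cast_ofNat] at this

end NoisyIQP

theorem mainTheorem3 :
    ∃ (prog : NoisyIQP.Cmd) (dstar : ℝ → ℕ → ℝ),
      (∃ A : ℝ, ∀ (p : ℝ) (k : ℕ), 0 < p → p ≤ 1 / 2 → 1 ≤ k →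
        dstar p k ≤ A * (p⁻¹ * Real.log (k * p⁻¹))) ∧
      ∀ (p₀ : ℝ) (k₀ : ℕ), 0 < p₀ →
        ∃ (B : ℝ) (a : ℕ),
          ∀ (n k d : ℕ) (C : NoisyIQP.IQPCircuit n k d) (N : NoisyIQP.PauliNoise) (ε : ℝ),
            1 ≤ n → 1 ≤ k → k ≤ k₀ → 1 / 2 ≤ N.pI → p₀ ≤ N.strength →
            dstar N.strength k < d → 0 < ε → ε ≤ 1 →
            ∃ T : ℕ, (T : ℝ) ≤ B * (d * (n / ε) ^ a) ∧
              NoisyIQP.HaltsWithin prog (NoisyIQP.inputMemory C N ε) T ∧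
              NoisyIQP.tvDist
                (NoisyIQP.sampledBits prog (NoisyIQP.inputMemory C N ε) T n)
                (NoisyIQP.outputProb (C.noisy N)) ≤ ε := by
  open NoisyIQP in
  refine ⟨sampler, depthThreshold, ⟨100, fun p k _ _ _ => le_rfl⟩, fun p₀ k₀ hp₀ =>
    ⟨timeFactor * (44 * (k₀ + 1) * 256 ^ 4) ^ timeExponent, 4 * timeExponent, ?_⟩⟩
  intro n k d C N ε hn hk hk₀ hN hp hd hε hε1
  have hp' : 0 < N.strength := hp₀.trans_le hp
  obtain ⟨L, T, hL, hT, h1, h2⟩ := NoisyIQP.sampler_spec C N hn hk hk₀ hN hp' hd hε hε1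
  refine ⟨T, ?_, h1, h2⟩
  have hd1 : (1 : ℝ) ≤ d := by
    exact_mod_cast NoisyIQP.depth_pos hp' (NoisyIQP.PauliNoise.strength_le hN) hk hd
  have hM4 : (2 ^ L) ^ 4 ≤ 256 ^ 4 * (n / ε : ℝ) ^ 4 := by
    rw [← mul_pow]
    exact pow_le_pow_left₀ (by positivity) hL 4
  have hM1 : (1 : ℝ) ≤ (2 ^ L) ^ 4 := one_le_pow₀ (one_le_pow₀ (by norm_num))
  have hX : (40 * (k₀ + 1) * (2 ^ L) ^ 4 + 4 : ℝ) ≤ 44 * (k₀ + 1) * 256 ^ 4 * (n / ε) ^ 4 := by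
    have h3 : (1 : ℝ) ≤ (k₀ + 1) * (2 ^ L) ^ 4 :=
      one_le_mul_of_one_le_of_one_le (by linarith [(Nat.cast_nonneg k₀ : (0 : ℝ) ≤ k₀)]) hM1
    have h4 := mul_le_mul_of_nonneg_left hM4 (by positivity : (0 : ℝ) ≤ 44 * (k₀ + 1))
    linarith
  have hT' : (T : ℝ) ≤ NoisyIQP.timeFactor *
      (40 * (k₀ + 1) * (2 ^ L) ^ 4 + 4) ^ NoisyIQP.timeExponent := by
    exact_mod_cast hT.trans (NoisyIQP.timeBound_le _)
  refine hT'.trans ?_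
  -- The exponent is a concrete number; as a variable it cannot be evaluated by the tactics.
  generalize NoisyIQP.timeFactor = c
  generalize NoisyIQP.timeExponent = e
  have h5 := pow_le_pow_left₀ (by positivity) hX e
  rw [mul_pow _ ((n / ε : ℝ) ^ 4), ← pow_mul (n / ε : ℝ)] at h5
  have h6 := mul_le_mul_of_nonneg_left h5 (Nat.cast_nonneg c : (0 : ℝ) ≤ _)
  refine h6.trans ?_
  rw [← mul_assoc]
  exact mul_le_mul_of_nonneg_left (le_mul_of_one_le_left (by positivity) hd1) (by positivity)
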